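/- **Setting.** Let $d,n$ be positive integers. Functions on the torus $(\mathbb{R}/2\pi\mathbb{Z})^d$ have Fourier coefficients $\widehat f_k=(2\pi)^{-d}\int_{[0,2\pi]^d}f(x)e^{-ik\cdot x}\,dx$, and for $r\ge 0$ we set $|f|_{H^r}^2=\sum_{k\in\mathbb{Z}^d}(1+|k|^2)^r|\widehat f_k|^2$; for $r>d/2$ elements of $H^r$ are identified with their continuous representatives. Consider the system $$\partial_t U+\sum_{j=1}^d A_j(U)\,\partial_{x_j}U=0,\qquad U|_{t=0}=U^0, \tag{1}$$ where the $A_j(\cdot)$ are real $n\times n$ matrices whose entries are polynomials. Assume that (1) is Friedrichs-symmetrizable: there are an open set $\mathcal U\subset\mathbb{R}^n$ with $0\in\mathcal U$ and a matrix $S(\cdot)$ with real polynomial entries such that for all $V\in\mathcal U$ the matrix $S(V)$ is symmetric positive definite and every $S(V)A_j(V)$ is symmetric. Let $P_N$ be the Fourier multiplier with symbol $\mathbf 1_{\{-N,\dots,N\}^d}$, and let $S_N$ be the Fourier multiplier with symbol $\sigma(\cdot/N)$, where $\sigma\in C^1(\mathbb{R}^d;[0,1])$ is even, $\sigma(k)=1$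 if $\max_j|k_j|\le 1/2$, $\sigma(k)=0$ if $\max_j|k_j|\ge 1$, and $|\cdot|\,\nabla(\sigma^{1/2})\in L^\infty(\mathbb{R}^d)$. Consider the two schemes $$\partial_t U_N+S_N\Big(\sum_{j=1}^d A_j(U_N)\,\partial_{x_j}U_N\Big)=0,\qquad U_N|_{t=0}=P_NU^0, \tag{2}$$ $$\partial_t U_N+\sum_{j=1}^d\Big(A_j^0\,\partial_{x_j}U_N+S_N\big(A_j^1(U_N)\,\partial_{x_j}U_N\big)\Big)=0,\qquad U_N|_{t=0}=P_NU^0, \tag{3}$$ where $A_j^0=A_j(0)$ and $A_j^1(V)=A_j(V)-A_j(0)$. For (1), (2), (3), a classical solution in $C(I;H^s)$ on an open interval $I\ni0$ is a function $U\in C(I;H^s)$, $C^1$ in $x$ and differentiable in $t$, satisfying the equation pointwise and the initial condition; it is maximal if it has no extension to a classical solution in $C(I';H^s)$ on a strictly larger open interval $I'$. **Statement.** Let $s>d/2+1$. For all $L,M\ge0$ and every compact set $\mathcal K^*\subset\mathcal U$ there are an integer $N_0\ge1$ and a constant $C^*>0$, depending only on $s,L,M,\mathcal K^*$ (and on the fixed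 data $d,n,A_j,S,\mathcal U,\sigma$), such that the following holds. Let $U^0\in H^s$ take values in $\mathcal U$ and let $U\in C(I;H^s)$ be a classical solution of (1) on an open interval $I\ni0$, for instance the maximal one. Let $I^*\subset I$ be compact and let $J^*$ be the smallest interval containing $I^*\cup\{0\}$ (so $J^*=I^*$ if $I^*$ is an interval containing $0$). Assume that $|J^*|\le L$, that $M^*:=\sup_{t\in J^*}|U(t,\cdot)|_{H^s}\le M$, and that $U(J^*\times\mathbb{R}^d)\subset\mathcal K^*$. Then for every $N\ge N_0$ scheme (2) has a maximal classical solution $U_N\in C(I_N;H^s)$, and every such maximal solution satisfies $I^*\subset I_N$ and, for all $0\le r\le s$, $$\sup_{t\in I^*}\big|(U-U_N)(t,\cdot)\big|_{H^r}\le C^*\,M^*\,N^{r-s}.$$ The same result (with possibly different $N_0$ and $C^*$) holds with (2) replaced by (3), provided that, with $S^0=S(0)$ and $S^1(V)=S(V)-S(0)$, for every $j$ and every $V\in\mathcal U$ the matrices $S^0A_j^0$, $S^0A_j^1(V)+S^1(V)A_j^0$ and $S^1(V)A_j^1(V)$ are symmetric. -/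

import Mathlib

open Filter Topology MeasureTheory

namespace FourierScheme

noncomputable section

/-! Functions on the torus `(ℝ / 2πℤ)^d` with values in `ℝ^n` are represented by functions
`(Fin d → ℝ) → (Fin n → ℝ)` that are `2π`-periodic in each variable. -/

/-- `2π`-periodicity in every coordinate direction. -/
def IsTorusPeriodic {d n : ℕ} (f : (Fin d → ℝ) → (Fin n → ℝ)) : Prop :=
  ∀ (j : Fin d) (x : Fin d → ℝ), f (x + Pi.single j (2 * Real.pi)) = f x

/-- The exponential `exp(i k·x)`. -/
def expMode {d : ℕ} (k : Fin d → ℤ) (x : Fin d → ℝ) : ℂ :=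
  Complex.exp (Complex.I * ((∑ j, (k j : ℝ) * x j : ℝ) : ℂ))

/-- The `k`-th Fourier coefficient of the `i`-th component of `f`,
`(2π)^{-d} ∫_{[0,2π]^d} f_i(x) exp(-i k·x) dx`, so that `f_i = ∑_k c_k exp(i k·x)`. -/
def coeff {d n : ℕ} (f : (Fin d → ℝ) → (Fin n → ℝ)) (k : Fin d → ℤ) (i : Fin n) : ℂ :=
  ((2 * Real.pi) ^ d : ℂ)⁻¹ *
    ∫ x in Set.Icc (0 : Fin d → ℝ) (fun _ => 2 * Real.pi), (f x i : ℂ) * expMode (-k) x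

/-- The Sobolev norm `(∑_k (1 + |k|²)^s |f̂_k|²)^{1/2}`, with values in `[0, ∞]`. -/
def hsNorm {d n : ℕ} (s : ℝ) (f : (Fin d → ℝ) → (Fin n → ℝ)) : ENNReal :=
  (∑' k : Fin d → ℤ, ENNReal.ofReal ((1 + ∑ j, (k j : ℝ) ^ 2) ^ s) *
    ∑ i, ‖coeff f k i‖ₑ ^ 2) ^ (1 / 2 : ℝ)

/-- `f` is the continuous representative of an element of `H^s` of the torus.  It is used for
`s > d/2` only, where every element of `H^s` has exactly one such representative. -/
structure MemHs {d n : ℕ} (s : ℝ) (f : (Fin d → ℝ) → (Fin n → ℝ)) : Prop where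
  continuous : Continuous f
  periodic : IsTorusPeriodic f
  norm_lt_top : hsNorm s f < ⊤

/-- The Fourier multiplier with real symbol `m`.  For the symbols below (even and finitely
supported) the sum is finite and real-valued for real `f`; `re` only turns it into a real number. -/
def fourierMultiplier {d n : ℕ} (m : (Fin d → ℤ) → ℝ) (f : (Fin d → ℝ) → (Fin n → ℝ)) :
    (Fin d → ℝ) → (Fin n → ℝ) :=
  fun x i => (∑' k : Fin d → ℤ, (m k : ℂ) * coeff f k i * expMode k x).re

open Classical in
/-- The sharp low-pass filter `P_N`, with symbol the indicator function of `{-N, …, N}^d`. -/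
def sharpFilter {d n : ℕ} (N : ℕ) (f : (Fin d → ℝ) → (Fin n → ℝ)) :
    (Fin d → ℝ) → (Fin n → ℝ) :=
  fourierMultiplier (fun k => if ∀ j, |k j| ≤ (N : ℤ) then 1 else 0) f

/-- The admissible profiles of smooth low-pass filters.  The last field says that
`|k| ∇(σ^{1/2})(k)` is bounded: `σ^{1/2}` is `C¹` on the open set `{σ ≠ 0}`, and its gradient
vanishes almost everywhere on `{σ = 0}`. -/
structure IsFilterProfile {d : ℕ} (σ : (Fin d → ℝ) → ℝ) : Prop where
  contDiff : ContDiff ℝ 1 σ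
  even : ∀ k, σ (-k) = σ k
  eq_one : ∀ k, (∀ j, |k j| ≤ 1 / 2) → σ k = 1
  eq_zero : ∀ k, (∃ j, 1 ≤ |k j|) → σ k = 0
  mem_Icc : ∀ k, σ k ∈ Set.Icc (0 : ℝ) 1
  sqrt_gradient : ∃ C : ℝ, ∀ k, σ k ≠ 0 → ‖k‖ * ‖fderiv ℝ (fun l => √(σ l)) k‖ ≤ C

/-- The smooth low-pass filter `S_N`, with symbol `σ(· / N)` (for `N ≥ 1`). -/
def smoothFilter {d n : ℕ} (σ : (Fin d → ℝ) → ℝ) (N : ℕ) (f : (Fin d → ℝ) → (Fin n → ℝ)) :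
    (Fin d → ℝ) → (Fin n → ℝ) :=
  fourierMultiplier (fun k => σ (fun j => (k j : ℝ) / (N : ℝ))) f

/-- The value at `v` of a matrix with polynomial entries. -/
def evalMat {n : ℕ} (B : Matrix (Fin n) (Fin n) (MvPolynomial (Fin n) ℝ)) (v : Fin n → ℝ) :
    Matrix (Fin n) (Fin n) ℝ :=
  B.map (MvPolynomial.eval v)

/-- `S` is a Friedrichs symmetrizer of the system with matrices `A_j` on the hyperbolic
domain `𝒰`, an open neighbourhood of the origin. -/
structure IsSymmetrizer {d n : ℕ} (A : Fin d → Matrix (Fin n) (Fin n) (MvPolynomial (Fin n) ℝ))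
    (S : Matrix (Fin n) (Fin n) (MvPolynomial (Fin n) ℝ)) (𝒰 : Set (Fin n → ℝ)) : Prop where
  isOpen : IsOpen 𝒰
  zero_mem : (0 : Fin n → ℝ) ∈ 𝒰
  posDef : ∀ v ∈ 𝒰, (evalMat S v).PosDef
  symm : ∀ j, ∀ v ∈ 𝒰, (evalMat S v * evalMat (A j) v).IsSymm

/-- Compatibility of the symmetrizer with the splittings `A_j = A_j(0) + A_j¹` and
`S = S(0) + S¹`. -/
def IsCompatible {d n : ℕ} (A : Fin d → Matrix (Fin n) (Fin n) (MvPolynomial (Fin n) ℝ))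
    (S : Matrix (Fin n) (Fin n) (MvPolynomial (Fin n) ℝ)) (𝒰 : Set (Fin n → ℝ)) : Prop :=
  ∀ j, ∀ v ∈ 𝒰,
    (evalMat S 0 * evalMat (A j) 0).IsSymm ∧
    (evalMat S 0 * (evalMat (A j) v - evalMat (A j) 0) +
      (evalMat S v - evalMat S 0) * evalMat (A j) 0).IsSymm ∧
    ((evalMat S v - evalMat S 0) * (evalMat (A j) v - evalMat (A j) 0)).IsSymm

/-- The partial derivative `∂_{x_j} f`. -/
def partialDeriv {d n : ℕ} (j : Fin d) (f : (Fin d → ℝ) → (Fin n → ℝ)) :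
    (Fin d → ℝ) → (Fin n → ℝ) :=
  fun x => fderiv ℝ f x (Pi.single j 1)

/-- `f ↦ ∑_j A_j(f) ∂_{x_j} f`. -/
def hypOp {d n : ℕ} (A : Fin d → Matrix (Fin n) (Fin n) (MvPolynomial (Fin n) ℝ))
    (f : (Fin d → ℝ) → (Fin n → ℝ)) : (Fin d → ℝ) → (Fin n → ℝ) :=
  fun x => ∑ j, (evalMat (A j) (f x)).mulVec (partialDeriv j f x)

/-- `f ↦ S_N (∑_j A_j(f) ∂_{x_j} f)`: the filter acts on all terms. -/
def fullFilterOp {d n : ℕ} (A : Fin d → Matrix (Fin n) (Fin n) (MvPolynomial (Fin n) ℝ))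
    (σ : (Fin d → ℝ) → ℝ) (N : ℕ) (f : (Fin d → ℝ) → (Fin n → ℝ)) :
    (Fin d → ℝ) → (Fin n → ℝ) :=
  smoothFilter σ N (hypOp A f)

/-- `f ↦ ∑_j (A_j(0) ∂_{x_j} f + S_N (A_j¹(f) ∂_{x_j} f))` with `A_j¹(v) = A_j(v) - A_j(0)`: the
filter acts on the nonlinear terms only. -/
def partialFilterOp {d n : ℕ} (A : Fin d → Matrix (Fin n) (Fin n) (MvPolynomial (Fin n) ℝ))
    (σ : (Fin d → ℝ) → ℝ) (N : ℕ) (f : (Fin d → ℝ) → (Fin n → ℝ)) :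
    (Fin d → ℝ) → (Fin n → ℝ) :=
  fun x => ∑ j, ((evalMat (A j) 0).mulVec (partialDeriv j f x) +
    smoothFilter σ N
      (fun y => (evalMat (A j) (f y) - evalMat (A j) 0).mulVec (partialDeriv j f y)) x)

/-- `U ∈ C(I; H^s)` is a classical solution of `∂_t U + G(U) = 0`, `U|_{t=0} = u₀`, on the open
interval `I` containing `0` (values of `U` outside `I` are irrelevant). -/
structure IsClassicalSolution {d n : ℕ} (s : ℝ)
    (G : ((Fin d → ℝ) → (Fin n → ℝ)) → ((Fin d → ℝ) → (Fin n → ℝ)))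
    (u₀ : (Fin d → ℝ) → (Fin n → ℝ)) (I : Set ℝ) (U : ℝ → (Fin d → ℝ) → (Fin n → ℝ)) :
    Prop where
  isOpen : IsOpen I
  ordConnected : I.OrdConnected
  zero_mem : (0 : ℝ) ∈ I
  memHs : ∀ t ∈ I, MemHs s (U t)
  continuous_hs : ∀ t₀ ∈ I, Tendsto (fun t => hsNorm s (U t - U t₀)) (𝓝[I] t₀) (𝓝 0)
  contDiff : ∀ t ∈ I, ContDiff ℝ 1 (U t)
  initial : U 0 = u₀
  hasDerivAt : ∀ t ∈ I, ∀ x, HasDerivAt (fun τ => U τ x) (-(G (U t) x)) t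

/-- The classical solution `U ∈ C(I; H^s)` is maximal in time: it has no extension to a strictly
larger open interval. -/
def IsMaximalSolution {d n : ℕ} (s : ℝ)
    (G : ((Fin d → ℝ) → (Fin n → ℝ)) → ((Fin d → ℝ) → (Fin n → ℝ)))
    (u₀ : (Fin d → ℝ) → (Fin n → ℝ)) (I : Set ℝ) (U : ℝ → (Fin d → ℝ) → (Fin n → ℝ)) : Prop :=
  IsClassicalSolution s G u₀ I U ∧
    ∀ (I' : Set ℝ) (U' : ℝ → (Fin d → ℝ) → (Fin n → ℝ)), IsClassicalSolution s G u₀ I' U' →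
      I ⊆ I' → (∀ t ∈ I, U' t = U t) → I' = I

/-- Spectral convergence in `H^s` of the scheme `∂_t U_N + G_N(U_N) = 0`, `U_N|_{t=0} = P_N u₀`,
to the system with matrices `A_j`, with hyperbolic domain `𝒰`.

The threshold `N₀` and the constant `C` are chosen after bounds `L` on the length of the time
interval and `M` on the `H^s` norm of the exact solution, and a compact set `K ⊆ 𝒰` containing its
values, but before the initial data, the solution and the compact set `Istar` of times.  These
three bounds refer to the smallest interval containing `0` and `Istar`, which is `Istar` itself if
`Istar` is an interval containing `0`.  The exact solution `U` on `I` may be the maximal one, but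
need not be. -/
def SpectrallyConverges {d n : ℕ}
    (A : Fin d → Matrix (Fin n) (Fin n) (MvPolynomial (Fin n) ℝ)) (𝒰 : Set (Fin n → ℝ)) (s : ℝ)
    (G : ℕ → ((Fin d → ℝ) → (Fin n → ℝ)) → ((Fin d → ℝ) → (Fin n → ℝ))) : Prop :=
  ∀ (L M : ℝ) (K : Set (Fin n → ℝ)), IsCompact K → K ⊆ 𝒰 →
    ∃ (N₀ : ℕ) (C : ℝ), 0 < N₀ ∧ 0 < C ∧
      ∀ (u₀ : (Fin d → ℝ) → (Fin n → ℝ)), MemHs s u₀ → (∀ x, u₀ x ∈ 𝒰) →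
      ∀ (I : Set ℝ) (U : ℝ → (Fin d → ℝ) → (Fin n → ℝ)),
        IsClassicalSolution s (hypOp A) u₀ I U →
      ∀ Istar : Set ℝ, IsCompact Istar → Istar ⊆ I →
        volume (convexHull ℝ (insert 0 Istar)) ≤ ENNReal.ofReal L →
        (∀ t ∈ convexHull ℝ (insert 0 Istar), hsNorm s (U t) ≤ ENNReal.ofReal M) →
        (∀ t ∈ convexHull ℝ (insert 0 Istar), ∀ x, U t x ∈ K) →
      ∀ N : ℕ, N₀ ≤ N →
        (∃ (IN : Set ℝ) (UN : ℝ → (Fin d → ℝ) → (Fin n → ℝ)),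
          IsMaximalSolution s (G N) (sharpFilter N u₀) IN UN) ∧
        ∀ (IN : Set ℝ) (UN : ℝ → (Fin d → ℝ) → (Fin n → ℝ)),
          IsMaximalSolution s (G N) (sharpFilter N u₀) IN UN →
            Istar ⊆ IN ∧
            ∀ r : ℝ, 0 ≤ r → r ≤ s → ∀ t ∈ Istar,
              hsNorm r (U t - UN t) ≤
                ENNReal.ofReal (C * (N : ℝ) ^ (r - s)) *
                  ⨆ τ ∈ convexHull ℝ (insert 0 Istar), hsNorm s (U τ)

end

end FourierScheme

/-!
The scheme is compared with the low-pass filtered exact solution `Θ U`, where `Θ` has the symbol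
`σ(2 · / N)`, so that `S_N Θ = Θ`.  Both `U_N` and `Θ U` are trigonometric polynomials of degree
`N`, and the error `z = U_N - Θ U` solves the scheme linearized at `U`, with a residual as source
term.

*Consistency* (`exists_l2n_residual_le`).  The residual consists of `(A(U_N) - A(U)) ∂ U_N`, which
is controlled by `U_N - U` in `L²`, and of the commutator of `Θ` with multiplication by `A(U)`.  The
latter only involves frequencies above `N / 8`, and is therefore `O(N^{-s})` in `L²`
(`exists_tsum_commutator_le`).

*Stability* (`exists_abs_energyForm_linOp_le`).  With `T = S_N^{1/2}`, the linearized scheme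
`∂_t z + A^a ∂ z + S_N (A^b ∂ z) = 0` is symmetrized by the energy
`(S^a z, z) + (S^b T z, T z)` as soon as `S^a A^a`, `S^a A^b + S^b A^a` and `S^b A^b` are symmetric:
moving factors `T` across multiplications by smooth functions costs one derivative of these
functions and gains one derivative on `z`, which is where the bound on `|·| ∇(σ^{1/2})` enters, and
what remains are symmetric first-order forms in `z`, `T z` and `T² z`.  The scheme that filters all
terms is the case `A^a = 0`, `S^b = 0`; for the one that filters the nonlinear terms only,
`A^a = A(0)` and `S^a = S(0)`.  The notion `IsSplitting` covers both.  In the second case coercivity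
of the energy follows from
`(S(0) z, z) - (S(0) T z, T z) ≥ c (|z|² - |T z|²)` and `(S(U) T z, T z) ≥ c |T z|²`
(`IsSymmetrizer.isSplitting_partial`).

Grönwall's inequality then gives `z = O(N^{-s})` in `L²`, as long as `U_N` remains bounded in the
Wiener norm `∑ (1 + |k|) |û_k|`, which controls `U_N` and its gradient.  By Bernstein's inequality
an `L²` error `O(N^{-s})` is `O(N^{d/2+1-s})` in the Wiener norm, hence small for large `N`, and a
continuity argument closes the estimate (`IsSplitting.exists_error_le`).  Working with Wiener norms
rather than with `L^∞` norms makes all product and commutator estimates consequences of Young's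
inequality for sequences.  Error bounds in `H^r` follow, again by Bernstein's inequality for `z` and
directly for `U - Θ U` (`hsNorm_sub_le_of_l2n_le`).

*Existence and uniqueness.*  Solutions of the scheme remain trigonometric polynomials, so that the
scheme is an ordinary differential equation for finitely many coefficients.  The a priori estimate
is applied to the solution of a truncated, globally Lipschitz equation
(`exists_truncated_solution`), which therefore never leaves the region where the truncation has no
effect, and coincides with the maximal solution of the scheme on the whole time interval
(`IsSplitting.spectrallyConverges`).
-/

namespace FourierScheme

noncomputable section

variable {d n : ℕ}

open scoped ENNReal

/-! ### Functions on the torus -/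

/-- The `k`-th Fourier coefficient of a complex-valued function. -/
def fc (g : (Fin d → ℝ) → ℂ) (k : Fin d → ℤ) : ℂ :=
  ((2 * Real.pi) ^ d : ℂ)⁻¹ *
    ∫ x in Set.Icc (0 : Fin d → ℝ) (fun _ => 2 * Real.pi), g x * expMode (-k) x

/-- The `i`-th component of a vector field, as a complex-valued function. -/
def comp (f : (Fin d → ℝ) → (Fin n → ℝ)) (i : Fin n) : (Fin d → ℝ) → ℂ :=
  fun x => (f x i : ℂ)

theorem coeff_eq_fc (f : (Fin d → ℝ) → (Fin n → ℝ)) (k : Fin d → ℤ) (i : Fin n) :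
    coeff f k i = fc (comp f i) k := rfl

/-- Continuous complex-valued functions on the torus `(ℝ / 2πℤ)^d`. -/
structure IsTorusFun (g : (Fin d → ℝ) → ℂ) : Prop where
  continuous : Continuous g
  periodic : ∀ (j : Fin d) (x : Fin d → ℝ), g (x + Pi.single j (2 * Real.pi)) = g x

/-! ### Exponentials -/

theorem expMode_add_index (k l : Fin d → ℤ) (x : Fin d → ℝ) :
    expMode (k + l) x = expMode k x * expMode l x := by
  simp only [expMode, ← Complex.exp_add, ← mul_add, ← Complex.ofReal_add, ← Finset.sum_add_distrib]
  simp [add_mul]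

theorem expMode_zero (x : Fin d → ℝ) : expMode (0 : Fin d → ℤ) x = 1 := by
  simp [expMode]

theorem norm_expMode (k : Fin d → ℤ) (x : Fin d → ℝ) : ‖expMode k x‖ = 1 := by
  rw [expMode, mul_comm, Complex.norm_exp_ofReal_mul_I]

theorem conj_expMode (k : Fin d → ℤ) (x : Fin d → ℝ) :
    (starRingEnd ℂ) (expMode k x) = expMode (-k) x := by
  simp only [expMode, ← Complex.exp_conj, map_mul, Complex.conj_I, Complex.conj_ofReal]
  congr 1
  simp

theorem continuous_expMode (k : Fin d → ℤ) : Continuous (expMode k) := by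
  unfold expMode; fun_prop

theorem expMode_add_single (k : Fin d → ℤ) (j : Fin d) (x : Fin d → ℝ) (t : ℝ) :
    expMode k (x + Pi.single j t) = expMode k x * Complex.exp (Complex.I * ((k j : ℝ) * t : ℝ)) := by
  simp only [expMode, ← Complex.exp_add, ← mul_add, ← Complex.ofReal_add]
  congr 3
  simp [mul_add, Finset.sum_add_distrib, Pi.single_apply]

theorem isTorusFun_expMode (k : Fin d → ℤ) : IsTorusFun (expMode k) := by
  refine ⟨continuous_expMode k, fun j x => ?_⟩
  rw [expMode_add_single]
  have : Complex.exp (Complex.I * ((k j : ℝ) * (2 * Real.pi) : ℝ)) = 1 := by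
    rw [Complex.exp_eq_one_iff]
    exact ⟨k j, by push_cast; ring⟩
  rw [this, mul_one]

namespace IsTorusFun

variable {f g : (Fin d → ℝ) → ℂ}

theorem add (hf : IsTorusFun f) (hg : IsTorusFun g) : IsTorusFun (fun x => f x + g x) :=
  ⟨hf.1.add hg.1, fun j x => by simp [hf.2, hg.2]⟩

theorem sub (hf : IsTorusFun f) (hg : IsTorusFun g) : IsTorusFun (fun x => f x - g x) :=
  ⟨hf.1.sub hg.1, fun j x => by simp [hf.2, hg.2]⟩

theorem mul (hf : IsTorusFun f) (hg : IsTorusFun g) : IsTorusFun (fun x => f x * g x) :=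
  ⟨hf.1.mul hg.1, fun j x => by simp [hf.2, hg.2]⟩

theorem const (c : ℂ) : IsTorusFun (fun _ : Fin d → ℝ => c) :=
  ⟨continuous_const, fun _ _ => rfl⟩

theorem sum {ι : Type*} {s : Finset ι} {F : ι → (Fin d → ℝ) → ℂ} (h : ∀ i ∈ s, IsTorusFun (F i)) :
    IsTorusFun (fun x => ∑ i ∈ s, F i x) :=
  ⟨continuous_finsetSum _ fun i hi => (h i hi).1,
    fun j x => Finset.sum_congr rfl fun i hi => (h i hi).2 j x⟩

theorem add_int (hg : IsTorusFun g) (m : Fin d → ℤ) (x : Fin d → ℝ) :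
    g (x + fun i => 2 * Real.pi * (m i : ℝ)) = g x := by
  let P : AddSubgroup (Fin d → ℝ) :=
    { carrier := {c | ∀ x, g (x + c) = g x}
      zero_mem' := fun x => by simp
      add_mem' := fun {a b} ha hb x => by rw [← add_assoc, hb, ha]
      neg_mem' := fun {a} ha x => by
        have := ha (x + -a)
        simpa using this.symm }
  have hP : ∀ j, (Pi.single j (2 * Real.pi) : Fin d → ℝ) ∈ P := fun j x => hg.2 j x
  have : (fun i => 2 * Real.pi * (m i : ℝ)) = ∑ j, m j • (Pi.single j (2 * Real.pi) : Fin d → ℝ) := by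
    ext i
    simp [Finset.sum_apply, Pi.single_apply, mul_comm]
  rw [this]
  exact (AddSubgroup.sum_mem P fun j _ => P.zsmul_mem (hP j) (m j)) x

end IsTorusFun

/-! ### Fourier coefficients -/

theorem integrableOn_box {g : (Fin d → ℝ) → ℂ} (hg : Continuous g) :
    IntegrableOn g (Set.Icc (0 : Fin d → ℝ) (fun _ => 2 * Real.pi)) :=
  hg.continuousOn.integrableOn_compact isCompact_Icc

theorem volume_box :
    volume.real (Set.Icc (0 : Fin d → ℝ) (fun _ => 2 * Real.pi)) = (2 * Real.pi) ^ d := by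
  rw [Measure.real, Real.volume_Icc_pi_toReal]
  · simp
  · intro i; simp only [Pi.zero_apply]; positivity

theorem fc_add {f g : (Fin d → ℝ) → ℂ} (hf : Continuous f) (hg : Continuous g) (k : Fin d → ℤ) :
    fc (fun x => f x + g x) k = fc f k + fc g k := by
  simp only [fc, add_mul]
  rw [← mul_add]
  congr 1
  exact integral_add (integrableOn_box (hf.mul (continuous_expMode _)))
    (integrableOn_box (hg.mul (continuous_expMode _)))

theorem fc_const_mul (c : ℂ) (f : (Fin d → ℝ) → ℂ) (k : Fin d → ℤ) :
    fc (fun x => c * f x) k = c * fc f k := by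
  simp only [fc, mul_assoc]
  rw [integral_const_mul]; ring

theorem fc_neg (f : (Fin d → ℝ) → ℂ) (k : Fin d → ℤ) :
    fc (fun x => - f x) k = - fc f k := by
  simpa using fc_const_mul (-1) f k

theorem fc_sub {f g : (Fin d → ℝ) → ℂ} (hf : Continuous f) (hg : Continuous g) (k : Fin d → ℤ) :
    fc (fun x => f x - g x) k = fc f k - fc g k := by
  simp only [sub_eq_add_neg]
  rw [← fc_neg]
  exact fc_add hf hg.neg k

theorem fc_zero (k : Fin d → ℤ) : fc (fun _ => 0) k = 0 := by simp [fc]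

theorem fc_sum {ι : Type*} {s : Finset ι} {F : ι → (Fin d → ℝ) → ℂ}
    (h : ∀ i ∈ s, Continuous (F i)) (k : Fin d → ℤ) :
    fc (fun x => ∑ i ∈ s, F i x) k = ∑ i ∈ s, fc (F i) k := by
  classical
  induction s using Finset.induction_on with
  | empty => simp [fc_zero]
  | insert a s ha ih =>
    simp only [Finset.sum_insert ha]
    rw [fc_add (h a (by simp)) (continuous_finsetSum _ fun i hi => h i (by simp [hi])),
      ih fun i hi => h i (by simp [hi])]

theorem fc_expMode_mul (p : Fin d → ℤ) (g : (Fin d → ℝ) → ℂ) (k : Fin d → ℤ) :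
    fc (fun x => expMode p x * g x) k = fc g (k - p) := by
  simp only [fc]
  congr 2
  ext x
  rw [mul_comm (expMode p x), mul_assoc, ← expMode_add_index]
  congr 2
  abel

theorem norm_fc_le {g : (Fin d → ℝ) → ℂ} {C : ℝ} (h : ∀ x, ‖g x‖ ≤ C) (k : Fin d → ℤ) :
    ‖fc g k‖ ≤ C := by
  have h1 := norm_setIntegral_le_of_norm_le_const (μ := volume) (C := C)
    (s := Set.Icc (0 : Fin d → ℝ) (fun _ => 2 * Real.pi)) (f := fun x => g x * expMode (-k) x)
    isCompact_Icc.measure_lt_top (fun x _ => by simpa [norm_expMode] using h x)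
  rw [volume_box] at h1
  have hp : (0 : ℝ) < (2 * Real.pi) ^ d := by positivity
  rw [fc, norm_mul, norm_inv]
  have : ‖((2 * Real.pi) ^ d : ℂ)‖ = (2 * Real.pi) ^ d := by
    rw [norm_pow, norm_mul]; simp [abs_of_pos Real.pi_pos]
  rw [this, inv_mul_le_iff₀ hp]
  exact h1.trans_eq (mul_comm _ _)

theorem conj_fc (g : (Fin d → ℝ) → ℂ) (k : Fin d → ℤ) :
    (starRingEnd ℂ) (fc g k) = fc (fun x => (starRingEnd ℂ) (g x)) (-k) := by
  simp only [fc, map_mul, map_inv₀, map_pow, Complex.conj_ofReal, ← integral_conj, conj_expMode,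
    map_ofNat]

theorem conj_fc_comp (f : (Fin d → ℝ) → (Fin n → ℝ)) (i : Fin n) (k : Fin d → ℤ) :
    (starRingEnd ℂ) (fc (comp f i) k) = fc (comp f i) (-k) := by
  rw [conj_fc]
  congr 1
  ext x
  simp [comp]

/-! ### Comparison with the Fourier series of Mathlib on `(ℝ / ℤ)^d` -/

/-- The function on `(ℝ / ℤ)^d` corresponding to a function on `(ℝ / 2πℤ)^d`. -/
def torusLift (g : (Fin d → ℝ) → ℂ) (y : UnitAddTorus (Fin d)) : ℂ :=
  g (fun i => 2 * Real.pi * ((AddCircle.equivIoc 1 0 (y i)).1 : ℝ))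

theorem torusLift_coe {g : (Fin d → ℝ) → ℂ} (hg : IsTorusFun g) (x : Fin d → ℝ) :
    torusLift g (fun i => (x i : UnitAddCircle)) = g (fun i => 2 * Real.pi * x i) := by
  have h : ∀ i, ∃ m : ℤ, x i = (AddCircle.equivIoc (1 : ℝ) 0 (x i : UnitAddCircle)).1 + m := by
    intro i
    have : ((AddCircle.equivIoc (1 : ℝ) 0 (x i : UnitAddCircle)).1 : UnitAddCircle) = x i :=
      (AddCircle.equivIoc (1 : ℝ) 0).symm_apply_apply _
    rw [← sub_eq_zero, ← AddCircle.coe_sub, AddCircle.coe_eq_zero_iff] at this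
    obtain ⟨m, hm⟩ := this
    refine ⟨-m, ?_⟩
    simp only [zsmul_eq_mul, mul_one] at hm
    push_cast
    linarith
  choose m hm using h
  rw [torusLift, ← hg.add_int m]
  congr 1
  ext i
  simp only [Pi.add_apply]
  rw [← mul_add, ← hm i]

theorem continuous_torusLift {g : (Fin d → ℝ) → ℂ} (hg : IsTorusFun g) :
    Continuous (torusLift g) := by
  have hq : IsOpenQuotientMap
      (Pi.map fun _ : Fin d => ((↑) : ℝ → UnitAddCircle)) :=
    IsOpenQuotientMap.piMap fun _ => QuotientAddGroup.isOpenQuotientMap_mk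
  rw [hq.isQuotientMap.continuous_iff]
  have : torusLift g ∘ (Pi.map fun _ : Fin d => ((↑) : ℝ → UnitAddCircle)) =
      fun x => g (fun i => 2 * Real.pi * x i) := by
    ext x
    exact torusLift_coe hg x
  rw [this]
  exact hg.1.comp (by fun_prop)

open scoped Pointwise in
theorem mFourierCoeff_torusLift {g : (Fin d → ℝ) → ℂ} (hg : IsTorusFun g) (k : Fin d → ℤ) :
    UnitAddTorus.mFourierCoeff (torusLift g) k = fc g k := by
  rw [UnitAddTorus.mFourierCoeff_eq_integral _ _ (fun _ => 0)]
  have h1 : ∀ x : Fin d → ℝ, UnitAddTorus.mFourier (-k) (fun i => (x i : UnitAddCircle)) •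
      torusLift g (fun i => (x i : UnitAddCircle)) =
      (fun y => g y * expMode (-k) y) ((2 * Real.pi) • x) := by
    intro x
    rw [torusLift_coe hg]
    have : UnitAddTorus.mFourier (-k) (fun i => (x i : UnitAddCircle)) =
        expMode (-k) ((2 * Real.pi) • x) := by
      simp only [UnitAddTorus.mFourier, ContinuousMap.coe_mk, fourier_coe_apply, expMode,
        ← Complex.exp_sum]
      congr 1
      push_cast
      rw [Finset.mul_sum]
      refine Finset.sum_congr rfl fun i _ => ?_
      simp
      ring
    rw [this, smul_eq_mul, mul_comm]
    rfl
  simp_rw [h1]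
  rw [Measure.setIntegral_comp_smul_of_pos volume (fun y => g y * expMode (-k) y) _
    (by positivity : (0:ℝ) < 2 * Real.pi)]
  rw [fc]
  have h2 : (2 * Real.pi) • {x : Fin d → ℝ | ∀ i, x i ∈ Set.Ioc (0:ℝ) (0 + 1)} =
      Set.univ.pi fun _ => Set.Ioc (0:ℝ) (2 * Real.pi) := by
    have : {x : Fin d → ℝ | ∀ i, x i ∈ Set.Ioc (0:ℝ) (0 + 1)} =
        Set.univ.pi fun _ => Set.Ioc (0:ℝ) 1 := by
      ext x; simp
    rw [this, Set.smul_set_pi₀ (by positivity)]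
    congr 1
    funext i
    rw [Pi.smul_apply, LinearOrderedField.smul_Ioc (by positivity)]
    simp
  have h3 : (Set.univ.pi fun _ => Set.Ioc (0:ℝ) (2 * Real.pi) : Set (Fin d → ℝ)) =ᵐ[volume]
      Set.Icc (0 : Fin d → ℝ) (fun _ => 2 * Real.pi) :=
    Measure.univ_pi_Ioc_ae_eq_Icc (f := fun _ : Fin d => (0:ℝ)) (g := fun _ => 2 * Real.pi)
  rw [h2, setIntegral_congr_set h3]
  simp

theorem fc_one (k : Fin d → ℤ) : fc (fun _ => 1) k = if k = 0 then 1 else 0 := by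
  rw [← mFourierCoeff_torusLift (IsTorusFun.const 1)]
  have h := UnitAddTorus.mFourierBasis_repr (UnitAddTorus.mFourierLp 2 (0 : Fin d → ℤ)) k
  rw [UnitAddTorus.mFourierCoeff_toLp] at h
  have h0 : torusLift (fun _ : Fin d → ℝ => (1:ℂ)) = UnitAddTorus.mFourier (0 : Fin d → ℤ) := by
    ext y; simp [torusLift, UnitAddTorus.mFourier_zero]
  rw [h0, ← h, ← UnitAddTorus.coe_mFourierBasis, HilbertBasis.repr_self]
  simp [lp.single_apply, Pi.single_apply]

/-- A continuous function on the torus with absolutely summable Fourier coefficients is the sum of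
its Fourier series. -/
theorem hasSum_fc {g : (Fin d → ℝ) → ℂ} (hg : IsTorusFun g) (hs : Summable (fc g))
    (x : Fin d → ℝ) : HasSum (fun k => fc g k * expMode k x) (g x) := by
  have hs' : Summable (UnitAddTorus.mFourierCoeff (⟨torusLift g, continuous_torusLift hg⟩ :
      C(UnitAddTorus (Fin d), ℂ))) := by
    refine hs.congr fun k => ?_
    exact (mFourierCoeff_torusLift hg k).symm
  have h := UnitAddTorus.hasSum_mFourier_series_apply_of_summable hs'
    (fun i => ((x i / (2 * Real.pi) : ℝ) : UnitAddCircle))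
  have hx : (fun i => 2 * Real.pi * (x i / (2 * Real.pi))) = x := by
    ext i; field_simp
  convert! h using 1
  · ext k
    have := mFourierCoeff_torusLift hg k
    simp only [ContinuousMap.coe_mk, this, smul_eq_mul]
    congr 1
    simp only [UnitAddTorus.mFourier, ContinuousMap.coe_mk, fourier_coe_apply, expMode,
        ← Complex.exp_sum]
    congr 1
    push_cast
    rw [Finset.mul_sum]
    refine Finset.sum_congr rfl fun i _ => ?_
    have : (Real.pi : ℂ) ≠ 0 := by exact_mod_cast Real.pi_ne_zero
    field_simp
  · have := torusLift_coe hg (fun i => x i / (2 * Real.pi))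
    rw [hx] at this
    exact this.symm

/-- The coefficients of the product with an absolutely convergent trigonometric series. -/
theorem hasSum_fc_mul {a : (Fin d → ℤ) → ℂ} (ha : Summable fun k => ‖a k‖)
    {f g : (Fin d → ℝ) → ℂ} (hf : ∀ x, HasSum (fun k => a k * expMode k x) (f x))
    (hg : Continuous g) (k : Fin d → ℤ) :
    HasSum (fun p => a p * fc g (k - p)) (fc (fun x => f x * g x) k) := by
  obtain ⟨C, hC⟩ := isCompact_Icc.exists_bound_of_continuousOn
    (s := Set.Icc (0 : Fin d → ℝ) (fun _ => 2 * Real.pi)) hg.continuousOn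
  have hC0 : 0 ≤ C := (norm_nonneg _).trans (hC 0 ⟨le_rfl, fun i => by simp; positivity⟩)
  have hcont : ∀ p, Continuous fun x => a p * expMode p x * g x * expMode (-k) x := fun p =>
    (((continuous_const.mul (continuous_expMode p)).mul hg).mul (continuous_expMode _))
  have key := hasSum_integral_of_summable_integral_norm
    (μ := volume.restrict (Set.Icc (0 : Fin d → ℝ) (fun _ => 2 * Real.pi)))
    (F := fun p x => a p * expMode p x * g x * expMode (-k) x)
    (fun p => integrableOn_box (hcont p)) ?_
  · have h2 : ∀ x, ∑' p, a p * expMode p x * g x * expMode (-k) x =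
        f x * g x * expMode (-k) x := by
      intro x
      exact (((hf x).mul_right (g x)).mul_right (expMode (-k) x)).tsum_eq
    simp_rw [h2] at key
    have := key.mul_left ((2 * Real.pi) ^ d : ℂ)⁻¹
    convert! this using 1
    ext p
    rw [← fc_expMode_mul, ← fc_const_mul]
    simp only [fc]
    congr 2
    ext x; ring
  · refine Summable.of_nonneg_of_le (fun p => by positivity) (fun p => ?_)
      (ha.mul_right (C * (2 * Real.pi) ^ d))
    have h1 : ∫ x in Set.Icc (0 : Fin d → ℝ) (fun _ => 2 * Real.pi),
        ‖a p * expMode p x * g x * expMode (-k) x‖ ≤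
        ∫ x in Set.Icc (0 : Fin d → ℝ) (fun _ => 2 * Real.pi), ‖a p‖ * C := by
      refine setIntegral_mono_on (integrableOn_box (hcont p)).norm
        (integrableOn_const isCompact_Icc.measure_lt_top.ne) measurableSet_Icc fun x hx => ?_
      simp only [norm_mul, norm_expMode, mul_one]
      exact mul_le_mul_of_nonneg_left (hC x hx) (norm_nonneg _)
    refine h1.trans_eq ?_
    rw [setIntegral_const, volume_box, smul_eq_mul]; ring

/-- The coefficients of an absolutely convergent trigonometric series. -/
theorem fc_eq_of_hasSum {a : (Fin d → ℤ) → ℂ} (ha : Summable fun k => ‖a k‖)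
    {f : (Fin d → ℝ) → ℂ} (hf : ∀ x, HasSum (fun k => a k * expMode k x) (f x))
    (k : Fin d → ℤ) : fc f k = a k := by
  have h := hasSum_fc_mul ha hf (continuous_const (y := (1:ℂ))) k
  simp only [mul_one, fc_one] at h
  refine h.unique ?_
  convert hasSum_ite_eq k (a k) using 2 with p
  by_cases hp : p = k
  · simp [hp]
  · simp [hp, sub_eq_zero, Ne.symm hp]

/-! ### Convolution of nonnegative sequences -/

/-- Convolution of sequences indexed by `ℤ^d` with values in `[0, ∞]`. -/
def conv (a b : (Fin d → ℤ) → ℝ≥0∞) (k : Fin d → ℤ) : ℝ≥0∞ := ∑' l, a (k - l) * b l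

theorem ENNReal_two_mul_le_add_sq (a b : ℝ≥0∞) : 2 * (a * b) ≤ a ^ 2 + b ^ 2 := by
  rcases le_total a b with h | h
  · obtain ⟨t, rfl⟩ := exists_add_of_le h
    calc 2 * (a * (a + t)) ≤ 2 * (a * (a + t)) + t ^ 2 := le_self_add
      _ = a ^ 2 + (a + t) ^ 2 := by ring
  · obtain ⟨t, rfl⟩ := exists_add_of_le h
    calc 2 * ((b + t) * b) ≤ 2 * ((b + t) * b) + t ^ 2 := le_self_add
      _ = (b + t) ^ 2 + b ^ 2 := by ring

theorem ENNReal_add_sq_le (a b : ℝ≥0∞) : (a + b) ^ 2 ≤ 2 * (a ^ 2 + b ^ 2) := by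
  calc (a + b) ^ 2 = a ^ 2 + b ^ 2 + 2 * (a * b) := by ring
    _ ≤ a ^ 2 + b ^ 2 + (a ^ 2 + b ^ 2) := by gcongr; exact ENNReal_two_mul_le_add_sq a b
    _ = _ := by ring

/-- The weighted Cauchy–Schwarz inequality for sums in `[0, ∞]`. -/
theorem tsum_mul_sq_le {ι : Type*} (w b : ι → ℝ≥0∞) :
    (∑' l, w l * b l) ^ 2 ≤ (∑' l, w l) * ∑' l, w l * b l ^ 2 := by
  have h : 2 * (∑' l, w l * b l) ^ 2 ≤ 2 * ((∑' l, w l) * ∑' l, w l * b l ^ 2) := by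
    have h1 : (∑' l, w l * b l) ^ 2 = ∑' l, ∑' m, w l * w m * (b l * b m) := by
      rw [sq, ← ENNReal.tsum_mul_right]
      refine tsum_congr fun l => ?_
      rw [← ENNReal.tsum_mul_left]
      exact tsum_congr fun m => by ring
    have h2 : (∑' l, w l) * ∑' l, w l * b l ^ 2 = ∑' l, ∑' m, w l * w m * b m ^ 2 := by
      rw [← ENNReal.tsum_mul_right]
      refine tsum_congr fun l => ?_
      rw [← ENNReal.tsum_mul_left]
      exact tsum_congr fun m => by ring
    have h3 : (∑' l, w l) * ∑' l, w l * b l ^ 2 = ∑' l, ∑' m, w l * w m * b l ^ 2 := by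
      rw [h2, ENNReal.tsum_comm]
      exact tsum_congr fun l => tsum_congr fun m => by ring
    calc 2 * (∑' l, w l * b l) ^ 2 = ∑' l, ∑' m, w l * w m * (2 * (b l * b m)) := by
          rw [h1, ← ENNReal.tsum_mul_left]
          refine tsum_congr fun l => ?_
          rw [← ENNReal.tsum_mul_left]
          exact tsum_congr fun m => by ring
      _ ≤ ∑' l, ∑' m, w l * w m * (b l ^ 2 + b m ^ 2) :=
          ENNReal.tsum_le_tsum fun l => ENNReal.tsum_le_tsum fun m => by
            gcongr; exact ENNReal_two_mul_le_add_sq _ _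
      _ = 2 * ((∑' l, w l) * ∑' l, w l * b l ^ 2) := by
          rw [two_mul]
          nth_rw 1 [h3]
          rw [h2, ← ENNReal.tsum_add]
          refine tsum_congr fun l => ?_
          rw [← ENNReal.tsum_add]
          exact tsum_congr fun m => by ring
  exact (ENNReal.mul_le_mul_iff_right (by simp) (by simp)).1 h

theorem tsum_sub_left (a : (Fin d → ℤ) → ℝ≥0∞) (k : Fin d → ℤ) : ∑' l, a (k - l) = ∑' l, a l :=
  (Equiv.subLeft k).tsum_eq a

theorem tsum_sub_right (a : (Fin d → ℤ) → ℝ≥0∞) (l : Fin d → ℤ) : ∑' k, a (k - l) = ∑' k, a k :=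
  (Equiv.subRight l).tsum_eq a

theorem tsum_conv (a b : (Fin d → ℤ) → ℝ≥0∞) :
    ∑' k, conv a b k = (∑' k, a k) * ∑' k, b k := by
  unfold conv
  rw [ENNReal.tsum_comm, ← ENNReal.tsum_mul_left]
  refine tsum_congr fun l => ?_
  rw [ENNReal.tsum_mul_right, tsum_sub_right]

theorem conv_comm (a b : (Fin d → ℤ) → ℝ≥0∞) (k : Fin d → ℤ) : conv a b k = conv b a k := by
  unfold conv
  rw [← (Equiv.subLeft k).tsum_eq]
  refine tsum_congr fun l => ?_
  simp [mul_comm]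

/-- Young's inequality `ℓ¹ * ℓ² → ℓ²`. -/
theorem tsum_conv_sq_le (a b : (Fin d → ℤ) → ℝ≥0∞) :
    ∑' k, conv a b k ^ 2 ≤ (∑' k, a k) ^ 2 * ∑' k, b k ^ 2 := by
  calc ∑' k, conv a b k ^ 2 ≤ ∑' k, (∑' l, a l) * conv a (fun l => b l ^ 2) k := by
        refine ENNReal.tsum_le_tsum fun k => ?_
        refine (tsum_mul_sq_le (fun l => a (k - l)) b).trans_eq ?_
        rw [tsum_sub_left]; rfl
    _ = (∑' k, a k) ^ 2 * ∑' k, b k ^ 2 := by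
        rw [ENNReal.tsum_mul_left, tsum_conv]; ring

/-! ### Wiener and Sobolev norms of scalar functions -/

/-- The weighted Wiener norm `∑ (1 + |k|) |ĝ_k|`. -/
def wn (g : (Fin d → ℝ) → ℂ) : ℝ≥0∞ := ∑' k, (1 + ‖k‖ₑ) * ‖fc g k‖ₑ

/-- The squared `ℓ²` norm of the Fourier coefficients. -/
def l2n (g : (Fin d → ℝ) → ℂ) : ℝ≥0∞ := ∑' k, ‖fc g k‖ₑ ^ 2

/-- The squared homogeneous Sobolev norm `∑ |k|^{2s} |ĝ_k|²`. -/
def hn (s : ℝ) (g : (Fin d → ℝ) → ℂ) : ℝ≥0∞ := ∑' k, (‖k‖ₑ ^ s * ‖fc g k‖ₑ) ^ 2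

/-- Functions on the torus with finite weighted Wiener norm. -/
structure IsWiener (g : (Fin d → ℝ) → ℂ) : Prop extends IsTorusFun g where
  wn_lt_top : wn g < ⊤

theorem tsum_enorm_fc_le (g : (Fin d → ℝ) → ℂ) : ∑' k, ‖fc g k‖ₑ ≤ wn g :=
  ENNReal.tsum_le_tsum fun k => by
    calc ‖fc g k‖ₑ = 1 * ‖fc g k‖ₑ := (one_mul _).symm
      _ ≤ _ := by gcongr; exact le_self_add

theorem tsum_enorm_mul_fc_le (g : (Fin d → ℝ) → ℂ) : ∑' k, ‖k‖ₑ * ‖fc g k‖ₑ ≤ wn g :=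
  ENNReal.tsum_le_tsum fun k => by gcongr; exact le_add_self

theorem summable_norm_of_tsum_enorm {ι : Type*} {a : ι → ℂ} (h : ∑' k, ‖a k‖ₑ < ⊤) :
    Summable fun k => ‖a k‖ := by
  have h1 : ∑' k, ((‖a k‖₊ : NNReal) : ℝ≥0∞) ≠ ⊤ := h.ne
  rw [ENNReal.tsum_coe_ne_top_iff_summable] at h1
  exact NNReal.summable_coe.2 h1

theorem IsWiener.summable_norm {g : (Fin d → ℝ) → ℂ} (hg : IsWiener g) :
    Summable fun k => ‖fc g k‖ :=
  summable_norm_of_tsum_enorm ((tsum_enorm_fc_le g).trans_lt hg.wn_lt_top)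

theorem IsWiener.hasSum {g : (Fin d → ℝ) → ℂ} (hg : IsWiener g) (x : Fin d → ℝ) :
    HasSum (fun k => fc g k * expMode k x) (g x) :=
  hasSum_fc hg.toIsTorusFun hg.summable_norm.of_norm x

theorem enorm_tsum_le {ι : Type*} (a : ι → ℂ) : ‖∑' k, a k‖ₑ ≤ ∑' k, ‖a k‖ₑ := by
  by_cases h : ∑' k, ‖a k‖ₑ = ⊤
  · rw [h]; exact le_top
  have h' := summable_norm_of_tsum_enorm (lt_top_iff_ne_top.2 h)
  have h1 := norm_tsum_le_tsum_norm h'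
  rw [← ofReal_norm]
  refine (ENNReal.ofReal_le_ofReal h1).trans_eq ?_
  rw [ENNReal.ofReal_tsum_of_nonneg (fun _ => norm_nonneg _) h']
  simp

theorem IsWiener.enorm_le {g : (Fin d → ℝ) → ℂ} (hg : IsWiener g) (x : Fin d → ℝ) :
    ‖g x‖ₑ ≤ wn g := by
  rw [← (hg.hasSum x).tsum_eq]
  refine (enorm_tsum_le _).trans ((ENNReal.tsum_le_tsum fun k => ?_).trans (tsum_enorm_fc_le g))
  rw [enorm_mul, ← ofReal_norm (expMode k x), norm_expMode]
  simp

theorem IsWiener.norm_le {g : (Fin d → ℝ) → ℂ} (hg : IsWiener g) (x : Fin d → ℝ) :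
    ‖g x‖ ≤ (wn g).toReal := by
  have := ENNReal.toReal_mono hg.wn_lt_top.ne (hg.enorm_le x)
  simpa using this

theorem IsWiener.fc_mul {f g : (Fin d → ℝ) → ℂ} (hf : IsWiener f) (hg : Continuous g)
    (k : Fin d → ℤ) : HasSum (fun p => fc f p * fc g (k - p)) (fc (fun x => f x * g x) k) :=
  hasSum_fc_mul hf.summable_norm hf.hasSum hg k

theorem IsWiener.enorm_fc_mul_le {f g : (Fin d → ℝ) → ℂ} (hf : IsWiener f) (hg : Continuous g)
    (k : Fin d → ℤ) :
    ‖fc (fun x => f x * g x) k‖ₑ ≤ conv (fun k => ‖fc g k‖ₑ) (fun k => ‖fc f k‖ₑ) k := by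
  rw [← (hf.fc_mul hg k).tsum_eq]
  refine (enorm_tsum_le _).trans_eq (tsum_congr fun p => ?_)
  rw [enorm_mul, mul_comm]

theorem enorm_index_le (k l : Fin d → ℤ) : ‖k‖ₑ ≤ ‖k - l‖ₑ + ‖l‖ₑ := by
  simpa using enorm_add_le (k - l) l

theorem wn_add_le {f g : (Fin d → ℝ) → ℂ} (hf : Continuous f) (hg : Continuous g) :
    wn (fun x => f x + g x) ≤ wn f + wn g := by
  unfold wn
  rw [← ENNReal.tsum_add]
  refine ENNReal.tsum_le_tsum fun k => ?_
  rw [fc_add hf hg, ← mul_add]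
  gcongr
  exact enorm_add_le _ _

theorem wn_mul_le {f g : (Fin d → ℝ) → ℂ} (hf : IsWiener f) (hg : Continuous g) :
    wn (fun x => f x * g x) ≤ wn f * wn g := by
  rw [mul_comm]
  unfold wn
  rw [← tsum_conv]
  refine ENNReal.tsum_le_tsum fun k => ?_
  calc (1 + ‖k‖ₑ) * ‖fc (fun x => f x * g x) k‖ₑ
      ≤ (1 + ‖k‖ₑ) * conv (fun k => ‖fc g k‖ₑ) (fun k => ‖fc f k‖ₑ) k := by
        gcongr; exact hf.enorm_fc_mul_le hg k
    _ ≤ _ := by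
        unfold conv
        rw [← ENNReal.tsum_mul_left]
        refine ENNReal.tsum_le_tsum fun l => ?_
        calc (1 + ‖k‖ₑ) * (‖fc g (k - l)‖ₑ * ‖fc f l‖ₑ)
            ≤ ((1 + ‖k - l‖ₑ) * (1 + ‖l‖ₑ)) * (‖fc g (k - l)‖ₑ * ‖fc f l‖ₑ) := by
              gcongr
              calc 1 + ‖k‖ₑ ≤ 1 + (‖k - l‖ₑ + ‖l‖ₑ) := by gcongr; exact enorm_index_le k l
                _ ≤ 1 + (‖k - l‖ₑ + ‖l‖ₑ) + ‖k - l‖ₑ * ‖l‖ₑ := le_self_add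
                _ = _ := by ring
          _ = _ := by ring

theorem wn_const (c : ℂ) : wn (fun _ : Fin d → ℝ => c) = ‖c‖ₑ := by
  unfold wn
  have h : ∀ k : Fin d → ℤ, fc (fun _ : Fin d → ℝ => c) k = if k = 0 then c else 0 := by
    intro k
    have := fc_const_mul c (fun _ => 1) k
    simp only [mul_one, fc_one] at this
    rw [this]; simp
  rw [tsum_eq_single 0]
  · simp [h]
  · intro k hk; simp [h, hk]

namespace IsWiener

variable {f g : (Fin d → ℝ) → ℂ}

theorem const (c : ℂ) : IsWiener (fun _ : Fin d → ℝ => c) :=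
  ⟨IsTorusFun.const c, by rw [wn_const]; exact enorm_lt_top⟩

theorem add (hf : IsWiener f) (hg : IsWiener g) : IsWiener (fun x => f x + g x) :=
  ⟨hf.toIsTorusFun.add hg.toIsTorusFun, (wn_add_le hf.continuous hg.continuous).trans_lt
    (ENNReal.add_lt_top.2 ⟨hf.wn_lt_top, hg.wn_lt_top⟩)⟩

theorem mul (hf : IsWiener f) (hg : IsWiener g) : IsWiener (fun x => f x * g x) :=
  ⟨hf.toIsTorusFun.mul hg.toIsTorusFun, (wn_mul_le hf hg.continuous).trans_lt
    (ENNReal.mul_lt_top hf.wn_lt_top hg.wn_lt_top)⟩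

theorem sum {ι : Type*} {s : Finset ι} {F : ι → (Fin d → ℝ) → ℂ} (h : ∀ i ∈ s, IsWiener (F i)) :
    IsWiener (fun x => ∑ i ∈ s, F i x) := by
  classical
  induction s using Finset.induction_on with
  | empty => simpa using const 0
  | insert a s ha ih =>
    simp only [Finset.sum_insert ha]
    exact (h a (by simp)).add (ih fun i hi => h i (by simp [hi]))

theorem sub (hf : IsWiener f) (hg : IsWiener g) : IsWiener (fun x => f x - g x) := by
  have := hf.add ((const (-1)).mul hg)
  simpa [sub_eq_add_neg] using this

end IsWiener

theorem enorm_index_rpow_le {s : ℝ} (hs : 0 ≤ s) (k l : Fin d → ℤ) :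
    ‖k‖ₑ ^ s ≤ 2 ^ s * (‖k - l‖ₑ ^ s + ‖l‖ₑ ^ s) := by
  have h : ‖k‖ₑ ≤ 2 * max ‖k - l‖ₑ ‖l‖ₑ := by
    refine (enorm_index_le k l).trans ?_
    rw [two_mul]
    exact add_le_add (le_max_left _ _) (le_max_right _ _)
  calc ‖k‖ₑ ^ s ≤ (2 * max ‖k - l‖ₑ ‖l‖ₑ) ^ s := ENNReal.rpow_le_rpow h hs
    _ = 2 ^ s * (max ‖k - l‖ₑ ‖l‖ₑ) ^ s := ENNReal.mul_rpow_of_nonneg _ _ hs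
    _ ≤ _ := by
      gcongr
      rcases max_cases ‖k - l‖ₑ ‖l‖ₑ with ⟨h, _⟩ | ⟨h, _⟩ <;> rw [h]
      · exact le_self_add
      · exact le_add_self

/-- The Sobolev product (Moser) estimate, with Wiener norms in place of `L^∞` norms. -/
theorem hn_mul_le {s : ℝ} (hs : 0 ≤ s) {f g : (Fin d → ℝ) → ℂ} (hf : IsWiener f)
    (hg : Continuous g) :
    hn s (fun x => f x * g x) ≤
      2 * (2 ^ s) ^ 2 * ((wn f) ^ 2 * hn s g + (wn g) ^ 2 * hn s f) := by
  set a := fun k => ‖fc g k‖ₑ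
  set b := fun k => ‖fc f k‖ₑ
  have h1 : ∀ k, ‖k‖ₑ ^ s * ‖fc (fun x => f x * g x) k‖ₑ ≤
      2 ^ s * (conv (fun k => ‖k‖ₑ ^ s * a k) b k + conv a (fun k => ‖k‖ₑ ^ s * b k) k) := by
    intro k
    calc _ ≤ ‖k‖ₑ ^ s * conv a b k := by gcongr; exact hf.enorm_fc_mul_le hg k
      _ ≤ _ := by
        unfold conv
        rw [← ENNReal.tsum_add, ← ENNReal.tsum_mul_left, ← ENNReal.tsum_mul_left]
        refine ENNReal.tsum_le_tsum fun l => ?_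
        calc ‖k‖ₑ ^ s * (a (k - l) * b l)
            ≤ (2 ^ s * (‖k - l‖ₑ ^ s + ‖l‖ₑ ^ s)) * (a (k - l) * b l) := by
              gcongr; exact enorm_index_rpow_le hs k l
          _ = _ := by ring
  calc hn s (fun x => f x * g x) ≤ ∑' k, (2 ^ s * (conv (fun k => ‖k‖ₑ ^ s * a k) b k +
        conv a (fun k => ‖k‖ₑ ^ s * b k) k)) ^ 2 :=
        ENNReal.tsum_le_tsum fun k => pow_le_pow_left' (h1 k) 2
    _ ≤ ∑' k, 2 * (2 ^ s) ^ 2 * (conv (fun k => ‖k‖ₑ ^ s * a k) b k ^ 2 +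
        conv a (fun k => ‖k‖ₑ ^ s * b k) k ^ 2) := by
        refine ENNReal.tsum_le_tsum fun k => ?_
        rw [mul_pow]
        calc _ ≤ (2 ^ s) ^ 2 * (2 * (conv (fun k => ‖k‖ₑ ^ s * a k) b k ^ 2 +
              conv a (fun k => ‖k‖ₑ ^ s * b k) k ^ 2)) := by
              gcongr; exact ENNReal_add_sq_le _ _
          _ = _ := by ring
    _ = 2 * (2 ^ s) ^ 2 * (∑' k, conv b (fun k => ‖k‖ₑ ^ s * a k) k ^ 2 +
        ∑' k, conv a (fun k => ‖k‖ₑ ^ s * b k) k ^ 2) := by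
        rw [ENNReal.tsum_mul_left, ENNReal.tsum_add]
        simp_rw [conv_comm b]
    _ ≤ _ := by
        gcongr
        · refine (tsum_conv_sq_le _ _).trans ?_
          gcongr
          · exact tsum_enorm_fc_le f
          · exact le_rfl
        · refine (tsum_conv_sq_le _ _).trans ?_
          gcongr
          · exact tsum_enorm_fc_le g
          · exact le_rfl

theorem hn_add_le (s : ℝ) {f g : (Fin d → ℝ) → ℂ} (hf : Continuous f) (hg : Continuous g) :
    hn s (fun x => f x + g x) ≤ 2 * (hn s f + hn s g) := by
  unfold hn
  rw [← ENNReal.tsum_add, ← ENNReal.tsum_mul_left]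
  refine ENNReal.tsum_le_tsum fun k => ?_
  rw [fc_add hf hg]
  calc _ ≤ (‖k‖ₑ ^ s * ‖fc f k‖ₑ + ‖k‖ₑ ^ s * ‖fc g k‖ₑ) ^ 2 := by
        rw [← mul_add]; gcongr; exact enorm_add_le _ _
    _ ≤ _ := ENNReal_add_sq_le _ _

theorem hn_const {s : ℝ} (hs : 0 < s) (c : ℂ) : hn s (fun _ : Fin d → ℝ => c) = 0 := by
  unfold hn
  rw [ENNReal.tsum_eq_zero]
  intro k
  have := fc_const_mul c (fun _ => 1) k
  simp only [mul_one, fc_one] at this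
  rw [this]
  by_cases hk : k = 0
  · simp [hk, ENNReal.zero_rpow_of_pos hs]
  · simp [hk]

/-! ### Means -/

/-- The mean value of a real function over the torus. -/
def mean (g : (Fin d → ℝ) → ℝ) : ℝ :=
  ((2 * Real.pi) ^ d)⁻¹ * ∫ x in Set.Icc (0 : Fin d → ℝ) (fun _ => 2 * Real.pi), g x

theorem fc_zero_eq_mean (g : (Fin d → ℝ) → ℝ) : fc (fun x => (g x : ℂ)) 0 = mean g := by
  simp only [fc, neg_zero, expMode_zero, mul_one, mean]
  rw [Complex.ofReal_mul]
  congr 1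
  · push_cast; rfl
  · exact integral_ofReal

theorem mean_mono {f g : (Fin d → ℝ) → ℝ} (hf : Continuous f) (hg : Continuous g)
    (h : ∀ x, f x ≤ g x) : mean f ≤ mean g := by
  unfold mean
  refine mul_le_mul_of_nonneg_left ?_ (by positivity)
  exact setIntegral_mono (hf.continuousOn.integrableOn_compact isCompact_Icc)
    (hg.continuousOn.integrableOn_compact isCompact_Icc) h

theorem mean_const_mul (c : ℝ) (f : (Fin d → ℝ) → ℝ) : mean (fun x => c * f x) = c * mean f := by
  unfold mean; rw [integral_const_mul]; ring

theorem mean_add {f g : (Fin d → ℝ) → ℝ} (hf : Continuous f) (hg : Continuous g) :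
    mean (fun x => f x + g x) = mean f + mean g := by
  unfold mean
  rw [← mul_add]
  congr 1
  exact integral_add (hf.continuousOn.integrableOn_compact isCompact_Icc)
    (hg.continuousOn.integrableOn_compact isCompact_Icc)

theorem mean_sum {ι : Type*} {s : Finset ι} {F : ι → (Fin d → ℝ) → ℝ}
    (h : ∀ i ∈ s, Continuous (F i)) : mean (fun x => ∑ i ∈ s, F i x) = ∑ i ∈ s, mean (F i) := by
  unfold mean
  rw [← Finset.mul_sum]
  congr 1
  exact integral_finsetSum _ fun i hi =>
    (h i hi).continuousOn.integrableOn_compact isCompact_Icc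

theorem mean_nonneg {f : (Fin d → ℝ) → ℝ} (h : ∀ x, 0 ≤ f x) : 0 ≤ mean f := by
  unfold mean
  exact mul_nonneg (by positivity) (integral_nonneg h)

theorem abs_mean_le {f g : (Fin d → ℝ) → ℝ} (hf : Continuous f) (hg : Continuous g)
    (h : ∀ x, |f x| ≤ g x) : |mean f| ≤ mean g := by
  rw [abs_le]
  constructor
  · have h1 : mean (fun x => -1 * g x) ≤ mean f :=
      mean_mono (continuous_const.mul hg) hf fun x => by
        simpa using neg_le_of_abs_le (h x)
    have h2 := mean_const_mul (-1) g
    linarith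
  · exact mean_mono hf hg fun x => (le_abs_self _).trans (h x)

/-- Parseval's identity for real functions with absolutely convergent Fourier series. -/
theorem hasSum_sq_fc {g : (Fin d → ℝ) → ℝ} (hg : IsWiener (fun x => (g x : ℂ))) :
    HasSum (fun k => ‖fc (fun x => (g x : ℂ)) k‖ ^ 2) (mean fun x => g x ^ 2) := by
  have h := hg.fc_mul hg.continuous 0
  have h1 : (fun x => (g x : ℂ) * (g x : ℂ)) = fun x => ((g x ^ 2 : ℝ) : ℂ) := by
    ext x; push_cast; ring
  rw [h1, fc_zero_eq_mean] at h
  have h2 : ∀ p, fc (fun x => (g x : ℂ)) p * fc (fun x => (g x : ℂ)) (0 - p) =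
      ((‖fc (fun x => (g x : ℂ)) p‖ ^ 2 : ℝ) : ℂ) := by
    intro p
    have h3 := conj_fc (fun x => (g x : ℂ)) p
    simp only [Complex.conj_ofReal] at h3
    rw [zero_sub, ← h3, Complex.mul_conj, Complex.normSq_eq_norm_sq]
  simp_rw [h2] at h
  exact_mod_cast h

theorem ofReal_mean_sq {g : (Fin d → ℝ) → ℝ} (hg : IsWiener (fun x => (g x : ℂ))) :
    ENNReal.ofReal (mean fun x => g x ^ 2) = l2n (fun x => (g x : ℂ)) := by
  have h := hasSum_sq_fc hg
  rw [← h.tsum_eq, ENNReal.ofReal_tsum_of_nonneg (fun _ => by positivity) h.summable]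
  unfold l2n
  refine tsum_congr fun k => ?_
  rw [ENNReal.ofReal_pow (norm_nonneg _), ofReal_norm]

/-! ### Trigonometric polynomials -/

/-- The frequencies `{-N, …, N}^d`. -/
def box (d N : ℕ) : Finset (Fin d → ℤ) := Fintype.piFinset fun _ => Finset.Icc (-(N : ℤ)) N

theorem mem_box {N : ℕ} {k : Fin d → ℤ} : k ∈ box d N ↔ ∀ j, |k j| ≤ (N : ℤ) := by
  simp [box, Fintype.mem_piFinset, abs_le]

theorem neg_mem_box {N : ℕ} {k : Fin d → ℤ} : -k ∈ box d N ↔ k ∈ box d N := by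
  simp [mem_box]

theorem mem_box_iff_norm_le {N : ℕ} {k : Fin d → ℤ} : k ∈ box d N ↔ ‖k‖ ≤ N := by
  rw [mem_box, pi_norm_le_iff_of_nonneg (by positivity)]
  refine forall_congr' fun j => ?_
  rw [Int.norm_eq_abs]
  exact_mod_cast Iff.rfl

theorem abs_apply_le_norm (k : Fin d → ℤ) (j : Fin d) : |(k j : ℝ)| ≤ ‖k‖ := by
  have := norm_le_pi_norm k j
  rwa [Int.norm_eq_abs] at this

theorem card_box (d N : ℕ) : (box d N).card = (2 * N + 1) ^ d := by
  simp [box]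
  congr 1
  omega

/-- Trigonometric polynomials with frequencies in `{-N, …, N}^d`. -/
structure IsTrig (N : ℕ) (g : (Fin d → ℝ) → ℂ) : Prop extends IsTorusFun g where
  fc_eq_zero : ∀ k, k ∉ box d N → fc g k = 0

theorem fc_finset_sum {s : Finset (Fin d → ℤ)} (a : (Fin d → ℤ) → ℂ) (k : Fin d → ℤ) :
    fc (fun x => ∑ l ∈ s, a l * expMode l x) k = if k ∈ s then a k else 0 := by
  rw [fc_sum (F := fun l x => a l * expMode l x)
    fun l _ => continuous_const.mul (continuous_expMode l)]
  have h : ∀ l : Fin d → ℤ, fc (fun x => a l * expMode l x) k = if l = k then a l else 0 := by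
    intro l
    rw [fc_const_mul]
    have := fc_expMode_mul l (fun _ => 1) k
    simp only [mul_one, fc_one, sub_eq_zero] at this
    rw [this]
    by_cases h : k = l
    · simp [h]
    · simp [h, Ne.symm h]
  simp_rw [h]
  exact Finset.sum_ite_eq' s k a

namespace IsTrig

variable {N : ℕ} {f g : (Fin d → ℝ) → ℂ}

theorem wn_eq (hg : IsTrig N g) : wn g = ∑ k ∈ box d N, (1 + ‖k‖ₑ) * ‖fc g k‖ₑ :=
  tsum_eq_sum fun k hk => by simp [hg.fc_eq_zero k hk]

theorem isWiener (hg : IsTrig N g) : IsWiener g where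
  toIsTorusFun := hg.toIsTorusFun
  wn_lt_top := by
    rw [hg.wn_eq]
    exact ENNReal.sum_lt_top.2 fun k _ => ENNReal.mul_lt_top
      (ENNReal.add_lt_top.2 ⟨ENNReal.one_lt_top, enorm_lt_top⟩) enorm_lt_top

theorem eq_sum (hg : IsTrig N g) (x : Fin d → ℝ) :
    g x = ∑ k ∈ box d N, fc g k * expMode k x := by
  rw [← (hg.isWiener.hasSum x).tsum_eq]
  exact tsum_eq_sum fun k hk => by simp [hg.fc_eq_zero k hk]

theorem fc_mul (hf : IsTrig N f) (hg : Continuous g) (k : Fin d → ℤ) :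
    fc (fun x => f x * g x) k = ∑ p ∈ box d N, fc f p * fc g (k - p) := by
  rw [← (hf.isWiener.fc_mul hg k).tsum_eq]
  exact tsum_eq_sum fun k hk => by simp [hf.fc_eq_zero k hk]

theorem sub (hf : IsTrig N f) (hg : IsTrig N g) : IsTrig N (fun x => f x - g x) where
  toIsTorusFun := hf.toIsTorusFun.sub hg.toIsTorusFun
  fc_eq_zero k hk := by
    rw [fc_sub hf.continuous hg.continuous, hf.fc_eq_zero k hk, hg.fc_eq_zero k hk, sub_zero]

theorem add (hf : IsTrig N f) (hg : IsTrig N g) : IsTrig N (fun x => f x + g x) where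
  toIsTorusFun := hf.toIsTorusFun.add hg.toIsTorusFun
  fc_eq_zero k hk := by
    rw [fc_add hf.continuous hg.continuous, hf.fc_eq_zero k hk, hg.fc_eq_zero k hk, add_zero]

theorem of_sum (a : (Fin d → ℤ) → ℂ) : IsTrig N (fun x => ∑ k ∈ box d N, a k * expMode k x) where
  toIsTorusFun := IsTorusFun.sum fun k _ => (IsTorusFun.const _).mul (isTorusFun_expMode k)
  fc_eq_zero k hk := by rw [fc_finset_sum, if_neg hk]

/-- Bernstein's inequality: the Wiener norm of a trigonometric polynomial is controlled by its
`L²` norm. -/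
theorem wn_sq_le (hg : IsTrig N g) :
    wn g ^ 2 ≤ (2 * N + 1) ^ d * (1 + N) ^ 2 * l2n g := by
  have h1 : wn g ≤ (1 + N) * ∑ k ∈ box d N, ‖fc g k‖ₑ := by
    rw [hg.wn_eq, Finset.mul_sum]
    refine Finset.sum_le_sum fun k hk => ?_
    gcongr
    rw [← ofReal_norm]
    have := mem_box_iff_norm_le.1 hk
    calc ENNReal.ofReal ‖k‖ ≤ ENNReal.ofReal N := ENNReal.ofReal_le_ofReal this
      _ = N := by simp
  have h2 : (∑ k ∈ box d N, ‖fc g k‖ₑ) ^ 2 ≤ (2 * N + 1) ^ d * l2n g := by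
    have h3 := tsum_mul_sq_le (fun k : Fin d → ℤ => if k ∈ box d N then (1 : ℝ≥0∞) else 0)
      (fun k => ‖fc g k‖ₑ)
    have h4 : ∑' k : Fin d → ℤ, (if k ∈ box d N then (1 : ℝ≥0∞) else 0) = (2 * N + 1) ^ d := by
      rw [tsum_eq_sum (s := box d N) fun k hk => by simp [hk]]
      rw [Finset.sum_congr rfl (g := fun _ => 1) fun k hk => by simp [hk]]
      simp [card_box]
    have h5 : ∑' k : Fin d → ℤ, (if k ∈ box d N then (1 : ℝ≥0∞) else 0) * ‖fc g k‖ₑ =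
        ∑ k ∈ box d N, ‖fc g k‖ₑ := by
      rw [tsum_eq_sum (s := box d N) fun k hk => by simp [hk]]
      exact Finset.sum_congr rfl fun k hk => by simp [hk]
    rw [h4, h5] at h3
    refine h3.trans ?_
    gcongr
    exact ENNReal.tsum_le_tsum fun k => by split_ifs <;> simp
  calc wn g ^ 2 ≤ ((1 + N) * ∑ k ∈ box d N, ‖fc g k‖ₑ) ^ 2 := pow_le_pow_left' h1 2
    _ = (1 + N) ^ 2 * (∑ k ∈ box d N, ‖fc g k‖ₑ) ^ 2 := mul_pow _ _ _
    _ ≤ (1 + N) ^ 2 * ((2 * N + 1) ^ d * l2n g) := by gcongr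
    _ = _ := by ring

end IsTrig

/-- The real trigonometric polynomial with (not necessarily Hermitian) coefficients `y`. -/
def realTrig (N : ℕ) (y : (Fin d → ℤ) → Fin n → ℂ) : (Fin d → ℝ) → (Fin n → ℝ) :=
  fun x i => (∑ k ∈ box d N, y k i * expMode k x).re

theorem comp_realTrig (N : ℕ) (y : (Fin d → ℤ) → Fin n → ℂ) (i : Fin n) :
    comp (realTrig N y) i = fun x => ∑ k ∈ box d N,
      ((y k i + (starRingEnd ℂ) (y (-k) i)) / 2) * expMode k x := by
  ext x
  simp only [comp, realTrig]
  rw [Complex.re_eq_add_conj, map_sum]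
  have h : ∑ k ∈ box d N, (starRingEnd ℂ) (y k i * expMode k x) =
      ∑ k ∈ box d N, (starRingEnd ℂ) (y (-k) i) * expMode k x := by
    refine Finset.sum_nbij' (fun k => -k) (fun k => -k) (fun k hk => neg_mem_box.2 hk)
      (fun k hk => neg_mem_box.2 hk) (fun k _ => neg_neg k) (fun k _ => neg_neg k) fun k _ => ?_
    rw [map_mul, conj_expMode, neg_neg]
  rw [h, ← Finset.sum_add_distrib, Finset.sum_div]
  exact Finset.sum_congr rfl fun k _ => by ring

theorem isTrig_realTrig (N : ℕ) (y : (Fin d → ℤ) → Fin n → ℂ) (i : Fin n) :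
    IsTrig N (comp (realTrig N y) i) := by
  rw [comp_realTrig]
  exact IsTrig.of_sum _

theorem fc_realTrig (N : ℕ) (y : (Fin d → ℤ) → Fin n → ℂ) (i : Fin n) (k : Fin d → ℤ) :
    fc (comp (realTrig N y) i) k =
      if k ∈ box d N then (y k i + (starRingEnd ℂ) (y (-k) i)) / 2 else 0 := by
  rw [comp_realTrig, fc_finset_sum]

theorem eq_realTrig {N : ℕ} {f : (Fin d → ℝ) → (Fin n → ℝ)} (hf : ∀ i, IsTrig N (comp f i)) :
    f = realTrig N fun k i => fc (comp f i) k := by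
  ext x i
  have := (hf i).eq_sum x
  rw [realTrig, ← this]
  simp [comp]

theorem contDiff_expMode {m : WithTop ℕ∞} (k : Fin d → ℤ) : ContDiff ℝ m (expMode k) := by
  have h : ContDiff ℝ m (fun x : Fin d → ℝ => ∑ j, (k j : ℝ) * x j) :=
    ContDiff.sum fun j _ => contDiff_const.mul (contDiff_apply ℝ ℝ j)
  have h1 : ContDiff ℝ m (fun x : Fin d → ℝ => ((∑ j, (k j : ℝ) * x j : ℝ) : ℂ)) :=
    Complex.ofRealCLM.contDiff.comp h
  exact ContDiff.cexp (contDiff_const.mul h1)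

theorem contDiff_realTrig {m : WithTop ℕ∞} (N : ℕ) (y : (Fin d → ℤ) → Fin n → ℂ) :
    ContDiff ℝ m (realTrig N y) := by
  rw [contDiff_pi]
  intro i
  exact Complex.reCLM.contDiff.comp
    (ContDiff.sum fun k _ => contDiff_const.mul (contDiff_expMode k))

theorem isTorusPeriodic_of_comp {f : (Fin d → ℝ) → (Fin n → ℝ)}
    (hf : ∀ i, IsTorusFun (comp f i)) : IsTorusPeriodic f := by
  intro j x
  ext i
  exact Complex.ofReal_injective ((hf i).periodic j x)

theorem continuous_of_comp {f : (Fin d → ℝ) → (Fin n → ℝ)}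
    (hf : ∀ i, IsTorusFun (comp f i)) : Continuous f :=
  continuous_pi fun i => by
    have := Complex.continuous_re.comp (hf i).continuous
    exact this

/-! ### Fourier multipliers -/

/-- Even symbols supported in `{-N, …, N}^d`. -/
structure IsSymbol (N : ℕ) (m : (Fin d → ℤ) → ℝ) : Prop where
  even : ∀ k, m (-k) = m k
  eq_zero : ∀ k, k ∉ box d N → m k = 0

theorem fourierMultiplier_eq_realTrig {N : ℕ} {m : (Fin d → ℤ) → ℝ} (hm : IsSymbol N m)
    (f : (Fin d → ℝ) → (Fin n → ℝ)) :
    fourierMultiplier m f = realTrig N fun k i => m k * fc (comp f i) k := by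
  ext x i
  rw [fourierMultiplier, realTrig, tsum_eq_sum (s := box d N)]
  · rfl
  · intro k hk
    simp [hm.eq_zero k hk]

theorem isTrig_multiplier {N : ℕ} {m : (Fin d → ℤ) → ℝ} (hm : IsSymbol N m)
    (f : (Fin d → ℝ) → (Fin n → ℝ)) (i : Fin n) : IsTrig N (comp (fourierMultiplier m f) i) := by
  rw [fourierMultiplier_eq_realTrig hm]
  exact isTrig_realTrig _ _ _

theorem fc_multiplier {N : ℕ} {m : (Fin d → ℤ) → ℝ} (hm : IsSymbol N m)
    (f : (Fin d → ℝ) → (Fin n → ℝ)) (i : Fin n) (k : Fin d → ℤ) :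
    fc (comp (fourierMultiplier m f) i) k = m k * fc (comp f i) k := by
  rw [fourierMultiplier_eq_realTrig hm, fc_realTrig]
  split_ifs with hk
  · rw [map_mul, Complex.conj_ofReal, conj_fc_comp, hm.even, neg_neg]; ring
  · simp [hm.eq_zero k hk]

/-! ### Partial derivatives -/

theorem hasDerivAt_expMode_line (k : Fin d → ℤ) (j : Fin d) (x : Fin d → ℝ) (t : ℝ) :
    HasDerivAt (fun τ : ℝ => expMode k (x + Pi.single j τ))
      (Complex.I * (k j : ℝ) * expMode k (x + Pi.single j t)) t := by
  simp_rw [expMode_add_single]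
  have h1 : HasDerivAt (fun τ : ℝ => Complex.I * ((k j : ℝ) * τ : ℝ))
      (Complex.I * (k j : ℝ)) t := by
    have := (((hasDerivAt_id t).const_mul (k j : ℝ)).ofReal_comp).const_mul Complex.I
    simpa using this
  have h2 := h1.cexp.const_mul (expMode k x)
  convert! h2 using 1
  ring

theorem comp_partialDeriv_hasDerivAt {f : (Fin d → ℝ) → (Fin n → ℝ)} (hf : Differentiable ℝ f)
    (j : Fin d) (i : Fin n) (x : Fin d → ℝ) :
    HasDerivAt (fun τ : ℝ => comp f i (x + Pi.single j τ)) (comp (partialDeriv j f) i x) 0 := by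
  have h0 : HasDerivAt (fun τ : ℝ => x + Pi.single j τ) (Pi.single j 1 : Fin d → ℝ) 0 := by
    have h := (hasDerivAt_id (0:ℝ)).smul_const (Pi.single j 1 : Fin d → ℝ)
    have h' := h.const_add x
    convert! h' using 1
    · ext τ l
      simp [Pi.single_apply]
    · simp
  have hx : HasFDerivAt f (fderiv ℝ f x) (x + Pi.single j 0) := by
    simpa using (hf x).hasFDerivAt
  have h1 := hx.comp_hasDerivAt (0:ℝ) h0
  have h2 := hasDerivAt_pi.1 h1 i
  exact h2.ofReal_comp

/-- Termwise differentiation of the Fourier series, for functions in the weighted Wiener algebra. -/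
theorem comp_partialDeriv_hasSum {f : (Fin d → ℝ) → (Fin n → ℝ)} (hf : Differentiable ℝ f)
    {i : Fin n} (hw : IsWiener (comp f i)) (j : Fin d) (x : Fin d → ℝ) :
    HasSum (fun k => (Complex.I * (k j : ℝ) * fc (comp f i) k) * expMode k x)
      (comp (partialDeriv j f) i x) := by
  have hsum : Summable fun k : Fin d → ℤ => ‖k‖ * ‖fc (comp f i) k‖ := by
    have h1 : ∑' k : Fin d → ℤ, ‖((‖k‖ : ℝ) : ℂ) * fc (comp f i) k‖ₑ < ⊤ := by
      refine lt_of_le_of_lt (le_of_eq (tsum_congr fun k => ?_))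
        ((tsum_enorm_mul_fc_le (comp f i)).trans_lt hw.wn_lt_top)
      rw [enorm_mul]
      congr 1
      rw [← ofReal_norm, ← ofReal_norm]; simp
    have := summable_norm_of_tsum_enorm h1
    simpa using this
  have hb : ∀ (k : Fin d → ℤ) (y : ℝ),
      ‖(Complex.I * (k j : ℝ) * fc (comp f i) k) * expMode k (x + Pi.single j y)‖ ≤
        ‖k‖ * ‖fc (comp f i) k‖ := by
    intro k y
    simp only [norm_mul, norm_expMode, Complex.norm_I, Complex.norm_real, one_mul, mul_one,
      Real.norm_eq_abs]
    gcongr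
    exact abs_apply_le_norm k j
  have hd : ∀ (k : Fin d → ℤ) (y : ℝ),
      HasDerivAt (fun τ : ℝ => fc (comp f i) k * expMode k (x + Pi.single j τ))
        ((Complex.I * (k j : ℝ) * fc (comp f i) k) * expMode k (x + Pi.single j y)) y := by
    intro k y
    have := (hasDerivAt_expMode_line k j x y).const_mul (fc (comp f i) k)
    rwa [← mul_assoc, mul_comm (fc (comp f i) k)] at this
  have hs0 : Summable fun k => fc (comp f i) k * expMode k (x + Pi.single j (0 : ℝ)) :=
    (hw.hasSum _).summable
  have h := hasDerivAt_tsum hsum hd hb hs0 0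
  have h1 : (fun τ : ℝ => ∑' k, fc (comp f i) k * expMode k (x + Pi.single j τ)) =
      fun τ => comp f i (x + Pi.single j τ) := by
    ext τ
    exact (hw.hasSum _).tsum_eq
  rw [h1] at h
  rw [(comp_partialDeriv_hasDerivAt hf j i x).unique h]
  simp only [Pi.single_zero, add_zero]
  refine Summable.hasSum (Summable.of_norm_bounded hsum fun k => ?_)
  simpa using hb k 0

theorem tsum_deriv_coeff_le (f : (Fin d → ℝ) → (Fin n → ℝ)) (i : Fin n)
    (j : Fin d) :
    ∑' k : Fin d → ℤ, ‖Complex.I * (k j : ℝ) * fc (comp f i) k‖ₑ ≤ wn (comp f i) := by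
  refine (ENNReal.tsum_le_tsum fun k => ?_).trans (tsum_enorm_mul_fc_le (comp f i))
  rw [enorm_mul]
  gcongr
  rw [← ofReal_norm, ← ofReal_norm]
  refine ENNReal.ofReal_le_ofReal ?_
  simpa using abs_apply_le_norm k j

theorem fc_partialDeriv {f : (Fin d → ℝ) → (Fin n → ℝ)} (hf : Differentiable ℝ f) {i : Fin n}
    (hw : IsWiener (comp f i)) (j : Fin d) (k : Fin d → ℤ) :
    fc (comp (partialDeriv j f) i) k = Complex.I * (k j : ℝ) * fc (comp f i) k :=
  fc_eq_of_hasSum (a := fun k => Complex.I * (k j : ℝ) * fc (comp f i) k)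
    (summable_norm_of_tsum_enorm ((tsum_deriv_coeff_le f i j).trans_lt hw.wn_lt_top))
    (comp_partialDeriv_hasSum hf hw j) k

theorem norm_partialDeriv_le {f : (Fin d → ℝ) → (Fin n → ℝ)} (hf : Differentiable ℝ f) {i : Fin n}
    (hw : IsWiener (comp f i)) (j : Fin d) (x : Fin d → ℝ) :
    |partialDeriv j f x i| ≤ (wn (comp f i)).toReal := by
  have h : ‖comp (partialDeriv j f) i x‖ₑ ≤ wn (comp f i) := by
    rw [← (comp_partialDeriv_hasSum hf hw j x).tsum_eq]
    refine (enorm_tsum_le _).trans ((ENNReal.tsum_le_tsum fun k => ?_).trans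
      (tsum_deriv_coeff_le f i j))
    rw [enorm_mul, ← ofReal_norm (expMode k x), norm_expMode]
    simp
  have := ENNReal.toReal_mono hw.wn_lt_top.ne h
  simpa [comp] using this

theorem isTorusFun_partialDeriv {f : (Fin d → ℝ) → (Fin n → ℝ)} (hf : ContDiff ℝ 1 f)
    (hp : IsTorusPeriodic f) (j : Fin d) (i : Fin n) : IsTorusFun (comp (partialDeriv j f) i) where
  continuous := by
    have h1 : Continuous fun x => fderiv ℝ f x (Pi.single j 1) :=
      (hf.continuous_fderiv one_ne_zero).clm_apply continuous_const
    exact Complex.continuous_ofReal.comp ((continuous_apply i).comp h1)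
  periodic l x := by
    simp only [comp, partialDeriv]
    have h1 : (fun y => f (y + Pi.single l (2 * Real.pi))) = f := funext fun y => hp l y
    have h2 := fderiv_comp_add_right (𝕜 := ℝ) (f := f) (x := x) (Pi.single l (2 * Real.pi))
    rw [h1] at h2
    rw [← h2]

theorem isTrig_partialDeriv {N : ℕ} {f : (Fin d → ℝ) → (Fin n → ℝ)} (hf : ContDiff ℝ 1 f)
    (ht : ∀ i, IsTrig N (comp f i)) (j : Fin d) (i : Fin n) :
    IsTrig N (comp (partialDeriv j f) i) where
  toIsTorusFun := isTorusFun_partialDeriv hf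
    (isTorusPeriodic_of_comp fun i => (ht i).toIsTorusFun) j i
  fc_eq_zero k hk := by
    rw [fc_partialDeriv (hf.differentiable one_ne_zero) (ht i).isWiener, (ht i).fc_eq_zero k hk,
      mul_zero]

/-! ### Sobolev norms -/

/-- The weight `1 + |k|²` with the Euclidean norm of `k`. -/
def jap (k : Fin d → ℤ) : ℝ := 1 + ∑ j, (k j : ℝ) ^ 2

/-- The squared Sobolev norm. -/
def hs2 (s : ℝ) (f : (Fin d → ℝ) → (Fin n → ℝ)) : ℝ≥0∞ :=
  ∑' k : Fin d → ℤ, ENNReal.ofReal (jap k ^ s) * ∑ i, ‖fc (comp f i) k‖ₑ ^ 2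

theorem hsNorm_eq (s : ℝ) (f : (Fin d → ℝ) → (Fin n → ℝ)) :
    hsNorm s f = hs2 s f ^ (1 / 2 : ℝ) := rfl

theorem hsNorm_sq (s : ℝ) (f : (Fin d → ℝ) → (Fin n → ℝ)) : hsNorm s f ^ 2 = hs2 s f := by
  rw [hsNorm_eq, ← ENNReal.rpow_natCast, ← ENNReal.rpow_mul]
  norm_num

theorem hsNorm_le_of_sq_le {s : ℝ} {f : (Fin d → ℝ) → (Fin n → ℝ)} {a : ℝ≥0∞}
    (h : hs2 s f ≤ a ^ 2) : hsNorm s f ≤ a := by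
  rw [← hsNorm_sq] at h
  exact (ENNReal.pow_le_pow_left_iff two_ne_zero).1 h

theorem hsNorm_lt_top_iff {s : ℝ} {f : (Fin d → ℝ) → (Fin n → ℝ)} :
    hsNorm s f < ⊤ ↔ hs2 s f < ⊤ := by
  rw [← hsNorm_sq, ENNReal.pow_lt_top_iff]
  simp

theorem one_le_jap (k : Fin d → ℤ) : 1 ≤ jap k := by
  unfold jap
  have : 0 ≤ ∑ j, (k j : ℝ) ^ 2 := Finset.sum_nonneg fun j _ => sq_nonneg _
  linarith

theorem jap_pos (k : Fin d → ℤ) : 0 < jap k := zero_lt_one.trans_le (one_le_jap k)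

theorem norm_sq_le_jap_sub_one (k : Fin d → ℤ) : ‖k‖ ^ 2 ≤ jap k - 1 := by
  unfold jap
  have h0 : 0 ≤ ∑ j, (k j : ℝ) ^ 2 := Finset.sum_nonneg fun j _ => sq_nonneg _
  have h : ‖k‖ ≤ √(∑ j, (k j : ℝ) ^ 2) := by
    rw [pi_norm_le_iff_of_nonneg (Real.sqrt_nonneg _)]
    intro j
    rw [Int.norm_eq_abs]
    refine Real.abs_le_sqrt ?_
    exact Finset.single_le_sum (f := fun j => (k j : ℝ) ^ 2) (fun _ _ => sq_nonneg _)
      (Finset.mem_univ j)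
  have := (Real.le_sqrt (norm_nonneg _) h0).1 h
  linarith

theorem jap_le (k : Fin d → ℤ) : jap k ≤ 1 + d * ‖k‖ ^ 2 := by
  unfold jap
  gcongr
  calc ∑ j, (k j : ℝ) ^ 2 ≤ ∑ _j : Fin d, ‖k‖ ^ 2 := by
        refine Finset.sum_le_sum fun j _ => ?_
        rw [← sq_abs]
        gcongr
        exact abs_apply_le_norm k j
    _ = _ := by simp

theorem summable_norm_rpow_index {p : ℝ} (hp : p < -d) :
    Summable fun k : Fin d → ℤ => ‖k‖ ^ p := by
  let b := Pi.basisFun ℝ (Fin d)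
  let L := Submodule.span ℤ (Set.range b)
  have hr : Module.finrank ℤ L = d := by
    rw [ZLattice.rank (K := ℝ)]; simp
  have h := ZLattice.summable_norm_rpow L p (by rw [hr]; exact hp)
  have hmem : ∀ k : Fin d → ℤ, (fun j => (k j : ℝ)) ∈ L := by
    intro k
    have : (fun j => (k j : ℝ)) = ∑ j, k j • b j := by
      ext i
      simp [b, Finset.sum_apply, Pi.single_apply]
    rw [this]
    exact Submodule.sum_mem _ fun j _ => Submodule.smul_mem _ _
      (Submodule.subset_span (Set.mem_range_self j))
  have hinj : Function.Injective fun k : Fin d → ℤ => (⟨fun j => (k j : ℝ), hmem k⟩ : L) := by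
    intro k l hkl
    ext j
    have h : (k j : ℝ) = l j := congrFun (congrArg Subtype.val hkl) j
    exact_mod_cast h
  refine (h.comp_injective hinj).congr fun k => ?_
  simp only [Function.comp]
  congr 1

theorem tsum_jap_rpow_lt_top {p : ℝ} (hp : (d : ℝ) / 2 < p) :
    ∑' k : Fin d → ℤ, ENNReal.ofReal (jap k ^ (-p)) < ⊤ := by
  have h1 : Summable fun k : Fin d → ℤ => jap k ^ (-p) := by
    have h2 := summable_norm_rpow_index (d := d) (p := -(2 * p)) (by linarith)
    refine Summable.of_norm_bounded_eventually h2 ?_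
    have hfin : {k : Fin d → ℤ | k = 0}.Finite := by simp
    refine Filter.mem_of_superset hfin.compl_mem_cofinite fun k hk => ?_
    have hk0 : 0 < ‖k‖ := norm_pos_iff.2 hk
    have hd0 : (0 : ℝ) ≤ d := by positivity
    rw [Set.mem_ofPred_eq]
    rw [Real.norm_of_nonneg (Real.rpow_nonneg (jap_pos k).le _)]
    have h3 : ‖k‖ ^ 2 ≤ jap k := by linarith [norm_sq_le_jap_sub_one k]
    calc jap k ^ (-p) ≤ (‖k‖ ^ 2) ^ (-p) :=
          Real.rpow_le_rpow_of_nonpos (by positivity) h3 (by linarith)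
      _ = ‖k‖ ^ (-(2 * p)) := by
          rw [← Real.rpow_natCast, ← Real.rpow_mul (norm_nonneg _)]
          congr 1; push_cast; ring
  exact lt_top_iff_ne_top.2 h1.tsum_ofReal_ne_top

/-- The Sobolev embedding of `H^s`, `s > d/2 + 1`, into the weighted Wiener algebra. -/
theorem exists_wn_sq_le {s : ℝ} (hs : (d : ℝ) / 2 + 1 < s) :
    ∃ C : ℝ≥0∞, C < ⊤ ∧ ∀ (f : (Fin d → ℝ) → (Fin n → ℝ)) (i : Fin n),
      wn (comp f i) ^ 2 ≤ C * hs2 s f := by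
  refine ⟨4 * ∑' k : Fin d → ℤ, ENNReal.ofReal (jap k ^ (-(s - 1))),
    ENNReal.mul_lt_top (by simp) (tsum_jap_rpow_lt_top (by linarith)), fun f i => ?_⟩
  have h1 : ∀ k : Fin d → ℤ, (1 + ‖k‖ₑ) * ‖fc (comp f i) k‖ₑ ≤
      2 * (ENNReal.ofReal (jap k ^ (-(s - 1))) *
        (ENNReal.ofReal (jap k ^ (s - 1 / 2)) * ‖fc (comp f i) k‖ₑ)) := by
    intro k
    rw [← mul_assoc (ENNReal.ofReal _), ← ENNReal.ofReal_mul (Real.rpow_nonneg (jap_pos k).le _),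
      ← Real.rpow_add (jap_pos k), ← mul_assoc]
    gcongr
    have h2 : 1 + ‖k‖ ≤ 2 * jap k ^ (-(s - 1) + (s - 1 / 2)) := by
      have : -(s - 1) + (s - 1 / 2) = 1 / 2 := by ring
      rw [this, ← Real.sqrt_eq_rpow]
      have h3 : (1 : ℝ) ≤ √(jap k) := Real.one_le_sqrt.2 (one_le_jap k)
      have h4 : ‖k‖ ≤ √(jap k) := Real.le_sqrt_of_sq_le (by linarith [norm_sq_le_jap_sub_one k])
      linarith
    calc 1 + ‖k‖ₑ = ENNReal.ofReal (1 + ‖k‖) := by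
          rw [ENNReal.ofReal_add zero_le_one (norm_nonneg _), ofReal_norm]; simp
      _ ≤ _ := by
          refine (ENNReal.ofReal_le_ofReal h2).trans_eq ?_
          rw [ENNReal.ofReal_mul (by norm_num)]; simp
  have h2 : ∑' k : Fin d → ℤ, ENNReal.ofReal (jap k ^ (-(s - 1))) *
      (ENNReal.ofReal (jap k ^ (s - 1 / 2)) * ‖fc (comp f i) k‖ₑ) ^ 2 ≤ hs2 s f := by
    refine ENNReal.tsum_le_tsum fun k => ?_
    rw [mul_pow, ← mul_assoc, ← ENNReal.ofReal_pow (Real.rpow_nonneg (jap_pos k).le _),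
      ← ENNReal.ofReal_mul (Real.rpow_nonneg (jap_pos k).le _), ← Real.rpow_natCast,
      ← Real.rpow_mul (jap_pos k).le, ← Real.rpow_add (jap_pos k)]
    have : -(s - 1) + (s - 1 / 2) * ((2 : ℕ) : ℝ) = s := by push_cast; ring
    rw [this]
    gcongr
    exact Finset.single_le_sum (f := fun i => ‖fc (comp f i) k‖ₑ ^ 2) (fun _ _ => by simp)
      (Finset.mem_univ i)
  calc wn (comp f i) ^ 2 ≤ (2 * ∑' k : Fin d → ℤ, ENNReal.ofReal (jap k ^ (-(s - 1))) *
        (ENNReal.ofReal (jap k ^ (s - 1 / 2)) * ‖fc (comp f i) k‖ₑ)) ^ 2 := by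
        rw [← ENNReal.tsum_mul_left]
        exact pow_le_pow_left' (ENNReal.tsum_le_tsum h1) 2
    _ ≤ 2 ^ 2 * ((∑' k : Fin d → ℤ, ENNReal.ofReal (jap k ^ (-(s - 1)))) * hs2 s f) := by
        rw [mul_pow]
        gcongr
        exact (tsum_mul_sq_le _ _).trans (by gcongr)
    _ = _ := by ring

theorem hn_le_hs2 {s : ℝ} (hs : 0 ≤ s) (f : (Fin d → ℝ) → (Fin n → ℝ)) (i : Fin n) :
    hn s (comp f i) ≤ hs2 s f := by
  refine ENNReal.tsum_le_tsum fun k => ?_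
  rw [mul_pow]
  gcongr
  · rw [← ofReal_norm, ENNReal.ofReal_rpow_of_nonneg (norm_nonneg _) hs,
      ← ENNReal.ofReal_pow (by positivity)]
    refine ENNReal.ofReal_le_ofReal ?_
    rw [← Real.rpow_natCast, ← Real.rpow_mul (norm_nonneg _), mul_comm, Real.rpow_mul (norm_nonneg _),
      Real.rpow_natCast]
    exact Real.rpow_le_rpow (by positivity) (by linarith [norm_sq_le_jap_sub_one k]) hs
  · exact Finset.single_le_sum (f := fun i => ‖fc (comp f i) k‖ₑ ^ 2) (fun _ _ => by simp)
      (Finset.mem_univ i)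

theorem continuous_comp {f : (Fin d → ℝ) → (Fin n → ℝ)} (hf : Continuous f) (i : Fin n) :
    Continuous (comp f i) :=
  Complex.continuous_ofReal.comp ((continuous_apply i).comp hf)

theorem fc_comp_sub {f g : (Fin d → ℝ) → (Fin n → ℝ)} (hf : Continuous f) (hg : Continuous g)
    (i : Fin n) (k : Fin d → ℤ) :
    fc (comp (f - g) i) k = fc (comp f i) k - fc (comp g i) k := by
  rw [← fc_sub (continuous_comp hf i) (continuous_comp hg i)]
  congr 1
  ext x
  simp [comp]

theorem isTorusFun_comp {f : (Fin d → ℝ) → (Fin n → ℝ)} (hf : Continuous f)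
    (hp : IsTorusPeriodic f) (i : Fin n) : IsTorusFun (comp f i) :=
  ⟨continuous_comp hf i, fun j x => by simp [comp, hp j x]⟩

theorem MemHs.isWiener {s : ℝ} (hs : (d : ℝ) / 2 + 1 < s) {f : (Fin d → ℝ) → (Fin n → ℝ)}
    (hf : MemHs s f) (i : Fin n) : IsWiener (comp f i) where
  toIsTorusFun := isTorusFun_comp hf.continuous hf.periodic i
  wn_lt_top := by
    obtain ⟨C, hC, h⟩ := exists_wn_sq_le (d := d) (n := n) hs
    have h1 : wn (comp f i) ^ 2 < ⊤ :=
      (h f i).trans_lt (ENNReal.mul_lt_top hC (hsNorm_lt_top_iff.1 hf.norm_lt_top))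
    simpa [ENNReal.pow_lt_top_iff] using h1

theorem sum_enorm_sub_sq_le (a b : Fin n → ℂ) :
    ∑ i, ‖a i - b i‖ₑ ^ 2 ≤ 2 * (∑ i, ‖a i‖ₑ ^ 2 + ∑ i, ‖b i‖ₑ ^ 2) := by
  rw [← Finset.sum_add_distrib, Finset.mul_sum]
  refine Finset.sum_le_sum fun i _ => ?_
  exact (pow_le_pow_left' (enorm_sub_le) 2).trans (ENNReal_add_sq_le _ _)

theorem hs2_sub_le (s : ℝ) {f g : (Fin d → ℝ) → (Fin n → ℝ)} (hf : Continuous f)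
    (hg : Continuous g) : hs2 s (f - g) ≤ 2 * (hs2 s f + hs2 s g) := by
  unfold hs2
  rw [← ENNReal.tsum_add, ← ENNReal.tsum_mul_left]
  refine ENNReal.tsum_le_tsum fun k => ?_
  simp_rw [fc_comp_sub hf hg]
  calc _ ≤ ENNReal.ofReal (jap k ^ s) * (2 * (∑ i, ‖fc (comp f i) k‖ₑ ^ 2 +
        ∑ i, ‖fc (comp g i) k‖ₑ ^ 2)) := by gcongr; exact sum_enorm_sub_sq_le _ _
    _ = _ := by ring

/-- Bernstein's inequality: the `H^r` norm of a trigonometric polynomial. -/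
theorem hs2_le_of_isTrig {N : ℕ} (hN : 1 ≤ N) {r : ℝ} (hr : 0 ≤ r)
    {f : (Fin d → ℝ) → (Fin n → ℝ)} (hf : ∀ i, IsTrig N (comp f i)) :
    hs2 r f ≤ ENNReal.ofReal ((1 + d) ^ r * (N : ℝ) ^ (2 * r)) * ∑ i, l2n (comp f i) := by
  unfold hs2 l2n
  rw [← Summable.tsum_finsetSum (fun _ _ => ENNReal.summable), ← ENNReal.tsum_mul_left]
  refine ENNReal.tsum_le_tsum fun k => ?_
  by_cases hk : k ∈ box d N
  · gcongr
    have h1 := mem_box_iff_norm_le.1 hk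
    have hN' : (1 : ℝ) ≤ N := by exact_mod_cast hN
    have h2 : jap k ≤ (1 + d) * (N : ℝ) ^ 2 := by
      have h3 : ‖k‖ ^ 2 ≤ (N : ℝ) ^ 2 := by gcongr
      have h4 : (1 : ℝ) ≤ (N : ℝ) ^ 2 := one_le_pow₀ hN'
      have h5 : (d : ℝ) * ‖k‖ ^ 2 ≤ d * (N : ℝ) ^ 2 := by gcongr
      linarith [jap_le k]
    calc jap k ^ r ≤ ((1 + d) * (N : ℝ) ^ 2) ^ r := Real.rpow_le_rpow (jap_pos k).le h2 hr
      _ = _ := by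
        rw [Real.mul_rpow (by positivity) (by positivity), ← Real.rpow_natCast (N : ℝ) 2,
          ← Real.rpow_mul (by positivity)]
        norm_num
  · simp [(hf _).fc_eq_zero k hk]

/-- The high frequencies of an element of `H^s`. -/
theorem hs2_le_of_fc_eq_zero {r s ρ : ℝ} (hrs : r ≤ s) (hρ : 0 < ρ)
    {f g : (Fin d → ℝ) → (Fin n → ℝ)} (hfg : ∀ k i, ‖fc (comp f i) k‖ₑ ≤ ‖fc (comp g i) k‖ₑ)
    (hf : ∀ k i, ‖k‖ < ρ → fc (comp f i) k = 0) :
    hs2 r f ≤ ENNReal.ofReal (ρ ^ (2 * (r - s))) * hs2 s g := by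
  unfold hs2
  rw [← ENNReal.tsum_mul_left]
  refine ENNReal.tsum_le_tsum fun k => ?_
  by_cases hk : ‖k‖ < ρ
  · simp [hf k _ hk]
  · rw [← mul_assoc, ← ENNReal.ofReal_mul (by positivity)]
    gcongr with i
    · have h1 : ρ ^ 2 ≤ jap k := by
        have : ρ ^ 2 ≤ ‖k‖ ^ 2 := by gcongr; exact not_lt.1 hk
        linarith [norm_sq_le_jap_sub_one k]
      calc jap k ^ r = jap k ^ (r - s) * jap k ^ s := by
            rw [← Real.rpow_add (jap_pos k)]; congr 1; ring
        _ ≤ (ρ ^ 2) ^ (r - s) * jap k ^ s := by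
            have := (jap_pos k).le
            refine mul_le_mul_of_nonneg_right ?_ (by positivity)
            exact Real.rpow_le_rpow_of_nonpos (by positivity) h1 (by linarith)
        _ = _ := by
            rw [← Real.rpow_natCast, ← Real.rpow_mul hρ.le]; norm_num
    · exact hfg k i

/-! ### Symbols of the filters -/

/-- The symbol `σ(· / N)` of the smooth filter. -/
def filterSymbol (σ : (Fin d → ℝ) → ℝ) (N : ℕ) (k : Fin d → ℤ) : ℝ :=
  σ fun j => (k j : ℝ) / (N : ℝ)

/-- The symbol `√(σ(· / N))`. -/
def sqrtSymbol (σ : (Fin d → ℝ) → ℝ) (N : ℕ) (k : Fin d → ℤ) : ℝ := √(filterSymbol σ N k)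

/-- The symbol `σ(2 · / N)`, supported where `σ(· / N) = 1`. -/
def lowSymbol (σ : (Fin d → ℝ) → ℝ) (N : ℕ) (k : Fin d → ℤ) : ℝ :=
  filterSymbol σ N (2 • k)

theorem smoothFilter_eq (σ : (Fin d → ℝ) → ℝ) (N : ℕ) (f : (Fin d → ℝ) → (Fin n → ℝ)) :
    smoothFilter σ N f = fourierMultiplier (filterSymbol σ N) f := rfl

section symbols

variable {σ : (Fin d → ℝ) → ℝ}

/-- The square root of a profile is Lipschitz in a scale-invariant way. -/
theorem IsFilterProfile.exists_sqrt_bound (hσ : IsFilterProfile σ) :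
    ∃ C : ℝ, 0 ≤ C ∧ ∀ x y : Fin d → ℝ, ‖y‖ * |√(σ x) - √(σ y)| ≤ C * ‖x - y‖ := by
  obtain ⟨C₀, hC₀⟩ := hσ.sqrt_gradient
  set C := max C₀ 0
  have hσ1 : ∀ x, √(σ x) ∈ Set.Icc (0 : ℝ) 1 := fun x =>
    ⟨Real.sqrt_nonneg _, Real.sqrt_le_one.2 (hσ.mem_Icc x).2⟩
  have hdiff : Differentiable ℝ σ := hσ.contDiff.differentiable one_ne_zero
  -- The regularization `√(σ + ε)` is differentiable also at the zeros of `σ`, where `σ` is minimal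
  -- and its gradient vanishes.
  have hreg : ∀ ε : ℝ, 0 < ε → ∀ x, ∃ D : (Fin d → ℝ) →L[ℝ] ℝ,
      HasFDerivAt (fun y => √(σ y + ε)) D x ∧ ‖x‖ * ‖D‖ ≤ C := by
    intro ε hε x
    have h1 : HasFDerivAt (fun y => √(σ y + ε)) ((1 / (2 * √(σ x + ε))) • fderiv ℝ σ x) x := by
      refine HasFDerivAt.sqrt ((hdiff x).hasFDerivAt.add_const ε) ?_
      have := (hσ.mem_Icc x).1
      positivity
    refine ⟨_, h1, ?_⟩
    by_cases hx : σ x = 0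
    · have : fderiv ℝ σ x = 0 := by
        refine IsLocalMin.fderiv_eq_zero (Filter.Eventually.of_forall fun y => ?_)
        rw [hx]
        exact (hσ.mem_Icc y).1
      rw [this]
      simp [C]
    · have hpos : 0 < σ x := lt_of_le_of_ne (hσ.mem_Icc x).1 (Ne.symm hx)
      have h2 : HasFDerivAt (fun y => √(σ y)) ((1 / (2 * √(σ x))) • fderiv ℝ σ x) x :=
        HasFDerivAt.sqrt (hdiff x).hasFDerivAt hx
      have h3 := hC₀ x hx
      rw [h2.fderiv] at h3
      refine le_trans ?_ (h3.trans (le_max_left _ _))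
      have h4 : 0 < √(σ x) := Real.sqrt_pos.2 hpos
      have h5 : √(σ x) ≤ √(σ x + ε) := Real.sqrt_le_sqrt (by linarith)
      rw [norm_smul, norm_smul]
      gcongr
      rw [Real.norm_of_nonneg (by positivity), Real.norm_of_nonneg (by positivity)]
      gcongr
  -- If `x` and `y` are comparable to their distance, boundedness of `√σ` suffices; otherwise the
  -- whole segment between them has norm at least `‖y‖ / 2` and the gradient bound applies.
  refine ⟨2 + 2 * C, by positivity, fun x y => ?_⟩
  by_cases hxy : ‖y‖ ≤ 2 * ‖x - y‖
  · have h1 : |√(σ x) - √(σ y)| ≤ 1 := by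
      rw [abs_le]; constructor <;> linarith [(hσ1 x).1, (hσ1 x).2, (hσ1 y).1, (hσ1 y).2]
    have hC0 : 0 ≤ C := le_max_right _ _
    calc ‖y‖ * |√(σ x) - √(σ y)| ≤ ‖y‖ * 1 := by gcongr
      _ ≤ 2 * ‖x - y‖ := by linarith
      _ ≤ _ := by nlinarith [norm_nonneg (x - y)]
  · push Not at hxy
    have hy : 0 < ‖y‖ := lt_of_le_of_lt (by positivity) hxy
    have hC0 : 0 ≤ C := le_max_right _ _
    have hε : ∀ ε : ℝ, 0 < ε → |√(σ x + ε) - √(σ y + ε)| ≤ 2 * C / ‖y‖ * ‖x - y‖ := by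
      intro ε hε
      choose D hD1 hD2 using hreg ε hε
      refine Convex.norm_image_sub_le_of_norm_hasFDerivWithin_le (s := segment ℝ y x)
        (f := fun y => √(σ y + ε)) (f' := D) (fun z _ => (hD1 z).hasFDerivWithinAt)
        (fun z hz => ?_) (convex_segment y x) (left_mem_segment ℝ y x) (right_mem_segment ℝ y x)
      have hz1 : ‖z - y‖ ≤ ‖x - y‖ := by
        obtain ⟨a, b, ha, hb, hab, rfl⟩ := hz
        have : a • y + b • x - y = b • (x - y) := by
          rw [← eq_sub_iff_add_eq] at hab
          rw [hab, smul_sub, sub_smul, one_smul]; abel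
        rw [this, norm_smul, Real.norm_of_nonneg hb]
        exact mul_le_of_le_one_left (norm_nonneg _) (by linarith)
      have hz2 : ‖y‖ / 2 ≤ ‖z‖ := by
        have : ‖y‖ ≤ ‖z‖ + ‖z - y‖ := by
          have := norm_sub_le z (z - y); simpa using this
        linarith
      rw [le_div_iff₀ hy]
      have h3 := hD2 z
      nlinarith [norm_nonneg (D z)]
    have hlim : |√(σ x) - √(σ y)| ≤ 2 * C / ‖y‖ * ‖x - y‖ := by
      have ht : Tendsto (fun ε : ℝ => |√(σ x + ε) - √(σ y + ε)|) (𝓝[>] 0)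
          (𝓝 |√(σ x + 0) - √(σ y + 0)|) := by
        refine Tendsto.mono_left (Continuous.tendsto ?_ 0) nhdsWithin_le_nhds
        fun_prop
      simp only [add_zero] at ht
      exact le_of_tendsto ht (eventually_nhdsWithin_of_forall fun ε h => hε ε h)
    calc ‖y‖ * |√(σ x) - √(σ y)| ≤ ‖y‖ * (2 * C / ‖y‖ * ‖x - y‖) := by gcongr
      _ = 2 * C * ‖x - y‖ := by field_simp
      _ ≤ _ := by nlinarith [norm_nonneg (x - y)]

theorem filterSymbol_mem_Icc (hσ : IsFilterProfile σ) (N : ℕ) (k : Fin d → ℤ) :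
    filterSymbol σ N k ∈ Set.Icc (0 : ℝ) 1 := hσ.mem_Icc _

theorem sqrtSymbol_sq (hσ : IsFilterProfile σ) (N : ℕ) (k : Fin d → ℤ) :
    sqrtSymbol σ N k ^ 2 = filterSymbol σ N k := Real.sq_sqrt (filterSymbol_mem_Icc hσ N k).1

theorem sqrtSymbol_mem_Icc (hσ : IsFilterProfile σ) (N : ℕ) (k : Fin d → ℤ) :
    sqrtSymbol σ N k ∈ Set.Icc (0 : ℝ) 1 :=
  ⟨Real.sqrt_nonneg _, Real.sqrt_le_one.2 (filterSymbol_mem_Icc hσ N k).2⟩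

theorem filterSymbol_even (hσ : IsFilterProfile σ) (N : ℕ) (k : Fin d → ℤ) :
    filterSymbol σ N (-k) = filterSymbol σ N k := by
  unfold filterSymbol
  rw [← hσ.even]
  congr 1
  ext j
  simp [neg_div]

theorem filterSymbol_eq_zero (hσ : IsFilterProfile σ) {N : ℕ} (hN : 1 ≤ N) {k : Fin d → ℤ}
    (hk : (N : ℝ) < ‖k‖) : filterSymbol σ N k = 0 := by
  have hN' : (0 : ℝ) < N := by exact_mod_cast hN
  refine hσ.eq_zero _ ?_
  by_contra h
  push Not at h
  refine absurd hk (not_lt.2 ?_)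
  rw [pi_norm_le_iff_of_nonneg hN'.le]
  intro j
  have := h j
  rw [abs_div, abs_of_pos hN', div_lt_one hN'] at this
  rw [Int.norm_eq_abs]
  exact this.le

theorem filterSymbol_eq_one (hσ : IsFilterProfile σ) {N : ℕ} (hN : 1 ≤ N) {k : Fin d → ℤ}
    (hk : ‖k‖ ≤ N / 2) : filterSymbol σ N k = 1 := by
  have hN' : (0 : ℝ) < N := by exact_mod_cast hN
  refine hσ.eq_one _ fun j => ?_
  rw [abs_div, abs_of_pos hN', div_le_div_iff₀ hN' two_pos]
  linarith [abs_apply_le_norm k j]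

theorem norm_two_smul (k : Fin d → ℤ) : ‖2 • k‖ = 2 * ‖k‖ := by
  rw [← Nat.cast_smul_eq_nsmul ℤ, norm_smul, Int.norm_eq_abs]
  norm_num

theorem lowSymbol_eq_one (hσ : IsFilterProfile σ) {N : ℕ} (hN : 1 ≤ N) {k : Fin d → ℤ}
    (hk : ‖k‖ ≤ N / 4) : lowSymbol σ N k = 1 :=
  filterSymbol_eq_one hσ hN (by rw [norm_two_smul]; linarith)

theorem lowSymbol_mem_Icc (hσ : IsFilterProfile σ) (N : ℕ) (k : Fin d → ℤ) :
    lowSymbol σ N k ∈ Set.Icc (0 : ℝ) 1 := filterSymbol_mem_Icc hσ _ _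

theorem filterSymbol_mul_lowSymbol (hσ : IsFilterProfile σ) {N : ℕ} (hN : 1 ≤ N)
    (k : Fin d → ℤ) : filterSymbol σ N k * lowSymbol σ N k = lowSymbol σ N k := by
  by_cases hk : ‖k‖ ≤ N / 2
  · rw [filterSymbol_eq_one hσ hN hk, one_mul]
  · have : lowSymbol σ N k = 0 := by
      refine filterSymbol_eq_zero hσ hN ?_
      rw [norm_two_smul]
      linarith [not_le.1 hk]
    rw [this, mul_zero]

theorem isSymbol_filterSymbol (hσ : IsFilterProfile σ) {N : ℕ} (hN : 1 ≤ N) :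
    IsSymbol N (filterSymbol σ N) where
  even := filterSymbol_even hσ N
  eq_zero _ hk := filterSymbol_eq_zero hσ hN (not_le.1 fun h => hk (mem_box_iff_norm_le.2 h))

theorem isSymbol_sqrtSymbol (hσ : IsFilterProfile σ) {N : ℕ} (hN : 1 ≤ N) :
    IsSymbol N (sqrtSymbol σ N) where
  even k := by rw [sqrtSymbol, filterSymbol_even hσ, sqrtSymbol]
  eq_zero k hk := by rw [sqrtSymbol, (isSymbol_filterSymbol hσ hN).eq_zero k hk, Real.sqrt_zero]

theorem isSymbol_lowSymbol (hσ : IsFilterProfile σ) {N : ℕ} (hN : 1 ≤ N) :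
    IsSymbol N (lowSymbol σ N) where
  even k := by rw [lowSymbol, smul_neg, filterSymbol_even hσ, lowSymbol]
  eq_zero k hk := by
    rw [← filterSymbol_mul_lowSymbol hσ hN, (isSymbol_filterSymbol hσ hN).eq_zero k hk, zero_mul]

theorem norm_intCast_div (N : ℕ) (k : Fin d → ℤ) :
    ‖fun j => (k j : ℝ) / (N : ℝ)‖ = ‖k‖ / N := by
  have h1 : (fun j => (k j : ℝ) / (N : ℝ)) = (N : ℝ)⁻¹ • fun j => (k j : ℝ) := by
    ext j; simp [div_eq_inv_mul]
  have h2 : ‖fun j => (k j : ℝ)‖ = ‖k‖ := rfl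
  rw [h1, norm_smul, h2, norm_inv, Real.norm_natCast, div_eq_inv_mul]

/-- The commutator bound for the symbol `√(σ(· / N))`, uniform in `N`. -/
theorem exists_sqrtSymbol_bound (hσ : IsFilterProfile σ) :
    ∃ C : ℝ, 0 ≤ C ∧ ∀ N : ℕ, 1 ≤ N → ∀ k l : Fin d → ℤ,
      ‖l‖ * |sqrtSymbol σ N k - sqrtSymbol σ N l| ≤ C * ‖k - l‖ := by
  obtain ⟨C, hC, h⟩ := hσ.exists_sqrt_bound
  refine ⟨C, hC, fun N hN k l => ?_⟩
  have hN' : (0 : ℝ) < N := by exact_mod_cast hN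
  have h1 := h (fun j => (k j : ℝ) / (N : ℝ)) (fun j => (l j : ℝ) / (N : ℝ))
  have h2 : (fun j => (k j : ℝ) / (N : ℝ)) - (fun j => (l j : ℝ) / (N : ℝ)) =
      fun j => (((k - l) j : ℤ) : ℝ) / (N : ℝ) := by
    ext j; simp [sub_div]
  rw [h2, norm_intCast_div, norm_intCast_div, div_mul_eq_mul_div, mul_div_assoc',
    div_le_div_iff_of_pos_right hN'] at h1
  exact h1

theorem exists_lowSymbol_bound (hσ : IsFilterProfile σ) :
    ∃ C : ℝ, 0 ≤ C ∧ ∀ N : ℕ, 1 ≤ N → ∀ k l : Fin d → ℤ,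
      ‖l‖ * |lowSymbol σ N k - lowSymbol σ N l| ≤ C * ‖k - l‖ := by
  obtain ⟨C, hC, h⟩ := exists_sqrtSymbol_bound hσ
  refine ⟨2 * C, by positivity, fun N hN k l => ?_⟩
  have h1 := h N hN (2 • k) (2 • l)
  rw [← smul_sub, norm_two_smul, norm_two_smul] at h1
  set a := sqrtSymbol σ N (2 • k) with ha
  set b := sqrtSymbol σ N (2 • l) with hb
  have h2 : lowSymbol σ N k - lowSymbol σ N l = (a - b) * (a + b) := by
    rw [lowSymbol, lowSymbol, ← sqrtSymbol_sq hσ, ← sqrtSymbol_sq hσ]; ring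
  have h3 := sqrtSymbol_mem_Icc hσ N (2 • k)
  have h4 := sqrtSymbol_mem_Icc hσ N (2 • l)
  have h5 : |a + b| ≤ 2 := by
    rw [abs_le]; constructor <;> linarith [h3.1, h3.2, h4.1, h4.2]
  rw [h2, abs_mul]
  have h6 : 0 ≤ ‖l‖ * |a - b| := by positivity
  calc ‖l‖ * (|a - b| * |a + b|) = (‖l‖ * |a - b|) * |a + b| := by ring
    _ ≤ (‖l‖ * |a - b|) * 2 := by gcongr
    _ ≤ _ := by linarith

end symbols

/-! ### Multilinear estimates -/

theorem ENNReal_mul_le_add_sq (a b : ℝ≥0∞) : a * b ≤ a ^ 2 + b ^ 2 := by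
  refine le_trans ?_ (ENNReal_two_mul_le_add_sq a b)
  rw [two_mul]; exact le_self_add

theorem tsum_neg_index (a : (Fin d → ℤ) → ℝ≥0∞) : ∑' k, a (-k) = ∑' k, a k :=
  (Equiv.neg (Fin d → ℤ)).tsum_eq a

theorem enorm_fc_pd {v w : (Fin d → ℝ) → ℂ} {j : Fin d}
    (hw : ∀ k, fc w k = Complex.I * (k j : ℝ) * fc v k) (k : Fin d → ℤ) :
    ‖fc w k‖ₑ ≤ ‖k‖ₑ * ‖fc v k‖ₑ := by
  rw [hw, enorm_mul]
  gcongr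
  rw [← ofReal_norm, ← ofReal_norm]
  refine ENNReal.ofReal_le_ofReal ?_
  simpa using abs_apply_le_norm k j

/-- Exchanging a multiplier `α` acting on a product for multipliers `β`, `γ` acting on the
trigonometric factors: no derivative is lost, provided that the symbols satisfy the commutator bound
`hsym`.  Here `w c = ∂_j (v c)`, `u' = β u`, `w' c = γ (w c)` and `H = α (∑ c, g c * w c)`. -/
theorem enorm_multiplier_exchange_le {N : ℕ} {α β γ : (Fin d → ℤ) → ℝ} {C : ℝ} (hC : 0 ≤ C)
    (hsym : ∀ k q l, ‖l‖ * |α k - β q * γ l| ≤ C * (‖k + q‖ + ‖k - l‖))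
    {f u u' H : (Fin d → ℝ) → ℂ} {g v w w' : Fin n → (Fin d → ℝ) → ℂ} (hf : IsWiener f)
    (hg : ∀ c, Continuous (g c)) (hu : IsTrig N u) (hu' : IsTrig N u')
    (huu : ∀ k, fc u' k = β k * fc u k) (hw : ∀ c, IsTrig N (w c)) {j : Fin d}
    (hvw : ∀ c k, fc (w c) k = Complex.I * (k j : ℝ) * fc (v c) k) (hw' : ∀ c, IsTrig N (w' c))
    (hww : ∀ c k, fc (w' c) k = γ k * fc (w c) k) (hH : Continuous H)
    (hHfc : ∀ k, fc H k = α k * ∑ c, fc (fun x => g c x * w c x) k) :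
    ‖fc (fun x => (f x * u x) * H x) 0 -
      ∑ c, fc (fun x => (f x * u' x) * (g c x * w' c x)) 0‖ₑ ≤
      ENNReal.ofReal C * ∑ c, (wn f ^ 2 * l2n u + wn (g c) ^ 2 * l2n (v c)) := by
  have hfu : ∀ p, fc (fun x => f x * u x) p = ∑ q ∈ box d N, fc u q * fc f (p - q) := by
    intro p
    rw [← hu.fc_mul hf.continuous]
    simp_rw [mul_comm (f _)]
  have hfu' : ∀ p, fc (fun x => f x * u' x) p = ∑ q ∈ box d N, β q * fc u q * fc f (p - q) := by
    intro p
    simp_rw [← huu]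
    rw [← hu'.fc_mul hf.continuous]
    simp_rw [mul_comm (f _)]
  have hgw : ∀ c p, fc (fun x => g c x * w c x) p =
      ∑ l ∈ box d N, fc (w c) l * fc (g c) (p - l) := by
    intro c p
    rw [← (hw c).fc_mul (hg c)]
    simp_rw [mul_comm (g c _)]
  have hgw' : ∀ c p, fc (fun x => g c x * w' c x) p =
      ∑ l ∈ box d N, γ l * fc (w c) l * fc (g c) (p - l) := by
    intro c p
    simp_rw [← hww]
    rw [← (hw' c).fc_mul (hg c)]
    simp_rw [mul_comm (g c _)]
  have h1 := (hf.mul hu.isWiener).fc_mul hH 0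
  have hgc : ∀ c, Continuous fun x => g c x * w' c x := fun c => (hg c).mul (hw' c).continuous
  have h2 := hasSum_sum (s := (Finset.univ : Finset (Fin n))) fun c _ =>
    (hf.mul hu'.isWiener).fc_mul (hgc c) 0
  rw [← (h1.sub h2).tsum_eq]
  refine (enorm_tsum_le _).trans ?_
  set F : (Fin d → ℤ) → ℝ≥0∞ := fun k => (1 + ‖k‖ₑ) * ‖fc f k‖ₑ
  set G : Fin n → (Fin d → ℤ) → ℝ≥0∞ := fun c k => (1 + ‖k‖ₑ) * ‖fc (g c) k‖ₑ
  have h3 : ∀ p, ‖fc (fun x => f x * u x) p * fc H (0 - p) - ∑ c, fc (fun x => f x * u' x) p *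
      fc (fun x => g c x * w' c x) (0 - p)‖ₑ ≤
      ∑ c, ENNReal.ofReal C * (conv F (fun k => ‖fc u k‖ₑ) p *
        conv (G c) (fun k => ‖fc (v c) k‖ₑ) (-p)) := by
    intro p
    -- In frequencies, the difference is a trilinear sum with kernel `α (-p) - β q * γ l`.
    have h4 : fc (fun x => f x * u x) p * fc H (0 - p) - ∑ c, fc (fun x => f x * u' x) p *
        fc (fun x => g c x * w' c x) (0 - p) = ∑ c, ∑ q ∈ box d N, ∑ l ∈ box d N,
        ((α (-p) : ℂ) - β q * γ l) * (fc u q * fc f (p - q)) *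
          (fc (w c) l * fc (g c) (-p - l)) := by
      rw [zero_sub, hHfc, Finset.mul_sum, Finset.mul_sum, ← Finset.sum_sub_distrib]
      refine Finset.sum_congr rfl fun c _ => ?_
      rw [hfu, hfu', hgw, hgw', Finset.mul_sum, Finset.sum_mul_sum, Finset.sum_mul_sum,
        ← Finset.sum_sub_distrib]
      refine Finset.sum_congr rfl fun q _ => ?_
      rw [← Finset.sum_sub_distrib]
      exact Finset.sum_congr rfl fun l _ => by ring
    rw [h4]
    refine (enorm_sum_le _ _).trans (Finset.sum_le_sum fun c _ => ?_)
    have h5 : ∀ q l, ‖((α (-p) : ℂ) - β q * γ l) * (fc u q * fc f (p - q)) *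
        (fc (w c) l * fc (g c) (-p - l))‖ₑ ≤ ENNReal.ofReal C *
        ((F (p - q) * ‖fc u q‖ₑ) * (G c (-p - l) * ‖fc (v c) l‖ₑ)) := by
      intro q l
      -- The factor `‖l‖` of the derivative is moved onto the coefficients `f` and `g c`.
      have h6 : ‖((α (-p) : ℂ) - β q * γ l)‖ₑ * ‖l‖ₑ ≤
          ENNReal.ofReal C * ((1 + ‖p - q‖ₑ) * (1 + ‖-p - l‖ₑ)) := by
        have h7 := hsym (-p) q l
        have h8 : ‖-p + q‖ = ‖p - q‖ := by rw [← norm_neg]; congr 1; abel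
        rw [h8] at h7
        have h9 : ‖l‖ * |α (-p) - β q * γ l| ≤ C * ((1 + ‖p - q‖) * (1 + ‖-p - l‖)) := by
          refine h7.trans (mul_le_mul_of_nonneg_left ?_ hC)
          nlinarith [norm_nonneg (p - q), norm_nonneg (-p - l)]
        have h10 : ‖((α (-p) : ℂ) - β q * γ l)‖ = |α (-p) - β q * γ l| := by
          rw [← Complex.ofReal_mul, ← Complex.ofReal_sub, Complex.norm_real, Real.norm_eq_abs]
        calc ‖((α (-p) : ℂ) - β q * γ l)‖ₑ * ‖l‖ₑ
            = ENNReal.ofReal (‖l‖ * |α (-p) - β q * γ l|) := by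
              rw [← ofReal_norm, ← ofReal_norm, h10, ← ENNReal.ofReal_mul (abs_nonneg _), mul_comm]
          _ ≤ _ := ENNReal.ofReal_le_ofReal h9
          _ = _ := by
            rw [ENNReal.ofReal_mul hC, ENNReal.ofReal_mul (by positivity),
              ENNReal.ofReal_add zero_le_one (norm_nonneg _),
              ENNReal.ofReal_add zero_le_one (norm_nonneg _), ofReal_norm, ofReal_norm,
              ENNReal.ofReal_one]
      rw [enorm_mul, enorm_mul, enorm_mul, enorm_mul]
      calc _ ≤ ‖((α (-p) : ℂ) - β q * γ l)‖ₑ * (‖fc u q‖ₑ * ‖fc f (p - q)‖ₑ) *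
            ((‖l‖ₑ * ‖fc (v c) l‖ₑ) * ‖fc (g c) (-p - l)‖ₑ) := by
            gcongr; exact enorm_fc_pd (hvw c) l
        _ = (‖((α (-p) : ℂ) - β q * γ l)‖ₑ * ‖l‖ₑ) * ((‖fc u q‖ₑ * ‖fc f (p - q)‖ₑ) *
            (‖fc (v c) l‖ₑ * ‖fc (g c) (-p - l)‖ₑ)) := by ring
        _ ≤ (ENNReal.ofReal C * ((1 + ‖p - q‖ₑ) * (1 + ‖-p - l‖ₑ))) *
            ((‖fc u q‖ₑ * ‖fc f (p - q)‖ₑ) * (‖fc (v c) l‖ₑ * ‖fc (g c) (-p - l)‖ₑ)) := by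
            gcongr
        _ = _ := by simp only [F, G]; ring
    calc _ ≤ ∑ q ∈ box d N, ∑ l ∈ box d N, ENNReal.ofReal C *
          ((F (p - q) * ‖fc u q‖ₑ) * (G c (-p - l) * ‖fc (v c) l‖ₑ)) :=
          (enorm_sum_le _ _).trans (Finset.sum_le_sum fun q _ =>
            (enorm_sum_le _ _).trans (Finset.sum_le_sum fun l _ => h5 q l))
      _ = ENNReal.ofReal C * ((∑ q ∈ box d N, F (p - q) * ‖fc u q‖ₑ) *
          ∑ l ∈ box d N, G c (-p - l) * ‖fc (v c) l‖ₑ) := by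
          rw [Finset.sum_mul_sum, Finset.mul_sum]
          exact Finset.sum_congr rfl fun q _ => by rw [Finset.mul_sum]
      _ ≤ _ := by
          gcongr
          · exact ENNReal.sum_le_tsum _
          · exact ENNReal.sum_le_tsum _
  refine (ENNReal.tsum_le_tsum h3).trans ?_
  rw [Summable.tsum_finsetSum (fun _ _ => ENNReal.summable), Finset.mul_sum]
  refine Finset.sum_le_sum fun c _ => ?_
  rw [ENNReal.tsum_mul_left]
  gcongr
  calc _ ≤ ∑' p, (conv F (fun k => ‖fc u k‖ₑ) p ^ 2 +
        conv (G c) (fun k => ‖fc (v c) k‖ₑ) (-p) ^ 2) :=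
        ENNReal.tsum_le_tsum fun p => ENNReal_mul_le_add_sq _ _
    _ ≤ _ := by
        rw [ENNReal.tsum_add, tsum_neg_index fun p => conv (G c) (fun k => ‖fc (v c) k‖ₑ) p ^ 2]
        exact add_le_add (tsum_conv_sq_le _ _) (tsum_conv_sq_le _ _)

/-- The energy identity for symmetric systems: since `M` is symmetric,
`∑ ∫ M_{bc} w_b ∂_j w_c = - ½ ∑ ∫ (∂_j M_{bc}) w_b w_c`, which loses no derivative of `w`. -/
theorem enorm_symmetric_form_le {N : ℕ} {M : Fin n → Fin n → (Fin d → ℝ) → ℂ}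
    (hM : ∀ b c, Continuous (M b c)) (hsymm : ∀ b c, M b c = M c b)
    {w dw : Fin n → (Fin d → ℝ) → ℂ} (hw : ∀ c, IsTrig N (w c)) (hdw : ∀ c, IsTrig N (dw c))
    {j : Fin d} (hwd : ∀ c k, fc (dw c) k = Complex.I * (k j : ℝ) * fc (w c) k) :
    ‖∑ b, ∑ c, fc (fun x => M b c x * w b x * dw c x) 0‖ₑ ≤
      ∑ b, ∑ c, (l2n (w b) + wn (M b c) ^ 2 * l2n (w c)) := by
  set Z := ∑ b, ∑ c, fc (fun x => M b c x * w b x * dw c x) 0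
  have h1 : ∀ b c, fc (fun x => M b c x * w b x * dw c x) 0 = ∑ q ∈ box d N, ∑ l ∈ box d N,
      fc (w b) q * (Complex.I * (l j : ℝ) * fc (w c) l * fc (M b c) (-q - l)) := by
    intro b c
    have : (fun x => M b c x * w b x * dw c x) = fun x => w b x * (dw c x * M b c x) := by
      ext x; ring
    have hc : Continuous fun x => dw c x * M b c x := (hdw c).continuous.mul (hM b c)
    rw [this, (hw b).fc_mul hc]
    refine Finset.sum_congr rfl fun q _ => ?_
    rw [(hdw c).fc_mul (hM b c), Finset.mul_sum]
    exact Finset.sum_congr rfl fun l _ => by rw [hwd, zero_sub]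
  have hZ1 : Z = ∑ b, ∑ c, ∑ q ∈ box d N, ∑ l ∈ box d N,
      fc (w b) q * (Complex.I * (l j : ℝ) * fc (w c) l * fc (M b c) (-q - l)) :=
    Finset.sum_congr rfl fun b _ => Finset.sum_congr rfl fun c _ => h1 b c
  have hZ2 : Z = ∑ b, ∑ c, ∑ q ∈ box d N, ∑ l ∈ box d N,
      fc (w b) q * (Complex.I * (q j : ℝ) * fc (w c) l * fc (M b c) (-q - l)) := by
    rw [hZ1, Finset.sum_comm]
    refine Finset.sum_congr rfl fun b _ => Finset.sum_congr rfl fun c _ => ?_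
    rw [Finset.sum_comm]
    refine Finset.sum_congr rfl fun q _ => Finset.sum_congr rfl fun l _ => ?_
    rw [hsymm c b, show -l - q = -q - l by abel]
    ring
  -- Averaging the two expressions replaces the frequency of `w c` by minus that of `M b c`.
  have hZ3 : 2 * Z = ∑ b, ∑ c, ∑ q ∈ box d N, ∑ l ∈ box d N,
      fc (w b) q * (Complex.I * ((q + l) j : ℤ) * fc (w c) l * fc (M b c) (-q - l)) := by
    rw [two_mul]
    nth_rw 1 [hZ1]
    rw [hZ2]
    simp_rw [← Finset.sum_add_distrib]
    refine Finset.sum_congr rfl fun b _ => Finset.sum_congr rfl fun c _ =>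
      Finset.sum_congr rfl fun q _ => Finset.sum_congr rfl fun l _ => ?_
    push_cast [Pi.add_apply]
    ring
  have h2 : ‖Z‖ₑ ≤ ‖2 * Z‖ₑ := by
    rw [enorm_mul, ← ofReal_norm (2 : ℂ)]
    simp only [Complex.norm_ofNat, ENNReal.ofReal_ofNat]
    rw [two_mul]; exact le_self_add
  refine h2.trans ?_
  rw [hZ3]
  refine (enorm_sum_le _ _).trans (Finset.sum_le_sum fun b _ =>
    (enorm_sum_le _ _).trans (Finset.sum_le_sum fun c _ => ?_))
  set G : (Fin d → ℤ) → ℝ≥0∞ := fun k => ‖k‖ₑ * ‖fc (M b c) k‖ₑ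
  have h3 : ∀ q l, ‖fc (w b) q * (Complex.I * ((q + l) j : ℤ) * fc (w c) l *
      fc (M b c) (-q - l))‖ₑ ≤ ‖fc (w b) q‖ₑ * (G (-q - l) * ‖fc (w c) l‖ₑ) := by
    intro q l
    rw [enorm_mul, enorm_mul, enorm_mul]
    have h4 : ‖Complex.I * (((q + l) j : ℤ) : ℂ)‖ₑ ≤ ‖-q - l‖ₑ := by
      rw [← ofReal_norm, ← ofReal_norm]
      refine ENNReal.ofReal_le_ofReal ?_
      have h5 : ‖-q - l‖ = ‖q + l‖ := by rw [← norm_neg]; congr 1; abel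
      rw [h5, norm_mul, Complex.norm_I, one_mul, Complex.norm_intCast]
      exact abs_apply_le_norm (q + l) j
    calc _ ≤ ‖fc (w b) q‖ₑ * (‖-q - l‖ₑ * ‖fc (w c) l‖ₑ * ‖fc (M b c) (-q - l)‖ₑ) := by gcongr
      _ = _ := by simp only [G]; ring
  calc _ ≤ ∑ q ∈ box d N, ∑ l ∈ box d N, ‖fc (w b) q‖ₑ * (G (-q - l) * ‖fc (w c) l‖ₑ) :=
        (enorm_sum_le _ _).trans (Finset.sum_le_sum fun q _ =>
          (enorm_sum_le _ _).trans (Finset.sum_le_sum fun l _ => h3 q l))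
    _ ≤ ∑ q ∈ box d N, ‖fc (w b) q‖ₑ * conv G (fun k => ‖fc (w c) k‖ₑ) (-q) := by
        refine Finset.sum_le_sum fun q _ => ?_
        rw [← Finset.mul_sum]
        gcongr
        exact ENNReal.sum_le_tsum _
    _ ≤ ∑' q, (‖fc (w b) q‖ₑ ^ 2 + conv G (fun k => ‖fc (w c) k‖ₑ) (-q) ^ 2) :=
        (ENNReal.sum_le_tsum _).trans (ENNReal.tsum_le_tsum fun q => ENNReal_mul_le_add_sq _ _)
    _ ≤ _ := by
        rw [ENNReal.tsum_add, tsum_neg_index fun p => conv G (fun k => ‖fc (w c) k‖ₑ) p ^ 2]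
        unfold l2n
        gcongr
        refine (tsum_conv_sq_le _ _).trans ?_
        gcongr
        exact tsum_enorm_mul_fc_le _

/-! ### Commutator conditions on products of symbols -/

theorem sqrtSymbol_exchange {m : (Fin d → ℤ) → ℝ} {C : ℝ} (hC : 0 ≤ C)
    (hm : ∀ k, m k ∈ Set.Icc (0 : ℝ) 1) (heven : ∀ k, m (-k) = m k)
    (hb : ∀ k l, ‖l‖ * |m k - m l| ≤ C * ‖k - l‖) (k q l : Fin d → ℤ) :
    ‖l‖ * |m k - m l| ≤ C * ‖k - l‖ ∧ ‖l‖ * |m k - m q| ≤ (C + 1) * (‖k + q‖ + ‖k - l‖) := by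
  refine ⟨hb k l, ?_⟩
  have h1 : ‖k‖ * |m k - m q| ≤ C * ‖k + q‖ := by
    have := hb (-q) k
    rw [heven, abs_sub_comm] at this
    have h : ‖-q - k‖ = ‖k + q‖ := by rw [← norm_neg]; congr 1; abel
    rwa [h] at this
  have h2 : ‖l‖ ≤ ‖k‖ + ‖k - l‖ := by
    have := norm_sub_le k (k - l); simpa using this
  have h3 : |m k - m q| ≤ 1 := by
    rw [abs_le]; constructor <;> linarith [(hm k).1, (hm k).2, (hm q).1, (hm q).2]
  have h4 : ‖l‖ * |m k - m q| ≤ (‖k‖ + ‖k - l‖) * |m k - m q| := by gcongr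
  have h5 : ‖k - l‖ * |m k - m q| ≤ ‖k - l‖ * 1 := by gcongr
  nlinarith [norm_nonneg (k + q), mul_nonneg hC (norm_nonneg (k - l))]

theorem symbol_exchange_sq {m : (Fin d → ℤ) → ℝ} {C : ℝ} (hC : 0 ≤ C)
    (hm : ∀ k, m k ∈ Set.Icc (0 : ℝ) 1) (heven : ∀ k, m (-k) = m k)
    (hb : ∀ k l, ‖l‖ * |m k - m l| ≤ C * ‖k - l‖) (k q l : Fin d → ℤ) :
    ‖l‖ * |m k ^ 2 - m q * m l| ≤ (4 * C + 4) * (‖k + q‖ + ‖k - l‖) := by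
  obtain ⟨h1, h2⟩ := sqrtSymbol_exchange hC hm heven hb k q l
  have h3 : |m k ^ 2 - m q * m l| ≤ |m k - m l| + |m k - m q| := by
    have : m k ^ 2 - m q * m l = m k * (m k - m l) + m l * (m k - m q) := by ring
    rw [this]
    refine (abs_add_le _ _).trans ?_
    rw [abs_mul, abs_mul, abs_of_nonneg (hm k).1, abs_of_nonneg (hm l).1]
    exact add_le_add (mul_le_of_le_one_left (abs_nonneg _) (hm k).2)
      (mul_le_of_le_one_left (abs_nonneg _) (hm l).2)
  have h4 : ‖l‖ * |m k ^ 2 - m q * m l| ≤ ‖l‖ * (|m k - m l| + |m k - m q|) := by gcongr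
  nlinarith [norm_nonneg (k + q), norm_nonneg (k - l), mul_nonneg hC (norm_nonneg (k - l)),
    mul_nonneg hC (norm_nonneg (k + q))]

theorem symbol_exchange_cube {m : (Fin d → ℤ) → ℝ} {C : ℝ} (hC : 0 ≤ C)
    (hm : ∀ k, m k ∈ Set.Icc (0 : ℝ) 1) (heven : ∀ k, m (-k) = m k)
    (hb : ∀ k l, ‖l‖ * |m k - m l| ≤ C * ‖k - l‖) (k q l : Fin d → ℤ) :
    ‖l‖ * |m k ^ 3 - m q * m l ^ 2| ≤ (4 * C + 4) * (‖k + q‖ + ‖k - l‖) := by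
  obtain ⟨h1, h2⟩ := sqrtSymbol_exchange hC hm heven hb k q l
  have h3 : |m k ^ 3 - m q * m l ^ 2| ≤ 2 * |m k - m l| + |m k - m q| := by
    have : m k ^ 3 - m q * m l ^ 2 =
        (m k * (m k + m l)) * (m k - m l) + m l ^ 2 * (m k - m q) := by ring
    rw [this]
    refine (abs_add_le _ _).trans ?_
    have hk := hm k
    have hl := hm l
    have h5 : m k * (m k + m l) ≤ 2 := by nlinarith [hk.1, hk.2, hl.1, hl.2]
    have h6 : 0 ≤ m k * (m k + m l) := mul_nonneg hk.1 (add_nonneg hk.1 hl.1)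
    have h7 : m l ^ 2 ≤ 1 := pow_le_one₀ hl.1 hl.2
    rw [abs_mul (m k * (m k + m l)), abs_mul (m l ^ 2), abs_of_nonneg h6, abs_of_nonneg (sq_nonneg (m l))]
    exact add_le_add (mul_le_mul_of_nonneg_right h5 (abs_nonneg _))
      (mul_le_of_le_one_left (abs_nonneg _) h7)
  have h4 : ‖l‖ * |m k ^ 3 - m q * m l ^ 2| ≤ ‖l‖ * (2 * |m k - m l| + |m k - m q|) := by gcongr
  nlinarith [norm_nonneg (k + q), norm_nonneg (k - l), mul_nonneg hC (norm_nonneg (k - l)),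
    mul_nonneg hC (norm_nonneg (k + q))]

/-! ### The energy estimate at a fixed time -/

theorem wn_sum_le {ι : Type*} {s : Finset ι} {F : ι → (Fin d → ℝ) → ℂ}
    (h : ∀ i ∈ s, Continuous (F i)) : wn (fun x => ∑ i ∈ s, F i x) ≤ ∑ i ∈ s, wn (F i) := by
  classical
  induction s using Finset.induction_on with
  | empty => simp [wn_const]
  | insert a s ha ih =>
    simp only [Finset.sum_insert ha]
    exact (wn_add_le (h a (by simp)) (continuous_finsetSum _ fun i hi => h i (by simp [hi]))).trans
      (by gcongr; exact ih fun i hi => h i (by simp [hi]))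

/-- The product of two matrices of functions. -/
def mmul (S B : Fin n → Fin n → (Fin d → ℝ) → ℂ) (a c : Fin n) : (Fin d → ℝ) → ℂ :=
  fun x => ∑ b, S a b x * B b c x

theorem isWiener_mmul {S B : Fin n → Fin n → (Fin d → ℝ) → ℂ} (hS : ∀ a b, IsWiener (S a b))
    (hB : ∀ a b, IsWiener (B a b)) (a c : Fin n) : IsWiener (mmul S B a c) :=
  IsWiener.sum fun b _ => (hS a b).mul (hB b c)

theorem wn_mmul_le {S B : Fin n → Fin n → (Fin d → ℝ) → ℂ} (hS : ∀ a b, IsWiener (S a b))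
    (hB : ∀ a b, IsWiener (B a b)) {R : ℝ≥0∞} (hSR : ∀ a b, wn (S a b) ≤ R)
    (hBR : ∀ a b, wn (B a b) ≤ R) (a c : Fin n) : wn (mmul S B a c) ≤ n * R ^ 2 := by
  refine (wn_sum_le fun b _ => ((hS a b).mul (hB b c)).continuous).trans ?_
  calc _ ≤ ∑ _b : Fin n, R ^ 2 := by
        refine Finset.sum_le_sum fun b _ => (wn_mul_le (hS a b) (hB b c).continuous).trans ?_
        rw [sq]
        exact mul_le_mul' (hSR a b) (hBR b c)
    _ = _ := by simp

/-- Expanding a product with a matrix-vector product. -/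
theorem sum_fc_mmul {S B : Fin n → Fin n → (Fin d → ℝ) → ℂ} (hS : ∀ a b, Continuous (S a b))
    (hB : ∀ a b, Continuous (B a b)) {z w : Fin n → (Fin d → ℝ) → ℂ}
    (hz : ∀ a, Continuous (z a)) (hw : ∀ a, Continuous (w a)) :
    ∑ a, ∑ b, ∑ c, fc (fun x => (S a b x * z a x) * (B b c x * w c x)) 0 =
      ∑ a, ∑ c, fc (fun x => mmul S B a c x * z a x * w c x) 0 := by
  refine Finset.sum_congr rfl fun a _ => ?_
  rw [Finset.sum_comm]
  refine Finset.sum_congr rfl fun c _ => ?_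
  have : (fun x => mmul S B a c x * z a x * w c x) =
      fun x => ∑ b, (S a b x * z a x) * (B b c x * w c x) := by
    ext x
    simp only [mmul, Finset.sum_mul]
    exact Finset.sum_congr rfl fun b _ => by ring
  rw [this, fc_sum]
  intro b _
  exact ((hS a b).mul (hz a)).mul ((hB b c).mul (hw c))

/-- The energy estimate for one direction of space: the contributions of `A ∂_j z` and
`S_N (B ∂_j z)` to the derivative of `∫ S_a z · z + ∫ S_b T z · T z` with `T ^ 2 = S_N` are
controlled by the `L²` norm of `z` alone. -/
theorem enorm_energy_direction_le {N : ℕ} {m : (Fin d → ℤ) → ℝ} {C : ℝ} (hC : 0 ≤ C)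
    (hm : ∀ k, m k ∈ Set.Icc (0 : ℝ) 1) (heven : ∀ k, m (-k) = m k)
    (hb : ∀ k l, ‖l‖ * |m k - m l| ≤ C * ‖k - l‖)
    {Sa Sb A B : Fin n → Fin n → (Fin d → ℝ) → ℂ}
    (hSa : ∀ a b, IsWiener (Sa a b)) (hSb : ∀ a b, IsWiener (Sb a b))
    (hA : ∀ a b, IsWiener (A a b)) (hB : ∀ a b, IsWiener (B a b)) {R : ℝ≥0∞}
    (hSaR : ∀ a b, wn (Sa a b) ≤ R) (hSbR : ∀ a b, wn (Sb a b) ≤ R)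
    (hAR : ∀ a b, wn (A a b) ≤ R) (hBR : ∀ a b, wn (B a b) ≤ R)
    (hs1 : ∀ a c, mmul Sa A a c = mmul Sa A c a)
    (hs2 : ∀ a c x, mmul Sa B a c x + mmul Sb A a c x = mmul Sa B c a x + mmul Sb A c a x)
    (hs3 : ∀ a c, mmul Sb B a c = mmul Sb B c a)
    {z Tz TTz dz dTz dTTz X TX : Fin n → (Fin d → ℝ) → ℂ} {j : Fin d}
    (hz : ∀ a, IsTrig N (z a)) (hTz : ∀ a, IsTrig N (Tz a)) (hTTz : ∀ a, IsTrig N (TTz a))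
    (hdz : ∀ a, IsTrig N (dz a)) (hdTz : ∀ a, IsTrig N (dTz a)) (hdTTz : ∀ a, IsTrig N (dTTz a))
    (h1 : ∀ a k, fc (Tz a) k = m k * fc (z a) k)
    (h2 : ∀ a k, fc (TTz a) k = m k * fc (Tz a) k)
    (h3 : ∀ a k, fc (dz a) k = Complex.I * (k j : ℝ) * fc (z a) k)
    (h4 : ∀ a k, fc (dTz a) k = Complex.I * (k j : ℝ) * fc (Tz a) k)
    (h5 : ∀ a k, fc (dTTz a) k = Complex.I * (k j : ℝ) * fc (TTz a) k)
    (hX : ∀ a, Continuous (X a)) (hTX : ∀ a, Continuous (TX a))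
    (hXfc : ∀ b k, fc (X b) k = (m k ^ 2 : ℝ) * ∑ c, fc (fun x => B b c x * dz c x) k)
    (hTXfc : ∀ b k, fc (TX b) k = (m k ^ 3 : ℝ) * ∑ c, fc (fun x => B b c x * dz c x) k) :
    ‖∑ a, ∑ b, ((∑ c, fc (fun x => (Sa a b x * z a x) * (A b c x * dz c x)) 0) +
        fc (fun x => (Sa a b x * z a x) * X b x) 0 +
        (∑ c, fc (fun x => (Sb a b x * Tz a x) * (A b c x * dTz c x)) 0) +
        fc (fun x => (Sb a b x * Tz a x) * TX b x) 0)‖ₑ ≤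
      (2 * n ^ 3 * ENNReal.ofReal (4 * C + 4) * (2 * R ^ 2) +
        3 * (n ^ 2 * (1 + (2 * (n * R ^ 2)) ^ 2))) * ∑ i, l2n (z i) := by
  set e := ∑ i, l2n (z i)
  have hze : ∀ a, l2n (z a) ≤ e := fun a =>
    Finset.single_le_sum (f := fun a => l2n (z a)) (fun _ _ => by simp) (Finset.mem_univ a)
  have hmul : ∀ (u v : (Fin d → ℝ) → ℂ), (∀ k, fc u k = m k * fc v k) → l2n u ≤ l2n v := by
    intro u v huv
    refine ENNReal.tsum_le_tsum fun k => ?_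
    rw [huv, enorm_mul]
    refine pow_le_pow_left' (mul_le_of_le_one_left' ?_) 2
    rw [← ofReal_norm, Complex.norm_real, Real.norm_of_nonneg (hm k).1]
    exact ENNReal.ofReal_le_one.2 (hm k).2
  have hTze : ∀ a, l2n (Tz a) ≤ e := fun a => (hmul _ _ (h1 a)).trans (hze a)
  have hTTze : ∀ a, l2n (TTz a) ≤ e := fun a => (hmul _ _ (h2 a)).trans (hTze a)
  -- Exchange of the filter in the terms with `S_N (B ∂_j z)`: one factor `T` goes to the left, and
  -- the remaining ones go to `∂_j z`.
  have k1 : ∀ a b, ‖fc (fun x => (Sa a b x * z a x) * X b x) 0 -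
      ∑ c, fc (fun x => (Sa a b x * Tz a x) * (B b c x * dTz c x)) 0‖ₑ ≤
      n * ENNReal.ofReal (4 * C + 4) * (2 * R ^ 2) * e := by
    intro a b
    refine (enorm_multiplier_exchange_le (α := fun k => m k ^ 2) (β := m) (γ := m)
      (by positivity) (symbol_exchange_sq hC hm heven hb) (hSa a b) (fun c => (hB b c).continuous)
      (hz a) (hTz a) (h1 a) hdz (v := z) (fun c k => h3 c k) hdTz (fun c k => ?_) (hX b)
      (fun k => hXfc b k)).trans ?_
    · rw [h4, h3, h1]; ring
    · calc _ ≤ ENNReal.ofReal (4 * C + 4) * ∑ _c : Fin n, (R ^ 2 * e + R ^ 2 * e) := by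
            gcongr with c
            · exact hSaR a b
            · exact hze a
            · exact hBR b c
            · exact hze c
        _ = _ := by simp; ring
  have k2 : ∀ a b, ‖fc (fun x => (Sb a b x * Tz a x) * TX b x) 0 -
      ∑ c, fc (fun x => (Sb a b x * TTz a x) * (B b c x * dTTz c x)) 0‖ₑ ≤
      n * ENNReal.ofReal (4 * C + 4) * (2 * R ^ 2) * e := by
    intro a b
    refine (enorm_multiplier_exchange_le (α := fun k => m k ^ 3) (β := m) (γ := fun k => m k ^ 2)
      (by positivity) (symbol_exchange_cube hC hm heven hb) (hSb a b)
      (fun c => (hB b c).continuous)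
      (hTz a) (hTTz a) (h2 a) hdz (v := z) (fun c k => h3 c k) hdTTz (fun c k => ?_) (hTX b)
      (fun k => hTXfc b k)).trans ?_
    · rw [h5, h3, h2, h1]; push_cast; ring
    · calc _ ≤ ENNReal.ofReal (4 * C + 4) * ∑ _c : Fin n, (R ^ 2 * e + R ^ 2 * e) := by
            gcongr with c
            · exact hSbR a b
            · exact hTze a
            · exact hBR b c
            · exact hze c
        _ = _ := by simp; ring
  -- What remains are symmetric forms in `z`, `T z` and `T² z`.
  have k3 : ∀ (M : Fin n → Fin n → (Fin d → ℝ) → ℂ) (w dw : Fin n → (Fin d → ℝ) → ℂ),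
      (∀ a c, Continuous (M a c)) → (∀ a c, M a c = M c a) →
      (∀ a c, wn (M a c) ≤ 2 * (n * R ^ 2)) → (∀ a, IsTrig N (w a)) → (∀ a, IsTrig N (dw a)) →
      (∀ a k, fc (dw a) k = Complex.I * (k j : ℝ) * fc (w a) k) → (∀ a, l2n (w a) ≤ e) →
      ‖∑ a, ∑ c, fc (fun x => M a c x * w a x * dw c x) 0‖ₑ ≤
        n ^ 2 * (1 + (2 * (n * R ^ 2)) ^ 2) * e := by
    intro M w dw hM hsymm hMR hw hdw hwd hwe
    refine (enorm_symmetric_form_le hM hsymm hw hdw hwd).trans ?_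
    calc _ ≤ ∑ _b : Fin n, ∑ _c : Fin n, (e + (2 * (n * R ^ 2)) ^ 2 * e) := by
          gcongr with b _ c
          · exact hwe b
          · exact hMR b c
          · exact hwe c
      _ = _ := by simp; ring
  -- The three matrices that have to be symmetric: `S_a A` acts on `z`, `S_a B + S_b A` on `T z` and
  -- `S_b B` on `T² z`.
  have hM1 := isWiener_mmul hSa hA
  have hM2 := isWiener_mmul hSa hB
  have hM2' := isWiener_mmul hSb hA
  have hM3 := isWiener_mmul hSb hB
  have hle : (n : ℝ≥0∞) * R ^ 2 ≤ 2 * (n * R ^ 2) := by rw [two_mul]; exact le_self_add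
  have j1 := k3 (mmul Sa A) z dz (fun a c => (hM1 a c).continuous) hs1
    (fun a c => (wn_mmul_le hSa hA hSaR hAR a c).trans hle) hz hdz h3 hze
  have j2 := k3 (fun a c x => mmul Sa B a c x + mmul Sb A a c x) Tz dTz
    (fun a c => (hM2 a c).continuous.add (hM2' a c).continuous) (fun a c => funext (hs2 a c))
    (fun a c => by
      refine (wn_add_le (hM2 a c).continuous (hM2' a c).continuous).trans ?_
      rw [two_mul]
      exact add_le_add (wn_mmul_le hSa hB hSaR hBR a c) (wn_mmul_le hSb hA hSbR hAR a c))
    hTz hdTz h4 hTze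
  have j3 := k3 (mmul Sb B) TTz dTTz (fun a c => (hM3 a c).continuous) hs3
    (fun a c => (wn_mmul_le hSb hB hSbR hBR a c).trans hle) hTTz hdTTz h5 hTTze
  have hcz := fun a => (hz a).continuous
  have hcTz := fun a => (hTz a).continuous
  have hcTTz := fun a => (hTTz a).continuous
  have hcdz := fun a => (hdz a).continuous
  have hcdTz := fun a => (hdTz a).continuous
  have hcdTTz := fun a => (hdTTz a).continuous
  have hcSa := fun a b => (hSa a b).continuous
  have hcSb := fun a b => (hSb a b).continuous
  have hcA := fun a b => (hA a b).continuous
  have hcB := fun a b => (hB a b).continuous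
  have e2 : ∑ a, ∑ c, fc (fun x => (mmul Sa B a c x + mmul Sb A a c x) * Tz a x * dTz c x) 0 =
      ∑ a, ∑ c, fc (fun x => mmul Sa B a c x * Tz a x * dTz c x) 0 +
      ∑ a, ∑ c, fc (fun x => mmul Sb A a c x * Tz a x * dTz c x) 0 := by
    simp_rw [← Finset.sum_add_distrib]
    refine Finset.sum_congr rfl fun a _ => Finset.sum_congr rfl fun c _ => ?_
    simp_rw [add_mul]
    exact fc_add (((hM2 a c).continuous.mul (hcTz a)).mul (hcdTz c))
      (((hM2' a c).continuous.mul (hcTz a)).mul (hcdTz c)) 0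
  rw [e2] at j2
  rw [← sum_fc_mmul hcSa hcA hcz hcdz] at j1
  rw [← sum_fc_mmul hcSa hcB hcTz hcdTz, ← sum_fc_mmul hcSb hcA hcTz hcdTz] at j2
  rw [← sum_fc_mmul hcSb hcB hcTTz hcdTTz] at j3
  have hdecomp : ∑ a, ∑ b, ((∑ c, fc (fun x => (Sa a b x * z a x) * (A b c x * dz c x)) 0) +
        fc (fun x => (Sa a b x * z a x) * X b x) 0 +
        (∑ c, fc (fun x => (Sb a b x * Tz a x) * (A b c x * dTz c x)) 0) +
        fc (fun x => (Sb a b x * Tz a x) * TX b x) 0) =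
      (∑ a, ∑ b, (fc (fun x => (Sa a b x * z a x) * X b x) 0 -
        ∑ c, fc (fun x => (Sa a b x * Tz a x) * (B b c x * dTz c x)) 0)) +
      (∑ a, ∑ b, (fc (fun x => (Sb a b x * Tz a x) * TX b x) 0 -
        ∑ c, fc (fun x => (Sb a b x * TTz a x) * (B b c x * dTTz c x)) 0)) +
      (∑ a, ∑ b, ∑ c, fc (fun x => (Sa a b x * z a x) * (A b c x * dz c x)) 0) +
      (∑ a, ∑ b, ∑ c, fc (fun x => (Sa a b x * Tz a x) * (B b c x * dTz c x)) 0 +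
        ∑ a, ∑ b, ∑ c, fc (fun x => (Sb a b x * Tz a x) * (A b c x * dTz c x)) 0) +
      (∑ a, ∑ b, ∑ c, fc (fun x => (Sb a b x * TTz a x) * (B b c x * dTTz c x)) 0) := by
    simp_rw [← Finset.sum_add_distrib]
    refine Finset.sum_congr rfl fun a _ => Finset.sum_congr rfl fun b _ => ?_
    simp_rw [Finset.sum_add_distrib]
    ring
  rw [hdecomp]
  have l1 := (enorm_sum_le _ _).trans (Finset.sum_le_sum fun a (_ : a ∈ Finset.univ) =>
    (enorm_sum_le _ _).trans (Finset.sum_le_sum fun b (_ : b ∈ Finset.univ) => k1 a b))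
  have l2 := (enorm_sum_le _ _).trans (Finset.sum_le_sum fun a (_ : a ∈ Finset.univ) =>
    (enorm_sum_le _ _).trans (Finset.sum_le_sum fun b (_ : b ∈ Finset.univ) => k2 a b))
  refine (enorm_add_le _ _).trans ((add_le_add ((enorm_add_le _ _).trans (add_le_add
    ((enorm_add_le _ _).trans (add_le_add ((enorm_add_le _ _).trans (add_le_add l1 l2)) j1)) j2))
    j3).trans_eq ?_)
  simp
  ring

/-! ### Polynomials of functions -/

theorem exists_bound_forall {ι : Type*} [Fintype ι] {P : ι → ℝ≥0∞ → Prop}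
    (hmono : ∀ i a b, a ≤ b → P i a → P i b) (h : ∀ i, ∃ C < ⊤, P i C) :
    ∃ C < ⊤, ∀ i, P i C := by
  choose C hC hP using h
  exact ⟨∑ i, C i, ENNReal.sum_lt_top.2 fun i _ => hC i, fun i =>
    hmono i _ _ (Finset.single_le_sum (f := C) (fun _ _ => by simp) (Finset.mem_univ i)) (hP i)⟩

theorem exists_real_bound_forall {ι : Type*} [Fintype ι] {P : ι → ℝ → Prop}
    (hmono : ∀ i a b, a ≤ b → P i a → P i b) (h : ∀ i, ∃ C, 0 ≤ C ∧ P i C) :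
    ∃ C, 0 ≤ C ∧ ∀ i, P i C := by
  choose C hC hP using h
  exact ⟨∑ i, C i, Finset.sum_nonneg fun i _ => hC i, fun i =>
    hmono i _ _ (Finset.single_le_sum (f := C) (fun i _ => hC i) (Finset.mem_univ i)) (hP i)⟩

/-- A polynomial evaluated along a vector-valued function. -/
def polyComp (P : MvPolynomial (Fin n) ℝ) (U : (Fin d → ℝ) → (Fin n → ℝ)) : (Fin d → ℝ) → ℂ :=
  fun x => (MvPolynomial.eval (U x) P : ℝ)

theorem polyComp_C (a : ℝ) (U : (Fin d → ℝ) → (Fin n → ℝ)) :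
    polyComp (MvPolynomial.C a) U = fun _ => (a : ℂ) := by
  ext x; simp [polyComp]

theorem polyComp_add (P Q : MvPolynomial (Fin n) ℝ) (U : (Fin d → ℝ) → (Fin n → ℝ)) :
    polyComp (P + Q) U = fun x => polyComp P U x + polyComp Q U x := by
  ext x; simp [polyComp]

theorem polyComp_mul_X (P : MvPolynomial (Fin n) ℝ) (i : Fin n) (U : (Fin d → ℝ) → (Fin n → ℝ)) :
    polyComp (P * MvPolynomial.X i) U = fun x => polyComp P U x * comp U i x := by
  ext x; simp [polyComp, comp]

theorem isWiener_polyComp (P : MvPolynomial (Fin n) ℝ) {U : (Fin d → ℝ) → (Fin n → ℝ)}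
    (hU : ∀ i, IsWiener (comp U i)) : IsWiener (polyComp P U) := by
  induction P using MvPolynomial.induction_on with
  | C a => rw [polyComp_C]; exact IsWiener.const _
  | add P Q hP hQ => rw [polyComp_add]; exact hP.add hQ
  | mul_X P i hP => rw [polyComp_mul_X]; exact hP.mul (hU i)

theorem exists_wn_polyComp_le (P : MvPolynomial (Fin n) ℝ) {R : ℝ≥0∞} (hR : R < ⊤) :
    ∃ C < ⊤, ∀ U : (Fin d → ℝ) → (Fin n → ℝ), (∀ i, IsWiener (comp U i)) →
      (∀ i, wn (comp U i) ≤ R) → wn (polyComp P U) ≤ C := by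
  induction P using MvPolynomial.induction_on with
  | C a => exact ⟨‖(a : ℂ)‖ₑ, enorm_lt_top, fun U _ _ => by rw [polyComp_C, wn_const]⟩
  | add P Q hP hQ =>
    obtain ⟨C, hC, h⟩ := hP
    obtain ⟨D, hD, h'⟩ := hQ
    refine ⟨C + D, ENNReal.add_lt_top.2 ⟨hC, hD⟩, fun U hU hUR => ?_⟩
    rw [polyComp_add]
    exact (wn_add_le (isWiener_polyComp P hU).continuous (isWiener_polyComp Q hU).continuous).trans
      (add_le_add (h U hU hUR) (h' U hU hUR))
  | mul_X P i hP =>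
    obtain ⟨C, hC, h⟩ := hP
    refine ⟨C * R, ENNReal.mul_lt_top hC hR, fun U hU hUR => ?_⟩
    rw [polyComp_mul_X]
    exact (wn_mul_le (isWiener_polyComp P hU) (hU i).continuous).trans
      (mul_le_mul' (h U hU hUR) (hUR i))

/-- A polynomial of `U` is controlled in `H^s` linearly by `U`, as long as `U` is bounded in the
Wiener algebra; the homogeneous norm does not see the constant term. -/
theorem exists_hn_polyComp_le (P : MvPolynomial (Fin n) ℝ) {R : ℝ≥0∞} (hR : R < ⊤) {s : ℝ}
    (hs : 0 < s) :
    ∃ C < ⊤, ∀ U : (Fin d → ℝ) → (Fin n → ℝ), (∀ i, IsWiener (comp U i)) →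
      (∀ i, wn (comp U i) ≤ R) → hn s (polyComp P U) ≤ C * ∑ i, hn s (comp U i) := by
  induction P using MvPolynomial.induction_on with
  | C a => exact ⟨0, by simp, fun U _ _ => by rw [polyComp_C, hn_const hs]; simp⟩
  | add P Q hP hQ =>
    obtain ⟨C, hC, h⟩ := hP
    obtain ⟨D, hD, h'⟩ := hQ
    refine ⟨2 * (C + D), ENNReal.mul_lt_top (by simp) (ENNReal.add_lt_top.2 ⟨hC, hD⟩),
      fun U hU hUR => ?_⟩
    rw [polyComp_add]
    refine (hn_add_le s (isWiener_polyComp P hU).continuous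
      (isWiener_polyComp Q hU).continuous).trans ?_
    calc _ ≤ 2 * (C * ∑ i, hn s (comp U i) + D * ∑ i, hn s (comp U i)) := by
          gcongr
          · exact h U hU hUR
          · exact h' U hU hUR
      _ = _ := by ring
  | mul_X P i hP =>
    obtain ⟨C, hC, h⟩ := hP
    obtain ⟨D, hD, h'⟩ := exists_wn_polyComp_le (d := d) P hR
    have h2 : (2 : ℝ≥0∞) ^ s < ⊤ := ENNReal.rpow_lt_top_of_nonneg hs.le (by simp)
    refine ⟨2 * (2 ^ s) ^ 2 * (D ^ 2 + R ^ 2 * C), ENNReal.mul_lt_top (ENNReal.mul_lt_top (by simp)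
      (ENNReal.pow_lt_top h2)) (ENNReal.add_lt_top.2 ⟨ENNReal.pow_lt_top hD,
        ENNReal.mul_lt_top (ENNReal.pow_lt_top hR) hC⟩), fun U hU hUR => ?_⟩
    rw [polyComp_mul_X]
    refine (hn_mul_le hs.le (isWiener_polyComp P hU) (hU i).continuous).trans ?_
    rw [mul_assoc (2 * ((2 : ℝ≥0∞) ^ s) ^ 2)]
    refine mul_le_mul_right ?_ _
    rw [add_mul, mul_assoc]
    gcongr
    · exact h' U hU hUR
    · exact Finset.single_le_sum (f := fun i => hn s (comp U i)) (fun _ _ => by simp)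
        (Finset.mem_univ i)
    · exact hUR i
    · exact h U hU hUR

theorem exists_abs_eval_le (P : MvPolynomial (Fin n) ℝ) (R : ℝ) :
    ∃ C, 0 ≤ C ∧ ∀ v : Fin n → ℝ, ‖v‖ ≤ R → |MvPolynomial.eval v P| ≤ C := by
  obtain ⟨C, hC⟩ := (isCompact_closedBall (0 : Fin n → ℝ) R).exists_bound_of_continuousOn
    (MvPolynomial.continuous_eval P).continuousOn
  exact ⟨max C 0, le_max_right _ _, fun v hv =>
    (hC v (mem_closedBall_zero_iff.2 hv)).trans (le_max_left _ _)⟩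

theorem hasDerivAt_eval (P : MvPolynomial (Fin n) ℝ) {u : ℝ → Fin n → ℝ} {u' : Fin n → ℝ} {t : ℝ}
    (hu : ∀ i, HasDerivAt (fun τ => u τ i) (u' i) t) :
    HasDerivAt (fun τ => MvPolynomial.eval (u τ) P)
      (∑ i, MvPolynomial.eval (u t) (MvPolynomial.pderiv i P) * u' i) t := by
  induction P using MvPolynomial.induction_on with
  | C a => simpa using hasDerivAt_const t a
  | add P Q hP hQ =>
    simpa [add_mul, Finset.sum_add_distrib] using hP.fun_add hQ
  | mul_X P i hP =>
    have h := hP.fun_mul (hu i)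
    simp only [map_mul, MvPolynomial.eval_X]
    convert! h using 1
    simp only [MvPolynomial.pderiv_mul, MvPolynomial.pderiv_X, map_add, map_mul,
      MvPolynomial.eval_X, add_mul, Finset.sum_add_distrib]
    congr 1
    · rw [Finset.sum_mul]
      exact Finset.sum_congr rfl fun j _ => by ring
    · rw [Finset.sum_eq_single i]
      · simp
      · intro j _ hj
        simp [Ne.symm hj]
      · simp

/-! ### Trigonometric vector fields and multipliers -/

namespace IsTrig

variable {N : ℕ} {f g : (Fin d → ℝ) → ℂ}

theorem const_mul (c : ℂ) (hf : IsTrig N f) : IsTrig N (fun x => c * f x) :=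
  ⟨(IsTorusFun.const c).mul hf.toIsTorusFun, fun k hk => by
    rw [fc_const_mul, hf.fc_eq_zero k hk, mul_zero]⟩

theorem sum {ι : Type*} {s : Finset ι} {F : ι → (Fin d → ℝ) → ℂ} (h : ∀ i ∈ s, IsTrig N (F i)) :
    IsTrig N (fun x => ∑ i ∈ s, F i x) :=
  ⟨IsTorusFun.sum fun i hi => (h i hi).toIsTorusFun, fun k hk => by
    rw [fc_sum fun i hi => (h i hi).continuous]
    exact Finset.sum_eq_zero fun i hi => (h i hi).fc_eq_zero k hk⟩

theorem ext_fc (hf : IsTrig N f) (hg : IsTrig N g) (h : ∀ k, fc f k = fc g k) : f = g := by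
  ext x
  rw [hf.eq_sum, hg.eq_sum]
  exact Finset.sum_congr rfl fun k _ => by rw [h]

end IsTrig

theorem contDiff_of_isTrig {m : WithTop ℕ∞} {N : ℕ} {f : (Fin d → ℝ) → (Fin n → ℝ)}
    (hf : ∀ i, IsTrig N (comp f i)) : ContDiff ℝ m f := by
  rw [eq_realTrig hf]
  exact contDiff_realTrig N _

/-! ### The energy form -/

/-- The entries of a matrix-valued function, as complex-valued functions. -/
def entries (S : (Fin d → ℝ) → Matrix (Fin n) (Fin n) ℝ) (a b : Fin n) : (Fin d → ℝ) → ℂ :=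
  fun x => (S x a b : ℂ)

/-- The linear operator `z ↦ ∑ (A_j ∂_j z + S_N (B_j ∂_j z))` with constant matrices `A_j` and
variable matrices `B_j`. -/
def linOp (A : Fin d → Matrix (Fin n) (Fin n) ℝ)
    (B : Fin d → (Fin d → ℝ) → Matrix (Fin n) (Fin n) ℝ) (σ : (Fin d → ℝ) → ℝ) (N : ℕ)
    (z : (Fin d → ℝ) → (Fin n → ℝ)) : (Fin d → ℝ) → (Fin n → ℝ) :=
  fun x => ∑ j, ((A j).mulVec (partialDeriv j z x) +
    smoothFilter σ N (fun y => (B j y).mulVec (partialDeriv j z y)) x)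

/-- The bilinear form `∫ S_a z · y + ∫ S_b T z · T y`, where `T` has symbol `m`. -/
def energyForm (Sa Sb : (Fin d → ℝ) → Matrix (Fin n) (Fin n) ℝ) (m : (Fin d → ℤ) → ℝ)
    (z y : (Fin d → ℝ) → (Fin n → ℝ)) : ℝ :=
  ∑ a, ∑ b, (mean (fun x => Sa x a b * z x a * y x b) +
    mean (fun x => Sb x a b * fourierMultiplier m z x a * fourierMultiplier m y x b))

theorem sum_l2n_eq {N : ℕ} {z : (Fin d → ℝ) → (Fin n → ℝ)} (hz : ∀ i, IsTrig N (comp z i)) :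
    ∑ i, l2n (comp z i) = ENNReal.ofReal (∑ i, mean fun x => z x i ^ 2) := by
  rw [ENNReal.ofReal_sum_of_nonneg fun i _ => mean_nonneg fun x => sq_nonneg _]
  exact Finset.sum_congr rfl fun i _ => (ofReal_mean_sq (g := fun x => z x i) (hz i).isWiener).symm

theorem entries_mulVec_eq (B : (Fin d → ℝ) → Matrix (Fin n) (Fin n) ℝ)
    (f : (Fin d → ℝ) → (Fin n → ℝ)) (b : Fin n) :
    comp (fun y => (B y).mulVec (f y)) b = fun x => ∑ c, entries B b c x * comp f c x := by
  ext x
  simp [comp, entries, Matrix.mulVec, dotProduct]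

theorem mmul_entries (S B : (Fin d → ℝ) → Matrix (Fin n) (Fin n) ℝ) (a c : Fin n) :
    mmul (entries S) (entries B) a c = fun x => (((S x * B x) a c : ℝ) : ℂ) := by
  ext x
  simp [mmul, entries, Matrix.mul_apply]

/-- The energy estimate at a fixed time: under the symmetry conditions, the operator `linOp` is
skew-symmetric for the energy form up to bounded terms, uniformly in `N`. -/
theorem exists_abs_energyForm_linOp_le {σ : (Fin d → ℝ) → ℝ} (hσ : IsFilterProfile σ) {R : ℝ≥0∞}
    (hR : R < ⊤) : ∃ K : ℝ, 0 ≤ K ∧ ∀ N : ℕ, 1 ≤ N →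
      ∀ (Sa Sb : (Fin d → ℝ) → Matrix (Fin n) (Fin n) ℝ) (A : Fin d → Matrix (Fin n) (Fin n) ℝ)
        (B : Fin d → (Fin d → ℝ) → Matrix (Fin n) (Fin n) ℝ),
      (∀ a b, IsWiener (entries Sa a b) ∧ wn (entries Sa a b) ≤ R) →
      (∀ a b, IsWiener (entries Sb a b) ∧ wn (entries Sb a b) ≤ R) →
      (∀ j a b, ‖((A j a b : ℝ) : ℂ)‖ₑ ≤ R) →
      (∀ j a b, IsWiener (entries (B j) a b) ∧ wn (entries (B j) a b) ≤ R) →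
      (∀ j x, (Sa x * A j).IsSymm) → (∀ j x, (Sa x * B j x + Sb x * A j).IsSymm) →
      (∀ j x, (Sb x * B j x).IsSymm) →
      ∀ z : (Fin d → ℝ) → (Fin n → ℝ), (∀ i, IsTrig N (comp z i)) →
        |energyForm Sa Sb (sqrtSymbol σ N) z (linOp A B σ N z)| ≤ K * ∑ i, mean fun x => z x i ^ 2 := by
  obtain ⟨C, hC, hbound⟩ := exists_sqrtSymbol_bound hσ
  set K₀ : ℝ≥0∞ := d * (2 * n ^ 3 * ENNReal.ofReal (4 * C + 4) * (2 * R ^ 2) +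
        3 * (n ^ 2 * (1 + (2 * (n * R ^ 2)) ^ 2)))
  have hK₀ : K₀ ≠ ⊤ := by
    have : R ≠ ⊤ := hR.ne
    finiteness
  refine ⟨K₀.toReal, ENNReal.toReal_nonneg, fun N hN Sa Sb A B hSa hSb hA hB hs1 hs2 hs3 z hz => ?_⟩
  set m := sqrtSymbol σ N
  have hm := isSymbol_sqrtSymbol hσ hN
  set Tz := fourierMultiplier m z
  set TTz := fourierMultiplier m Tz
  have hTz : ∀ i, IsTrig N (comp Tz i) := isTrig_multiplier hm z
  have hTTz : ∀ i, IsTrig N (comp TTz i) := isTrig_multiplier hm Tz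
  have hpd : ∀ {f : (Fin d → ℝ) → (Fin n → ℝ)}, (∀ i, IsTrig N (comp f i)) → ∀ j i,
      IsTrig N (comp (partialDeriv j f) i) := fun hf => isTrig_partialDeriv (contDiff_of_isTrig hf) hf
  have hfpd : ∀ {f : (Fin d → ℝ) → (Fin n → ℝ)}, (∀ i, IsTrig N (comp f i)) → ∀ j i k,
      fc (comp (partialDeriv j f) i) k = Complex.I * (k j : ℝ) * fc (comp f i) k :=
    fun {f} hf j i k => fc_partialDeriv
      ((contDiff_of_isTrig (m := 1) hf).differentiable one_ne_zero) (hf i).isWiener j k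
  -- The terms `S_N (B_j ∂_j z)`.
  set X : Fin d → (Fin d → ℝ) → (Fin n → ℝ) := fun j =>
    smoothFilter σ N fun y => (B j y).mulVec (partialDeriv j z y)
  have hXt : ∀ j b, IsTrig N (comp (X j) b) := fun j b =>
    isTrig_multiplier (isSymbol_filterSymbol hσ hN) _ b
  have hXfc : ∀ j b k, fc (comp (X j) b) k = (m k ^ 2 : ℝ) *
      ∑ c, fc (fun x => entries (B j) b c x * comp (partialDeriv j z) c x) k := by
    intro j b k
    rw [show comp (X j) b = comp (fourierMultiplier (filterSymbol σ N)
      fun y => (B j y).mulVec (partialDeriv j z y)) b from rfl,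
      fc_multiplier (isSymbol_filterSymbol hσ hN), entries_mulVec_eq, fc_sum, sqrtSymbol_sq hσ]
    exact fun c _ => (hB j b c).1.continuous.fun_mul (hpd hz j c).continuous
  set Y := linOp A B σ N z
  have hYcomp : ∀ b, comp Y b = fun x => ∑ j, ((∑ c, (A j b c : ℂ) * comp (partialDeriv j z) c x) +
      comp (X j) b x) := by
    intro b
    ext x
    simp [comp, Y, linOp, Matrix.mulVec, dotProduct, X, Finset.sum_apply]
  -- `T` commutes with the constant matrices `A_j` and with derivatives.
  have hTYcomp : ∀ b, comp (fourierMultiplier m Y) b = fun x => ∑ j,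
      ((∑ c, (A j b c : ℂ) * comp (partialDeriv j Tz) c x) +
        comp (fourierMultiplier m (X j)) b x) := by
    intro b
    refine (isTrig_multiplier hm Y b).ext_fc (IsTrig.sum fun j _ => (IsTrig.sum fun c _ =>
      (hpd hTz j c).const_mul _).add (isTrig_multiplier hm _ b)) fun k => ?_
    have hc1 : ∀ j, Continuous fun x => ∑ c, (A j b c : ℂ) * comp (partialDeriv j z) c x :=
      fun j => continuous_finsetSum _ fun c _ => continuous_const.fun_mul (hpd hz j c).continuous
    have hc2 : ∀ j, Continuous fun x => ∑ c, (A j b c : ℂ) * comp (partialDeriv j Tz) c x :=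
      fun j => continuous_finsetSum _ fun c _ => continuous_const.fun_mul (hpd hTz j c).continuous
    rw [fc_multiplier hm, hYcomp, fc_sum fun j _ => (hc1 j).fun_add (hXt j b).continuous,
      fc_sum fun j _ => (hc2 j).fun_add (isTrig_multiplier hm _ b).continuous, Finset.mul_sum]
    refine Finset.sum_congr rfl fun j _ => ?_
    rw [fc_add (hc1 j) (hXt j b).continuous,
      fc_add (hc2 j) (isTrig_multiplier hm _ b).continuous, fc_multiplier hm, mul_add,
      fc_sum fun c _ => (IsTrig.const_mul _ (hpd hz j c)).continuous,
      fc_sum fun c _ => (IsTrig.const_mul _ (hpd hTz j c)).continuous, Finset.mul_sum]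
    congr 1
    refine Finset.sum_congr rfl fun c _ => ?_
    rw [fc_const_mul, fc_const_mul, hfpd hz, hfpd hTz, fc_multiplier hm]
    ring
  -- The energy form as a sum over the directions of space.
  have key : ((energyForm Sa Sb m z Y : ℝ) : ℂ) = ∑ j, ∑ a, ∑ b,
      ((∑ c, fc (fun x => (entries Sa a b x * comp z a x) *
          ((A j b c : ℂ) * comp (partialDeriv j z) c x)) 0) +
        fc (fun x => (entries Sa a b x * comp z a x) * comp (X j) b x) 0 +
        (∑ c, fc (fun x => (entries Sb a b x * comp Tz a x) *
          ((A j b c : ℂ) * comp (partialDeriv j Tz) c x)) 0) +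
        fc (fun x => (entries Sb a b x * comp Tz a x) * comp (fourierMultiplier m (X j)) b x) 0) := by
    rw [Finset.sum_comm, energyForm]
    push_cast
    refine Finset.sum_congr rfl fun a _ => ?_
    rw [Finset.sum_comm]
    refine Finset.sum_congr rfl fun b _ => ?_
    rw [← fc_zero_eq_mean, ← fc_zero_eq_mean]
    have hcSa := (hSa a b).1.continuous
    have hcSb := (hSb a b).1.continuous
    have hcz := (hz a).continuous
    have hcTz := (hTz a).continuous
    have e1 : (fun x => ((Sa x a b * z x a * Y x b : ℝ) : ℂ)) = fun x => ∑ j,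
        ((∑ c, (entries Sa a b x * comp z a x) * ((A j b c : ℂ) * comp (partialDeriv j z) c x)) +
          (entries Sa a b x * comp z a x) * comp (X j) b x) := by
      ext x
      have := congrFun (hYcomp b) x
      rw [Complex.ofReal_mul, show ((Y x b : ℝ) : ℂ) = comp Y b x from rfl, this]
      simp_rw [← Finset.mul_sum, ← mul_add]
      rw [← Finset.mul_sum]
      simp [entries, comp]
    have e2 : (fun x => ((Sb x a b * Tz x a * fourierMultiplier m Y x b : ℝ) : ℂ)) =
        fun x => ∑ j, ((∑ c, (entries Sb a b x * comp Tz a x) *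
          ((A j b c : ℂ) * comp (partialDeriv j Tz) c x)) +
          (entries Sb a b x * comp Tz a x) * comp (fourierMultiplier m (X j)) b x) := by
      ext x
      have := congrFun (hTYcomp b) x
      rw [Complex.ofReal_mul, show ((fourierMultiplier m Y x b : ℝ) : ℂ) =
        comp (fourierMultiplier m Y) b x from rfl, this]
      simp_rw [← Finset.mul_sum, ← mul_add]
      rw [← Finset.mul_sum]
      simp [entries, comp]
    have hc1 : ∀ j, Continuous fun x => ∑ c, (entries Sa a b x * comp z a x) *
        ((A j b c : ℂ) * comp (partialDeriv j z) c x) := fun j =>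
      continuous_finsetSum _ fun c _ =>
        (hcSa.fun_mul hcz).fun_mul (continuous_const.fun_mul (hpd hz j c).continuous)
    have hc2 : ∀ j, Continuous fun x => ∑ c, (entries Sb a b x * comp Tz a x) *
        ((A j b c : ℂ) * comp (partialDeriv j Tz) c x) := fun j =>
      continuous_finsetSum _ fun c _ =>
        (hcSb.fun_mul hcTz).fun_mul (continuous_const.fun_mul (hpd hTz j c).continuous)
    have hc3 : ∀ j, Continuous fun x => (entries Sa a b x * comp z a x) * comp (X j) b x :=
      fun j => (hcSa.fun_mul hcz).fun_mul (hXt j b).continuous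
    have hc4 : ∀ j, Continuous fun x => (entries Sb a b x * comp Tz a x) *
        comp (fourierMultiplier m (X j)) b x :=
      fun j => (hcSb.fun_mul hcTz).fun_mul (isTrig_multiplier hm _ b).continuous
    rw [e1, e2, fc_sum fun j _ => (hc1 j).fun_add (hc3 j), fc_sum fun j _ => (hc2 j).fun_add (hc4 j),
      ← Finset.sum_add_distrib]
    refine Finset.sum_congr rfl fun j _ => ?_
    rw [fc_add (hc1 j) (hc3 j), fc_add (hc2 j) (hc4 j), fc_sum fun c _ =>
      (hcSa.fun_mul hcz).fun_mul (IsTrig.const_mul _ (hpd hz j c)).continuous, fc_sum fun c _ =>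
      (hcSb.fun_mul hcTz).fun_mul (IsTrig.const_mul _ (hpd hTz j c)).continuous]
    ring
  have hfinal : ‖((energyForm Sa Sb m z Y : ℝ) : ℂ)‖ₑ ≤ K₀ * ∑ i, l2n (comp z i) := by
    rw [key]
    refine (enorm_sum_le _ _).trans ?_
    calc _ ≤ ∑ _j : Fin d, (2 * n ^ 3 * ENNReal.ofReal (4 * C + 4) * (2 * R ^ 2) +
        3 * (n ^ 2 * (1 + (2 * (n * R ^ 2)) ^ 2))) * ∑ i, l2n (comp z i) := by
          refine Finset.sum_le_sum fun j _ => ?_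
          refine enorm_energy_direction_le (A := fun b c _ => (A j b c : ℂ))
            (B := entries (B j)) (TTz := comp TTz) (dTTz := comp (partialDeriv j TTz))
            hC (sqrtSymbol_mem_Icc hσ N) hm.even (hbound N hN)
            (fun a b => (hSa a b).1) (fun a b => (hSb a b).1) (fun a b => IsWiener.const _)
            (fun a b => (hB j a b).1) (fun a b => (hSa a b).2) (fun a b => (hSb a b).2)
            (fun a b => by rw [wn_const]; exact hA j a b) (fun a b => (hB j a b).2)
            ?_ ?_ ?_ hz hTz hTTz (hpd hz j) (hpd hTz j) (hpd hTTz j)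
            (fun a k => fc_multiplier hm _ _ _) (fun a k => fc_multiplier hm _ _ _)
            (hfpd hz j) (hfpd hTz j) (hfpd hTTz j) (fun b => (hXt j b).continuous)
            (fun b => (isTrig_multiplier hm _ b).continuous) (hXfc j) ?_
          · intro a c
            have h1 := mmul_entries Sa (fun _ => A j) a c
            have h2 := mmul_entries Sa (fun _ => A j) c a
            refine h1.trans (Eq.trans ?_ h2.symm)
            ext x
            rw [(hs1 j x).apply]
          · intro a c x
            have h1 := congrFun (mmul_entries Sa (B j) a c) x
            have h2 := congrFun (mmul_entries Sa (B j) c a) x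
            have h3 := congrFun (mmul_entries Sb (fun _ => A j) a c) x
            have h4 := congrFun (mmul_entries Sb (fun _ => A j) c a) x
            have h5 := (hs2 j x).apply a c
            simp only [Matrix.add_apply] at h5
            refine (congrArg₂ (· + ·) h1 h3).trans (Eq.trans ?_ (congrArg₂ (· + ·) h2 h4).symm)
            simp only [← Complex.ofReal_add, h5]
          · intro a c
            rw [mmul_entries, mmul_entries]
            ext x
            rw [(hs3 j x).apply]
          · intro b k
            rw [fc_multiplier hm, hXfc]
            push_cast
            ring
      _ = _ := by simp [K₀, mul_assoc]
  rw [sum_l2n_eq hz, ← ofReal_norm, Complex.norm_real, Real.norm_eq_abs] at hfinal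
  have hE : 0 ≤ ∑ i, mean fun x => z x i ^ 2 :=
    Finset.sum_nonneg fun i _ => mean_nonneg fun x => sq_nonneg _
  have := ENNReal.toReal_mono (ENNReal.mul_ne_top hK₀ ENNReal.ofReal_ne_top) hfinal
  rwa [ENNReal.toReal_ofReal (abs_nonneg _), ENNReal.toReal_mul, ENNReal.toReal_ofReal hE] at this

/-! ### The commutator of the low-pass filter with multiplication -/

theorem l2n_mul_le {f g : (Fin d → ℝ) → ℂ} (hf : IsWiener f) (hg : Continuous g) :
    l2n (fun x => f x * g x) ≤ (∑' k, ‖fc f k‖ₑ) ^ 2 * l2n g := by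
  refine (ENNReal.tsum_le_tsum fun k => ?_).trans (tsum_conv_sq_le (fun k => ‖fc f k‖ₑ)
    fun k => ‖fc g k‖ₑ)
  gcongr
  rw [conv_comm]
  exact hf.enorm_fc_mul_le hg k

theorem l2n_add_le {f g : (Fin d → ℝ) → ℂ} (hf : Continuous f) (hg : Continuous g) :
    l2n (fun x => f x + g x) ≤ 2 * (l2n f + l2n g) := by
  unfold l2n
  rw [← ENNReal.tsum_add, ← ENNReal.tsum_mul_left]
  refine ENNReal.tsum_le_tsum fun k => ?_
  rw [fc_add hf hg]
  exact (pow_le_pow_left₀ (by simp) (enorm_add_le _ _) 2).trans (ENNReal_add_sq_le _ _)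

/-- Polynomials are Lipschitz in `L²` on bounded sets of the Wiener algebra. -/
theorem exists_l2n_polyComp_sub_le (P : MvPolynomial (Fin n) ℝ) {R : ℝ≥0∞} (hR : R < ⊤) :
    ∃ C < ⊤, ∀ U V : (Fin d → ℝ) → (Fin n → ℝ), (∀ i, IsWiener (comp U i)) →
      (∀ i, wn (comp U i) ≤ R) → (∀ i, IsWiener (comp V i)) → (∀ i, wn (comp V i) ≤ R) →
      l2n (fun x => polyComp P V x - polyComp P U x) ≤
        C * ∑ i, l2n (fun x => comp V i x - comp U i x) := by
  induction P using MvPolynomial.induction_on with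
  | C a =>
    refine ⟨0, by simp, fun U V _ _ _ _ => ?_⟩
    rw [polyComp_C, polyComp_C]
    simp [l2n, fc_zero]
  | add P Q hP hQ =>
    obtain ⟨C, hC, h⟩ := hP
    obtain ⟨D, hD, h'⟩ := hQ
    refine ⟨2 * (C + D), by finiteness, fun U V hU hUR hV hVR => ?_⟩
    have e : (fun x => polyComp (P + Q) V x - polyComp (P + Q) U x) = fun x =>
        (polyComp P V x - polyComp P U x) + (polyComp Q V x - polyComp Q U x) := by
      ext x; rw [polyComp_add, polyComp_add]; ring
    rw [e]
    refine (l2n_add_le ((isWiener_polyComp P hV).sub (isWiener_polyComp P hU)).continuous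
      ((isWiener_polyComp Q hV).sub (isWiener_polyComp Q hU)).continuous).trans ?_
    rw [mul_assoc, add_mul]
    gcongr
    · exact h U V hU hUR hV hVR
    · exact h' U V hU hUR hV hVR
  | mul_X P i hP =>
    obtain ⟨C, hC, h⟩ := hP
    obtain ⟨D, hD, h'⟩ := exists_wn_polyComp_le (d := d) P hR
    refine ⟨2 * (R ^ 2 * C + D ^ 2), by finiteness, fun U V hU hUR hV hVR => ?_⟩
    have e : (fun x => polyComp (P * MvPolynomial.X i) V x - polyComp (P * MvPolynomial.X i) U x) =
        fun x => comp V i x * (polyComp P V x - polyComp P U x) +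
          polyComp P U x * (comp V i x - comp U i x) := by
      ext x; rw [polyComp_mul_X, polyComp_mul_X]; ring
    have hP := (isWiener_polyComp P hV).sub (isWiener_polyComp P hU)
    have hi := (hV i).sub (hU i)
    rw [e]
    refine (l2n_add_le ((hV i).mul hP).continuous
      ((isWiener_polyComp P hU).mul hi).continuous).trans ?_
    rw [mul_assoc, add_mul, mul_assoc]
    gcongr
    · refine (l2n_mul_le (hV i) hP.continuous).trans ?_
      gcongr
      · exact (tsum_enorm_fc_le _).trans (hVR i)
      · exact h U V hU hUR hV hVR
    · refine (l2n_mul_le (isWiener_polyComp P hU) hi.continuous).trans ?_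
      gcongr
      · exact (tsum_enorm_fc_le _).trans (h' U hU hUR)
      · exact Finset.single_le_sum (f := fun i => l2n fun x => comp V i x - comp U i x)
          (fun _ _ => by simp) (Finset.mem_univ i)

theorem one_le_ofReal_rpow_mul {s ρ : ℝ} (hs : 0 ≤ s) (hρ : 0 < ρ) {k : Fin d → ℤ}
    (hk : ρ ≤ ‖k‖) : 1 ≤ ENNReal.ofReal (ρ ^ (-s)) * ‖k‖ₑ ^ s := by
  rw [← ofReal_norm, ENNReal.ofReal_rpow_of_nonneg (norm_nonneg _) hs,
    ← ENNReal.ofReal_mul (by positivity), ← ENNReal.ofReal_one]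
  refine ENNReal.ofReal_le_ofReal ?_
  rw [Real.rpow_neg hρ.le]
  have := Real.rpow_le_rpow hρ.le hk hs
  have h0 : 0 < ρ ^ s := Real.rpow_pos_of_pos hρ s
  rw [inv_mul_eq_div, one_le_div h0]
  exact this

/-- The low-pass filter almost commutes with multiplication by `g`: the commutator applied to
`∂_j u` only involves frequencies at least `N / 8` of `g` or of `u`, so that it is `O(N^{-s})` in
`L²`.  Here `du = ∂_j u` and `dw` is the filtered `du`. -/
theorem exists_tsum_commutator_le {σ : (Fin d → ℝ) → ℝ} (hσ : IsFilterProfile σ) {s : ℝ}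
    (hs : 0 ≤ s) : ∃ C : ℝ≥0∞, C < ⊤ ∧ ∀ N : ℕ, 1 ≤ N → ∀ (g u du dw : (Fin d → ℝ) → ℂ) (j : Fin d),
      IsWiener g → Continuous du → Continuous dw →
      (∀ k, fc du k = Complex.I * (k j : ℝ) * fc u k) →
      (∀ k, fc dw k = lowSymbol σ N k * fc du k) →
      ∑' k, ‖fc (fun x => g x * dw x) k - lowSymbol σ N k * fc (fun x => g x * du x) k‖ₑ ^ 2 ≤
        C * ENNReal.ofReal (((N : ℝ) / 8) ^ (-s)) ^ 2 *
          (wn g ^ 2 * hn s u + wn u ^ 2 * hn s g) := by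
  obtain ⟨C, hC, hbound⟩ := exists_lowSymbol_bound hσ
  refine ⟨2 * (ENNReal.ofReal C ^ 2 + 1), by finiteness,
    fun N hN g u du dw j hg hdu hdw hduu hdww => ?_⟩
  set θ := lowSymbol σ N
  set ρ : ℝ := (N : ℝ) / 8
  have hρ : 0 < ρ := by positivity
  set c := ENNReal.ofReal (ρ ^ (-s))
  -- The kernel `θ l - θ k` of the commutator, according to which of `l` and `k - l` is large.
  have hθ : ∀ k l : Fin d → ℤ, ‖(θ l : ℂ) - θ k‖ₑ * ‖l‖ₑ ≤
      ENNReal.ofReal C * ‖k - l‖ₑ * (c * ‖l‖ₑ ^ s) + (c * ‖k - l‖ₑ ^ s) * ‖l‖ₑ := by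
    intro k l
    have e : ‖(θ l : ℂ) - θ k‖ₑ = ENNReal.ofReal |θ k - θ l| := by
      rw [← ofReal_norm, ← Complex.ofReal_sub, Complex.norm_real, Real.norm_eq_abs, abs_sub_comm]
    by_cases h1 : ρ ≤ ‖l‖
    · refine le_trans ?_ le_self_add
      calc _ ≤ ENNReal.ofReal C * ‖k - l‖ₑ * 1 := by
            rw [e, ← ofReal_norm, ← ofReal_norm, ← ENNReal.ofReal_mul (abs_nonneg _), mul_one,
              ← ENNReal.ofReal_mul hC, mul_comm]
            exact ENNReal.ofReal_le_ofReal (hbound N hN k l)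
        _ ≤ _ := by gcongr; exact one_le_ofReal_rpow_mul hs hρ h1
    by_cases h2 : ρ ≤ ‖k - l‖
    · refine le_trans ?_ le_add_self
      gcongr
      refine le_trans ?_ (one_le_ofReal_rpow_mul hs hρ h2)
      rw [e, ← ENNReal.ofReal_one]
      refine ENNReal.ofReal_le_ofReal ?_
      have := lowSymbol_mem_Icc hσ N k
      have := lowSymbol_mem_Icc hσ N l
      rw [abs_le]
      constructor <;> linarith [(lowSymbol_mem_Icc hσ N k).1, (lowSymbol_mem_Icc hσ N k).2,
        (lowSymbol_mem_Icc hσ N l).1, (lowSymbol_mem_Icc hσ N l).2]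
    · -- both frequencies are below `N / 8`, where the symbol is constant
      push Not at h1 h2
      have hρ8 : ρ = N / 8 := rfl
      clear_value ρ
      have h3 : ‖k‖ ≤ ‖k - l‖ + ‖l‖ := by simpa using norm_add_le (k - l) l
      have h4 : θ l = 1 := lowSymbol_eq_one hσ hN (by linarith [norm_nonneg l])
      have h5 : θ k = 1 := lowSymbol_eq_one hσ hN (by linarith)
      simp [h4, h5]
  have hk : ∀ k, ‖fc (fun x => g x * dw x) k - θ k * fc (fun x => g x * du x) k‖ₑ ≤
      c * (ENNReal.ofReal C * conv (fun p => ‖p‖ₑ * ‖fc g p‖ₑ) (fun l => ‖l‖ₑ ^ s * ‖fc u l‖ₑ) k +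
        conv (fun p => ‖p‖ₑ ^ s * ‖fc g p‖ₑ) (fun l => ‖l‖ₑ * ‖fc u l‖ₑ) k) := by
    intro k
    rw [← ((hg.fc_mul hdw k).sub ((hg.fc_mul hdu k).mul_left (θ k : ℂ))).tsum_eq]
    refine (enorm_tsum_le _).trans ?_
    rw [conv_comm, conv_comm (fun p => ‖p‖ₑ ^ s * ‖fc g p‖ₑ)]
    unfold conv
    rw [← ENNReal.tsum_mul_left, ← ENNReal.tsum_add, ← ENNReal.tsum_mul_left]
    refine ENNReal.tsum_le_tsum fun p => ?_
    have e : fc g p * fc dw (k - p) - θ k * (fc g p * fc du (k - p)) =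
        fc g p * (((θ (k - p) : ℂ) - θ k) * fc du (k - p)) := by rw [hdww]; ring
    rw [e, enorm_mul, enorm_mul]
    have h1 := hθ k (k - p)
    rw [sub_sub_cancel] at h1
    calc _ ≤ ‖fc g p‖ₑ * (‖(θ (k - p) : ℂ) - θ k‖ₑ * (‖k - p‖ₑ * ‖fc u (k - p)‖ₑ)) := by
          gcongr; exact enorm_fc_pd hduu _
      _ = ‖fc g p‖ₑ * ‖fc u (k - p)‖ₑ * (‖(θ (k - p) : ℂ) - θ k‖ₑ * ‖k - p‖ₑ) := by ring
      _ ≤ ‖fc g p‖ₑ * ‖fc u (k - p)‖ₑ * (ENNReal.ofReal C * ‖p‖ₑ * (c * ‖k - p‖ₑ ^ s) +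
            (c * ‖p‖ₑ ^ s) * ‖k - p‖ₑ) := by gcongr
      _ = _ := by ring
  have h1 := tsum_conv_sq_le (fun p => ‖p‖ₑ * ‖fc g p‖ₑ) fun l => ‖l‖ₑ ^ s * ‖fc u l‖ₑ
  have h2 := tsum_conv_sq_le (fun l => ‖l‖ₑ * ‖fc u l‖ₑ) fun p => ‖p‖ₑ ^ s * ‖fc g p‖ₑ
  simp_rw [conv_comm (fun l => ‖l‖ₑ * ‖fc u l‖ₑ)] at h2
  set X := conv (fun p => ‖p‖ₑ * ‖fc g p‖ₑ) fun l => ‖l‖ₑ ^ s * ‖fc u l‖ₑ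
  set Y := conv (fun p => ‖p‖ₑ ^ s * ‖fc g p‖ₑ) fun l => ‖l‖ₑ * ‖fc u l‖ₑ
  calc _ ≤ ∑' k, 2 * c ^ 2 * (ENNReal.ofReal C ^ 2 * X k ^ 2 + Y k ^ 2) := by
        refine ENNReal.tsum_le_tsum fun k => (pow_le_pow_left₀ (by simp) (hk k) 2).trans ?_
        rw [mul_pow]
        refine (mul_le_mul_right (ENNReal_add_sq_le _ _) _).trans (le_of_eq ?_)
        ring
    _ = 2 * c ^ 2 * (ENNReal.ofReal C ^ 2 * ∑' k, X k ^ 2 + ∑' k, Y k ^ 2) := by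
        rw [ENNReal.tsum_mul_left, ENNReal.tsum_add, ENNReal.tsum_mul_left]
    _ ≤ 2 * c ^ 2 * (ENNReal.ofReal C ^ 2 * (wn g ^ 2 * hn s u) + wn u ^ 2 * hn s g) := by
        gcongr
        · refine h1.trans ?_
          unfold hn
          gcongr
          exact tsum_enorm_mul_fc_le g
        · refine h2.trans ?_
          unfold hn
          gcongr
          exact tsum_enorm_mul_fc_le u
    _ ≤ 2 * c ^ 2 * ((ENNReal.ofReal C ^ 2 + 1) * (wn g ^ 2 * hn s u) +
          (ENNReal.ofReal C ^ 2 + 1) * (wn u ^ 2 * hn s g)) := by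
        refine mul_le_mul_right (add_le_add (mul_le_mul_left le_self_add _) ?_) _
        rw [add_mul, one_mul]
        exact le_add_self
    _ = _ := by ring

/-! ### Consistency of the scheme -/

theorem ENNReal_sum_sq_le {ι : Type*} [Fintype ι] (b : ι → ℝ≥0∞) :
    (∑ i, b i) ^ 2 ≤ Fintype.card ι * ∑ i, b i ^ 2 := by
  have := tsum_mul_sq_le (fun _ : ι => (1 : ℝ≥0∞)) b
  simpa [tsum_fintype] using this

theorem hs2_zero (f : (Fin d → ℝ) → (Fin n → ℝ)) : hs2 0 f = ∑ i, l2n (comp f i) := by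
  simp only [hs2, l2n, Real.rpow_zero, ENNReal.ofReal_one, one_mul]
  rw [Summable.tsum_finsetSum fun _ _ => ENNReal.summable]

theorem ofReal_div_rpow {N : ℕ} (hN : 1 ≤ N) {c : ℝ} (hc : 0 < c) (p : ℝ) :
    ENNReal.ofReal (((N : ℝ) / c) ^ p) = ENNReal.ofReal (c ^ (-p)) * ENNReal.ofReal ((N : ℝ) ^ p) := by
  have : (0 : ℝ) < N := by exact_mod_cast hN
  rw [← ENNReal.ofReal_mul (by positivity), Real.div_rpow this.le hc.le, Real.rpow_neg hc.le,
    div_eq_inv_mul]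

/-- The high frequencies removed by the low-pass filter are small in weaker norms. -/
theorem hs2_sub_low_le {σ : (Fin d → ℝ) → ℝ} (hσ : IsFilterProfile σ) {N : ℕ} (hN : 1 ≤ N)
    {r s : ℝ} (hrs : r ≤ s) {f : (Fin d → ℝ) → (Fin n → ℝ)} (hf : Continuous f) :
    hs2 r (f - fourierMultiplier (lowSymbol σ N) f) ≤
      ENNReal.ofReal (4 ^ (-(2 * (r - s)))) * ENNReal.ofReal ((N : ℝ) ^ (2 * (r - s))) * hs2 s f := by
  have hm := isSymbol_lowSymbol hσ hN
  have hc : Continuous (fourierMultiplier (lowSymbol σ N) f) :=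
    continuous_of_comp fun i => (isTrig_multiplier hm f i).toIsTorusFun
  have hfc : ∀ k i, fc (comp (f - fourierMultiplier (lowSymbol σ N) f) i) k =
      ((1 - lowSymbol σ N k : ℝ) : ℂ) * fc (comp f i) k := by
    intro k i
    rw [fc_comp_sub hf hc, fc_multiplier hm]
    push_cast
    ring
  rw [← ofReal_div_rpow hN (by norm_num)]
  refine hs2_le_of_fc_eq_zero hrs (by positivity) (fun k i => ?_) fun k i hk => ?_
  · rw [hfc, enorm_mul]
    refine mul_le_of_le_one_left (by simp) ?_
    have := lowSymbol_mem_Icc hσ N k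
    rw [← ofReal_norm, Complex.norm_real, Real.norm_eq_abs, abs_of_nonneg (by linarith [this.2]),
      ← ENNReal.ofReal_one]
    exact ENNReal.ofReal_le_ofReal (by linarith [this.1])
  · rw [hfc, lowSymbol_eq_one hσ hN hk.le]
    simp

theorem entries_evalMat (B : Matrix (Fin n) (Fin n) (MvPolynomial (Fin n) ℝ))
    (U : (Fin d → ℝ) → (Fin n → ℝ)) (a b : Fin n) :
    entries (fun x => evalMat B (U x)) a b = polyComp (B a b) U := by
  ext x
  simp [entries, evalMat, polyComp]

theorem fc_mulVec {B : (Fin d → ℝ) → Matrix (Fin n) (Fin n) ℝ}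
    (hB : ∀ a b, Continuous (entries B a b)) {f : (Fin d → ℝ) → (Fin n → ℝ)}
    (hf : ∀ i, Continuous (comp f i)) (b : Fin n) (k : Fin d → ℤ) :
    fc (comp (fun y => (B y).mulVec (f y)) b) k =
      ∑ c, fc (fun x => entries B b c x * comp f c x) k := by
  rw [entries_mulVec_eq, fc_sum fun c _ => (hB b c).fun_mul (hf c)]

theorem comp_linOp (A : Fin d → Matrix (Fin n) (Fin n) ℝ)
    (B : Fin d → (Fin d → ℝ) → Matrix (Fin n) (Fin n) ℝ) (σ : (Fin d → ℝ) → ℝ) (N : ℕ)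
    (z : (Fin d → ℝ) → (Fin n → ℝ)) (b : Fin n) :
    comp (linOp A B σ N z) b = fun x => ∑ j, ((∑ c, (A j b c : ℂ) * comp (partialDeriv j z) c x) +
      comp (smoothFilter σ N fun y => (B j y).mulVec (partialDeriv j z y)) b x) := by
  ext x
  simp [comp, linOp, Matrix.mulVec, dotProduct, Finset.sum_apply]

theorem isTorusFun_linOp {σ : (Fin d → ℝ) → ℝ} (hσ : IsFilterProfile σ) {N : ℕ} (hN : 1 ≤ N)
    (A : Fin d → Matrix (Fin n) (Fin n) ℝ) (B : Fin d → (Fin d → ℝ) → Matrix (Fin n) (Fin n) ℝ)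
    {z : (Fin d → ℝ) → (Fin n → ℝ)} (hz : ContDiff ℝ 1 z) (hp : IsTorusPeriodic z) (b : Fin n) :
    IsTorusFun (comp (linOp A B σ N z) b) := by
  rw [comp_linOp]
  exact IsTorusFun.sum fun j _ => (IsTorusFun.sum fun c _ => (IsTorusFun.const _).mul
    (isTorusFun_partialDeriv hz hp j c)).add
    (isTrig_multiplier (isSymbol_filterSymbol hσ hN) _ b).toIsTorusFun

theorem fc_linOp {σ : (Fin d → ℝ) → ℝ} (hσ : IsFilterProfile σ) {N : ℕ} (hN : 1 ≤ N)
    (A : Fin d → Matrix (Fin n) (Fin n) ℝ) {B : Fin d → (Fin d → ℝ) → Matrix (Fin n) (Fin n) ℝ}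
    (hB : ∀ j a b, Continuous (entries (B j) a b))
    {z : (Fin d → ℝ) → (Fin n → ℝ)} (hz : ContDiff ℝ 1 z) (hp : IsTorusPeriodic z) (b : Fin n)
    (k : Fin d → ℤ) :
    fc (comp (linOp A B σ N z) b) k = ∑ j, ∑ c, ((A j b c : ℂ) * fc (comp (partialDeriv j z) c) k +
      filterSymbol σ N k * fc (fun x => entries (B j) b c x * comp (partialDeriv j z) c x) k) := by
  have hc : ∀ j c, Continuous (comp (partialDeriv j z) c) :=
    fun j c => (isTorusFun_partialDeriv hz hp j c).continuous
  have hm := isSymbol_filterSymbol hσ hN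
  have h1 : ∀ j, Continuous fun x => ∑ c, (A j b c : ℂ) * comp (partialDeriv j z) c x :=
    fun j => continuous_finsetSum _ fun c _ => continuous_const.fun_mul (hc j c)
  have h2 : ∀ j, Continuous (comp (smoothFilter σ N fun y =>
      (B j y).mulVec (partialDeriv j z y)) b) := fun j => (isTrig_multiplier hm _ b).continuous
  rw [comp_linOp, fc_sum fun j _ => (h1 j).fun_add (h2 j)]
  refine Finset.sum_congr rfl fun j _ => ?_
  rw [fc_add (h1 j) (h2 j),
    fc_sum fun c _ => continuous_const.fun_mul (hc j c), smoothFilter_eq, fc_multiplier hm,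
    fc_mulVec (hB j) (hc j), Finset.mul_sum, ← Finset.sum_add_distrib]
  exact Finset.sum_congr rfl fun c _ => by rw [fc_const_mul]

theorem isTorusFun_hypOp (A : Fin d → Matrix (Fin n) (Fin n) (MvPolynomial (Fin n) ℝ))
    {f : (Fin d → ℝ) → (Fin n → ℝ)} (hf : ContDiff ℝ 1 f) (hp : IsTorusPeriodic f) (b : Fin n) :
    IsTorusFun (comp (hypOp A f) b) := by
  have h : comp (hypOp A f) b = fun x => ∑ j, ∑ c,
      polyComp (A j b c) f x * comp (partialDeriv j f) c x := by
    ext x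
    simp [comp, hypOp, Matrix.mulVec, dotProduct, Finset.sum_apply, polyComp, evalMat]
  have hpoly : ∀ P : MvPolynomial (Fin n) ℝ, IsTorusFun (polyComp P f) := fun P =>
    ⟨Complex.continuous_ofReal.comp ((MvPolynomial.continuous_eval P).comp hf.continuous),
      fun j x => by simp only [polyComp, hp j x]⟩
  rw [h]
  exact IsTorusFun.sum fun j _ => IsTorusFun.sum fun c _ =>
    (hpoly _).mul (isTorusFun_partialDeriv hf hp j c)

/-- The spatial operator `f ↦ ∑ (A^a_j ∂_j f + S_N (A^b_j(f) ∂_j f))` of a scheme in which the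
filter acts on the part `A^b` of the coefficients only. -/
def schemeOp (Aa : Fin d → Matrix (Fin n) (Fin n) ℝ)
    (Ab : Fin d → Matrix (Fin n) (Fin n) (MvPolynomial (Fin n) ℝ)) (σ : (Fin d → ℝ) → ℝ) (N : ℕ)
    (f : (Fin d → ℝ) → (Fin n → ℝ)) : (Fin d → ℝ) → (Fin n → ℝ) :=
  linOp Aa (fun j x => evalMat (Ab j) (f x)) σ N f

/-- The residual of the filtered exact solution in the scheme linearized at the exact solution. -/
def residual (A : Fin d → Matrix (Fin n) (Fin n) (MvPolynomial (Fin n) ℝ))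
    (Aa : Fin d → Matrix (Fin n) (Fin n) ℝ)
    (Ab : Fin d → Matrix (Fin n) (Fin n) (MvPolynomial (Fin n) ℝ)) (σ : (Fin d → ℝ) → ℝ) (N : ℕ)
    (U V : (Fin d → ℝ) → (Fin n → ℝ)) : (Fin d → ℝ) → (Fin n → ℝ) :=
  schemeOp Aa Ab σ N V - fourierMultiplier (lowSymbol σ N) (hypOp A U) -
    linOp Aa (fun j x => evalMat (Ab j) (U x)) σ N (V - fourierMultiplier (lowSymbol σ N) U)

/-- Consistency: the residual is bounded in `L²` by the error and by `N^{-s}` times the norm of the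
exact solution. -/
theorem exists_l2n_residual_le {σ : (Fin d → ℝ) → ℝ} (hσ : IsFilterProfile σ) {s : ℝ}
    (hs : (d : ℝ) / 2 + 1 < s) {A : Fin d → Matrix (Fin n) (Fin n) (MvPolynomial (Fin n) ℝ)}
    {Aa : Fin d → Matrix (Fin n) (Fin n) ℝ}
    {Ab : Fin d → Matrix (Fin n) (Fin n) (MvPolynomial (Fin n) ℝ)}
    (hA : ∀ j v, evalMat (A j) v = Aa j + evalMat (Ab j) v) {R : ℝ≥0∞} (hR : R < ⊤) :
    ∃ K : ℝ≥0∞, K < ⊤ ∧ ∀ N : ℕ, 1 ≤ N → ∀ U V : (Fin d → ℝ) → (Fin n → ℝ), MemHs s U →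
      ContDiff ℝ 1 U → (∀ i, wn (comp U i) ≤ R) → (∀ i, IsTrig N (comp V i)) →
      (∀ i, wn (comp V i) ≤ R) →
      ∑ i, l2n (comp (residual A Aa Ab σ N U V) i) ≤
        K * (∑ i, l2n (comp (V - fourierMultiplier (lowSymbol σ N) U) i) +
          ENNReal.ofReal ((N : ℝ) ^ (-(2 * s))) * hs2 s U) := by
  have hs0 : 0 < s := by have : (0 : ℝ) ≤ d := Nat.cast_nonneg d; linarith
  obtain ⟨C₁, hC₁, hcomm⟩ := exists_tsum_commutator_le (d := d) hσ hs0.le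
  obtain ⟨C₂, hC₂, hlip⟩ := exists_bound_forall (ι := Fin d × Fin n × Fin n)
    (P := fun q C => ∀ U V : (Fin d → ℝ) → (Fin n → ℝ), (∀ i, IsWiener (comp U i)) →
      (∀ i, wn (comp U i) ≤ R) → (∀ i, IsWiener (comp V i)) → (∀ i, wn (comp V i) ≤ R) →
      l2n (fun x => polyComp (Ab q.1 q.2.1 q.2.2) V x - polyComp (Ab q.1 q.2.1 q.2.2) U x) ≤
        C * ∑ i, l2n (fun x => comp V i x - comp U i x))
    (fun q a b hab h U V h1 h2 h3 h4 => (h U V h1 h2 h3 h4).trans (mul_le_mul_left hab _))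
    fun q => exists_l2n_polyComp_sub_le _ hR
  obtain ⟨C₃, hC₃, hwn⟩ := exists_bound_forall (ι := Fin d × Fin n × Fin n)
    (P := fun q C => ∀ U : (Fin d → ℝ) → (Fin n → ℝ), (∀ i, IsWiener (comp U i)) →
      (∀ i, wn (comp U i) ≤ R) → wn (polyComp (Ab q.1 q.2.1 q.2.2) U) ≤ C)
    (fun q a b hab h U h1 h2 => (h U h1 h2).trans hab)
    fun q => exists_wn_polyComp_le _ hR
  obtain ⟨C₄, hC₄, hhn⟩ := exists_bound_forall (ι := Fin d × Fin n × Fin n)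
    (P := fun q C => ∀ U : (Fin d → ℝ) → (Fin n → ℝ), (∀ i, IsWiener (comp U i)) →
      (∀ i, wn (comp U i) ≤ R) → hn s (polyComp (Ab q.1 q.2.1 q.2.2) U) ≤
        C * ∑ i, hn s (comp U i))
    (fun q a b hab h U h1 h2 => (h U h1 h2).trans (mul_le_mul_left hab _))
    fun q => exists_hn_polyComp_le _ hR hs0
  set D₁ : ℝ≥0∞ := R ^ 2 * (C₂ * (2 * (1 + ENNReal.ofReal (4 ^ (2 * s)))))
  set D₂ : ℝ≥0∞ := C₁ * ENNReal.ofReal (8 ^ s) ^ 2 * (C₃ ^ 2 + R ^ 2 * (C₄ * n))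
  have hD₁ : D₁ < ⊤ := by finiteness
  have hD₂ : D₂ < ⊤ := by finiteness
  refine ⟨n * (Fintype.card (Fin d × Fin n) * (Fintype.card (Fin d × Fin n) * (2 * (D₁ + D₂)))),
    by finiteness, fun N hN U V hU hU1 hUR hV hVR => ?_⟩
  have hUw : ∀ i, IsWiener (comp U i) := hU.isWiener hs
  set θ := lowSymbol σ N
  have hθ := isSymbol_lowSymbol hσ hN
  set W := fourierMultiplier θ U
  have hW : ∀ i, IsTrig N (comp W i) := isTrig_multiplier hθ U
  set z := V - W
  have hcz : ∀ i, comp z i = fun x => comp V i x - comp W i x := fun i => by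
    ext x; simp [comp, z]
  have hz : ∀ i, IsTrig N (comp z i) := fun i => by rw [hcz]; exact (hV i).sub (hW i)
  set X := ∑ i, l2n (comp z i)
  set Y := ENNReal.ofReal ((N : ℝ) ^ (-(2 * s))) * hs2 s U
  have hV1 : ContDiff ℝ 1 V := contDiff_of_isTrig hV
  have hW1 : ContDiff ℝ 1 W := contDiff_of_isTrig hW
  have hz1 : ContDiff ℝ 1 z := contDiff_of_isTrig hz
  have hVp : IsTorusPeriodic V := isTorusPeriodic_of_comp fun i => (hV i).toIsTorusFun
  have hWp : IsTorusPeriodic W := isTorusPeriodic_of_comp fun i => (hW i).toIsTorusFun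
  have hzp : IsTorusPeriodic z := isTorusPeriodic_of_comp fun i => (hz i).toIsTorusFun
  have hVw : ∀ i, IsWiener (comp V i) := fun i => (hV i).isWiener
  have hpd : ∀ {f : (Fin d → ℝ) → (Fin n → ℝ)}, ContDiff ℝ 1 f → (∀ i, IsWiener (comp f i)) →
      ∀ j c k, fc (comp (partialDeriv j f) c) k = Complex.I * (k j : ℝ) * fc (comp f c) k :=
    fun hf hw j c k => fc_partialDeriv (hf.differentiable one_ne_zero) (hw c) j k
  have hcU : ∀ j c, Continuous (comp (partialDeriv j U) c) :=
    fun j c => (isTorusFun_partialDeriv hU1 hU.periodic j c).continuous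
  have hcV : ∀ j c, IsTrig N (comp (partialDeriv j V) c) := isTrig_partialDeriv hV1 hV
  have hcW : ∀ j c, IsTrig N (comp (partialDeriv j W) c) := isTrig_partialDeriv hW1 hW
  have hcz' : ∀ j c, IsTrig N (comp (partialDeriv j z) c) := isTrig_partialDeriv hz1 hz
  have hcP : ∀ {f : (Fin d → ℝ) → (Fin n → ℝ)}, (∀ i, IsWiener (comp f i)) → ∀ j a b,
      IsWiener (entries (fun x => evalMat (Ab j) (f x)) a b) := fun hf j a b => by
    rw [entries_evalMat]; exact isWiener_polyComp _ hf
  -- `V - U` is the difference of the error `z` and of the tail of `U`, which is `O(N^{-s})`.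
  have hVU : ∑ i, l2n (fun x => comp V i x - comp U i x) ≤
      2 * (1 + ENNReal.ofReal (4 ^ (2 * s))) * (X + Y) := by
    have h1 : ∑ i, l2n (fun x => comp V i x - comp U i x) = hs2 0 (z - (U - W)) := by
      rw [hs2_zero]
      refine Finset.sum_congr rfl fun i _ => ?_
      congr 1
      ext x
      simp [comp, z]
    rw [h1]
    refine (hs2_sub_le 0 hz1.continuous (hU1.continuous.sub hW1.continuous)).trans ?_
    rw [hs2_zero z, mul_assoc]
    refine mul_le_mul_right ?_ _
    have h2 := hs2_sub_low_le hσ hN hs0.le hU1.continuous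
    rw [show -(2 * (0 - s)) = 2 * s by ring, show 2 * (0 - s) = -(2 * s) by ring, mul_assoc] at h2
    calc _ ≤ X + ENNReal.ofReal (4 ^ (2 * s)) * Y := add_le_add le_rfl h2
      _ ≤ (X + Y) + ENNReal.ofReal (4 ^ (2 * s)) * (X + Y) := by
          gcongr
          · exact le_self_add
          · exact le_add_self
      _ = _ := by ring
  -- The constant parts cancel because `S_N Θ = Θ`, which leaves the error of the coefficients,
  -- `S_N ((A^b(V) - A^b(U)) ∂_j V)`, and the commutator `S_N (A^b(U) ∂_j Θ U) - Θ (A^b(U) ∂_j U)`.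
  have hfc : ∀ b k, fc (comp (residual A Aa Ab σ N U V) b) k = ∑ q : Fin d × Fin n,
      (filterSymbol σ N k * fc (fun x => comp (partialDeriv q.1 V) q.2 x *
          (polyComp (Ab q.1 b q.2) V x - polyComp (Ab q.1 b q.2) U x)) k +
        filterSymbol σ N k * (fc (fun x => polyComp (Ab q.1 b q.2) U x *
            comp (partialDeriv q.1 W) q.2 x) k -
          θ k * fc (fun x => polyComp (Ab q.1 b q.2) U x * comp (partialDeriv q.1 U) q.2 x) k)) := by
    intro b k
    have c1 : Continuous (schemeOp Aa Ab σ N V) :=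
      continuous_of_comp fun i => isTorusFun_linOp hσ hN Aa _ hV1 hVp i
    have c2 : Continuous (fourierMultiplier θ (hypOp A U)) :=
      continuous_of_comp fun i => (isTrig_multiplier hθ _ i).toIsTorusFun
    have c3 : Continuous (linOp Aa (fun j x => evalMat (Ab j) (U x)) σ N z) :=
      continuous_of_comp fun i => isTorusFun_linOp hσ hN Aa _ hz1 hzp i
    have hhyp : fc (comp (hypOp A U) b) k = ∑ j, ∑ c, ((Aa j b c : ℂ) *
        fc (comp (partialDeriv j U) c) k +
        fc (fun x => polyComp (Ab j b c) U x * comp (partialDeriv j U) c x) k) := by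
      have h : comp (hypOp A U) b = fun x => ∑ j, ∑ c, ((Aa j b c : ℂ) *
          comp (partialDeriv j U) c x + polyComp (Ab j b c) U x * comp (partialDeriv j U) c x) := by
        ext x
        have hA' : ∀ j c, MvPolynomial.eval (U x) (A j b c) =
            Aa j b c + MvPolynomial.eval (U x) (Ab j b c) := fun j c =>
          congrFun (congrFun (hA j (U x)) b) c
        simp [comp, hypOp, Matrix.mulVec, dotProduct, Finset.sum_apply, polyComp, hA', evalMat,
          add_mul]
      have c4 : ∀ j c, Continuous fun x => (Aa j b c : ℂ) * comp (partialDeriv j U) c x :=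
        fun j c => continuous_const.fun_mul (hcU j c)
      have c5 : ∀ j c, Continuous fun x => polyComp (Ab j b c) U x * comp (partialDeriv j U) c x :=
        fun j c => (isWiener_polyComp _ hUw).continuous.fun_mul (hcU j c)
      rw [h, fc_sum fun j _ => continuous_finsetSum _ fun c _ => (c4 j c).fun_add (c5 j c)]
      refine Finset.sum_congr rfl fun j _ => ?_
      rw [fc_sum fun c _ => (c4 j c).fun_add (c5 j c)]
      exact Finset.sum_congr rfl fun c _ => by rw [fc_add (c4 j c) (c5 j c), fc_const_mul]
    rw [residual, fc_comp_sub (c1.sub c2) c3, fc_comp_sub c1 c2, fc_multiplier hθ, hhyp, schemeOp,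
      fc_linOp hσ hN Aa (fun j a b => (hcP hVw j a b).continuous) hV1 hVp,
      fc_linOp hσ hN Aa (fun j a b => (hcP hUw j a b).continuous) hz1 hzp, Fintype.sum_prod_type,
      Finset.mul_sum, ← Finset.sum_sub_distrib, ← Finset.sum_sub_distrib]
    refine Finset.sum_congr rfl fun j _ => ?_
    rw [Finset.mul_sum, ← Finset.sum_sub_distrib, ← Finset.sum_sub_distrib]
    refine Finset.sum_congr rfl fun c _ => ?_
    simp only [entries_evalMat]
    have hPU := (isWiener_polyComp (Ab j b c) hUw).continuous
    have hPV := (isWiener_polyComp (Ab j b c) hVw).continuous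
    have hzd : ∀ x, comp (partialDeriv j z) c x =
        comp (partialDeriv j V) c x - comp (partialDeriv j W) c x := by
      have : comp (partialDeriv j z) c = fun x =>
          comp (partialDeriv j V) c x - comp (partialDeriv j W) c x := by
        refine (hcz' j c).ext_fc ((hcV j c).sub (hcW j c)) fun l => ?_
        rw [fc_sub (hcV j c).continuous (hcW j c).continuous,
          hpd hz1 (fun i => (hz i).isWiener), hpd hV1 hVw, hpd hW1 (fun i => (hW i).isWiener), hcz,
          fc_sub (hV c).continuous (hW c).continuous]
        ring
      exact congrFun this
    have e1 : fc (fun x => comp (partialDeriv j V) c x *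
        (polyComp (Ab j b c) V x - polyComp (Ab j b c) U x)) k =
        fc (fun x => polyComp (Ab j b c) V x * comp (partialDeriv j V) c x) k -
          fc (fun x => polyComp (Ab j b c) U x * comp (partialDeriv j V) c x) k := by
      rw [← fc_sub (hPV.fun_mul (hcV j c).continuous) (hPU.fun_mul (hcV j c).continuous)]
      congr 1
      ext x
      ring
    have e2 : fc (fun x => polyComp (Ab j b c) U x * comp (partialDeriv j z) c x) k =
        fc (fun x => polyComp (Ab j b c) U x * comp (partialDeriv j V) c x) k -
          fc (fun x => polyComp (Ab j b c) U x * comp (partialDeriv j W) c x) k := by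
      rw [← fc_sub (hPU.fun_mul (hcV j c).continuous) (hPU.fun_mul (hcW j c).continuous)]
      congr 1
      ext x
      rw [hzd]
      ring
    have e3 : fc (comp (partialDeriv j z) c) k = fc (comp (partialDeriv j V) c) k -
        θ k * fc (comp (partialDeriv j U) c) k := by
      rw [hpd hz1 (fun i => (hz i).isWiener), hpd hV1 hVw, hpd hU1 hUw, hcz,
        fc_sub (hV c).continuous (hW c).continuous, fc_multiplier hθ]
      ring
    have e4 : (filterSymbol σ N k : ℂ) * θ k = θ k := by
      exact_mod_cast congrArg (fun x : ℝ => (x : ℂ)) (filterSymbol_mul_lowSymbol hσ hN k)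
    rw [e1, e2, e3, mul_sub (filterSymbol σ N k : ℂ) _ ((θ k : ℂ) * _), ← mul_assoc _ (θ k : ℂ), e4]
    ring
  have hσ1 : ∀ k, ‖(filterSymbol σ N k : ℂ)‖ₑ ≤ 1 := fun k => by
    have := filterSymbol_mem_Icc hσ N k
    rw [← ofReal_norm, Complex.norm_real, Real.norm_eq_abs, abs_of_nonneg this.1,
      ← ENNReal.ofReal_one]
    exact ENNReal.ofReal_le_ofReal this.2
  -- Each entry contributes at most `D₁` (error of the coefficients) plus `D₂` (commutator).
  have hterm : ∀ b (q : Fin d × Fin n), ∑' k,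
      ‖filterSymbol σ N k * fc (fun x => comp (partialDeriv q.1 V) q.2 x *
          (polyComp (Ab q.1 b q.2) V x - polyComp (Ab q.1 b q.2) U x)) k +
        filterSymbol σ N k * (fc (fun x => polyComp (Ab q.1 b q.2) U x *
            comp (partialDeriv q.1 W) q.2 x) k -
          θ k * fc (fun x => polyComp (Ab q.1 b q.2) U x * comp (partialDeriv q.1 U) q.2 x) k)‖ₑ ^ 2 ≤
      2 * (D₁ + D₂) * (X + Y) := by
    rintro b ⟨j, c⟩
    set P := Ab j b c
    have hPd := (isWiener_polyComp P hVw).sub (isWiener_polyComp P hUw)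
    have t1 : ∑' k, ‖fc (fun x => comp (partialDeriv j V) c x *
        (polyComp P V x - polyComp P U x)) k‖ₑ ^ 2 ≤ D₁ * (X + Y) := by
      refine (l2n_mul_le (hcV j c).isWiener hPd.continuous).trans ?_
      have h1 : ∑' k, ‖fc (comp (partialDeriv j V) c) k‖ₑ ≤ R := by
        refine le_trans (le_of_eq ?_) ((tsum_deriv_coeff_le V c j).trans (hVR c))
        exact tsum_congr fun k => by rw [hpd hV1 hVw]
      calc _ ≤ R ^ 2 * (C₂ * (2 * (1 + ENNReal.ofReal (4 ^ (2 * s))) * (X + Y))) := by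
            gcongr
            exact (hlip ⟨j, b, c⟩ U V hUw hUR hVw hVR).trans (mul_le_mul_right hVU _)
        _ = _ := by simp only [D₁]; ring
    have t2 : ∑' k, ‖fc (fun x => polyComp P U x * comp (partialDeriv j W) c x) k -
          θ k * fc (fun x => polyComp P U x * comp (partialDeriv j U) c x) k‖ₑ ^ 2 ≤ D₂ * (X + Y) := by
      refine (hcomm N hN _ (comp U c) (comp (partialDeriv j U) c) (comp (partialDeriv j W) c) j
        (isWiener_polyComp P hUw) (hcU j c) (hcW j c).continuous (hpd hU1 hUw j c) fun k => ?_).trans ?_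
      · rw [hpd hW1 (fun i => (hW i).isWiener), hpd hU1 hUw, fc_multiplier hθ]
        ring
      have h1 : ENNReal.ofReal (((N : ℝ) / 8) ^ (-s)) ^ 2 =
          ENNReal.ofReal (8 ^ s) ^ 2 * ENNReal.ofReal ((N : ℝ) ^ (-(2 * s))) := by
        rw [ofReal_div_rpow hN (by norm_num), neg_neg, mul_pow, ← ENNReal.ofReal_pow (by positivity)
          2 (p := (N : ℝ) ^ (-s)), ← Real.rpow_mul_natCast (by positivity)]
        congr 3
        push_cast
        ring
      have h2 : hn s (polyComp P U) ≤ C₄ * (n * hs2 s U) := by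
        refine (hhn ⟨j, b, c⟩ U hUw hUR).trans (mul_le_mul_right ?_ _)
        refine (Finset.sum_le_sum fun i _ => hn_le_hs2 hs0.le U i).trans ?_
        simp
      rw [h1]
      calc _ ≤ C₁ * (ENNReal.ofReal (8 ^ s) ^ 2 * ENNReal.ofReal ((N : ℝ) ^ (-(2 * s)))) *
            (C₃ ^ 2 * hs2 s U + R ^ 2 * (C₄ * (n * hs2 s U))) := by
            gcongr
            · exact hwn ⟨j, b, c⟩ U hUw hUR
            · exact hn_le_hs2 hs0.le U c
            · exact hUR c
        _ = D₂ * Y := by simp only [D₂, Y]; ring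
        _ ≤ _ := by gcongr; exact le_add_self
    calc _ ≤ ∑' k, 2 * (‖fc (fun x => comp (partialDeriv j V) c x *
            (polyComp P V x - polyComp P U x)) k‖ₑ ^ 2 +
          ‖fc (fun x => polyComp P U x * comp (partialDeriv j W) c x) k -
          θ k * fc (fun x => polyComp P U x * comp (partialDeriv j U) c x) k‖ₑ ^ 2) := by
          refine ENNReal.tsum_le_tsum fun k => ?_
          rw [← mul_add, enorm_mul]
          refine le_trans (pow_le_pow_left₀ (by simp) ((mul_le_of_le_one_left (by simp)
            (hσ1 k)).trans (enorm_add_le _ _)) 2) (ENNReal_add_sq_le _ _)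
      _ ≤ 2 * (D₁ * (X + Y) + D₂ * (X + Y)) := by
          rw [ENNReal.tsum_mul_left, ENNReal.tsum_add]
          gcongr
      _ = _ := by ring
  calc _ ≤ ∑ _b : Fin n, Fintype.card (Fin d × Fin n) * (Fintype.card (Fin d × Fin n) *
        (2 * (D₁ + D₂) * (X + Y))) := by
        refine Finset.sum_le_sum fun b _ => ?_
        unfold l2n
        refine (ENNReal.tsum_le_tsum fun k => (congrArg (fun w => ‖w‖ₑ ^ 2) (hfc b k)).le.trans
          ((pow_le_pow_left₀ (by simp) (enorm_sum_le _ _) 2).trans (ENNReal_sum_sq_le _))).trans ?_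
        rw [ENNReal.tsum_mul_left, Summable.tsum_finsetSum fun _ _ => ENNReal.summable]
        gcongr
        refine (Finset.sum_le_sum fun q _ => hterm b q).trans ?_
        simp
    _ = _ := by
        rw [Finset.sum_const, Finset.card_univ, Fintype.card_fin, nsmul_eq_mul]
        ring

/-! ### Differentiation in time -/

/-- The family `F` of functions on the torus is differentiable in time on `O` with derivative `F'`,
pointwise in space but locally uniformly bounded in time, which makes Fourier coefficients
differentiable. -/
structure IsTimeC1 (O : Set ℝ) (F F' : ℝ → (Fin d → ℝ) → ℝ) : Prop where
  continuous : ∀ t ∈ O, Continuous (F t)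
  continuous' : ∀ t ∈ O, Continuous (F' t)
  hasDerivAt : ∀ t ∈ O, ∀ x, HasDerivAt (fun τ => F τ x) (F' t x) t
  bound : ∀ t ∈ O, ∃ C : ℝ, ∀ᶠ τ in 𝓝 t, ∀ x, |F τ x| ≤ C ∧ |F' τ x| ≤ C

theorem hasDerivAt_of_ofReal {f : ℝ → ℝ} {f' t : ℝ}
    (h : HasDerivAt (fun τ => (f τ : ℂ)) (f' : ℂ) t) : HasDerivAt f f' t :=
  Complex.reCLM.hasFDerivAt.comp_hasDerivAt t h

namespace IsTimeC1

variable {O : Set ℝ} {F F' G G' : ℝ → (Fin d → ℝ) → ℝ}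

theorem mono {O' : Set ℝ} (h : IsTimeC1 O F F') (hO : O' ⊆ O) : IsTimeC1 O' F F' :=
  ⟨fun t ht => h.continuous t (hO ht), fun t ht => h.continuous' t (hO ht),
    fun t ht => h.hasDerivAt t (hO ht), fun t ht => h.bound t (hO ht)⟩

theorem const (c : ℝ) : IsTimeC1 O (fun _ (_ : Fin d → ℝ) => c) fun _ _ => 0 :=
  ⟨fun _ _ => continuous_const, fun _ _ => continuous_const, fun t _ _ => hasDerivAt_const t c,
    fun _ _ => ⟨|c|, Eventually.of_forall fun _ _ => ⟨le_rfl, by simp⟩⟩⟩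

theorem add (hF : IsTimeC1 O F F') (hG : IsTimeC1 O G G') :
    IsTimeC1 O (fun t x => F t x + G t x) fun t x => F' t x + G' t x := by
  refine ⟨fun t ht => (hF.continuous t ht).add (hG.continuous t ht),
    fun t ht => (hF.continuous' t ht).add (hG.continuous' t ht),
    fun t ht x => (hF.hasDerivAt t ht x).fun_add (hG.hasDerivAt t ht x), fun t ht => ?_⟩
  obtain ⟨C, hC⟩ := hF.bound t ht
  obtain ⟨D, hD⟩ := hG.bound t ht
  refine ⟨C + D, ?_⟩
  filter_upwards [hC, hD] with τ h1 h2 x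
  exact ⟨(abs_add_le _ _).trans (add_le_add (h1 x).1 (h2 x).1),
    (abs_add_le _ _).trans (add_le_add (h1 x).2 (h2 x).2)⟩

theorem mul (hF : IsTimeC1 O F F') (hG : IsTimeC1 O G G') :
    IsTimeC1 O (fun t x => F t x * G t x) fun t x => F' t x * G t x + F t x * G' t x := by
  refine ⟨fun t ht => (hF.continuous t ht).mul (hG.continuous t ht),
    fun t ht => ((hF.continuous' t ht).mul (hG.continuous t ht)).add
      ((hF.continuous t ht).mul (hG.continuous' t ht)),
    fun t ht x => (hF.hasDerivAt t ht x).fun_mul (hG.hasDerivAt t ht x), fun t ht => ?_⟩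
  obtain ⟨C, hC⟩ := hF.bound t ht
  obtain ⟨D, hD⟩ := hG.bound t ht
  refine ⟨C * D + C * D, ?_⟩
  filter_upwards [hC, hD] with τ h1 h2 x
  have hC0 : 0 ≤ C := (abs_nonneg _).trans (h1 x).1
  have hD0 : 0 ≤ D := (abs_nonneg _).trans (h2 x).1
  refine ⟨?_, (abs_add_le _ _).trans (add_le_add ?_ ?_)⟩ <;> rw [abs_mul]
  · nlinarith [mul_le_mul (h1 x).1 (h2 x).1 (abs_nonneg _) hC0, mul_nonneg hC0 hD0]
  · exact mul_le_mul (h1 x).2 (h2 x).1 (abs_nonneg _) hC0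
  · exact mul_le_mul (h1 x).1 (h2 x).2 (abs_nonneg _) hC0

theorem sub (hF : IsTimeC1 O F F') (hG : IsTimeC1 O G G') :
    IsTimeC1 O (fun t x => F t x - G t x) fun t x => F' t x - G' t x := by
  have h := hF.add ((const (-1)).mul hG)
  convert! h using 3 <;> ring

/-- Differentiation of Fourier coefficients under the integral sign. -/
theorem hasDerivAt_fc (hO : IsOpen O) (h : IsTimeC1 O F F') {t : ℝ} (ht : t ∈ O)
    (k : Fin d → ℤ) :
    HasDerivAt (fun τ => fc (fun x => (F τ x : ℂ)) k) (fc (fun x => (F' t x : ℂ)) k) t := by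
  obtain ⟨C, hC⟩ := h.bound t ht
  have hOt := hO.mem_nhds ht
  have hc : ∀ τ ∈ O, Continuous fun x => (F τ x : ℂ) * expMode (-k) x := fun τ hτ =>
    (Complex.continuous_ofReal.comp (h.continuous τ hτ)).mul (continuous_expMode _)
  have hc' : Continuous fun x => (F' t x : ℂ) * expMode (-k) x :=
    (Complex.continuous_ofReal.comp (h.continuous' t ht)).mul (continuous_expMode _)
  refine HasDerivAt.const_mul _ (hasDerivAt_integral_of_dominated_loc_of_deriv_le
    (F := fun τ x => (F τ x : ℂ) * expMode (-k) x)
    (F' := fun τ x => (F' τ x : ℂ) * expMode (-k) x)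
    (bound := fun _ => C) (inter_mem hC hOt) ?_ ?_ ?_ ?_ ?_ ?_).2
  · filter_upwards [hOt] with τ hτ
    exact (hc τ hτ).aestronglyMeasurable
  · exact (hc t ht).continuousOn.integrableOn_compact isCompact_Icc
  · exact hc'.aestronglyMeasurable
  · refine Eventually.of_forall fun x τ hτ => ?_
    rw [norm_mul, norm_expMode, mul_one, Complex.norm_real]
    exact (hτ.1 x).2
  · exact (continuousOn_const (s := Set.Icc (0 : Fin d → ℝ) fun _ =>
      2 * Real.pi)).integrableOn_compact isCompact_Icc
  · exact Eventually.of_forall fun x τ hτ => ((h.hasDerivAt τ hτ.2 x).ofReal_comp).mul_const _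

theorem hasDerivAt_mean (hO : IsOpen O) (h : IsTimeC1 O F F') {t : ℝ} (ht : t ∈ O) :
    HasDerivAt (fun τ => mean (F τ)) (mean (F' t)) t := by
  have h1 := h.hasDerivAt_fc hO ht 0
  simp_rw [fc_zero_eq_mean] at h1
  exact hasDerivAt_of_ofReal h1

theorem eval {u u' : ℝ → (Fin d → ℝ) → (Fin n → ℝ)}
    (h : ∀ i, IsTimeC1 O (fun t x => u t x i) fun t x => u' t x i) (P : MvPolynomial (Fin n) ℝ) :
    IsTimeC1 O (fun t x => MvPolynomial.eval (u t x) P)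
      fun t x => ∑ i, MvPolynomial.eval (u t x) (MvPolynomial.pderiv i P) * u' t x i := by
  have hu : ∀ t ∈ O, Continuous (u t) := fun t ht =>
    continuous_pi fun i => (h i).continuous t ht
  refine ⟨fun t ht => (MvPolynomial.continuous_eval P).comp (hu t ht), fun t ht =>
    continuous_finsetSum _ fun i _ => ((MvPolynomial.continuous_eval _).comp (hu t ht)).mul
      ((h i).continuous' t ht), fun t ht x => hasDerivAt_eval P fun i => (h i).hasDerivAt t ht x,
    fun t ht => ?_⟩
  choose C hC using fun i => (h i).bound t ht
  set R := ∑ i, |C i|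
  have hCR : ∀ i, C i ≤ R := fun i => (le_abs_self _).trans
    (Finset.single_le_sum (f := fun i => |C i|) (fun _ _ => abs_nonneg _) (Finset.mem_univ i))
  have hR0 : 0 ≤ R := Finset.sum_nonneg fun _ _ => abs_nonneg _
  obtain ⟨D, hD, hbd⟩ := exists_abs_eval_le P R
  obtain ⟨D', hD', hbd'⟩ := exists_real_bound_forall (ι := Fin n)
    (P := fun i D => ∀ v : Fin n → ℝ, ‖v‖ ≤ R → |MvPolynomial.eval v (MvPolynomial.pderiv i P)| ≤ D)
    (fun i a b hab h v hv => (h v hv).trans hab) fun i => exists_abs_eval_le _ R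
  refine ⟨D + ∑ _i : Fin n, D' * R, ?_⟩
  filter_upwards [eventually_all.2 hC] with τ hτ x
  have hn : ‖u τ x‖ ≤ R := (pi_norm_le_iff_of_nonneg hR0).2 fun i => ((hτ i x).1).trans (hCR i)
  have h0 : 0 ≤ ∑ _i : Fin n, D' * R := Finset.sum_nonneg fun _ _ => mul_nonneg hD' hR0
  constructor
  · linarith [hbd _ hn]
  · refine ((Finset.abs_sum_le_sum_abs _ _).trans (Finset.sum_le_sum fun i _ => ?_)).trans
      (le_add_of_nonneg_left hD)
    rw [abs_mul]
    exact mul_le_mul (hbd' i _ hn) (((hτ i x).2).trans (hCR i)) (abs_nonneg _) hD'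

theorem multiplier (hO : IsOpen O) {N : ℕ} {m : (Fin d → ℤ) → ℝ} (hm : IsSymbol N m)
    {u u' : ℝ → (Fin d → ℝ) → (Fin n → ℝ)}
    (h : ∀ i, IsTimeC1 O (fun t x => u t x i) fun t x => u' t x i) (i : Fin n) :
    IsTimeC1 O (fun t x => fourierMultiplier m (u t) x i)
      fun t x => fourierMultiplier m (u' t) x i := by
  have hsum : ∀ (f : (Fin d → ℝ) → (Fin n → ℝ)) x, (fourierMultiplier m f x i : ℂ) =
      ∑ k ∈ box d N, m k * fc (comp f i) k * expMode k x := fun f x => by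
    have := (isTrig_multiplier hm f i).eq_sum x
    simp_rw [fc_multiplier hm] at this
    exact this
  have hb : ∀ {f : (Fin d → ℝ) → (Fin n → ℝ)} {C : ℝ}, (∀ x, |f x i| ≤ C) →
      ∀ x, |fourierMultiplier m f x i| ≤ ∑ k ∈ box d N, |m k| * C := by
    intro f C hC x
    rw [← Real.norm_eq_abs, ← Complex.norm_real, hsum]
    refine norm_sum_le_of_le _ fun k _ => ?_
    rw [norm_mul, norm_mul, norm_expMode, mul_one, Complex.norm_real, Real.norm_eq_abs]
    refine mul_le_mul_of_nonneg_left (norm_fc_le (fun y => ?_) k) (abs_nonneg _)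
    simpa [comp] using hC y
  refine ⟨fun t _ => ?_, fun t _ => ?_, fun t ht x => ?_, fun t ht => ?_⟩
  · exact (continuous_apply i).comp
      (continuous_of_comp fun i => (isTrig_multiplier hm (u t) i).toIsTorusFun)
  · exact (continuous_apply i).comp
      (continuous_of_comp fun i => (isTrig_multiplier hm (u' t) i).toIsTorusFun)
  · have h1 : HasDerivAt (fun τ => ∑ k ∈ box d N, m k * fc (comp (u τ) i) k * expMode k x)
        (∑ k ∈ box d N, m k * fc (comp (u' t) i) k * expMode k x) t :=
      HasDerivAt.fun_sum fun k _ => (((h i).hasDerivAt_fc hO ht k).const_mul _).mul_const _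
    simp_rw [← hsum] at h1
    exact hasDerivAt_of_ofReal h1
  · obtain ⟨C, hC⟩ := (h i).bound t ht
    refine ⟨∑ k ∈ box d N, |m k| * C, ?_⟩
    filter_upwards [hC] with τ hτ x
    exact ⟨hb (fun y => (hτ y).1) x, hb (fun y => (hτ y).2) x⟩

end IsTimeC1

/-- A classical solution is bounded in the Wiener norm locally in time. -/
theorem exists_eventually_wn_le {s : ℝ} (hs : (d : ℝ) / 2 + 1 < s)
    {G : ((Fin d → ℝ) → (Fin n → ℝ)) → ((Fin d → ℝ) → (Fin n → ℝ))}
    {u₀ : (Fin d → ℝ) → (Fin n → ℝ)} {I : Set ℝ} {U : ℝ → (Fin d → ℝ) → (Fin n → ℝ)}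
    (hU : IsClassicalSolution s G u₀ I U) {t : ℝ} (ht : t ∈ I) :
    ∃ R : ℝ≥0∞, R < ⊤ ∧ ∀ᶠ τ in 𝓝 t, ∀ i, wn (comp (U τ) i) ≤ R := by
  obtain ⟨C, hC, hwn⟩ := exists_wn_sq_le (d := d) (n := n) hs
  have hfin := (hsNorm_lt_top_iff.1 (hU.memHs t ht).norm_lt_top)
  refine ⟨C * (2 * (1 + hs2 s (U t))) + 1, by finiteness, ?_⟩
  have h1 := hU.continuous_hs t ht
  rw [hU.isOpen.nhdsWithin_eq ht] at h1
  filter_upwards [h1.eventually (gt_mem_nhds (zero_lt_one (α := ℝ≥0∞))), hU.isOpen.mem_nhds ht]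
    with τ hτ hτI i
  have h2 : hs2 s (U τ) ≤ 2 * (1 + hs2 s (U t)) := by
    have h3 := hs2_sub_le s (f := U τ - U t) (g := -U t)
      ((hU.memHs τ hτI).continuous.sub (hU.memHs t ht).continuous) (hU.memHs t ht).continuous.neg
    rw [sub_neg_eq_add, sub_add_cancel] at h3
    refine h3.trans (mul_le_mul_right (add_le_add ?_ (le_of_eq ?_)) _)
    · rw [← hsNorm_sq]
      exact pow_le_one₀ (by simp) hτ.le
    · unfold hs2
      refine tsum_congr fun k => ?_
      congr 1
      refine Finset.sum_congr rfl fun i _ => ?_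
      have h4 : fc (comp (-U t) i) k = -fc (comp (U t) i) k := by
        rw [← fc_neg]
        congr 1
        ext x
        simp [comp]
      rw [h4, enorm_neg]
  have h5 : wn (comp (U τ) i) ^ 2 ≤ C * (2 * (1 + hs2 s (U t))) :=
    (hwn _ i).trans (mul_le_mul_right h2 _)
  rcases le_total (wn (comp (U τ) i)) 1 with h | h
  · exact h.trans le_add_self
  · refine le_trans ?_ (h5.trans le_self_add)
    rw [pow_two]
    exact le_mul_of_one_le_left (by simp) h

theorem IsWiener.abs_le {f : (Fin d → ℝ) → (Fin n → ℝ)} {i : Fin n} (hf : IsWiener (comp f i))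
    {R : ℝ≥0∞} (hR : R < ⊤) (h : wn (comp f i) ≤ R) (x : Fin d → ℝ) : |f x i| ≤ R.toReal := by
  have := (hf.norm_le x).trans (ENNReal.toReal_mono hR.ne h)
  simpa [comp] using this

theorem exists_abs_hypOp_le (A : Fin d → Matrix (Fin n) (Fin n) (MvPolynomial (Fin n) ℝ))
    {R : ℝ≥0∞} (hR : R < ⊤) : ∃ C : ℝ, 0 ≤ C ∧ ∀ f : (Fin d → ℝ) → (Fin n → ℝ), ContDiff ℝ 1 f →
      (∀ i, IsWiener (comp f i)) → (∀ i, wn (comp f i) ≤ R) → ∀ x i, |hypOp A f x i| ≤ C := by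
  obtain ⟨C, hC, hbd⟩ := exists_real_bound_forall (ι := Fin d × Fin n × Fin n)
    (P := fun q C => ∀ v : Fin n → ℝ, ‖v‖ ≤ R.toReal →
      |MvPolynomial.eval v (A q.1 q.2.1 q.2.2)| ≤ C)
    (fun q a b hab h v hv => (h v hv).trans hab) fun q => exists_abs_eval_le _ _
  refine ⟨∑ _j : Fin d, ∑ _c : Fin n, C * R.toReal, Finset.sum_nonneg fun _ _ =>
    Finset.sum_nonneg fun _ _ => mul_nonneg hC ENNReal.toReal_nonneg, fun f hf hw hwR x i => ?_⟩
  have hux : ‖f x‖ ≤ R.toReal := (pi_norm_le_iff_of_nonneg ENNReal.toReal_nonneg).2 fun c =>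
    (hw c).abs_le hR (hwR c) x
  rw [hypOp, Finset.sum_apply]
  refine (Finset.abs_sum_le_sum_abs _ _).trans (Finset.sum_le_sum fun j _ => ?_)
  rw [Matrix.mulVec, dotProduct]
  refine (Finset.abs_sum_le_sum_abs _ _).trans (Finset.sum_le_sum fun c _ => ?_)
  rw [abs_mul]
  refine mul_le_mul (hbd ⟨j, i, c⟩ _ hux) ?_ (abs_nonneg _) hC
  exact (norm_partialDeriv_le (hf.differentiable one_ne_zero) (hw c) j x).trans
    (ENNReal.toReal_mono hR.ne (hwR c))

/-- Classical solutions of the hyperbolic system are differentiable in time. -/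
theorem IsClassicalSolution.isTimeC1 {s : ℝ} (hs : (d : ℝ) / 2 + 1 < s)
    {A : Fin d → Matrix (Fin n) (Fin n) (MvPolynomial (Fin n) ℝ)}
    {u₀ : (Fin d → ℝ) → (Fin n → ℝ)} {I : Set ℝ} {U : ℝ → (Fin d → ℝ) → (Fin n → ℝ)}
    (hU : IsClassicalSolution s (hypOp A) u₀ I U) (i : Fin n) :
    IsTimeC1 I (fun t x => U t x i) fun t x => -hypOp A (U t) x i := by
  have hc' : ∀ t ∈ I, Continuous (hypOp A (U t)) := fun t ht => continuous_of_comp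
    (isTorusFun_hypOp A (hU.contDiff t ht) (hU.memHs t ht).periodic)
  refine ⟨fun t ht => (continuous_apply i).comp (hU.memHs t ht).continuous,
    fun t ht => ((continuous_apply i).comp (hc' t ht)).neg, fun t ht x => ?_, fun t ht => ?_⟩
  · simpa using (hasDerivAt_pi.1 (hU.hasDerivAt t ht x)) i
  obtain ⟨R, hR, hev⟩ := exists_eventually_wn_le hs hU ht
  obtain ⟨C, hC, hbd⟩ := exists_abs_hypOp_le A hR
  refine ⟨R.toReal + C, ?_⟩
  filter_upwards [hev, hU.isOpen.mem_nhds ht] with τ hτ hτI x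
  have hw := (hU.memHs τ hτI).isWiener hs
  refine ⟨((hw i).abs_le hR (hτ i) x).trans (le_add_of_nonneg_right hC), ?_⟩
  rw [abs_neg]
  exact (hbd _ (hU.contDiff τ hτI) hw hτ x i).trans (le_add_of_nonneg_left ENNReal.toReal_nonneg)

/-! ### The energy estimate -/

/-- A splitting `A = A^a + A^b` of the coefficients into a constant part and a polynomial part, with
a splitting `S^a + S^b` of the symmetrizer which symmetrizes the scheme that filters the part `A^b`
only.  The energy form associated with `S^a` and `S^b` is required to be coercive. -/
structure IsSplitting (A : Fin d → Matrix (Fin n) (Fin n) (MvPolynomial (Fin n) ℝ))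
    (Aa : Fin d → Matrix (Fin n) (Fin n) ℝ)
    (Ab : Fin d → Matrix (Fin n) (Fin n) (MvPolynomial (Fin n) ℝ))
    (Sa Sb : Matrix (Fin n) (Fin n) (MvPolynomial (Fin n) ℝ)) (𝒰 : Set (Fin n → ℝ))
    (σ : (Fin d → ℝ) → ℝ) : Prop where
  eq_add : ∀ j v, evalMat (A j) v = Aa j + evalMat (Ab j) v
  symm_a : ∀ v ∈ 𝒰, (evalMat Sa v).IsSymm
  symm_b : ∀ v ∈ 𝒰, (evalMat Sb v).IsSymm
  symm_aa : ∀ j, ∀ v ∈ 𝒰, (evalMat Sa v * Aa j).IsSymm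
  symm_ab : ∀ j, ∀ v ∈ 𝒰, (evalMat Sa v * evalMat (Ab j) v + evalMat Sb v * Aa j).IsSymm
  symm_bb : ∀ j, ∀ v ∈ 𝒰, (evalMat Sb v * evalMat (Ab j) v).IsSymm
  coercive : ∀ K ⊆ 𝒰, IsCompact K → ∃ c : ℝ, 0 < c ∧ ∀ N : ℕ, 1 ≤ N →
    ∀ U : (Fin d → ℝ) → (Fin n → ℝ), Continuous U → (∀ x, U x ∈ K) →
    ∀ z : (Fin d → ℝ) → (Fin n → ℝ), (∀ i, IsTrig N (comp z i)) →
      c * ∑ i, mean (fun x => z x i ^ 2) ≤ energyForm (fun x => evalMat Sa (U x))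
        (fun x => evalMat Sb (U x)) (sqrtSymbol σ N) z z

theorem IsTorusFun.continuous_apply {f : (Fin d → ℝ) → (Fin n → ℝ)} {i : Fin n}
    (h : IsTorusFun (comp f i)) : Continuous fun x => f x i :=
  Complex.continuous_re.comp h.continuous

theorem sum_mean_sq_multiplier_le {N : ℕ} {m : (Fin d → ℤ) → ℝ} (hm : IsSymbol N m)
    (hm1 : ∀ k, m k ∈ Set.Icc (0 : ℝ) 1) {z : (Fin d → ℝ) → (Fin n → ℝ)}
    (hz : ∀ i, IsTrig N (comp z i)) :
    ∑ i, mean (fun x => fourierMultiplier m z x i ^ 2) ≤ ∑ i, mean fun x => z x i ^ 2 := by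
  rw [← ENNReal.ofReal_le_ofReal_iff (Finset.sum_nonneg fun i _ => mean_nonneg fun x => sq_nonneg _),
    ← sum_l2n_eq (isTrig_multiplier hm z), ← sum_l2n_eq hz]
  refine Finset.sum_le_sum fun i _ => ENNReal.tsum_le_tsum fun k => ?_
  rw [fc_multiplier hm, enorm_mul]
  gcongr
  refine mul_le_of_le_one_left (by simp) ?_
  rw [← ofReal_norm, Complex.norm_real, Real.norm_eq_abs, abs_of_nonneg (hm1 k).1,
    ← ENNReal.ofReal_one]
  exact ENNReal.ofReal_le_ofReal (hm1 k).2

theorem abs_energyForm_le {N : ℕ} {m : (Fin d → ℤ) → ℝ} (hm : IsSymbol N m)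
    (hm1 : ∀ k, m k ∈ Set.Icc (0 : ℝ) 1) {Sa Sb : (Fin d → ℝ) → Matrix (Fin n) (Fin n) ℝ} {R : ℝ}
    (hR : 0 ≤ R)
    (hSa : ∀ a b, Continuous (fun x => Sa x a b)) (hSaR : ∀ a b x, |Sa x a b| ≤ R)
    (hSb : ∀ a b, Continuous (fun x => Sb x a b)) (hSbR : ∀ a b x, |Sb x a b| ≤ R)
    {z y : (Fin d → ℝ) → (Fin n → ℝ)} (hz : ∀ i, IsTrig N (comp z i))
    (hy : ∀ i, IsTrig N (comp y i)) :
    |energyForm Sa Sb m z y| ≤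
      2 * n * R * (∑ i, mean (fun x => z x i ^ 2) + ∑ i, mean fun x => y x i ^ 2) := by
  have key : ∀ {S : (Fin d → ℝ) → Matrix (Fin n) (Fin n) ℝ} {v w : (Fin d → ℝ) → (Fin n → ℝ)},
      (∀ a b, Continuous (fun x => S x a b)) → (∀ a b x, |S x a b| ≤ R) →
      (∀ i, Continuous fun x => v x i) → (∀ i, Continuous fun x => w x i) → ∀ a b,
      |mean (fun x => S x a b * v x a * w x b)| ≤
        R * (mean (fun x => v x a ^ 2) + mean fun x => w x b ^ 2) := by
    intro S v w hS hSR hv hw a b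
    rw [← mean_add (f := fun x => v x a ^ 2) (g := fun x => w x b ^ 2) ((hv a).pow 2) ((hw b).pow 2),
      ← mean_const_mul]
    refine abs_mean_le (((hS a b).mul (hv a)).mul (hw b))
      (continuous_const.mul (((hv a).pow 2).add ((hw b).pow 2))) fun x => ?_
    rw [mul_assoc, abs_mul]
    refine mul_le_mul (hSR a b x) ?_ (abs_nonneg _) hR
    rw [abs_le]
    constructor <;> nlinarith [sq_nonneg (v x a + w x b), sq_nonneg (v x a - w x b),
      sq_nonneg (v x a), sq_nonneg (w x b)]
  have hsum : ∀ {α β : Fin n → ℝ}, ∑ a, ∑ b, R * (α a + β b) = n * R * (∑ a, α a + ∑ b, β b) := by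
    intro α β
    simp only [← Finset.mul_sum, Finset.sum_add_distrib, Finset.sum_const, Finset.card_univ,
      Fintype.card_fin, nsmul_eq_mul]
    ring
  have h1 := sum_mean_sq_multiplier_le hm hm1 hz
  have h2 := sum_mean_sq_multiplier_le hm hm1 hy
  refine (Finset.abs_sum_le_sum_abs _ _).trans ((Finset.sum_le_sum fun a _ =>
    (Finset.abs_sum_le_sum_abs _ _).trans (Finset.sum_le_sum fun b _ => (abs_add_le _ _).trans
      (add_le_add (key hSa hSaR (fun i => (hz i).toIsTorusFun.continuous_apply)
          (fun i => (hy i).toIsTorusFun.continuous_apply) a b)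
        (key hSb hSbR (fun i => (isTrig_multiplier hm z i).toIsTorusFun.continuous_apply)
          (fun i => (isTrig_multiplier hm y i).toIsTorusFun.continuous_apply) a b)))).trans ?_)
  simp only [Finset.sum_add_distrib] at hsum ⊢
  rw [hsum, hsum]
  have : (0 : ℝ) ≤ n * R := by positivity
  nlinarith [mul_le_mul_of_nonneg_left h1 this, mul_le_mul_of_nonneg_left h2 this]

theorem energyForm_symm {Sa Sb : (Fin d → ℝ) → Matrix (Fin n) (Fin n) ℝ}
    (ha : ∀ x, (Sa x).IsSymm) (hb : ∀ x, (Sb x).IsSymm) (m : (Fin d → ℤ) → ℝ)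
    (z y : (Fin d → ℝ) → (Fin n → ℝ)) : energyForm Sa Sb m z y = energyForm Sa Sb m y z := by
  rw [energyForm, Finset.sum_comm]
  refine Finset.sum_congr rfl fun a _ => Finset.sum_congr rfl fun b _ => ?_
  congr 2 <;> ext x
  · rw [(ha x).apply]; ring
  · rw [(hb x).apply]; ring

theorem multiplier_neg_add {N : ℕ} {m : (Fin d → ℤ) → ℝ} (hm : IsSymbol N m)
    {f g : (Fin d → ℝ) → (Fin n → ℝ)} (hf : Continuous f) (hg : Continuous g) :
    fourierMultiplier m (-(f + g)) = -(fourierMultiplier m f + fourierMultiplier m g) := by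
  have h : ∀ i, comp (fourierMultiplier m (-(f + g))) i = fun x =>
      -1 * (comp (fourierMultiplier m f) i x + comp (fourierMultiplier m g) i x) := fun i => by
    refine (isTrig_multiplier hm _ i).ext_fc (((isTrig_multiplier hm f i).add
      (isTrig_multiplier hm g i)).const_mul _) fun k => ?_
    have e : comp (-(f + g)) i = fun x => -1 * (comp f i x + comp g i x) := by
      ext x; simp [comp]
    rw [fc_multiplier hm, e, fc_const_mul, fc_const_mul,
      fc_add (continuous_comp hf i) (continuous_comp hg i),
      fc_add (isTrig_multiplier hm f i).continuous (isTrig_multiplier hm g i).continuous,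
      fc_multiplier hm, fc_multiplier hm]
    ring
  ext x i
  have := congrFun (h i) x
  simp only [comp] at this
  have h2 : ((fourierMultiplier m (-(f + g)) x i : ℝ) : ℂ) =
      ((-(fourierMultiplier m f x i + fourierMultiplier m g x i) : ℝ) : ℂ) := by
    rw [this]; push_cast; ring
  exact_mod_cast h2

theorem energyForm_neg_add_right {N : ℕ} {m : (Fin d → ℤ) → ℝ} (hm : IsSymbol N m)
    {Sa Sb : (Fin d → ℝ) → Matrix (Fin n) (Fin n) ℝ}
    (hSa : ∀ a b, Continuous (fun x => Sa x a b)) (hSb : ∀ a b, Continuous (fun x => Sb x a b))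
    {z f g : (Fin d → ℝ) → (Fin n → ℝ)} (hz : Continuous z) (hf : Continuous f)
    (hg : Continuous g) :
    energyForm Sa Sb m z (-(f + g)) = -(energyForm Sa Sb m z f + energyForm Sa Sb m z g) := by
  have key : ∀ {S : (Fin d → ℝ) → Matrix (Fin n) (Fin n) ℝ} {v w w' : (Fin d → ℝ) → (Fin n → ℝ)},
      (∀ a b, Continuous (fun x => S x a b)) → Continuous v → Continuous w → Continuous w' → ∀ a b,
      mean (fun x => S x a b * v x a * (-(w + w')) x b) =
        -(mean (fun x => S x a b * v x a * w x b) + mean fun x => S x a b * v x a * w' x b) := by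
    intro S v w w' hS hv hw hw' a b
    have c1 : ∀ {u : (Fin d → ℝ) → (Fin n → ℝ)}, Continuous u →
        Continuous fun x => S x a b * v x a * u x b := fun hu =>
      ((hS a b).mul ((continuous_apply a).comp hv)).mul ((continuous_apply b).comp hu)
    have e : (fun x => S x a b * v x a * (-(w + w')) x b) = fun x =>
        -1 * (S x a b * v x a * w x b + S x a b * v x a * w' x b) := by
      ext x
      simp only [Pi.neg_apply, Pi.add_apply]
      ring
    rw [e, mean_const_mul, mean_add (c1 hw) (c1 hw'), neg_one_mul]
  have hT : ∀ f : (Fin d → ℝ) → (Fin n → ℝ), Continuous (fourierMultiplier m f) := fun f =>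
    continuous_of_comp fun i => (isTrig_multiplier hm f i).toIsTorusFun
  unfold energyForm
  rw [multiplier_neg_add hm hf hg, ← Finset.sum_add_distrib, ← Finset.sum_neg_distrib]
  refine Finset.sum_congr rfl fun a _ => ?_
  rw [← Finset.sum_add_distrib, ← Finset.sum_neg_distrib]
  refine Finset.sum_congr rfl fun b _ => ?_
  rw [key hSa hz hf hg, key hSb (hT _) (hT _) (hT _)]
  ring

/-- The derivative of a matrix with polynomial entries at `u` in the direction `u'`. -/
def dirDeriv (S : Matrix (Fin n) (Fin n) (MvPolynomial (Fin n) ℝ)) (u u' : Fin n → ℝ) :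
    Matrix (Fin n) (Fin n) ℝ :=
  fun a b => ∑ i, MvPolynomial.eval u (MvPolynomial.pderiv i (S a b)) * u' i

theorem hasDerivAt_energyForm {N : ℕ} {m : (Fin d → ℤ) → ℝ} (hm : IsSymbol N m)
    (Sa Sb : Matrix (Fin n) (Fin n) (MvPolynomial (Fin n) ℝ)) {O : Set ℝ} (hO : IsOpen O)
    {U U' z z' : ℝ → (Fin d → ℝ) → (Fin n → ℝ)}
    (hU : ∀ i, IsTimeC1 O (fun t x => U t x i) fun t x => U' t x i)
    (hz : ∀ i, IsTimeC1 O (fun t x => z t x i) fun t x => z' t x i) {t : ℝ} (ht : t ∈ O) :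
    HasDerivAt (fun τ => energyForm (fun x => evalMat Sa (U τ x)) (fun x => evalMat Sb (U τ x)) m
        (z τ) (z τ))
      (energyForm (fun x => dirDeriv Sa (U t x) (U' t x)) (fun x => dirDeriv Sb (U t x) (U' t x)) m
          (z t) (z t) +
        energyForm (fun x => evalMat Sa (U t x)) (fun x => evalMat Sb (U t x)) m (z' t) (z t) +
        energyForm (fun x => evalMat Sa (U t x)) (fun x => evalMat Sb (U t x)) m (z t) (z' t)) t := by
  have key : ∀ (S : Matrix (Fin n) (Fin n) (MvPolynomial (Fin n) ℝ))
      {v v' : ℝ → (Fin d → ℝ) → (Fin n → ℝ)},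
      (∀ i, IsTimeC1 O (fun t x => v t x i) fun t x => v' t x i) → ∀ a b,
      HasDerivAt (fun τ => mean fun x => evalMat S (U τ x) a b * v τ x a * v τ x b)
        (mean (fun x => dirDeriv S (U t x) (U' t x) a b * v t x a * v t x b) +
          mean (fun x => evalMat S (U t x) a b * v' t x a * v t x b) +
          mean (fun x => evalMat S (U t x) a b * v t x a * v' t x b)) t := by
    intro S v v' hv a b
    have hS := IsTimeC1.eval hU (S a b)
    have h1 := (hS.mul (hv a)).mul (hv b)
    have c1 := ((hS.continuous' t ht).fun_mul ((hv a).continuous t ht)).fun_mul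
      ((hv b).continuous t ht)
    have c2 := ((hS.continuous t ht).fun_mul ((hv a).continuous' t ht)).fun_mul
      ((hv b).continuous t ht)
    have c3 := ((hS.continuous t ht).fun_mul ((hv a).continuous t ht)).fun_mul
      ((hv b).continuous' t ht)
    have h2 := h1.hasDerivAt_mean hO ht
    simp only [add_mul] at h2
    rw [mean_add (c1.fun_add c2) c3, mean_add c1 c2] at h2
    exact h2
  have hT := fun i => IsTimeC1.multiplier hO hm hz i
  have h := HasDerivAt.fun_sum (u := Finset.univ) fun a _ =>
    HasDerivAt.fun_sum (u := Finset.univ) fun b _ => (key Sa hz a b).fun_add (key Sb hT a b)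
  refine h.congr_deriv ?_
  unfold energyForm
  simp only [← Finset.sum_add_distrib]
  exact Finset.sum_congr rfl fun a _ => Finset.sum_congr rfl fun b _ => by ring

theorem isTrig_linOp {σ : (Fin d → ℝ) → ℝ} (hσ : IsFilterProfile σ) {N : ℕ} (hN : 1 ≤ N)
    (A : Fin d → Matrix (Fin n) (Fin n) ℝ) (B : Fin d → (Fin d → ℝ) → Matrix (Fin n) (Fin n) ℝ)
    {z : (Fin d → ℝ) → (Fin n → ℝ)} (hz : ∀ i, IsTrig N (comp z i)) (b : Fin n) :
    IsTrig N (comp (linOp A B σ N z) b) := by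
  rw [comp_linOp]
  exact IsTrig.sum fun j _ => (IsTrig.sum fun c _ => IsTrig.const_mul _
    (isTrig_partialDeriv (contDiff_of_isTrig hz) hz j c)).add
    (isTrig_multiplier (isSymbol_filterSymbol hσ hN) _ b)

theorem IsTrig.comp_sub {N : ℕ} {f g : (Fin d → ℝ) → (Fin n → ℝ)} {i : Fin n}
    (hf : IsTrig N (comp f i)) (hg : IsTrig N (comp g i)) : IsTrig N (comp (f - g) i) := by
  have : comp (f - g) i = fun x => comp f i x - comp g i x := by ext x; simp [comp]
  rw [this]
  exact hf.sub hg

/-- The energy inequality: the time derivative of the energy of the error `V - Θ U` is bounded by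
the energy and the square of the consistency error.  The expression on the left is the derivative
given by `hasDerivAt_energyForm`. -/
theorem IsSplitting.exists_energy_deriv_le {σ : (Fin d → ℝ) → ℝ} (hσ : IsFilterProfile σ) {s : ℝ}
    (hs : (d : ℝ) / 2 + 1 < s) {A : Fin d → Matrix (Fin n) (Fin n) (MvPolynomial (Fin n) ℝ)}
    {Aa : Fin d → Matrix (Fin n) (Fin n) ℝ}
    {Ab : Fin d → Matrix (Fin n) (Fin n) (MvPolynomial (Fin n) ℝ)}
    {Sa Sb : Matrix (Fin n) (Fin n) (MvPolynomial (Fin n) ℝ)} {𝒰 : Set (Fin n → ℝ)}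
    (hA : IsSplitting A Aa Ab Sa Sb 𝒰 σ) {R : ℝ≥0∞} (hR : R < ⊤) :
    ∃ K : ℝ, 0 ≤ K ∧ ∀ N : ℕ, 1 ≤ N → ∀ U V : (Fin d → ℝ) → (Fin n → ℝ), MemHs s U →
      ContDiff ℝ 1 U → (∀ x, U x ∈ 𝒰) → (∀ i, wn (comp U i) ≤ R) → (∀ i, IsTrig N (comp V i)) →
      (∀ i, wn (comp V i) ≤ R) → ∀ z z' : (Fin d → ℝ) → (Fin n → ℝ),
      z = V - fourierMultiplier (lowSymbol σ N) U →
      z' = -(schemeOp Aa Ab σ N V - fourierMultiplier (lowSymbol σ N) (hypOp A U)) →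
      |energyForm (fun x => dirDeriv Sa (U x) (-hypOp A U x))
          (fun x => dirDeriv Sb (U x) (-hypOp A U x)) (sqrtSymbol σ N) z z +
        energyForm (fun x => evalMat Sa (U x)) (fun x => evalMat Sb (U x)) (sqrtSymbol σ N) z' z +
        energyForm (fun x => evalMat Sa (U x)) (fun x => evalMat Sb (U x)) (sqrtSymbol σ N) z z'| ≤
      K * (∑ i, mean (fun x => z x i ^ 2) + (N : ℝ) ^ (-(2 * s)) * (hs2 s U).toReal) := by
  obtain ⟨C₁, hC₁, hres⟩ := exists_l2n_residual_le hσ hs hA.eq_add hR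
  obtain ⟨Ra, hRa, hwa⟩ := exists_bound_forall (ι := Fin n × Fin n)
    (P := fun q C => ∀ U : (Fin d → ℝ) → (Fin n → ℝ), (∀ i, IsWiener (comp U i)) →
      (∀ i, wn (comp U i) ≤ R) → wn (polyComp (Sa q.1 q.2) U) ≤ C)
    (fun q a b hab h U h1 h2 => (h U h1 h2).trans hab) fun q => exists_wn_polyComp_le _ hR
  obtain ⟨Rb, hRb, hwb⟩ := exists_bound_forall (ι := Fin n × Fin n)
    (P := fun q C => ∀ U : (Fin d → ℝ) → (Fin n → ℝ), (∀ i, IsWiener (comp U i)) →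
      (∀ i, wn (comp U i) ≤ R) → wn (polyComp (Sb q.1 q.2) U) ≤ C)
    (fun q a b hab h U h1 h2 => (h U h1 h2).trans hab) fun q => exists_wn_polyComp_le _ hR
  obtain ⟨Rc, hRc, hwc⟩ := exists_bound_forall (ι := Fin d × Fin n × Fin n)
    (P := fun q C => ∀ U : (Fin d → ℝ) → (Fin n → ℝ), (∀ i, IsWiener (comp U i)) →
      (∀ i, wn (comp U i) ≤ R) → wn (polyComp (Ab q.1 q.2.1 q.2.2) U) ≤ C)
    (fun q a b hab h U h1 h2 => (h U h1 h2).trans hab) fun q => exists_wn_polyComp_le _ hR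
  set R₁ : ℝ≥0∞ := Ra + Rb + Rc + ∑ j, ∑ a, ∑ b, ‖((Aa j a b : ℝ) : ℂ)‖ₑ
  have hR₁ : R₁ < ⊤ := by
    refine ENNReal.add_lt_top.2 ⟨by finiteness, ?_⟩
    exact ENNReal.sum_lt_top.2 fun j _ => ENNReal.sum_lt_top.2 fun a _ =>
      ENNReal.sum_lt_top.2 fun b _ => enorm_lt_top
  obtain ⟨C₂, hC₂, hen⟩ := exists_abs_energyForm_linOp_le (d := d) (n := n) hσ hR₁
  obtain ⟨C₃, hC₃, hhyp⟩ := exists_abs_hypOp_le A hR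
  obtain ⟨C₄, hC₄, hpa⟩ := exists_real_bound_forall (ι := Fin n × Fin n × Fin n)
    (P := fun q D => ∀ v : Fin n → ℝ, ‖v‖ ≤ R.toReal →
      |MvPolynomial.eval v (MvPolynomial.pderiv q.1 (Sa q.2.1 q.2.2))| ≤ D)
    (fun q a b hab h v hv => (h v hv).trans hab) fun q => exists_abs_eval_le _ _
  obtain ⟨C₅, hC₅, hpb⟩ := exists_real_bound_forall (ι := Fin n × Fin n × Fin n)
    (P := fun q D => ∀ v : Fin n → ℝ, ‖v‖ ≤ R.toReal →
      |MvPolynomial.eval v (MvPolynomial.pderiv q.1 (Sb q.2.1 q.2.2))| ≤ D)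
    (fun q a b hab h v hv => (h v hv).trans hab) fun q => exists_abs_eval_le _ _
  set D : ℝ := n * ((C₄ + C₅) * C₃)
  refine ⟨2 * n * D * 2 + 2 * (C₂ + 2 * n * R₁.toReal * (1 + C₁.toReal)), by positivity,
    fun N hN U V hU hU1 hUK hUR hV hVR z z' hzdef hzdef' => ?_⟩
  have hUw : ∀ i, IsWiener (comp U i) := hU.isWiener hs
  have hθ := isSymbol_lowSymbol hσ hN
  have hm := isSymbol_sqrtSymbol hσ hN
  have hm1 := sqrtSymbol_mem_Icc hσ N
  have hz : ∀ i, IsTrig N (comp z i) := fun i => by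
    rw [hzdef]; exact (hV i).comp_sub (isTrig_multiplier hθ U i)
  set m := sqrtSymbol σ N
  set Z := ∑ i, mean fun x => z x i ^ 2
  set δ := (N : ℝ) ^ (-(2 * s)) * (hs2 s U).toReal
  have hδ : 0 ≤ δ := by positivity
  have hZ : 0 ≤ Z := Finset.sum_nonneg fun i _ => mean_nonneg fun x => sq_nonneg _
  have hzc : Continuous z := continuous_of_comp fun i => (hz i).toIsTorusFun
  have hcS : ∀ (S : Matrix (Fin n) (Fin n) (MvPolynomial (Fin n) ℝ)) a b,
      Continuous fun x => evalMat S (U x) a b := fun S a b =>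
    (MvPolynomial.continuous_eval _).comp hU.continuous
  have hux : ∀ x, ‖U x‖ ≤ R.toReal := fun x =>
    (pi_norm_le_iff_of_nonneg ENNReal.toReal_nonneg).2 fun c => (hUw c).abs_le hR (hUR c) x
  set lin := linOp Aa (fun j x => evalMat (Ab j) (U x)) σ N z
  set res := residual A Aa Ab σ N U V
  have hlin : ∀ i, IsTrig N (comp lin i) := isTrig_linOp hσ hN _ _ hz
  have hrt : ∀ i, IsTrig N (comp res i) := fun i => by
    refine ((isTrig_linOp hσ hN _ _ hV i).comp_sub (isTrig_multiplier hθ _ i)).comp_sub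
      (isTrig_linOp hσ hN _ _ (fun i => ?_) i)
    exact (hV i).comp_sub (isTrig_multiplier hθ U i)
  -- The error solves the scheme linearized at `U`, with the residual as source term.
  have hz' : z' = -(lin + res) := by
    rw [hzdef', show res = schemeOp Aa Ab σ N V - fourierMultiplier (lowSymbol σ N) (hypOp A U) -
      lin by simp only [res, lin, residual, hzdef], add_sub_cancel]
  have hsymm := energyForm_symm (Sa := fun x => evalMat Sa (U x)) (Sb := fun x => evalMat Sb (U x))
    (fun x => hA.symm_a _ (hUK x)) (fun x => hA.symm_b _ (hUK x)) m z' z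
  rw [hsymm, hz', energyForm_neg_add_right hm (hcS Sa) (hcS Sb) hzc
    (continuous_of_comp fun i => (hlin i).toIsTorusFun)
    (continuous_of_comp fun i => (hrt i).toIsTorusFun)]
  have hea : ∀ a b, wn (polyComp (Sa a b) U) ≤ R₁ := fun a b => (hwa ⟨a, b⟩ U hUw hUR).trans
    (by simp only [R₁, add_assoc]; exact le_self_add)
  have heb : ∀ a b, wn (polyComp (Sb a b) U) ≤ R₁ := fun a b => (hwb ⟨a, b⟩ U hUw hUR).trans
    (by simp only [R₁, add_assoc]; exact le_self_add.trans le_add_self)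
  -- The linearized operator is skew-symmetric for the energy form up to bounded terms.
  have b1 : |energyForm (fun x => evalMat Sa (U x)) (fun x => evalMat Sb (U x)) m z lin| ≤
      C₂ * Z := by
    refine hen N hN _ _ Aa _ (fun a b => ?_) (fun a b => ?_) (fun j a b => ?_) (fun j a b => ?_)
      (fun j x => hA.symm_aa j _ (hUK x)) (fun j x => hA.symm_ab j _ (hUK x))
      (fun j x => hA.symm_bb j _ (hUK x)) z hz
    · rw [entries_evalMat]; exact ⟨isWiener_polyComp _ hUw, hea a b⟩
    · rw [entries_evalMat]; exact ⟨isWiener_polyComp _ hUw, heb a b⟩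
    · refine le_trans ?_ (le_add_self : _ ≤ R₁)
      refine (Finset.single_le_sum (f := fun b => ‖((Aa j a b : ℝ) : ℂ)‖ₑ) (fun _ _ => by simp)
        (Finset.mem_univ b)).trans ((Finset.single_le_sum (f := fun a => ∑ b,
          ‖((Aa j a b : ℝ) : ℂ)‖ₑ) (fun _ _ => by simp) (Finset.mem_univ a)).trans
          (Finset.single_le_sum (f := fun j => ∑ a, ∑ b, ‖((Aa j a b : ℝ) : ℂ)‖ₑ)
            (fun _ _ => by simp) (Finset.mem_univ j)))
    · rw [entries_evalMat]
      refine ⟨isWiener_polyComp _ hUw, (hwc ⟨j, a, b⟩ U hUw hUR).trans ?_⟩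
      exact le_add_self.trans le_self_add
  have hev : ∀ (S : Matrix (Fin n) (Fin n) (MvPolynomial (Fin n) ℝ)),
      (∀ a b, wn (polyComp (S a b) U) ≤ R₁) → ∀ a b x, |evalMat S (U x) a b| ≤ R₁.toReal := by
    intro S h a b x
    have := ((isWiener_polyComp (S a b) hUw).norm_le x).trans (ENNReal.toReal_mono hR₁.ne (h a b))
    simpa [polyComp, evalMat] using this
  have b2 : |energyForm (fun x => evalMat Sa (U x)) (fun x => evalMat Sb (U x)) m z res| ≤
      2 * n * R₁.toReal * (Z + C₁.toReal * (Z + δ)) := by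
    refine (abs_energyForm_le hm hm1 ENNReal.toReal_nonneg (hcS Sa) (hev Sa hea) (hcS Sb)
      (hev Sb heb) hz hrt).trans ?_
    gcongr
    have h1 := hres N hN U V hU hU1 hUR hV hVR
    rw [← hzdef, sum_l2n_eq hrt, sum_l2n_eq hz] at h1
    have h2 : ENNReal.ofReal ((N : ℝ) ^ (-(2 * s))) * hs2 s U = ENNReal.ofReal δ := by
      rw [ENNReal.ofReal_mul (by positivity),
        ENNReal.ofReal_toReal (hsNorm_lt_top_iff.1 hU.norm_lt_top).ne]
    rw [h2, ← ENNReal.ofReal_add hZ hδ, ← ENNReal.ofReal_toReal hC₁.ne,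
      ← ENNReal.ofReal_mul ENNReal.toReal_nonneg] at h1
    exact (ENNReal.ofReal_le_ofReal_iff (by positivity)).1 h1
  -- The time derivative of the symmetrizer is bounded, since `∂_t U = -∑ A_j(U) ∂_j U` is.
  have hdd : ∀ (S : Matrix (Fin n) (Fin n) (MvPolynomial (Fin n) ℝ)) {C : ℝ}, C ≤ C₄ + C₅ →
      (∀ (q : Fin n × Fin n × Fin n) (v : Fin n → ℝ), ‖v‖ ≤ R.toReal →
        |MvPolynomial.eval v (MvPolynomial.pderiv q.1 (S q.2.1 q.2.2))| ≤ C) →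
      ∀ a b x, |dirDeriv S (U x) (-hypOp A U x) a b| ≤ D := by
    intro S C hC hS a b x
    have hD : ∑ _i : Fin n, (C₄ + C₅) * C₃ = D := by simp [D]
    refine (Finset.abs_sum_le_sum_abs _ _).trans ((Finset.sum_le_sum fun i _ => ?_).trans hD.le)
    rw [abs_mul, Pi.neg_apply, abs_neg]
    exact mul_le_mul ((hS ⟨i, a, b⟩ _ (hux x)).trans hC) (hhyp U hU1 hUw hUR x i) (abs_nonneg _)
      (by positivity)
  have hdc : ∀ (S : Matrix (Fin n) (Fin n) (MvPolynomial (Fin n) ℝ)) a b,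
      Continuous fun x => dirDeriv S (U x) (-hypOp A U x) a b := fun S a b =>
    continuous_finsetSum _ fun i _ => ((MvPolynomial.continuous_eval _).comp hU.continuous).mul
      ((continuous_apply i).comp (continuous_of_comp
        (isTorusFun_hypOp A hU1 hU.periodic)).neg)
  have b3 := abs_energyForm_le hm hm1 (R := D) (by positivity) (hdc Sa)
    (hdd Sa (le_add_of_nonneg_right hC₅) hpa) (hdc Sb) (hdd Sb (le_add_of_nonneg_left hC₄) hpb) hz hz
  refine (abs_add_le _ _).trans ((add_le_add ((abs_add_le _ _).trans (add_le_add b3 ?_)) ?_).trans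
    (b := 2 * n * D * (Z + Z) + (C₂ * Z + 2 * n * R₁.toReal * (Z + C₁.toReal * (Z + δ))) +
      (C₂ * Z + 2 * n * R₁.toReal * (Z + C₁.toReal * (Z + δ)))) ?_)
  · rw [abs_neg]
    exact (abs_add_le _ _).trans (add_le_add b1 b2)
  · rw [abs_neg]
    exact (abs_add_le _ _).trans (add_le_add b1 b2)
  · have hR0 : 0 ≤ R₁.toReal := ENNReal.toReal_nonneg
    have h1 : 0 ≤ 2 * n * D * 2 * δ := by positivity
    have h2 : 0 ≤ 2 * C₂ * δ := by positivity
    have h3 : 0 ≤ 2 * (2 * n * R₁.toReal) * δ := by positivity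
    nlinarith

/-! ### The error estimate on an interval -/

theorem le_exp_mul_of_abs_deriv_le_of_nonneg {f f' : ℝ → ℝ} {t C : ℝ} (ht : 0 ≤ t)
    (hf : ∀ τ ∈ Set.Icc 0 t, HasDerivAt f (f' τ) τ) (hf0 : ∀ τ ∈ Set.Icc 0 t, 0 ≤ f τ)
    (h : ∀ τ ∈ Set.Icc 0 t, |f' τ| ≤ C * f τ) : f t ≤ Real.exp (C * t) * f 0 := by
  have h1 := norm_le_gronwallBound_of_norm_deriv_right_le (f := f) (f' := f') (δ := f 0) (K := C)
    (ε := 0) (a := 0) (b := t) (fun τ hτ => (hf τ hτ).continuousAt.continuousWithinAt)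
    (fun τ hτ => (hf τ (Set.Ico_subset_Icc_self hτ)).hasDerivWithinAt)
    (by rw [Real.norm_of_nonneg (hf0 0 ⟨le_rfl, ht⟩)])
    (fun τ hτ => by
      have hτ' := Set.Ico_subset_Icc_self hτ
      rw [Real.norm_of_nonneg (hf0 τ hτ'), add_zero]
      exact h τ hτ') t ⟨ht, le_rfl⟩
  rw [gronwallBound_ε0, sub_zero, Real.norm_of_nonneg (hf0 t ⟨ht, le_rfl⟩)] at h1
  linarith

theorem le_exp_mul_of_abs_deriv_le {f f' : ℝ → ℝ} {t C : ℝ}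
    (hf : ∀ τ ∈ Set.uIcc 0 t, HasDerivAt f (f' τ) τ) (hf0 : ∀ τ ∈ Set.uIcc 0 t, 0 ≤ f τ)
    (h : ∀ τ ∈ Set.uIcc 0 t, |f' τ| ≤ C * f τ) : f t ≤ Real.exp (C * |t|) * f 0 := by
  rcases le_total 0 t with ht | ht
  · rw [Set.uIcc_of_le ht] at hf hf0 h
    rw [abs_of_nonneg ht]
    exact le_exp_mul_of_abs_deriv_le_of_nonneg ht hf hf0 h
  · rw [Set.uIcc_of_ge ht] at hf hf0 h
    rw [abs_of_nonpos ht]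
    have hmem : ∀ τ ∈ Set.Icc 0 (-t), -τ ∈ Set.Icc t 0 := fun τ hτ =>
      ⟨by linarith [hτ.2], by linarith [hτ.1]⟩
    have := le_exp_mul_of_abs_deriv_le_of_nonneg (f := fun τ => f (-τ)) (f' := fun τ => -f' (-τ))
      (t := -t) (C := C) (by linarith)
      (fun τ hτ => by
        have := (hf _ (hmem τ hτ)).scomp τ (hasDerivAt_neg τ)
        simpa using! this)
      (fun τ hτ => hf0 _ (hmem τ hτ)) (fun τ hτ => by rw [abs_neg]; exact h _ (hmem τ hτ))
    simpa using this

/-- Continuity argument: a bound that improves itself on every interval issued from `0` holds. -/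
theorem lt_of_bootstrap {J : Set ℝ} (hJ : J.OrdConnected) (h0 : (0 : ℝ) ∈ J) {φ : ℝ → ℝ} {η : ℝ}
    (hφ : ContinuousOn φ J) (hφ0 : φ 0 < η)
    (h : ∀ t ∈ J, (∀ τ ∈ Set.uIcc 0 t, φ τ ≤ η) → φ t < η) : ∀ t ∈ J, φ t < η := by
  intro t ht
  by_contra! hcon
  have hmem : ∀ r ∈ Set.Icc (0 : ℝ) 1, r * t ∈ J := fun r hr => by
    refine hJ.uIcc_subset h0 ht ?_
    rw [← segment_eq_uIcc, segment_eq_image]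
    exact ⟨r, hr, by simp⟩
  set g : ℝ → ℝ := fun r => φ (r * t)
  have hg : ContinuousOn g (Set.Icc 0 1) :=
    hφ.comp (continuous_id.mul continuous_const).continuousOn hmem
  have hclosed : IsClosed (Set.Icc (0 : ℝ) 1 ∩ g ⁻¹' Set.Ici η) :=
    hg.preimage_isClosed_of_isClosed isClosed_Icc isClosed_Ici
  obtain ⟨r, hr⟩ := (isCompact_Icc.of_isClosed_subset hclosed Set.inter_subset_left).exists_isLeast
    ⟨1, ⟨zero_le_one, le_rfl⟩, by simpa [g] using hcon⟩
  have hr1 := hr.1.1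
  have hg0 : g 0 < η := by simpa [g] using hφ0
  -- at the first time when the bound is reached, it is an equality
  have hgr : g r = η := by
    obtain ⟨q, hq, hgq⟩ := intermediate_value_Icc hr1.1
      (hg.mono (Set.Icc_subset_Icc le_rfl hr1.2)) ⟨hg0.le, hr.1.2⟩
    have : r ≤ q := hr.2 ⟨⟨hq.1, hq.2.trans hr1.2⟩, hgq.ge⟩
    rw [le_antisymm this hq.2, hgq]
  refine (h _ (hmem r hr1) fun τ hτ => ?_).ne hgr
  rw [← segment_eq_uIcc, segment_eq_image] at hτ
  obtain ⟨q, hq, rfl⟩ := hτ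
  have hle : q * r ≤ r := mul_le_of_le_one_left hr1.1 hq.2
  have he : (1 - q) • (0 : ℝ) + q • (r * t) = q * r * t := by simp [mul_assoc]
  change φ ((1 - q) • (0 : ℝ) + q • (r * t)) ≤ η
  rw [he]
  rcases hle.eq_or_lt with h1 | h1
  · rw [h1]; exact hgr.le
  · by_contra! hcon'
    exact h1.not_ge (hr.2 ⟨⟨mul_nonneg hq.1 hr1.1, hle.trans hr1.2⟩, hcon'.le⟩)

open Classical in
/-- The symbol of the sharp low-pass filter. -/
def sharpSymbol (d N : ℕ) (k : Fin d → ℤ) : ℝ := if ∀ j, |k j| ≤ (N : ℤ) then 1 else 0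

theorem sharpFilter_eq (N : ℕ) (f : (Fin d → ℝ) → (Fin n → ℝ)) :
    sharpFilter N f = fourierMultiplier (sharpSymbol d N) f := rfl

theorem sharpSymbol_eq_one {N : ℕ} {k : Fin d → ℤ} (hk : k ∈ box d N) : sharpSymbol d N k = 1 :=
  if_pos (mem_box.1 hk)

theorem sharpSymbol_eq_zero {N : ℕ} {k : Fin d → ℤ} (hk : k ∉ box d N) : sharpSymbol d N k = 0 :=
  if_neg fun h => hk (mem_box.2 h)

theorem isSymbol_sharpSymbol (d N : ℕ) : IsSymbol N (sharpSymbol d N) :=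
  ⟨fun k => by simp [sharpSymbol], fun _ hk => sharpSymbol_eq_zero hk⟩

theorem sharpSymbol_mem_Icc (d N : ℕ) (k : Fin d → ℤ) : sharpSymbol d N k ∈ Set.Icc (0 : ℝ) 1 := by
  by_cases hk : k ∈ box d N
  · rw [sharpSymbol_eq_one hk]; simp
  · rw [sharpSymbol_eq_zero hk]; simp

/-- The sharp and the smooth low-pass filters only differ at high frequencies. -/
theorem sum_l2n_sharp_sub_low_le {σ : (Fin d → ℝ) → ℝ} (hσ : IsFilterProfile σ) {N : ℕ}
    (hN : 1 ≤ N) {s : ℝ} (hs : 0 ≤ s) (f : (Fin d → ℝ) → (Fin n → ℝ)) :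
    ∑ i, l2n (comp (sharpFilter N f - fourierMultiplier (lowSymbol σ N) f) i) ≤
      ENNReal.ofReal (4 ^ (2 * s)) * (ENNReal.ofReal ((N : ℝ) ^ (-(2 * s))) * hs2 s f) := by
  have hm := isSymbol_lowSymbol hσ hN
  have hm' := isSymbol_sharpSymbol d N
  have hfc : ∀ k i, fc (comp (sharpFilter N f - fourierMultiplier (lowSymbol σ N) f) i) k =
      ((sharpSymbol d N k - lowSymbol σ N k : ℝ) : ℂ) * fc (comp f i) k := by
    intro k i
    rw [sharpFilter_eq, fc_comp_sub
      (continuous_of_comp fun i => (isTrig_multiplier hm' f i).toIsTorusFun)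
      (continuous_of_comp fun i => (isTrig_multiplier hm f i).toIsTorusFun), fc_multiplier hm,
      fc_multiplier hm']
    push_cast
    ring
  have h := hs2_le_of_fc_eq_zero (r := 0) (s := s) (ρ := (N : ℝ) / 4) hs (by positivity)
    (f := sharpFilter N f - fourierMultiplier (lowSymbol σ N) f) (g := f) (fun k i => ?_)
    fun k i hk => ?_
  · rw [ofReal_div_rpow hN (by norm_num), hs2_zero, mul_assoc] at h
    rwa [show -(2 * (0 - s)) = 2 * s by ring, show 2 * (0 - s) = -(2 * s) by ring] at h
  · rw [hfc, enorm_mul]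
    refine mul_le_of_le_one_left (by simp) ?_
    have h1 := lowSymbol_mem_Icc hσ N k
    have h2 := sharpSymbol_mem_Icc d N k
    rw [← ofReal_norm, Complex.norm_real, Real.norm_eq_abs, ← ENNReal.ofReal_one]
    refine ENNReal.ofReal_le_ofReal (abs_le.2 ⟨?_, ?_⟩) <;> linarith [h1.1, h1.2, h2.1, h2.2]
  · have hN0 : (0 : ℝ) < N := by exact_mod_cast hN
    rw [hfc, lowSymbol_eq_one hσ hN hk.le, sharpSymbol_eq_one (mem_box_iff_norm_le.2 (by linarith))]
    simp

theorem wn_multiplier_le {N : ℕ} {m : (Fin d → ℤ) → ℝ} (hm : IsSymbol N m)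
    (hm1 : ∀ k, m k ∈ Set.Icc (0 : ℝ) 1) (f : (Fin d → ℝ) → (Fin n → ℝ)) (i : Fin n) :
    wn (comp (fourierMultiplier m f) i) ≤ wn (comp f i) := by
  refine ENNReal.tsum_le_tsum fun k => ?_
  rw [fc_multiplier hm, enorm_mul]
  gcongr
  refine mul_le_of_le_one_left (by simp) ?_
  rw [← ofReal_norm, Complex.norm_real, Real.norm_eq_abs, abs_of_nonneg (hm1 k).1,
    ← ENNReal.ofReal_one]
  exact ENNReal.ofReal_le_ofReal (hm1 k).2

theorem multiplier_neg (m : (Fin d → ℤ) → ℝ) (f : (Fin d → ℝ) → (Fin n → ℝ)) :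
    fourierMultiplier m (fun x => -f x) = -fourierMultiplier m f := by
  have h : ∀ k i, coeff (fun x => -f x) k i = -coeff f k i := fun k i => by
    rw [coeff_eq_fc, coeff_eq_fc, ← fc_neg]
    congr 1
    ext x
    simp [comp]
  ext x i
  simp [fourierMultiplier, h, tsum_neg]

/-- A priori estimate.  The error `V - Θ U` is `O(N^{-s})` in `L²` on every bounded interval of times
on which the exact solution is controlled; moreover `V` stays bounded by `R` there.  It is enough
that `V` solves the scheme as long as it is bounded by `R`. -/
theorem IsSplitting.exists_error_le {σ : (Fin d → ℝ) → ℝ} (hσ : IsFilterProfile σ) {s : ℝ}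
    (hs : (d : ℝ) / 2 + 1 < s) {A : Fin d → Matrix (Fin n) (Fin n) (MvPolynomial (Fin n) ℝ)}
    {Aa : Fin d → Matrix (Fin n) (Fin n) ℝ}
    {Ab : Fin d → Matrix (Fin n) (Fin n) (MvPolynomial (Fin n) ℝ)}
    {Sa Sb : Matrix (Fin n) (Fin n) (MvPolynomial (Fin n) ℝ)} {𝒰 : Set (Fin n → ℝ)}
    (hA : IsSplitting A Aa Ab Sa Sb 𝒰 σ) (L M : ℝ) {K : Set (Fin n → ℝ)} (hK : IsCompact K)
    (hKU : K ⊆ 𝒰) :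
    ∃ (N₀ : ℕ) (C : ℝ) (R : ℝ≥0∞), 1 ≤ N₀ ∧ 0 < C ∧ R < ⊤ ∧
      ∀ (u₀ : (Fin d → ℝ) → (Fin n → ℝ)) (I : Set ℝ) (U : ℝ → (Fin d → ℝ) → (Fin n → ℝ)),
        IsClassicalSolution s (hypOp A) u₀ I U →
      ∀ (J O : Set ℝ), J.OrdConnected → 0 ∈ J → J ⊆ O → IsOpen O → O ⊆ I → (∀ t ∈ J, |t| ≤ L) →
      ∀ D : ℝ, D ≤ M ^ 2 → (∀ t ∈ J, (hs2 s (U t)).toReal ≤ D) → (∀ t ∈ J, ∀ x, U t x ∈ K) →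
      ∀ N : ℕ, N₀ ≤ N → ∀ V V' : ℝ → (Fin d → ℝ) → (Fin n → ℝ),
        (∀ i, IsTimeC1 O (fun t x => V t x i) fun t x => V' t x i) →
        (∀ t ∈ O, ∀ i, IsTrig N (comp (V t) i)) → V 0 = sharpFilter N u₀ →
        (∀ t ∈ O, (∀ i, wn (comp (V t) i) ≤ R) → V' t = -schemeOp Aa Ab σ N (V t)) →
        ∀ t ∈ J, (∀ i, wn (comp (V t) i) < R) ∧
          ∑ i, l2n (comp (V t - fourierMultiplier (lowSymbol σ N) (U t)) i) ≤
            ENNReal.ofReal (C * ((N : ℝ) ^ (-(2 * s)) * D)) := by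
  have hs0 : 0 < s := by have : (0 : ℝ) ≤ d := Nat.cast_nonneg d; linarith
  obtain ⟨C₀, hC₀, hwn⟩ := exists_wn_sq_le (d := d) (n := n) hs
  obtain ⟨c, hc, hcoer⟩ := hA.coercive K hKU hK
  -- `R₀` bounds the Wiener norm of the exact solution, and `R` that of the numerical one with room
  -- to spare.
  set R₀ : ℝ≥0∞ := C₀ * ENNReal.ofReal (M ^ 2) + 1
  have hR₀ : R₀ < ⊤ := by finiteness
  set R : ℝ≥0∞ := R₀ + 2
  have hR : R < ⊤ := by finiteness
  obtain ⟨K₁, hK₁, hderiv⟩ := hA.exists_energy_deriv_le hσ hs hR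
  obtain ⟨R₁, hR₁, hSa⟩ := exists_real_bound_forall (ι := Fin n × Fin n)
    (P := fun q D => ∀ v : Fin n → ℝ, ‖v‖ ≤ R.toReal → |MvPolynomial.eval v (Sa q.1 q.2)| ≤ D)
    (fun q a b hab h v hv => (h v hv).trans hab) fun q => exists_abs_eval_le _ _
  obtain ⟨R₂, hR₂, hSb⟩ := exists_real_bound_forall (ι := Fin n × Fin n)
    (P := fun q D => ∀ v : Fin n → ℝ, ‖v‖ ≤ R.toReal → |MvPolynomial.eval v (Sb q.1 q.2)| ≤ D)
    (fun q a b hab h v hv => (h v hv).trans hab) fun q => exists_abs_eval_le _ _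
  set K₂ : ℝ := 2 * n * (R₁ + R₂) * 2
  have hK₂ : 0 ≤ K₂ := by positivity
  set K₃ : ℝ := 4 ^ (2 * s)
  have hK₃ : 0 < K₃ := by positivity
  set C : ℝ := Real.exp (K₁ / c * L) * (K₂ * K₃ + c) / c + K₃
  have hC : 0 < C := by positivity
  -- `N₀` makes the error estimate stronger than the bootstrap assumption `φ ≤ η` below, which is
  -- possible because `2 s > d + 2`.
  have hp : 0 < 2 * s - (d + 2) := by linarith
  obtain ⟨N₁, hN₁⟩ : ∃ N₁ : ℕ, ∀ N : ℕ, N₁ ≤ N →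
      4 * 3 ^ d * (C * M ^ 2) < (N : ℝ) ^ (2 * s - (d + 2)) :=
    eventually_atTop.1 (((tendsto_rpow_atTop hp).comp
      tendsto_natCast_atTop_atTop).eventually_gt_atTop _)
  refine ⟨max N₁ 1, C, R, le_max_right _ _, hC, hR, ?_⟩
  intro u₀ I U hU J O hJ h0 hJO hO hOI hJL D hDM hD hUK N hN V V' hV hVt hV0 hVs
  have hN1 : 1 ≤ N := (le_max_right _ _).trans hN
  have hNN : N₁ ≤ N := (le_max_left _ _).trans hN
  have hN0 : (0 : ℝ) < N := by exact_mod_cast hN1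
  have hD0 : 0 ≤ D := ENNReal.toReal_nonneg.trans (hD 0 h0)
  have hm := isSymbol_sqrtSymbol hσ hN1
  have hm1 := sqrtSymbol_mem_Icc hσ N
  have hθ := isSymbol_lowSymbol hσ hN1
  set z : ℝ → (Fin d → ℝ) → (Fin n → ℝ) := fun t => V t - fourierMultiplier (lowSymbol σ N) (U t)
  set z' : ℝ → (Fin d → ℝ) → (Fin n → ℝ) := fun t =>
    V' t - fourierMultiplier (lowSymbol σ N) fun x => -hypOp A (U t) x
  have hUC : ∀ i, IsTimeC1 O (fun t x => U t x i) fun t x => -hypOp A (U t) x i := fun i =>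
    (hU.isTimeC1 hs i).mono hOI
  have hzC : ∀ i, IsTimeC1 O (fun t x => z t x i) fun t x => z' t x i := fun i =>
    (hV i).sub (IsTimeC1.multiplier hO hθ hUC i)
  have hzt : ∀ t ∈ O, ∀ i, IsTrig N (comp (z t) i) := fun t ht i =>
    (hVt t ht i).comp_sub (isTrig_multiplier hθ _ i)
  set φ : ℝ → ℝ := fun t => ∑ i, mean fun x => z t x i ^ 2
  have hφ0 : ∀ t, 0 ≤ φ t := fun t => Finset.sum_nonneg fun i _ => mean_nonneg fun x => sq_nonneg _
  have hφl : ∀ t ∈ O, ∑ i, l2n (comp (z t) i) = ENNReal.ofReal (φ t) := fun t ht =>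
    sum_l2n_eq (hzt t ht)
  have hφc : ContinuousOn φ J := fun t ht => by
    refine ContinuousAt.continuousWithinAt (tendsto_finsetSum _ fun i _ => ?_)
    have h1 := ((hzC i).mul (hzC i)).hasDerivAt_mean hO (hJO ht)
    simp only [← pow_two] at h1
    exact h1.continuousAt
  set δ : ℝ := (N : ℝ) ^ (-(2 * s)) * D
  have hδ : 0 ≤ δ := by positivity
  set η : ℝ := (4 * 3 ^ d * (N : ℝ) ^ (d + 2))⁻¹
  have hη : 0 < η := by positivity
  have hCδ : C * δ < η := by
    have h1 := hN₁ N hNN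
    have ha : (0 : ℝ) < (N : ℝ) ^ (2 * s) := by positivity
    have hb : (0 : ℝ) < (N : ℝ) ^ (d + 2) := by positivity
    have e : (N : ℝ) ^ ((d : ℝ) + 2) = (N : ℝ) ^ (d + 2) := by
      rw [← Real.rpow_natCast]; push_cast; rfl
    rw [Real.rpow_sub hN0, e, lt_div_iff₀ hb] at h1
    have h2 : C * δ = C * D / (N : ℝ) ^ (2 * s) := by
      simp only [δ]
      rw [Real.rpow_neg hN0.le]
      field_simp
    rw [h2, div_lt_iff₀ ha]
    simp only [η]
    rw [inv_mul_eq_div, lt_div_iff₀ (by positivity)]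
    refine lt_of_le_of_lt ?_ h1
    have h3 : C * D ≤ C * M ^ 2 := by gcongr
    have h4 : (0 : ℝ) ≤ 4 * 3 ^ d * (N : ℝ) ^ (d + 2) := by positivity
    nlinarith [mul_le_mul_of_nonneg_right h3 h4]
  have hUR : ∀ t ∈ J, ∀ i, wn (comp (U t) i) ≤ R₀ := by
    intro t ht i
    have hfin := hsNorm_lt_top_iff.1 (hU.memHs t (hOI (hJO ht))).norm_lt_top
    have h1 : wn (comp (U t) i) ^ 2 ≤ C₀ * ENNReal.ofReal (M ^ 2) := by
      refine (hwn (U t) i).trans (mul_le_mul_right ?_ _)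
      rw [← ENNReal.ofReal_toReal hfin.ne]
      exact ENNReal.ofReal_le_ofReal ((hD t ht).trans hDM)
    rcases le_total (wn (comp (U t) i)) 1 with h | h
    · exact h.trans le_add_self
    · refine le_trans ?_ (h1.trans le_self_add)
      rw [pow_two]
      exact le_mul_of_one_le_left (by simp) h
  -- By Bernstein's inequality, an `L²` error below `η` is at most `1` in the Wiener norm, which keeps
  -- `V` in the region where it solves the scheme.
  have hVR : ∀ t ∈ J, φ t ≤ η → ∀ i, wn (comp (V t) i) < R := by
    intro t ht hφt i
    have hz1 : wn (comp (z t) i) ≤ 1 := by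
      have h1 := (hzt t (hJO ht) i).wn_sq_le
      have h2 : l2n (comp (z t) i) ≤ ENNReal.ofReal η :=
        (Finset.single_le_sum (f := fun i => l2n (comp (z t) i)) (fun _ _ => by simp)
          (Finset.mem_univ i)).trans ((hφl t (hJO ht)).le.trans (ENNReal.ofReal_le_ofReal hφt))
      have h3 : ((2 * N + 1) ^ d * (1 + N) ^ 2 : ℝ≥0∞) =
          ENNReal.ofReal ((2 * N + 1) ^ d * (1 + N) ^ 2) := by
        have : ((2 * N + 1) ^ d * (1 + N) ^ 2 : ℝ) =
          (((2 * N + 1) ^ d * (1 + N) ^ 2 : ℕ) : ℝ) := by push_cast; ring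
        rw [this, ENNReal.ofReal_natCast]
        push_cast
        ring
      have h4 : wn (comp (z t) i) ^ 2 ≤ 1 := by
        refine (h1.trans (mul_le_mul_right h2 _)).trans ?_
        rw [h3, ← ENNReal.ofReal_mul (by positivity), ← ENNReal.ofReal_one]
        refine ENNReal.ofReal_le_ofReal ?_
        simp only [η]
        rw [← div_eq_mul_inv, div_le_one (by positivity)]
        have hN1' : (1 : ℝ) ≤ N := by exact_mod_cast hN1
        calc ((2 * N + 1) ^ d * (1 + N) ^ 2 : ℝ) ≤ (3 * N) ^ d * (2 * N) ^ 2 := by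
              gcongr <;> linarith
          _ = _ := by rw [mul_pow]; ring
      by_contra! hlt
      exact (one_lt_pow₀ hlt two_ne_zero).not_ge h4
    have h3 : comp (V t) i = fun x =>
        comp (z t) i x + comp (fourierMultiplier (lowSymbol σ N) (U t)) i x := by
      ext x; simp [comp, z]
    rw [h3]
    calc _ ≤ wn (comp (z t) i) + wn (comp (fourierMultiplier (lowSymbol σ N) (U t)) i) :=
          wn_add_le (hzt t (hJO ht) i).continuous (isTrig_multiplier hθ _ i).continuous
      _ ≤ 1 + R₀ := add_le_add hz1
          ((wn_multiplier_le hθ (lowSymbol_mem_Icc hσ N) _ i).trans (hUR t ht i))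
      _ < R := by
          rw [add_comm]
          exact ENNReal.add_lt_add_left hR₀.ne (by norm_num)
  have hinit : φ 0 ≤ K₃ * δ := by
    have h1 := sum_l2n_sharp_sub_low_le hσ hN1 hs0.le u₀
    have hfin := hsNorm_lt_top_iff.1 (hU.memHs 0 hU.zero_mem).norm_lt_top
    have h2 := hD 0 h0
    rw [← hV0, ← hU.initial] at h1
    rw [hφl 0 (hJO h0), ← ENNReal.ofReal_toReal hfin.ne, ← ENNReal.ofReal_mul (by positivity),
      ← ENNReal.ofReal_mul (by positivity), ENNReal.ofReal_le_ofReal_iff (by positivity)] at h1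
    refine h1.trans ?_
    simp only [δ]
    gcongr
  -- Grönwall's inequality for the energy of the error, as long as `φ ≤ η`.
  have hstep : ∀ t ∈ J, (∀ τ ∈ Set.uIcc 0 t, φ τ ≤ η) → φ t ≤ C * δ := by
    intro t ht hφη
    have hsub : Set.uIcc 0 t ⊆ J := hJ.uIcc_subset h0 ht
    set E : ℝ → ℝ := fun τ => energyForm (fun x => evalMat Sa (U τ x))
      (fun x => evalMat Sb (U τ x)) (sqrtSymbol σ N) (z τ) (z τ)
    set E' : ℝ → ℝ := fun τ =>
      energyForm (fun x => dirDeriv Sa (U τ x) (-hypOp A (U τ) x))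
          (fun x => dirDeriv Sb (U τ x) (-hypOp A (U τ) x)) (sqrtSymbol σ N) (z τ) (z τ) +
        energyForm (fun x => evalMat Sa (U τ x)) (fun x => evalMat Sb (U τ x)) (sqrtSymbol σ N)
          (z' τ) (z τ) +
        energyForm (fun x => evalMat Sa (U τ x)) (fun x => evalMat Sb (U τ x)) (sqrtSymbol σ N)
          (z τ) (z' τ)
    have hE : ∀ τ ∈ Set.uIcc 0 t, HasDerivAt E (E' τ) τ := fun τ hτ =>
      hasDerivAt_energyForm hm Sa Sb hO (U' := fun τ x => -hypOp A (U τ) x) hUC hzC (hJO (hsub hτ))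
    have hcE : ∀ τ ∈ Set.uIcc 0 t, c * φ τ ≤ E τ := fun τ hτ =>
      hcoer N hN1 (U τ) (hU.memHs τ (hOI (hJO (hsub hτ)))).continuous (hUK τ (hsub hτ)) (z τ)
        (hzt τ (hJO (hsub hτ)))
    have hE'b : ∀ τ ∈ Set.uIcc 0 t, |E' τ| ≤ K₁ * (φ τ + δ) := by
      intro τ hτ
      have hτJ := hsub hτ
      have hτI := hOI (hJO hτJ)
      have hVτ := hVR τ hτJ (hφη τ hτ)
      have hz'τ : z' τ = -(schemeOp Aa Ab σ N (V τ) -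
          fourierMultiplier (lowSymbol σ N) (hypOp A (U τ))) := by
        simp only [z']
        rw [hVs τ (hJO hτJ) fun i => (hVτ i).le]
        rw [multiplier_neg, neg_sub, sub_neg_eq_add, neg_add_eq_sub]
      refine (hderiv N hN1 (U τ) (V τ) (hU.memHs τ hτI) (hU.contDiff τ hτI)
        (fun x => hKU (hUK τ hτJ x)) (fun i => (hUR τ hτJ i).trans le_self_add) (hVt τ (hJO hτJ))
        (fun i => (hVτ i).le) (z τ) (z' τ) rfl hz'τ).trans ?_
      gcongr
      simp only [δ]
      gcongr
      exact hD τ hτJ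
    have hgr := le_exp_mul_of_abs_deriv_le (f := fun τ => E τ + c * δ) (f' := E') (t := t)
      (C := K₁ / c) (fun τ hτ => (hE τ hτ).add_const _)
      (fun τ hτ => by
        have := hcE τ hτ
        have := mul_nonneg hc.le (hφ0 τ)
        have := mul_nonneg hc.le hδ
        linarith)
      (fun τ hτ => by
        refine (hE'b τ hτ).trans ?_
        rw [div_mul_eq_mul_div, le_div_iff₀ hc]
        nlinarith [hcE τ hτ])
    have hE0 : E 0 ≤ K₂ * φ 0 := by
      have hUw := (hU.memHs 0 hU.zero_mem).isWiener hs
      have hux : ∀ x, ‖U 0 x‖ ≤ R.toReal := fun x =>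
        (pi_norm_le_iff_of_nonneg ENNReal.toReal_nonneg).2 fun i =>
          (hUw i).abs_le hR ((hUR 0 h0 i).trans le_self_add) x
      have hcS : ∀ (S : Matrix (Fin n) (Fin n) (MvPolynomial (Fin n) ℝ)) a b,
          Continuous fun x => evalMat S (U 0 x) a b := fun S a b =>
        (MvPolynomial.continuous_eval _).comp (hU.memHs 0 hU.zero_mem).continuous
      have h1 := abs_energyForm_le hm hm1 (R := R₁ + R₂) (by positivity) (hcS Sa)
        (fun a b x => (hSa ⟨a, b⟩ _ (hux x)).trans (le_add_of_nonneg_right hR₂)) (hcS Sb)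
        (fun a b x => (hSb ⟨a, b⟩ _ (hux x)).trans (le_add_of_nonneg_left hR₁))
        (hzt 0 (hJO h0)) (hzt 0 (hJO h0))
      refine (le_abs_self _).trans (h1.trans (le_of_eq ?_))
      simp only [K₂, φ]
      ring
    have h1 := hcE t Set.right_mem_uIcc
    have h2 : Real.exp (K₁ / c * |t|) ≤ Real.exp (K₁ / c * L) := by
      gcongr
      exact hJL t ht
    have h3 : E 0 + c * δ ≤ (K₂ * K₃ + c) * δ := by nlinarith
    have h4 : c * φ t ≤ Real.exp (K₁ / c * L) * ((K₂ * K₃ + c) * δ) := by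
      have h5 : 0 ≤ (K₂ * K₃ + c) * δ := by positivity
      have h6 := mul_le_mul_of_nonneg_left h3 (Real.exp_pos (K₁ / c * |t|)).le
      have h7 := mul_le_mul_of_nonneg_right h2 h5
      have h8 := mul_nonneg hc.le hδ
      linarith
    have h5 : φ t ≤ Real.exp (K₁ / c * L) * ((K₂ * K₃ + c) * δ) / c := by
      rw [le_div_iff₀ hc]; linarith
    have h6 : Real.exp (K₁ / c * L) * ((K₂ * K₃ + c) * δ) / c =
      Real.exp (K₁ / c * L) * (K₂ * K₃ + c) / c * δ := by ring
    have h7 := mul_nonneg hK₃.le hδ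
    simp only [C, add_mul]
    linarith
  have hinitC : φ 0 ≤ C * δ := by
    have : 0 ≤ Real.exp (K₁ / c * L) * (K₂ * K₃ + c) / c * δ := by positivity
    simp only [C, add_mul]
    linarith
  have hboot := lt_of_bootstrap hJ h0 hφc (hinitC.trans_lt hCδ)
    fun t ht h => (hstep t ht h).trans_lt hCδ
  intro t ht
  refine ⟨hVR t ht (hboot t ht).le, ?_⟩
  rw [hφl t (hJO ht)]
  exact ENNReal.ofReal_le_ofReal (hstep t ht fun τ hτ => (hboot τ (hJ.uIcc_subset h0 ht hτ)).le)

/-! ### Ordinary differential equations with continuously differentiable right-hand side -/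

section ODE

open scoped NNReal

variable {Y : Type*} [NormedAddCommGroup Y] [NormedSpace ℝ Y] [FiniteDimensional ℝ Y]

/-- A `C¹` vector field agrees on a given ball with a bounded, globally Lipschitz one. -/
theorem exists_lipschitz_eqOn_closedBall {F : Y → Y} (hF : ContDiff ℝ 1 F) {R : ℝ} (hR : 0 < R) :
    ∃ (G : Y → Y) (K B : ℝ≥0), LipschitzWith K G ∧ (∀ y, ‖G y‖ ≤ B) ∧ ∀ y, ‖y‖ ≤ R → G y = F y := by
  let χ : ContDiffBump (0 : Y) := ⟨R, R + 1, hR, by linarith⟩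
  have hG : ContDiff ℝ 1 fun y => χ y • F y := (χ.contDiff (n := 1)).smul hF
  have hc : HasCompactSupport fun y => χ y • F y := χ.hasCompactSupport.smul_right
  obtain ⟨K, hK⟩ := hG.lipschitzWith_of_hasCompactSupport hc one_ne_zero
  obtain ⟨B, hB⟩ := hc.exists_bound_of_continuous hG.continuous
  refine ⟨_, K, B.toNNReal, hK, fun y => (hB y).trans (Real.le_coe_toNNReal B), fun y hy => ?_⟩
  rw [χ.one_of_mem_closedBall (by simpa [χ] using hy), one_smul]

theorem exists_solution_of_lipschitz {G : Y → Y} {K B : ℝ≥0} (hK : LipschitzWith K G)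
    (hB : ∀ y, ‖G y‖ ≤ B) (y₀ : Y) {T : ℝ} (hT : 0 < T) :
    ∃ y : ℝ → Y, y 0 = y₀ ∧ ∀ t ∈ Set.Ioo (-T) T, HasDerivAt y (G (y t)) t := by
  have hcomplete : CompleteSpace Y := FiniteDimensional.complete ℝ Y
  have hPL : IsPicardLindelof (fun _ => G) (tmin := -T) (tmax := T)
      ⟨0, by constructor <;> linarith⟩ y₀ (B * T.toNNReal) 0 B K :=
    ⟨fun _ _ => hK.lipschitzOnWith, fun _ _ => continuousOn_const, fun _ _ y _ => hB y, by
      simp [Real.coe_toNNReal _ hT.le]⟩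
  obtain ⟨y, hy0, hy⟩ := hPL.exists_eq_forall_mem_Icc_hasDerivWithinAt₀
  exact ⟨y, hy0, fun t ht => (hy t (Set.Ioo_subset_Icc_self ht)).hasDerivAt
    (Icc_mem_nhds ht.1 ht.2)⟩

/-- Uniqueness for autonomous equations on open intervals. -/
theorem eqOn_of_hasDerivAt {F : Y → Y} (hF : ContDiff ℝ 1 F) {O : Set ℝ} (hO : IsOpen O)
    (hOc : O.OrdConnected) (h0 : (0 : ℝ) ∈ O) {y w : ℝ → Y}
    (hy : ∀ t ∈ O, HasDerivAt y (F (y t)) t) (hw : ∀ t ∈ O, HasDerivAt w (F (w t)) t)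
    (h : y 0 = w 0) : Set.EqOn y w O := by
  intro t ht
  have hsub : Set.uIcc 0 t ⊆ O := hOc.uIcc_subset h0 ht
  -- a slightly larger compact interval
  obtain ⟨ε, hε, hεO⟩ : ∃ ε > 0, Set.Icc (min 0 t - ε) (max 0 t + ε) ⊆ O := by
    have hmin : min 0 t ∈ O := hsub ⟨le_rfl, min_le_max⟩
    have hmax : max 0 t ∈ O := hsub ⟨min_le_max, le_rfl⟩
    obtain ⟨ε₁, h1, h1'⟩ := Metric.isOpen_iff.1 hO _ hmin
    obtain ⟨ε₂, h2, h2'⟩ := Metric.isOpen_iff.1 hO _ hmax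
    refine ⟨min ε₁ ε₂ / 2, by positivity, hOc.out (h1' ?_) (h2' ?_)⟩
    · rw [Metric.mem_ball, Real.dist_eq, abs_lt]
      constructor <;> linarith [min_le_left ε₁ ε₂, lt_min h1 h2]
    · rw [Metric.mem_ball, Real.dist_eq, abs_lt]
      constructor <;> linarith [min_le_right ε₁ ε₂, lt_min h1 h2]
  obtain ⟨B₁, hB₁⟩ := isCompact_Icc.exists_bound_of_continuousOn (f := y)
    fun τ hτ => (hy τ (hεO hτ)).continuousAt.continuousWithinAt
  obtain ⟨B₂, hB₂⟩ := isCompact_Icc.exists_bound_of_continuousOn (f := w)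
    fun τ hτ => (hw τ (hεO hτ)).continuousAt.continuousWithinAt
  obtain ⟨G, K, B, hK, -, hG⟩ := exists_lipschitz_eqOn_closedBall hF
    (R := |B₁| + |B₂| + 1) (by positivity)
  have hmem : ∀ τ, min 0 t ≤ τ → τ ≤ max 0 t →
      τ ∈ Set.Ioo (min 0 t - ε) (max 0 t + ε) := fun τ h1 h2 => ⟨by linarith, by linarith⟩
  refine ODE_solution_unique_of_mem_Ioo (v := fun _ => G) (s := fun _ => Set.univ) (K := K)
    (fun _ _ => hK.lipschitzOnWith) (hmem 0 (min_le_left _ _) (le_max_left _ _))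
    (fun τ hτ => ⟨?_, trivial⟩) (fun τ hτ => ⟨?_, trivial⟩) h
    (hmem t (min_le_right _ _) (le_max_right _ _))
  · have hτ' := Set.Ioo_subset_Icc_self hτ
    rw [hG]
    · exact hy τ (hεO hτ')
    · linarith [hB₁ τ hτ', le_abs_self B₁, abs_nonneg B₂]
  · have hτ' := Set.Ioo_subset_Icc_self hτ
    rw [hG]
    · exact hw τ (hεO hτ')
    · linarith [hB₂ τ hτ', le_abs_self B₂, abs_nonneg B₁]

end ODE

/-! ### The scheme as an ordinary differential equation -/

namespace IsTrig

variable {M N : ℕ} {f g : (Fin d → ℝ) → ℂ}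

theorem mono (hMN : M ≤ N) (hf : IsTrig M f) : IsTrig N f :=
  ⟨hf.toIsTorusFun, fun k hk => hf.fc_eq_zero k fun h => hk (by
    rw [mem_box_iff_norm_le] at h ⊢
    exact h.trans (by exact_mod_cast hMN))⟩

theorem mul (hf : IsTrig M f) (hg : IsTrig N g) : IsTrig (M + N) (fun x => f x * g x) := by
  refine ⟨hf.toIsTorusFun.mul hg.toIsTorusFun, fun k hk => ?_⟩
  rw [hf.fc_mul hg.continuous]
  refine Finset.sum_eq_zero fun p hp => ?_
  rw [hg.fc_eq_zero (k - p), mul_zero]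
  intro h
  rw [mem_box_iff_norm_le] at h hk hp
  refine hk ?_
  have := norm_add_le (k - p) p
  rw [sub_add_cancel] at this
  push_cast
  linarith

end IsTrig

/-- A family of trigonometric polynomials of bounded degree whose coefficients depend on a parameter
in a continuously differentiable way. -/
structure IsSmoothFamily {Y : Type*} [NormedAddCommGroup Y] [NormedSpace ℝ Y]
    (G : Y → (Fin d → ℝ) → ℂ) : Prop where
  isTrig : ∃ M, ∀ y, IsTrig M (G y)
  contDiff : ∀ k, ContDiff ℝ 1 fun y => fc (G y) k

namespace IsSmoothFamily

variable {Y : Type*} [NormedAddCommGroup Y] [NormedSpace ℝ Y] {G H : Y → (Fin d → ℝ) → ℂ}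

theorem const (c : ℂ) : IsSmoothFamily fun (_ : Y) (_ : Fin d → ℝ) => c := by
  refine ⟨⟨0, fun y => ⟨IsTorusFun.const c, fun k hk => ?_⟩⟩, fun k => contDiff_const⟩
  have h : fc (fun _ : Fin d → ℝ => c * 1) k = 0 := by
    rw [fc_const_mul, fc_one, if_neg, mul_zero]
    rintro rfl
    exact hk (mem_box_iff_norm_le.2 (by simp))
  simpa using h

theorem add (hG : IsSmoothFamily G) (hH : IsSmoothFamily H) :
    IsSmoothFamily fun y x => G y x + H y x := by
  obtain ⟨M, hM⟩ := hG.isTrig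
  obtain ⟨M', hM'⟩ := hH.isTrig
  refine ⟨⟨max M M', fun y => ((hM y).mono (le_max_left _ _)).add
    ((hM' y).mono (le_max_right _ _))⟩, fun k => ?_⟩
  have h : (fun y => fc (fun x => G y x + H y x) k) = fun y => fc (G y) k + fc (H y) k :=
    funext fun y => fc_add (hM y).continuous (hM' y).continuous k
  rw [h]
  exact (hG.contDiff k).add (hH.contDiff k)

theorem mul (hG : IsSmoothFamily G) (hH : IsSmoothFamily H) :
    IsSmoothFamily fun y x => G y x * H y x := by
  obtain ⟨M, hM⟩ := hG.isTrig
  obtain ⟨M', hM'⟩ := hH.isTrig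
  refine ⟨⟨M + M', fun y => (hM y).mul (hM' y)⟩, fun k => ?_⟩
  have h : (fun y => fc (fun x => G y x * H y x) k) =
      fun y => ∑ p ∈ box d M, fc (G y) p * fc (H y) (k - p) :=
    funext fun y => (hM y).fc_mul (hM' y).continuous k
  rw [h]
  exact ContDiff.sum fun p _ => (hG.contDiff p).mul (hH.contDiff (k - p))

theorem polyComp (P : MvPolynomial (Fin n) ℝ) {u : Y → (Fin d → ℝ) → (Fin n → ℝ)}
    (hu : ∀ i, IsSmoothFamily fun y => comp (u y) i) :
    IsSmoothFamily fun y => FourierScheme.polyComp P (u y) := by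
  induction P using MvPolynomial.induction_on with
  | C a => simp_rw [polyComp_C]; exact const _
  | add P Q hP hQ => simp_rw [polyComp_add]; exact hP.add hQ
  | mul_X P i hP => simp_rw [polyComp_mul_X]; exact hP.mul (hu i)

theorem partialDeriv {u : Y → (Fin d → ℝ) → (Fin n → ℝ)}
    (hu : ∀ i, IsSmoothFamily fun y => comp (u y) i) (huc : ∀ y, ContDiff ℝ 1 (u y)) (j : Fin d)
    (i : Fin n) : IsSmoothFamily fun y => comp (FourierScheme.partialDeriv j (u y)) i := by
  choose M hM using fun i => (hu i).isTrig
  have hM' : ∀ y i, IsTrig (∑ i, M i) (comp (u y) i) := fun y i =>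
    (hM i y).mono (Finset.single_le_sum (f := M) (fun _ _ => Nat.zero_le _) (Finset.mem_univ i))
  refine ⟨⟨∑ i, M i, fun y => isTrig_partialDeriv (huc y) (hM' y) j i⟩, fun k => ?_⟩
  have h : (fun y => fc (comp (FourierScheme.partialDeriv j (u y)) i) k) =
      fun y => Complex.I * (k j : ℝ) * fc (comp (u y) i) k := funext fun y =>
    fc_partialDeriv ((huc y).differentiable one_ne_zero) (hM' y i).isWiener j k
  rw [h]
  exact contDiff_const.mul ((hu i).contDiff k)

end IsSmoothFamily

/-- The Fourier coefficients with frequencies in the box. -/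
abbrev Coeffs (d n N : ℕ) : Type := box d N → Fin n → ℂ

/-- The real trigonometric polynomial with given coefficients. -/
def trigOf {N : ℕ} (y : Coeffs d n N) : (Fin d → ℝ) → (Fin n → ℝ) :=
  realTrig N fun k i => if h : k ∈ box d N then y ⟨k, h⟩ i else 0

/-- The Fourier coefficients of a vector field with frequencies in the box. -/
def coeffsOf (N : ℕ) (f : (Fin d → ℝ) → (Fin n → ℝ)) : Coeffs d n N :=
  fun k i => fc (comp f i) k

theorem isTrig_trigOf {N : ℕ} (y : Coeffs d n N) (i : Fin n) : IsTrig N (comp (trigOf y) i) :=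
  isTrig_realTrig _ _ _

theorem trigOf_coeffsOf {N : ℕ} {f : (Fin d → ℝ) → (Fin n → ℝ)}
    (hf : ∀ i, IsTrig N (comp f i)) : trigOf (coeffsOf N f) = f := by
  conv_rhs => rw [eq_realTrig hf]
  ext x i
  simp only [trigOf, realTrig, coeffsOf]
  congr 1
  exact Finset.sum_congr rfl fun k hk => by rw [dif_pos hk]

theorem fc_trigOf {N : ℕ} (y : Coeffs d n N) (i : Fin n) (k : box d N) :
    fc (comp (trigOf y) i) k =
      (y k i + (starRingEnd ℂ) (y ⟨-k, neg_mem_box.2 k.2⟩ i)) / 2 := by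
  rw [trigOf, fc_realTrig, if_pos k.2, dif_pos k.2, dif_pos (neg_mem_box.2 k.2)]

theorem contDiff_fc_trigOf {N : ℕ} (i : Fin n) (k : Fin d → ℤ) :
    ContDiff ℝ 1 fun y : Coeffs d n N => fc (comp (trigOf y) i) k := by
  by_cases hk : k ∈ box d N
  · have h : (fun y : Coeffs d n N => fc (comp (trigOf y) i) k) = fun y =>
        (y ⟨k, hk⟩ i + Complex.conjCLE (y ⟨-k, neg_mem_box.2 hk⟩ i)) / 2 :=
      funext fun y => fc_trigOf y i ⟨k, hk⟩
    rw [h]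
    have h1 : ∀ q : box d N, ContDiff ℝ 1 fun y : Coeffs d n N => y q i := fun q =>
      (contDiff_apply_apply ℝ ℂ q i)
    exact ((h1 _).add (Complex.conjCLE.contDiff.comp (h1 _))).div_const _
  · have h : (fun y : Coeffs d n N => fc (comp (trigOf y) i) k) = fun y => 0 :=
      funext fun y => (isTrig_trigOf y i).fc_eq_zero k hk
    rw [h]
    exact contDiff_const

theorem isSmoothFamily_trigOf {N : ℕ} (i : Fin n) :
    IsSmoothFamily fun y : Coeffs d n N => comp (trigOf y) i :=
  ⟨⟨N, fun y => isTrig_trigOf y i⟩, contDiff_fc_trigOf i⟩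

/-- The vector field on Fourier coefficients that corresponds to the scheme. -/
def schemeField (Aa : Fin d → Matrix (Fin n) (Fin n) ℝ)
    (Ab : Fin d → Matrix (Fin n) (Fin n) (MvPolynomial (Fin n) ℝ)) (σ : (Fin d → ℝ) → ℝ) (N : ℕ)
    (y : Coeffs d n N) : Coeffs d n N :=
  -coeffsOf N (schemeOp Aa Ab σ N (trigOf y))

theorem contDiff_schemeField {σ : (Fin d → ℝ) → ℝ} (hσ : IsFilterProfile σ) {N : ℕ} (hN : 1 ≤ N)
    (Aa : Fin d → Matrix (Fin n) (Fin n) ℝ)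
    (Ab : Fin d → Matrix (Fin n) (Fin n) (MvPolynomial (Fin n) ℝ)) :
    ContDiff ℝ 1 (schemeField Aa Ab σ N) := by
  refine contDiff_pi.2 fun k => contDiff_pi.2 fun b => ContDiff.neg (f := fun y =>
    fc (comp (schemeOp Aa Ab σ N (trigOf y)) b) k) ?_
  have hc : ∀ y : Coeffs d n N, ContDiff ℝ 1 (trigOf y) := fun y =>
    contDiff_of_isTrig (isTrig_trigOf y)
  have h : (fun y : Coeffs d n N => fc (comp (schemeOp Aa Ab σ N (trigOf y)) b) k) = fun y =>
      ∑ j, ∑ c, ((Aa j b c : ℂ) * fc (comp (partialDeriv j (trigOf y)) c) k +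
        filterSymbol σ N k * fc (fun x => polyComp (Ab j b c) (trigOf y) x *
          comp (partialDeriv j (trigOf y)) c x) k) := by
    funext y
    have hw : ∀ i, IsWiener (comp (trigOf y) i) := fun i => (isTrig_trigOf y i).isWiener
    rw [schemeOp, fc_linOp hσ hN Aa (fun j a b => ?_) (hc y)
      (isTorusPeriodic_of_comp fun i => (isTrig_trigOf y i).toIsTorusFun)]
    · simp only [entries_evalMat]
    · rw [entries_evalMat]
      exact (isWiener_polyComp _ hw).continuous
  rw [h]
  have hpd : ∀ j c, IsSmoothFamily fun y : Coeffs d n N => comp (partialDeriv j (trigOf y)) c :=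
    fun j c => IsSmoothFamily.partialDeriv isSmoothFamily_trigOf hc j c
  exact ContDiff.sum fun j _ => ContDiff.sum fun c _ =>
    (contDiff_const.mul ((hpd j c).contDiff k)).add (contDiff_const.mul
      (((IsSmoothFamily.polyComp (Ab j b c) isSmoothFamily_trigOf).mul (hpd j c)).contDiff k))

theorem isTrig_schemeOp {σ : (Fin d → ℝ) → ℝ} (hσ : IsFilterProfile σ) {N : ℕ} (hN : 1 ≤ N)
    (Aa : Fin d → Matrix (Fin n) (Fin n) ℝ)
    (Ab : Fin d → Matrix (Fin n) (Fin n) (MvPolynomial (Fin n) ℝ))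
    {z : (Fin d → ℝ) → (Fin n → ℝ)} (hz : ∀ i, IsTrig N (comp z i)) (b : Fin n) :
    IsTrig N (comp (schemeOp Aa Ab σ N z) b) := isTrig_linOp hσ hN _ _ hz b

theorem trigOf_neg {N : ℕ} (y : Coeffs d n N) : trigOf (-y) = -trigOf y := by
  ext x i
  simp only [trigOf, realTrig, Pi.neg_apply, ← Complex.neg_re, ← Finset.sum_neg_distrib]
  congr 1
  exact Finset.sum_congr rfl fun k hk => by rw [dif_pos hk, dif_pos hk, neg_mul]

theorem norm_coeffsOf_le {N : ℕ} {f : (Fin d → ℝ) → (Fin n → ℝ)} {R : ℝ≥0∞} (hR : R < ⊤)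
    (h : ∀ i, wn (comp f i) ≤ R) : ‖coeffsOf N f‖ ≤ R.toReal := by
  refine (pi_norm_le_iff_of_nonneg ENNReal.toReal_nonneg).2 fun k =>
    (pi_norm_le_iff_of_nonneg ENNReal.toReal_nonneg).2 fun i => ?_
  have h1 : ‖coeffsOf N f k i‖ₑ ≤ R :=
    ((ENNReal.le_tsum (k : Fin d → ℤ)).trans (tsum_enorm_fc_le _)).trans (h i)
  have h2 := ENNReal.toReal_mono hR.ne h1
  rwa [toReal_enorm] at h2

theorem lipschitzWith_coeffsOf_trigOf (N : ℕ) :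
    LipschitzWith 1 fun y : Coeffs d n N => coeffsOf N (trigOf y) := by
  refine LipschitzWith.of_dist_le_mul fun y w => ?_
  rw [NNReal.coe_one, one_mul, dist_pi_le_iff dist_nonneg]
  intro k
  rw [dist_pi_le_iff dist_nonneg]
  intro i
  simp only [coeffsOf]
  rw [fc_trigOf, fc_trigOf, dist_eq_norm, ← sub_div, norm_div, Complex.norm_ofNat,
    div_le_iff₀ two_pos]
  have h : ∀ q : box d N, ‖y q i - w q i‖ ≤ dist y w := fun q => by
    rw [← dist_eq_norm]
    exact (dist_le_pi_dist (y q) (w q) i).trans (dist_le_pi_dist y w q)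
  have e : y k i + (starRingEnd ℂ) (y ⟨-k, neg_mem_box.2 k.2⟩ i) -
      (w k i + (starRingEnd ℂ) (w ⟨-k, neg_mem_box.2 k.2⟩ i)) = (y k i - w k i) +
      (starRingEnd ℂ) (y ⟨-k, neg_mem_box.2 k.2⟩ i - w ⟨-k, neg_mem_box.2 k.2⟩ i) := by
    rw [map_sub]; ring
  rw [e]
  refine (norm_add_le _ _).trans ?_
  rw [RCLike.norm_conj]
  linarith [h k, h ⟨-k, neg_mem_box.2 k.2⟩]

/-- A curve of Fourier coefficients gives a family of functions that is differentiable in time. -/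
theorem isTimeC1_trigOf {N : ℕ} {O : Set ℝ} {y : ℝ → Coeffs d n N} {G : Coeffs d n N → Coeffs d n N}
    {B : ℝ} (hG : ∀ w, ‖G w‖ ≤ B) (hy : ∀ t ∈ O, HasDerivAt y (G (y t)) t) (i : Fin n) :
    IsTimeC1 O (fun t x => trigOf (y t) x i) fun t x => trigOf (G (y t)) x i := by
  have hc : ∀ y : Coeffs d n N, Continuous fun x => trigOf y x i := fun y =>
    (isTrig_trigOf y i).toIsTorusFun.continuous_apply
  have hb : ∀ {y : Coeffs d n N} {C : ℝ}, ‖y‖ ≤ C → ∀ x, |trigOf y x i| ≤ ∑ k ∈ box d N, C := by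
    intro y C hC x
    refine (Complex.abs_re_le_norm _).trans (norm_sum_le_of_le _ fun k hk => ?_)
    simp only [norm_mul, norm_expMode, mul_one, dif_pos hk]
    exact ((norm_le_pi_norm (y ⟨k, hk⟩) i).trans (norm_le_pi_norm y _)).trans hC
  refine ⟨fun t _ => hc _, fun t _ => hc _, fun t ht x => ?_, fun t ht => ?_⟩
  · have h1 : HasDerivAt (fun τ => ∑ k ∈ box d N,
        (if h : k ∈ box d N then y τ ⟨k, h⟩ i else 0) * expMode k x)
        (∑ k ∈ box d N, (if h : k ∈ box d N then G (y t) ⟨k, h⟩ i else 0) * expMode k x) t := by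
      refine HasDerivAt.fun_sum fun k hk => ?_
      simp only [dif_pos hk]
      exact (hasDerivAt_pi.1 (hasDerivAt_pi.1 (hy t ht) ⟨k, hk⟩) i).mul_const _
    exact Complex.reCLM.hasFDerivAt.comp_hasDerivAt t h1
  · refine ⟨max (∑ k ∈ box d N, (‖y t‖ + 1)) (∑ k ∈ box d N, B), ?_⟩
    have h1 := (hy t ht).continuousAt.norm.eventually (gt_mem_nhds (lt_add_one ‖y t‖))
    filter_upwards [h1] with τ hτ x
    exact ⟨(hb hτ.le x).trans (le_max_left _ _), (hb (hG _) x).trans (le_max_right _ _)⟩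

/-- There is a family of trigonometric polynomials on `(-T, T)` that starts from given data and
solves the scheme at all times when it is bounded by `R`. -/
theorem exists_truncated_solution {σ : (Fin d → ℝ) → ℝ} (hσ : IsFilterProfile σ) {N : ℕ}
    (hN : 1 ≤ N) (Aa : Fin d → Matrix (Fin n) (Fin n) ℝ)
    (Ab : Fin d → Matrix (Fin n) (Fin n) (MvPolynomial (Fin n) ℝ)) {R : ℝ≥0∞} (hR : R < ⊤) {T : ℝ}
    (hT : 0 < T) {v₀ : (Fin d → ℝ) → (Fin n → ℝ)} (hv₀ : ∀ i, IsTrig N (comp v₀ i)) :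
    ∃ V V' : ℝ → (Fin d → ℝ) → (Fin n → ℝ),
      (∀ i, IsTimeC1 (Set.Ioo (-T) T) (fun t x => V t x i) fun t x => V' t x i) ∧
      (∀ t i, IsTrig N (comp (V t) i)) ∧ V 0 = v₀ ∧
      ∀ t, (∀ i, wn (comp (V t) i) ≤ R) → V' t = -schemeOp Aa Ab σ N (V t) := by
  obtain ⟨G, K, B, hK, hB, hG⟩ := exists_lipschitz_eqOn_closedBall
    (contDiff_schemeField hσ hN Aa Ab) (R := R.toReal + 1)
    (by have := ENNReal.toReal_nonneg (a := R); linarith)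
  obtain ⟨y, hy0, hy⟩ := exists_solution_of_lipschitz
    (hK.comp (lipschitzWith_coeffsOf_trigOf N)) (fun y => hB _) (coeffsOf N v₀) hT
  refine ⟨fun t => trigOf (y t), fun t => trigOf (G (coeffsOf N (trigOf (y t)))),
    isTimeC1_trigOf (G := fun w => G (coeffsOf N (trigOf w))) (fun w => hB _) hy,
    fun t i => isTrig_trigOf _ i, ?_, fun t ht => ?_⟩
  · simp only [hy0]
    exact trigOf_coeffsOf hv₀
  · simp only
    rw [hG _ ((norm_coeffsOf_le hR ht).trans (by linarith)), schemeField,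
      trigOf_coeffsOf (isTrig_trigOf _), trigOf_neg,
      trigOf_coeffsOf (isTrig_schemeOp hσ hN Aa Ab (isTrig_trigOf _))]

/-- A family of trigonometric polynomials that solves the scheme is a classical solution. -/
theorem isClassicalSolution_of_isTrig {N : ℕ} (hN : 1 ≤ N) {s : ℝ} (hs : 0 ≤ s)
    {G : ((Fin d → ℝ) → (Fin n → ℝ)) → ((Fin d → ℝ) → (Fin n → ℝ))} {O : Set ℝ} (hO : IsOpen O)
    (hOc : O.OrdConnected) (h0 : (0 : ℝ) ∈ O) {V V' : ℝ → (Fin d → ℝ) → (Fin n → ℝ)}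
    (hV : ∀ i, IsTimeC1 O (fun t x => V t x i) fun t x => V' t x i)
    (hVt : ∀ t ∈ O, ∀ i, IsTrig N (comp (V t) i)) (hV' : ∀ t ∈ O, V' t = -G (V t)) :
    IsClassicalSolution s G (V 0) O V := by
  have hfin : ∀ t ∈ O, hs2 s (V t) < ⊤ := fun t ht => by
    refine (hs2_le_of_isTrig hN hs (hVt t ht)).trans_lt ?_
    rw [sum_l2n_eq (hVt t ht)]
    finiteness
  refine ⟨hO, hOc, h0, fun t ht => ⟨(contDiff_of_isTrig (m := 1) (hVt t ht)).continuous,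
    isTorusPeriodic_of_comp fun i => (hVt t ht i).toIsTorusFun, hsNorm_lt_top_iff.2 (hfin t ht)⟩,
    fun t₀ ht₀ => ?_, fun t ht => contDiff_of_isTrig (hVt t ht), rfl, fun t ht x => ?_⟩
  -- For trigonometric polynomials of fixed degree, continuity in `L²` implies continuity in `H^s`.
  · rw [hO.nhdsWithin_eq ht₀]
    set φ : ℝ → ℝ := fun τ => ∑ i, mean fun x => (V τ x i - V t₀ x i) ^ 2
    have hconst : ∀ i, IsTimeC1 O (fun _ x => V t₀ x i) fun _ _ => 0 := fun i =>
      ⟨fun _ _ => (hV i).continuous t₀ ht₀, fun _ _ => continuous_const,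
        fun t _ x => hasDerivAt_const t _, fun t _ => by
          obtain ⟨C, hC⟩ := (hV i).bound t₀ ht₀
          have := hC.self_of_nhds
          exact ⟨C, Eventually.of_forall fun _ x =>
            ⟨(this x).1, by simpa using (abs_nonneg _).trans (this x).1⟩⟩⟩
    have hφ : ContinuousAt φ t₀ := by
      refine tendsto_finsetSum _ fun i _ => ?_
      have h1 := (((hV i).sub (hconst i)).mul ((hV i).sub (hconst i))).hasDerivAt_mean hO ht₀
      simp only [← pow_two] at h1
      exact h1.continuousAt
    have hφ0 : φ t₀ = 0 := by
      have h := mean_const_mul (d := d) 0 fun _ => 0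
      simp only [zero_mul] at h
      simp [φ, h]
    have hle : ∀ᶠ τ in 𝓝 t₀, hsNorm s (V τ - V t₀) ≤
        (ENNReal.ofReal ((1 + d) ^ s * (N : ℝ) ^ (2 * s)) * ENNReal.ofReal (φ τ)) ^ (1 / 2 : ℝ) := by
      filter_upwards [hO.mem_nhds ht₀] with τ hτ
      rw [hsNorm_eq]
      refine ENNReal.rpow_le_rpow ?_ (by norm_num)
      have ht : ∀ i, IsTrig N (comp (V τ - V t₀) i) := fun i => (hVt τ hτ i).comp_sub (hVt t₀ ht₀ i)
      refine (hs2_le_of_isTrig hN hs ht).trans ?_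
      rw [sum_l2n_eq ht]
      rfl
    refine tendsto_of_tendsto_of_tendsto_of_le_of_le' tendsto_const_nhds ?_
      (Eventually.of_forall fun _ => zero_le) hle
    have h1 : Tendsto (fun τ => ENNReal.ofReal ((1 + d) ^ s * (N : ℝ) ^ (2 * s)) *
        ENNReal.ofReal (φ τ)) (𝓝 t₀) (𝓝 (ENNReal.ofReal ((1 + d) ^ s * (N : ℝ) ^ (2 * s)) * 0)) := by
      refine ENNReal.Tendsto.const_mul ?_ (Or.inr ENNReal.ofReal_ne_top)
      have := ENNReal.tendsto_ofReal hφ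
      rwa [hφ0, ENNReal.ofReal_zero] at this
    rw [mul_zero] at h1
    have h2 := (ENNReal.continuous_rpow_const (y := 1 / 2)).continuousAt.tendsto.comp h1
    rwa [ENNReal.zero_rpow_of_pos (by norm_num)] at h2
  · refine hasDerivAt_pi.2 fun i => ?_
    have := (hV i).hasDerivAt t ht x
    rw [hV' t ht] at this
    exact this

/-! ### Uniqueness for the scheme -/

theorem exists_abs_schemeOp_le {σ : (Fin d → ℝ) → ℝ} (hσ : IsFilterProfile σ) {N : ℕ}
    (hN : 1 ≤ N) (Aa : Fin d → Matrix (Fin n) (Fin n) ℝ)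
    (Ab : Fin d → Matrix (Fin n) (Fin n) (MvPolynomial (Fin n) ℝ)) {R : ℝ≥0∞} (hR : R < ⊤) :
    ∃ C : ℝ, 0 ≤ C ∧ ∀ f : (Fin d → ℝ) → (Fin n → ℝ), ContDiff ℝ 1 f →
      (∀ i, IsWiener (comp f i)) → (∀ i, wn (comp f i) ≤ R) →
      ∀ x i, |schemeOp Aa Ab σ N f x i| ≤ C := by
  obtain ⟨C, hC, hbd⟩ := exists_real_bound_forall (ι := Fin d × Fin n × Fin n)
    (P := fun q C => ∀ v : Fin n → ℝ, ‖v‖ ≤ R.toReal →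
      |MvPolynomial.eval v (Ab q.1 q.2.1 q.2.2)| ≤ C)
    (fun q a b hab h v hv => (h v hv).trans hab) fun q => exists_abs_eval_le _ _
  obtain ⟨D, hD, hAa⟩ := exists_real_bound_forall (ι := Fin d × Fin n × Fin n)
    (P := fun q C => |Aa q.1 q.2.1 q.2.2| ≤ C) (fun q a b hab h => h.trans hab)
    fun q => ⟨_, abs_nonneg _, le_rfl⟩
  set B := R.toReal
  have hB : 0 ≤ B := ENNReal.toReal_nonneg
  refine ⟨∑ _j : Fin d, (∑ _c : Fin n, D * B + ∑ k ∈ box d N, ∑ _c : Fin n, C * B), by positivity,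
    fun f hf hw hwR x i => ?_⟩
  have hux : ∀ x, ‖f x‖ ≤ B := fun x => (pi_norm_le_iff_of_nonneg hB).2 fun c =>
    (hw c).abs_le hR (hwR c) x
  have hpd : ∀ j c x, |partialDeriv j f x c| ≤ B := fun j c x =>
    (norm_partialDeriv_le (hf.differentiable one_ne_zero) (hw c) j x).trans
      (ENNReal.toReal_mono hR.ne (hwR c))
  have hm := isSymbol_filterSymbol hσ hN
  rw [schemeOp, linOp, Finset.sum_apply]
  refine (Finset.abs_sum_le_sum_abs _ _).trans (Finset.sum_le_sum fun j _ =>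
    (abs_add_le _ _).trans (add_le_add ?_ ?_))
  · rw [Matrix.mulVec, dotProduct]
    refine (Finset.abs_sum_le_sum_abs _ _).trans (Finset.sum_le_sum fun c _ => ?_)
    rw [abs_mul]
    exact mul_le_mul (hAa ⟨j, i, c⟩) (hpd j c x) (abs_nonneg _) hD
  · rw [smoothFilter_eq]
    have h1 := (isTrig_multiplier hm (fun y => (evalMat (Ab j) (f y)).mulVec
      (partialDeriv j f y)) i).eq_sum x
    rw [← Real.norm_eq_abs, ← Complex.norm_real]
    refine (congrArg norm h1).le.trans (norm_sum_le_of_le _ fun k _ => ?_)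
    rw [norm_mul, norm_expMode, mul_one, fc_multiplier hm, norm_mul, Complex.norm_real,
      Real.norm_of_nonneg (filterSymbol_mem_Icc hσ N k).1]
    refine (mul_le_of_le_one_left (norm_nonneg _) (filterSymbol_mem_Icc hσ N k).2).trans ?_
    refine norm_fc_le (fun y => ?_) k
    simp only [comp, Complex.norm_real, Real.norm_eq_abs, Matrix.mulVec, dotProduct]
    refine (Finset.abs_sum_le_sum_abs _ _).trans (Finset.sum_le_sum fun c _ => ?_)
    rw [abs_mul]
    exact mul_le_mul (hbd ⟨j, i, c⟩ _ (hux y)) (hpd j c y) (abs_nonneg _) hC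

section Uniqueness

variable {σ : (Fin d → ℝ) → ℝ} {N : ℕ} {s : ℝ} {Aa : Fin d → Matrix (Fin n) (Fin n) ℝ}
  {Ab : Fin d → Matrix (Fin n) (Fin n) (MvPolynomial (Fin n) ℝ)}
  {u₀ : (Fin d → ℝ) → (Fin n → ℝ)} {I : Set ℝ} {U : ℝ → (Fin d → ℝ) → (Fin n → ℝ)}

theorem IsClassicalSolution.isTimeC1_scheme (hσ : IsFilterProfile σ) (hN : 1 ≤ N)
    (hs : (d : ℝ) / 2 + 1 < s) (hU : IsClassicalSolution s (schemeOp Aa Ab σ N) u₀ I U) (i : Fin n) :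
    IsTimeC1 I (fun t x => U t x i) fun t x => -schemeOp Aa Ab σ N (U t) x i := by
  have hc' : ∀ t ∈ I, Continuous (schemeOp Aa Ab σ N (U t)) := fun t ht => continuous_of_comp
    (isTorusFun_linOp hσ hN _ _ (hU.contDiff t ht) (hU.memHs t ht).periodic)
  refine ⟨fun t ht => (continuous_apply i).comp (hU.memHs t ht).continuous,
    fun t ht => ((continuous_apply i).comp (hc' t ht)).neg, fun t ht x => ?_, fun t ht => ?_⟩
  · simpa using (hasDerivAt_pi.1 (hU.hasDerivAt t ht x)) i
  obtain ⟨R, hR, hev⟩ := exists_eventually_wn_le hs hU ht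
  obtain ⟨C, hC, hbd⟩ := exists_abs_schemeOp_le hσ hN Aa Ab hR
  refine ⟨R.toReal + C, ?_⟩
  filter_upwards [hev, hU.isOpen.mem_nhds ht] with τ hτ hτI x
  have hw := (hU.memHs τ hτI).isWiener hs
  refine ⟨((hw i).abs_le hR (hτ i) x).trans (le_add_of_nonneg_right hC), ?_⟩
  rw [abs_neg]
  exact (hbd _ (hU.contDiff τ hτI) hw hτ x i).trans (le_add_of_nonneg_left ENNReal.toReal_nonneg)

theorem IsClassicalSolution.hasDerivAt_fc_scheme (hσ : IsFilterProfile σ) (hN : 1 ≤ N)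
    (hs : (d : ℝ) / 2 + 1 < s) (hU : IsClassicalSolution s (schemeOp Aa Ab σ N) u₀ I U) {t : ℝ}
    (ht : t ∈ I) (i : Fin n) (k : Fin d → ℤ) :
    HasDerivAt (fun τ => fc (comp (U τ) i) k) (-fc (comp (schemeOp Aa Ab σ N (U t)) i) k) t := by
  have h := (hU.isTimeC1_scheme hσ hN hs i).hasDerivAt_fc hU.isOpen ht k
  refine h.congr_deriv ?_
  rw [← fc_neg]
  congr 1
  ext x
  simp [comp]

/-- Solutions of the scheme remain trigonometric polynomials: their coefficients outside the box
solve homogeneous linear equations. -/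
theorem IsClassicalSolution.isTrig_scheme (hσ : IsFilterProfile σ) (hN : 1 ≤ N)
    (hs : (d : ℝ) / 2 + 1 < s) (hU : IsClassicalSolution s (schemeOp Aa Ab σ N) u₀ I U)
    (hu₀ : ∀ i, IsTrig N (comp u₀ i)) {t : ℝ} (ht : t ∈ I) (i : Fin n) :
    IsTrig N (comp (U t) i) := by
  refine ⟨((hU.memHs t ht).isWiener hs i).toIsTorusFun, fun k hk => ?_⟩
  set F : (Fin n → ℂ) → Fin n → ℂ := fun w b =>
    -∑ j, ∑ c, (Aa j b c : ℂ) * (Complex.I * (k j : ℝ) * w c)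
  have hF : ContDiff ℝ 1 F := contDiff_pi.2 fun b => ContDiff.neg <| ContDiff.sum fun j _ =>
    ContDiff.sum fun c _ => contDiff_const.mul (contDiff_const.mul (contDiff_apply ℝ ℂ c))
  have hσk : filterSymbol σ N k = 0 := filterSymbol_eq_zero hσ hN (by
    rw [mem_box_iff_norm_le] at hk; exact not_le.1 hk)
  have h := eqOn_of_hasDerivAt hF hU.isOpen hU.ordConnected hU.zero_mem
    (y := fun τ b => fc (comp (U τ) b) k) (w := fun _ => 0) (fun τ hτ => ?_) (fun τ _ => ?_) ?_ ht
  · exact congrFun h i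
  · refine hasDerivAt_pi.2 fun b => (hU.hasDerivAt_fc_scheme hσ hN hs hτ b k).congr_deriv ?_
    have hw := (hU.memHs τ hτ).isWiener hs
    rw [schemeOp, fc_linOp hσ hN Aa (fun j a b => by
      rw [entries_evalMat]; exact (isWiener_polyComp _ hw).continuous) (hU.contDiff τ hτ)
      (hU.memHs τ hτ).periodic, hσk]
    simp only [F, Complex.ofReal_zero, zero_mul, add_zero]
    congr 1
    refine Finset.sum_congr rfl fun j _ => Finset.sum_congr rfl fun c _ => ?_
    rw [fc_partialDeriv ((hU.contDiff τ hτ).differentiable one_ne_zero) (hw c)]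
  · have : F 0 = 0 := by ext b; simp [F]
    rw [this]
    exact hasDerivAt_const τ 0
  · ext b
    simp only [hU.initial]
    exact (hu₀ b).fc_eq_zero k hk

/-- Uniqueness for the scheme, from uniqueness for the equation satisfied by the coefficients. -/
theorem IsClassicalSolution.eqOn_scheme (hσ : IsFilterProfile σ) (hN : 1 ≤ N)
    (hs : (d : ℝ) / 2 + 1 < s) (hu₀ : ∀ i, IsTrig N (comp u₀ i))
    (hU : IsClassicalSolution s (schemeOp Aa Ab σ N) u₀ I U) {I' : Set ℝ}
    {U' : ℝ → (Fin d → ℝ) → (Fin n → ℝ)}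
    (hU' : IsClassicalSolution s (schemeOp Aa Ab σ N) u₀ I' U') : Set.EqOn U U' (I ∩ I') := by
  have key : ∀ {I : Set ℝ} {U : ℝ → (Fin d → ℝ) → (Fin n → ℝ)},
      IsClassicalSolution s (schemeOp Aa Ab σ N) u₀ I U → ∀ t ∈ I,
      HasDerivAt (fun τ => coeffsOf N (U τ)) (schemeField Aa Ab σ N (coeffsOf N (U t))) t := by
    intro I U hU t ht
    refine hasDerivAt_pi.2 fun k => hasDerivAt_pi.2 fun i => ?_
    rw [schemeField, trigOf_coeffsOf fun i => hU.isTrig_scheme hσ hN hs hu₀ ht i]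
    exact hU.hasDerivAt_fc_scheme hσ hN hs ht i k
  intro t ht
  have h := eqOn_of_hasDerivAt (contDiff_schemeField hσ hN Aa Ab) (hU.isOpen.inter hU'.isOpen)
    (hU.ordConnected.inter hU'.ordConnected) ⟨hU.zero_mem, hU'.zero_mem⟩
    (fun τ hτ => key hU τ hτ.1) (fun τ hτ => key hU' τ hτ.2)
    (by simp only [hU.initial, hU'.initial]) ht
  simp only at h
  rw [← trigOf_coeffsOf fun i => hU.isTrig_scheme hσ hN hs hu₀ ht.1 i, h,
    trigOf_coeffsOf fun i => hU'.isTrig_scheme hσ hN hs hu₀ ht.2 i]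

end Uniqueness

/-! ### Maximal solutions -/

section Maximal

variable {s : ℝ} {G : ((Fin d → ℝ) → (Fin n → ℝ)) → ((Fin d → ℝ) → (Fin n → ℝ))}
  {u₀ : (Fin d → ℝ) → (Fin n → ℝ)}

/-- Classical solutions that agree on the intersections of their intervals can be glued. -/
theorem IsClassicalSolution.exists_glue {ι : Type*} [Nonempty ι] {I : ι → Set ℝ}
    {U : ι → ℝ → (Fin d → ℝ) → (Fin n → ℝ)} (hU : ∀ i, IsClassicalSolution s G u₀ (I i) (U i))
    (h : ∀ i j, Set.EqOn (U i) (U j) (I i ∩ I j)) :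
    ∃ W, IsClassicalSolution s G u₀ (⋃ i, I i) W ∧ ∀ i, Set.EqOn W (U i) (I i) := by
  classical
  set W : ℝ → (Fin d → ℝ) → (Fin n → ℝ) := fun t =>
    if ht : ∃ i, t ∈ I i then U ht.choose t else 0
  have hW : ∀ i, Set.EqOn W (U i) (I i) := by
    intro i t ht
    have hex : ∃ i, t ∈ I i := ⟨i, ht⟩
    simp only [W, dif_pos hex]
    exact h _ _ ⟨hex.choose_spec, ht⟩
  have hev : ∀ i, ∀ t ∈ I i, ∀ᶠ τ in 𝓝 t, W τ = U i τ := fun i t ht =>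
    mem_of_superset ((hU i).isOpen.mem_nhds ht) fun τ hτ => hW i hτ
  have hopen : IsOpen (⋃ i, I i) := isOpen_iUnion fun i => (hU i).isOpen
  obtain ⟨i₀⟩ := ‹Nonempty ι›
  refine ⟨W, ⟨hopen, ?_, Set.mem_iUnion.2 ⟨i₀, (hU i₀).zero_mem⟩, fun t ht => ?_, fun t ht => ?_,
    fun t ht => ?_, ?_, fun t ht x => ?_⟩, hW⟩
  · exact isPreconnected_iff_ordConnected.1 (isPreconnected_iUnion
      ⟨0, Set.mem_iInter.2 fun i => (hU i).zero_mem⟩ fun i => (hU i).ordConnected.isPreconnected)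
  · obtain ⟨i, hi⟩ := Set.mem_iUnion.1 ht
    rw [hW i hi]
    exact (hU i).memHs t hi
  · obtain ⟨i, hi⟩ := Set.mem_iUnion.1 ht
    rw [hopen.nhdsWithin_eq ht, hW i hi]
    have h1 := (hU i).continuous_hs t hi
    rw [(hU i).isOpen.nhdsWithin_eq hi] at h1
    exact h1.congr' ((hev i t hi).mono fun τ hτ => by simp only [hτ])
  · obtain ⟨i, hi⟩ := Set.mem_iUnion.1 ht
    rw [hW i hi]
    exact (hU i).contDiff t hi
  · rw [hW i₀ (hU i₀).zero_mem]
    exact (hU i₀).initial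
  · obtain ⟨i, hi⟩ := Set.mem_iUnion.1 ht
    rw [hW i hi]
    exact ((hU i).hasDerivAt t hi x).congr_of_eventuallyEq
      ((hev i t hi).mono fun τ hτ => by simp only [hτ])

/-- If solutions are unique, the union of all of them is a maximal solution. -/
theorem exists_isMaximalSolution (huniq : ∀ I I' U U', IsClassicalSolution s G u₀ I U →
      IsClassicalSolution s G u₀ I' U' → Set.EqOn U U' (I ∩ I'))
    (hex : ∃ I U, IsClassicalSolution s G u₀ I U) : ∃ I U, IsMaximalSolution s G u₀ I U := by
  let ι := {p : Set ℝ × (ℝ → (Fin d → ℝ) → (Fin n → ℝ)) // IsClassicalSolution s G u₀ p.1 p.2}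
  obtain ⟨I, U, hU⟩ := hex
  have : Nonempty ι := ⟨⟨(I, U), hU⟩⟩
  obtain ⟨W, hW, -⟩ := IsClassicalSolution.exists_glue (ι := ι) (I := fun p => p.1.1)
    (U := fun p => p.1.2) (fun p => p.2) fun p q => huniq _ _ _ _ p.2 q.2
  exact ⟨_, W, hW, fun I' U' hU' hsub _ =>
    (Set.subset_iUnion (fun p : ι => p.1.1) ⟨(I', U'), hU'⟩).antisymm hsub⟩

/-- If solutions are unique, a maximal solution extends every solution. -/
theorem IsMaximalSolution.subset_and_eqOn (huniq : ∀ I I' U U', IsClassicalSolution s G u₀ I U →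
      IsClassicalSolution s G u₀ I' U' → Set.EqOn U U' (I ∩ I')) {I I' : Set ℝ}
    {U U' : ℝ → (Fin d → ℝ) → (Fin n → ℝ)} (hU : IsMaximalSolution s G u₀ I U)
    (hU' : IsClassicalSolution s G u₀ I' U') : I' ⊆ I ∧ Set.EqOn U U' I' := by
  have hb : ∀ b : Bool, IsClassicalSolution s G u₀ (cond b I I') (cond b U U') := fun b => by
    cases b
    · exact hU'
    · exact hU.1
  obtain ⟨W, hW, hWe⟩ := IsClassicalSolution.exists_glue hb fun b c => huniq _ _ _ _ (hb b) (hb c)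
  have h1 := hU.2 _ W hW (Set.subset_iUnion (fun b => cond b I I') true) (hWe true)
  have h2 : I' ⊆ I := (Set.subset_iUnion (fun b => cond b I I') false).trans h1.le
  exact ⟨h2, fun t ht => huniq _ _ _ _ hU.1 hU' ⟨h2 ht, ht⟩⟩

theorem IsClassicalSolution.congr {G' : ((Fin d → ℝ) → (Fin n → ℝ)) → ((Fin d → ℝ) → (Fin n → ℝ))}
    (h : ∀ f : (Fin d → ℝ) → (Fin n → ℝ), ContDiff ℝ 1 f → IsTorusPeriodic f → G f = G' f)
    {I : Set ℝ} {U : ℝ → (Fin d → ℝ) → (Fin n → ℝ)} (hU : IsClassicalSolution s G u₀ I U) :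
    IsClassicalSolution s G' u₀ I U :=
  { hU with
    hasDerivAt := fun t ht x => by
      rw [← h _ (hU.contDiff t ht) (hU.memHs t ht).periodic]
      exact hU.hasDerivAt t ht x }

end Maximal

/-! ### Convergence of the scheme -/

/-- Error bounds in `L²` for trigonometric polynomials give error bounds in all Sobolev norms, since
the filtered exact solution is itself a trigonometric polynomial. -/
theorem hsNorm_sub_le_of_l2n_le {σ : (Fin d → ℝ) → ℝ} (hσ : IsFilterProfile σ) {N : ℕ} (hN : 1 ≤ N)
    {r s C : ℝ} (hr : 0 ≤ r) (hrs : r ≤ s) (hC : 0 ≤ C) {u v : (Fin d → ℝ) → (Fin n → ℝ)}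
    (hu : Continuous u) (hv : ∀ i, IsTrig N (comp v i)) {D : ℝ≥0∞} (hD : D < ⊤)
    (huD : hsNorm s u ≤ D)
    (h : ∑ i, l2n (comp (v - fourierMultiplier (lowSymbol σ N) u) i) ≤
      ENNReal.ofReal (C * ((N : ℝ) ^ (-(2 * s)) * D.toReal ^ 2))) :
    hsNorm r (u - v) ≤ ENNReal.ofReal (√(2 * (4 ^ (2 * s) + (1 + d) ^ s * C)) *
      (N : ℝ) ^ (r - s)) * D := by
  have hN' : (0 : ℝ) < N := by exact_mod_cast hN
  have hs : 0 ≤ s := hr.trans hrs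
  have hm := isSymbol_lowSymbol hσ hN
  set w := fourierMultiplier (lowSymbol σ N) u
  have hw : ∀ i, IsTrig N (comp w i) := isTrig_multiplier hm u
  have hz : ∀ i, IsTrig N (comp (v - w) i) := fun i => (hv i).comp_sub (hw i)
  have hwc : Continuous w := continuous_of_comp fun i => (hw i).toIsTorusFun
  have hvc : Continuous v := continuous_of_comp fun i => (hv i).toIsTorusFun
  have hdec : u - v = (u - w) - (v - w) := by abel
  have hpow : ((N : ℝ) ^ (r - s)) ^ 2 = (N : ℝ) ^ (2 * (r - s)) := by
    rw [← Real.rpow_natCast, ← Real.rpow_mul hN'.le]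
    congr 1
    push_cast
    ring
  have h1 : hs2 r (u - w) ≤ ENNReal.ofReal (4 ^ (2 * s) * (N : ℝ) ^ (2 * (r - s))) * D ^ 2 := by
    refine (hs2_sub_low_le hσ hN hrs hu).trans ?_
    rw [← ENNReal.ofReal_mul (by positivity), ← hsNorm_sq]
    gcongr ENNReal.ofReal (?_ * _) * ?_ ^ 2
    exact Real.rpow_le_rpow_of_exponent_le (by norm_num) (by linarith)
  have h2 : hs2 r (v - w) ≤ ENNReal.ofReal ((1 + d) ^ s * C * (N : ℝ) ^ (2 * (r - s))) * D ^ 2 := by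
    have hDD : D ^ 2 = ENNReal.ofReal (D.toReal ^ 2) := by
      rw [← ENNReal.toReal_pow, ENNReal.ofReal_toReal (by finiteness)]
    refine (hs2_le_of_isTrig hN hr hz).trans ((mul_le_mul' le_rfl h).trans ?_)
    rw [hDD, ← ENNReal.ofReal_mul (by positivity), ← ENNReal.ofReal_mul (by positivity)]
    refine ENNReal.ofReal_le_ofReal ?_
    have h3 : (N : ℝ) ^ (2 * r) * (N : ℝ) ^ (-(2 * s)) = (N : ℝ) ^ (2 * (r - s)) := by
      rw [← Real.rpow_add hN']; congr 1; ring
    calc _ = (1 + (d : ℝ)) ^ r * (C * ((N : ℝ) ^ (2 * r) * (N : ℝ) ^ (-(2 * s))) * D.toReal ^ 2) := by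
          ring
      _ ≤ (1 + (d : ℝ)) ^ s * (C * ((N : ℝ) ^ (2 * r) * (N : ℝ) ^ (-(2 * s))) * D.toReal ^ 2) := by
          gcongr
          have : (0 : ℝ) ≤ d := Nat.cast_nonneg d
          linarith
      _ = _ := by rw [h3]; ring
  refine hsNorm_le_of_sq_le ?_
  rw [hdec]
  refine (hs2_sub_le r (hu.sub hwc) (hvc.sub hwc)).trans ((mul_le_mul' le_rfl
    (add_le_add h1 h2)).trans (le_of_eq ?_))
  rw [← add_mul, ← ENNReal.ofReal_add (by positivity) (by positivity), ← mul_assoc, mul_pow,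
    ← ENNReal.ofReal_pow (by positivity), mul_pow, hpow, Real.sq_sqrt (by positivity), ← add_mul,
    ← ENNReal.ofReal_ofNat 2, ← ENNReal.ofReal_mul (by norm_num), mul_assoc 2]

theorem isOpen_setOf_wn_lt {O : Set ℝ} (hO : IsOpen O) {N : ℕ}
    {V V' : ℝ → (Fin d → ℝ) → (Fin n → ℝ)}
    (hV : ∀ i, IsTimeC1 O (fun t x => V t x i) fun t x => V' t x i)
    (hVt : ∀ t ∈ O, ∀ i, IsTrig N (comp (V t) i)) (R : ℝ≥0∞) :
    IsOpen {t ∈ O | ∀ i, wn (comp (V t) i) < R} := by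
  have hcont : ∀ i, ContinuousOn (fun t => wn (comp (V t) i)) O := fun i => by
    have h1 : ContinuousOn (fun t => ∑ k ∈ box d N, (1 + ‖k‖ₑ) * ‖fc (comp (V t) i) k‖ₑ) O :=
      fun t ht => ContinuousAt.continuousWithinAt <| tendsto_finsetSum _ fun k _ =>
        ENNReal.Tendsto.const_mul
          (((hV i).hasDerivAt_fc hO ht k).continuousAt.enorm) (Or.inr (by finiteness))
    exact h1.congr fun t ht => (hVt t ht i).wn_eq
  have h2 : {t ∈ O | ∀ i, wn (comp (V t) i) < R} =
      O ∩ ⋂ i, O ∩ (fun t => wn (comp (V t) i)) ⁻¹' Set.Iio R := by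
    ext t
    simp only [Set.mem_ofPred_eq, Set.mem_inter_iff, Set.mem_iInter, Set.mem_preimage, Set.mem_Iio]
    exact ⟨fun h => ⟨h.1, fun i => ⟨h.1, h.2 i⟩⟩, fun h => ⟨h.1, fun i => (h.2 i).2⟩⟩
  rw [h2]
  exact hO.inter (isOpen_iInter_of_finite fun i => (hcont i).isOpen_inter_preimage hO isOpen_Iio)

theorem abs_le_of_volume_le {J : Set ℝ} (hJ : J.OrdConnected) (h0 : (0 : ℝ) ∈ J) {L : ℝ}
    (hL : volume J ≤ ENNReal.ofReal L) {t : ℝ} (ht : t ∈ J) : |t| ≤ max L 0 := by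
  have h1 : volume (Set.uIcc 0 t) ≤ ENNReal.ofReal L := (measure_mono (hJ.uIcc_subset h0 ht)).trans hL
  rw [Real.volume_interval, sub_zero] at h1
  have h2 := ENNReal.toReal_mono ENNReal.ofReal_ne_top h1
  rwa [ENNReal.toReal_ofReal (abs_nonneg _), ENNReal.toReal_ofReal'] at h2

/-- Convergence of the scheme with spatial operator `G`, given a splitting whose scheme coincides
with `G` on `C¹` functions.  The maximal solution of the scheme is compared with the solution of a
globally Lipschitz equation, which exists for as long as needed and which, by the error estimate,
never leaves the region where the two equations agree. -/
theorem IsSplitting.spectrallyConverges {σ : (Fin d → ℝ) → ℝ} (hσ : IsFilterProfile σ) {s : ℝ}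
    (hs : (d : ℝ) / 2 + 1 < s) {A : Fin d → Matrix (Fin n) (Fin n) (MvPolynomial (Fin n) ℝ)}
    {Aa : Fin d → Matrix (Fin n) (Fin n) ℝ}
    {Ab : Fin d → Matrix (Fin n) (Fin n) (MvPolynomial (Fin n) ℝ)}
    {Sa Sb : Matrix (Fin n) (Fin n) (MvPolynomial (Fin n) ℝ)} {𝒰 : Set (Fin n → ℝ)}
    (hA : IsSplitting A Aa Ab Sa Sb 𝒰 σ)
    {G : ℕ → ((Fin d → ℝ) → (Fin n → ℝ)) → ((Fin d → ℝ) → (Fin n → ℝ))}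
    (hG : ∀ N, 1 ≤ N → ∀ f : (Fin d → ℝ) → (Fin n → ℝ), ContDiff ℝ 1 f → IsTorusPeriodic f →
      G N f = schemeOp Aa Ab σ N f) :
    SpectrallyConverges A 𝒰 s G := by
  intro L M K hK hKU
  have hs0 : 0 ≤ s := by have : (0 : ℝ) ≤ d := Nat.cast_nonneg d; linarith
  obtain ⟨N₀, C, R, hN₀, hC, hR, herr⟩ := hA.exists_error_le hσ hs (max L 0) (max M 0) hK hKU
  refine ⟨N₀, √(2 * (4 ^ (2 * s) + (1 + d) ^ s * C)), hN₀, by positivity, ?_⟩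
  intro u₀ _ _ I U hU Istar _ hIstar hL hM hUK N hN
  have hN1 : 1 ≤ N := hN₀.trans hN
  set J := convexHull ℝ (insert 0 Istar)
  have hJ : J.OrdConnected := (convex_convexHull ℝ _).ordConnected
  have hsub : insert 0 Istar ⊆ J := subset_convexHull ℝ _
  have h0 : (0 : ℝ) ∈ J := hsub (Set.mem_insert _ _)
  have hJI : J ⊆ I := convexHull_min (Set.insert_subset hU.zero_mem hIstar) hU.ordConnected.convex
  have hJL : ∀ t ∈ J, |t| ≤ max L 0 := fun t ht => abs_le_of_volume_le hJ h0 hL ht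
  set T := max L 0 + 1
  have hT : 0 < T := by positivity
  set O := I ∩ Set.Ioo (-T) T
  have hO : IsOpen O := hU.isOpen.inter isOpen_Ioo
  have hJO : J ⊆ O := fun t ht => ⟨hJI ht, abs_lt.1 ((hJL t ht).trans_lt (lt_add_one _))⟩
  have hv₀ : ∀ i, IsTrig N (comp (sharpFilter N u₀) i) := fun i => by
    rw [sharpFilter_eq]; exact isTrig_multiplier (isSymbol_sharpSymbol d N) u₀ i
  obtain ⟨V, V', hVd, hVt, hV0, hVV'⟩ := exists_truncated_solution hσ hN1 Aa Ab hR hT hv₀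
  have hVd' : ∀ i, IsTimeC1 O (fun t x => V t x i) fun t x => V' t x i := fun i =>
    (hVd i).mono Set.inter_subset_right
  set D : ℝ≥0∞ := ⨆ τ ∈ J, hsNorm s (U τ)
  have hDM : D ≤ ENNReal.ofReal M := iSup₂_le hM
  have hD : D < ⊤ := hDM.trans_lt ENNReal.ofReal_lt_top
  have hUD : ∀ t ∈ J, hsNorm s (U t) ≤ D := fun t ht =>
    le_iSup₂ (f := fun τ (_ : τ ∈ J) => hsNorm s (U τ)) t ht
  have hDM' : D.toReal ≤ max M 0 := by
    have := ENNReal.toReal_mono ENNReal.ofReal_ne_top hDM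
    rwa [ENNReal.toReal_ofReal'] at this
  have hE := herr u₀ I U hU J O hJ h0 hJO hO Set.inter_subset_left hJL (D.toReal ^ 2)
    (pow_le_pow_left₀ ENNReal.toReal_nonneg hDM' 2) (fun t ht => by
      rw [← hsNorm_sq, ENNReal.toReal_pow]
      exact pow_le_pow_left₀ ENNReal.toReal_nonneg (ENNReal.toReal_mono hD.ne (hUD t ht)) 2)
    hUK N hN V V' hVd' (fun t _ i => hVt t i) hV0 fun t _ h => hVV' t h
  -- The truncated solution solves the scheme on an open interval containing `J`.
  set W := {t ∈ O | ∀ i, wn (comp (V t) i) < R}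
  have hW : IsOpen W := isOpen_setOf_wn_lt hO hVd' (fun t _ => hVt t) R
  have hJW : J ⊆ W := fun t ht => ⟨hJO ht, (hE t ht).1⟩
  set I' := connectedComponentIn W 0
  have hI'W : I' ⊆ W := connectedComponentIn_subset W 0
  have hJI' : J ⊆ I' := hJ.isPreconnected.subset_connectedComponentIn h0 hJW
  have hsol : IsClassicalSolution s (G N) (sharpFilter N u₀) I' V := by
    rw [← hV0]
    refine (isClassicalSolution_of_isTrig (G := schemeOp Aa Ab σ N) hN1 hs0
      hW.connectedComponentIn (isPreconnected_iff_ordConnected.1 isPreconnected_connectedComponentIn)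
      (hJI' h0) (fun i => (hVd' i).mono fun t ht => (hI'W ht).1) (fun t _ => hVt t)
      fun t ht => hVV' t fun i => ((hI'W ht).2 i).le).congr fun f h1 h2 => (hG N hN1 f h1 h2).symm
  have huniq : ∀ I₁ I₂ U₁ U₂, IsClassicalSolution s (G N) (sharpFilter N u₀) I₁ U₁ →
      IsClassicalSolution s (G N) (sharpFilter N u₀) I₂ U₂ → Set.EqOn U₁ U₂ (I₁ ∩ I₂) :=
    fun I₁ I₂ U₁ U₂ h1 h2 => (h1.congr (hG N hN1)).eqOn_scheme hσ hN1 hs hv₀ (h2.congr (hG N hN1))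
  refine ⟨exists_isMaximalSolution huniq ⟨I', V, hsol⟩, fun IN UN hUN => ?_⟩
  obtain ⟨hI'N, heq⟩ := hUN.subset_and_eqOn huniq hsol
  have hIJ : Istar ⊆ J := (Set.subset_insert _ _).trans hsub
  refine ⟨hIJ.trans (hJI'.trans hI'N), fun r hr hrs t ht => ?_⟩
  rw [heq (hJI' (hIJ ht))]
  exact hsNorm_sub_le_of_l2n_le hσ hN1 hr hrs hC.le (hU.memHs t (hIstar ht)).continuous (hVt t) hD
    (hUD t (hIJ ht)) (hE t (hIJ ht)).2

/-! ### The two splittings -/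

theorem continuous_evalMat_apply (B : Matrix (Fin n) (Fin n) (MvPolynomial (Fin n) ℝ)) (a b : Fin n) :
    Continuous fun v => evalMat B v a b :=
  MvPolynomial.continuous_eval (B a b)

theorem evalMat_zero (v : Fin n → ℝ) : evalMat 0 v = 0 := by
  ext a b; simp [evalMat]

theorem evalMat_map_C (B : Matrix (Fin n) (Fin n) ℝ) (v : Fin n → ℝ) :
    evalMat (B.map MvPolynomial.C) v = B := by
  ext a b; simp [evalMat]

theorem evalMat_sub (B B' : Matrix (Fin n) (Fin n) (MvPolynomial (Fin n) ℝ)) (v : Fin n → ℝ) :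
    evalMat (B - B') v = evalMat B v - evalMat B' v := by
  ext a b; simp [evalMat]

theorem isSymm_of_posDef {B : Matrix (Fin n) (Fin n) ℝ} (h : B.PosDef) : B.IsSymm := by
  have := h.isHermitian
  rwa [Matrix.IsHermitian, Matrix.conjTranspose_eq_transpose_of_trivial] at this

theorem continuous_quadratic {X : Type*} [TopologicalSpace X] {B : X → Matrix (Fin n) (Fin n) ℝ}
    (hB : ∀ a b, Continuous fun x => B x a b) {z : X → Fin n → ℝ} (hz : Continuous z) :
    Continuous fun x => z x ⬝ᵥ (B x).mulVec (z x) := by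
  simp only [dotProduct, Matrix.mulVec]
  exact continuous_finsetSum _ fun a _ => ((continuous_apply a).comp hz).mul
    (continuous_finsetSum _ fun b _ => (hB a b).mul ((continuous_apply b).comp hz))

/-- A symmetrizer is uniformly positive definite on compact sets. -/
theorem IsSymmetrizer.exists_coercive
    {A : Fin d → Matrix (Fin n) (Fin n) (MvPolynomial (Fin n) ℝ)}
    {S : Matrix (Fin n) (Fin n) (MvPolynomial (Fin n) ℝ)} {𝒰 : Set (Fin n → ℝ)}
    (hS : IsSymmetrizer A S 𝒰) {K : Set (Fin n → ℝ)} (hKU : K ⊆ 𝒰) (hK : IsCompact K) :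
    ∃ c : ℝ, 0 < c ∧ ∀ v ∈ K, ∀ w : Fin n → ℝ,
      c * ∑ i, w i ^ 2 ≤ w ⬝ᵥ (evalMat S v).mulVec w := by
  have hcpt : IsCompact (K ×ˢ Metric.sphere (0 : Fin n → ℝ) 1) := hK.prod (isCompact_sphere 0 1)
  have hcont : Continuous fun p : (Fin n → ℝ) × (Fin n → ℝ) => p.2 ⬝ᵥ (evalMat S p.1).mulVec p.2 :=
    continuous_quadratic (B := fun p : (Fin n → ℝ) × (Fin n → ℝ) => evalMat S p.1)
      (fun a b => (continuous_evalMat_apply S a b).comp continuous_fst) continuous_snd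
  -- The minimum over unit vectors for the sup norm; the factor `n + 1` below compares `‖w‖²` with
  -- `∑ i, w i ^ 2`, also when `n = 0`.
  obtain ⟨c, hc, hbd⟩ : ∃ c : ℝ, 0 < c ∧ ∀ v ∈ K, ∀ u : Fin n → ℝ, ‖u‖ = 1 →
      c ≤ u ⬝ᵥ (evalMat S v).mulVec u := by
    rcases (K ×ˢ Metric.sphere (0 : Fin n → ℝ) 1).eq_empty_or_nonempty with h | h
    · refine ⟨1, one_pos, fun v hv u hu => ?_⟩
      have : (v, u) ∈ K ×ˢ Metric.sphere (0 : Fin n → ℝ) 1 := ⟨hv, by simpa using hu⟩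
      rw [h] at this
      exact this.elim
    · obtain ⟨p, hp, hmin⟩ := hcpt.exists_isMinOn h hcont.continuousOn
      have hp2 : ‖p.2‖ = 1 := by simpa using hp.2
      refine ⟨_, ?_, fun v hv u hu => hmin (a := (v, u)) ⟨hv, by simpa using hu⟩⟩
      have h1 := (hS.posDef p.1 (hKU hp.1)).dotProduct_mulVec_pos (x := p.2) (by
        intro h0; simp [h0] at hp2)
      simpa using h1
  refine ⟨c / (n + 1), by positivity, fun v hv w => ?_⟩
  rcases eq_or_ne w 0 with rfl | hw
  · simp
  have hw' : 0 < ‖w‖ := norm_pos_iff.2 hw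
  have h1 := hbd v hv (‖w‖⁻¹ • w) (by rw [norm_smul, norm_inv, norm_norm, inv_mul_cancel₀ hw'.ne'])
  rw [Matrix.mulVec_smul, dotProduct_smul, smul_dotProduct, smul_eq_mul, smul_eq_mul, ← mul_assoc]
    at h1
  have h2 : c * ‖w‖ ^ 2 ≤ w ⬝ᵥ (evalMat S v).mulVec w := by
    have h3 := mul_le_mul_of_nonneg_right h1 (sq_nonneg ‖w‖)
    refine h3.trans (le_of_eq ?_)
    field_simp
  have h4 : ∑ i, w i ^ 2 ≤ (n + 1) * ‖w‖ ^ 2 := by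
    calc ∑ i, w i ^ 2 ≤ ∑ _i : Fin n, ‖w‖ ^ 2 := Finset.sum_le_sum fun i _ => by
          rw [← sq_abs]
          exact pow_le_pow_left₀ (abs_nonneg _) (norm_le_pi_norm w i) 2
      _ = n * ‖w‖ ^ 2 := by simp
      _ ≤ _ := by gcongr; linarith
  calc c / (n + 1) * ∑ i, w i ^ 2 ≤ c / (n + 1) * ((n + 1) * ‖w‖ ^ 2) := by gcongr
    _ = c * ‖w‖ ^ 2 := by field_simp
    _ ≤ _ := h2

theorem sum_mean_eq_mean_quadratic {B : (Fin d → ℝ) → Matrix (Fin n) (Fin n) ℝ}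
    (hB : ∀ a b, Continuous fun x => B x a b) {z : (Fin d → ℝ) → (Fin n → ℝ)} (hz : Continuous z) :
    ∑ a, ∑ b, mean (fun x => B x a b * z x a * z x b) =
      mean fun x => z x ⬝ᵥ (B x).mulVec (z x) := by
  have hc : ∀ a b, Continuous fun x => B x a b * z x a * z x b := fun a b =>
    ((hB a b).mul ((continuous_apply a).comp hz)).mul ((continuous_apply b).comp hz)
  rw [← Finset.sum_congr rfl fun a _ => mean_sum fun b _ => hc a b,
    ← mean_sum fun a _ => continuous_finsetSum _ fun b _ => hc a b]
  congr 1
  ext x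
  simp only [dotProduct, Matrix.mulVec, Finset.mul_sum]
  exact Finset.sum_congr rfl fun a _ => Finset.sum_congr rfl fun b _ => by ring

theorem mean_coercive_le {B : (Fin d → ℝ) → Matrix (Fin n) (Fin n) ℝ}
    (hB : ∀ a b, Continuous fun x => B x a b) {z : (Fin d → ℝ) → (Fin n → ℝ)} (hz : Continuous z)
    {c : ℝ} (h : ∀ x, ∀ w : Fin n → ℝ, c * ∑ i, w i ^ 2 ≤ w ⬝ᵥ (B x).mulVec w) :
    c * ∑ i, mean (fun x => z x i ^ 2) ≤ mean fun x => z x ⬝ᵥ (B x).mulVec (z x) := by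
  have hc : ∀ i, Continuous fun x => z x i ^ 2 := fun i => ((continuous_apply i).comp hz).pow 2
  rw [← mean_sum fun i _ => hc i, ← mean_const_mul]
  exact mean_mono (continuous_const.mul (continuous_finsetSum _ fun i _ => hc i))
    (continuous_quadratic hB hz) fun x => h x (z x)

/-- A Fourier multiplier with symbol in `[0, 1]` decreases positive semidefinite quadratic forms
with constant coefficients. -/
theorem mean_multiplier_quadratic_le {N : ℕ} {m : (Fin d → ℤ) → ℝ} (hm : IsSymbol N m)
    (hm1 : ∀ k, m k ∈ Set.Icc (0 : ℝ) 1) {Q : Matrix (Fin n) (Fin n) ℝ} (hQ : Q.PosSemidef)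
    {z : (Fin d → ℝ) → (Fin n → ℝ)} (hz : ∀ i, IsTrig N (comp z i)) :
    mean (fun x => fourierMultiplier m z x ⬝ᵥ Q.mulVec (fourierMultiplier m z x)) ≤
      mean fun x => z x ⬝ᵥ Q.mulVec (z x) := by
  -- `Q` is a sum of squares of linear forms, which commute with the multiplier.
  obtain ⟨p, v, hv⟩ := Matrix.posSemidef_iff_eq_sum_vecMulVec.1 hQ
  have hq : ∀ w : Fin n → ℝ, w ⬝ᵥ Q.mulVec w = ∑ l, (v l ⬝ᵥ w) ^ 2 := fun w => by
    rw [hv, Matrix.sum_mulVec, dotProduct_sum]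
    refine Finset.sum_congr rfl fun l _ => ?_
    rw [Matrix.vecMulVec_mulVec]
    simp [dotProduct_comm w, sq]
  set F : ((Fin d → ℝ) → (Fin n → ℝ)) → (Fin d → ℝ) → (Fin p → ℝ) := fun f x l => v l ⬝ᵥ f x
  have hF : ∀ f l, comp (F f) l = fun x => ∑ i, (v l i : ℂ) * comp f i x := fun f l => by
    ext x; simp [F, comp, dotProduct]
  have hFt : ∀ f, (∀ i, IsTrig N (comp f i)) → ∀ l, IsTrig N (comp (F f) l) := fun f hf l => by
    rw [hF]; exact IsTrig.sum fun i _ => (hf i).const_mul _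
  have hfc : ∀ f, (∀ i, IsTrig N (comp f i)) → ∀ l k,
      fc (comp (F f) l) k = ∑ i, (v l i : ℂ) * fc (comp f i) k := fun f hf l k => by
    rw [hF, fc_sum fun i _ => continuous_const.fun_mul (hf i).continuous]
    exact Finset.sum_congr rfl fun i _ => fc_const_mul _ _ _
  have hTz := isTrig_multiplier hm z
  have hcomm : F (fourierMultiplier m z) = fourierMultiplier m (F z) := by
    ext x l
    have h1 : comp (F (fourierMultiplier m z)) l = comp (fourierMultiplier m (F z)) l :=
      (hFt _ hTz l).ext_fc (isTrig_multiplier hm _ l) fun k => by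
        rw [hfc _ hTz, fc_multiplier hm, hfc _ hz, Finset.mul_sum]
        refine Finset.sum_congr rfl fun i _ => ?_
        rw [fc_multiplier hm]
        ring
    exact Complex.ofReal_injective (congrFun h1 x)
  have hc : ∀ f, (∀ i, IsTrig N (comp f i)) → ∀ l, Continuous fun x => F f x l ^ 2 := fun f hf l =>
    (hFt f hf l).toIsTorusFun.continuous_apply.pow 2
  have hsum : ∀ f, (∀ i, IsTrig N (comp f i)) →
      mean (fun x => f x ⬝ᵥ Q.mulVec (f x)) = ∑ l, mean fun x => F f x l ^ 2 := fun f hf => by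
    rw [← mean_sum fun l _ => hc f hf l]
    exact congrArg mean (funext fun x => hq (f x))
  rw [hsum _ hTz, hsum _ hz, hcomm]
  exact sum_mean_sq_multiplier_le hm hm1 (hFt z hz)

/-- If the filter acts on all terms, the symmetrizer needs no splitting. -/
theorem IsSymmetrizer.isSplitting_full (σ : (Fin d → ℝ) → ℝ)
    {A : Fin d → Matrix (Fin n) (Fin n) (MvPolynomial (Fin n) ℝ)}
    {S : Matrix (Fin n) (Fin n) (MvPolynomial (Fin n) ℝ)} {𝒰 : Set (Fin n → ℝ)}
    (hS : IsSymmetrizer A S 𝒰) : IsSplitting A 0 A S 0 𝒰 σ where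
  eq_add j v := by simp
  symm_a v hv := isSymm_of_posDef (hS.posDef v hv)
  symm_b v _ := by rw [evalMat_zero]; exact Matrix.isSymm_zero
  symm_aa j v _ := by simp
  symm_ab j v hv := by simpa using hS.symm j v hv
  symm_bb j v _ := by simp [evalMat_zero]
  coercive K hKU hK := by
    obtain ⟨c, hc, h⟩ := hS.exists_coercive hKU hK
    refine ⟨c, hc, fun N _ U hU hUK z hz => ?_⟩
    have hzc : Continuous z := continuous_of_comp fun i => (hz i).toIsTorusFun
    have hB : ∀ a b, Continuous fun x => evalMat S (U x) a b := fun a b =>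
      (continuous_evalMat_apply S a b).comp hU
    refine (mean_coercive_le hB hzc fun x => h _ (hUK x)).trans (le_of_eq ?_)
    rw [← sum_mean_eq_mean_quadratic hB hzc, energyForm]
    refine Finset.sum_congr rfl fun a _ => Finset.sum_congr rfl fun b _ => ?_
    have : mean (fun x => evalMat 0 (U x) a b * fourierMultiplier (sqrtSymbol σ N) z x a *
        fourierMultiplier (sqrtSymbol σ N) z x b) = 0 := by
      simp [evalMat_zero, mean]
    rw [this, add_zero]

/-- If the filter acts on the nonlinear terms only, a compatible symmetrizer is split into its value
at the origin and the remainder.  With `T` the multiplier `√σ(· / N)`, the energy form is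
`(S⁰ z, z) - (S⁰ T z, T z) + (S(U) T z, T z)`. -/
theorem IsSymmetrizer.isSplitting_partial {σ : (Fin d → ℝ) → ℝ} (hσ : IsFilterProfile σ)
    {A : Fin d → Matrix (Fin n) (Fin n) (MvPolynomial (Fin n) ℝ)}
    {S : Matrix (Fin n) (Fin n) (MvPolynomial (Fin n) ℝ)} {𝒰 : Set (Fin n → ℝ)}
    (hS : IsSymmetrizer A S 𝒰) (hAS : IsCompatible A S 𝒰) :
    IsSplitting A (fun j => evalMat (A j) 0)
      (fun j => A j - (evalMat (A j) 0).map MvPolynomial.C) ((evalMat S 0).map MvPolynomial.C)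
      (S - (evalMat S 0).map MvPolynomial.C) 𝒰 σ where
  eq_add j v := by rw [evalMat_sub, evalMat_map_C, add_sub_cancel]
  symm_a v hv := by
    rw [evalMat_map_C]; exact isSymm_of_posDef (hS.posDef 0 hS.zero_mem)
  symm_b v hv := by
    rw [evalMat_sub, evalMat_map_C]
    exact (isSymm_of_posDef (hS.posDef v hv)).sub (isSymm_of_posDef (hS.posDef 0 hS.zero_mem))
  symm_aa j v hv := by
    rw [evalMat_map_C]; exact (hAS j v hv).1
  symm_ab j v hv := by
    simp only [evalMat_sub, evalMat_map_C]; exact (hAS j v hv).2.1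
  symm_bb j v hv := by
    simp only [evalMat_sub, evalMat_map_C]; exact (hAS j v hv).2.2
  coercive K hKU hK := by
    obtain ⟨c, hc, h⟩ := hS.exists_coercive (Set.insert_subset hS.zero_mem hKU) (hK.insert 0)
    refine ⟨c, hc, fun N hN U hU hUK z hz => ?_⟩
    have hm := isSymbol_sqrtSymbol hσ hN
    set T := fourierMultiplier (sqrtSymbol σ N) z
    have hT : ∀ i, IsTrig N (comp T i) := isTrig_multiplier hm z
    have hzc : Continuous z := continuous_of_comp fun i => (hz i).toIsTorusFun
    have hTc : Continuous T := continuous_of_comp fun i => (hT i).toIsTorusFun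
    have hSU : ∀ a b, Continuous fun x => evalMat S (U x) a b := fun a b =>
      (continuous_evalMat_apply S a b).comp hU
    -- `(S⁰ z, z) - (S⁰ T z, T z) ≥ c (|z|² - |T z|²)` because `S⁰ - c` is positive semidefinite.
    set Q : Matrix (Fin n) (Fin n) ℝ := evalMat S 0 - c • 1
    have hQw : ∀ w : Fin n → ℝ, w ⬝ᵥ Q.mulVec w =
        w ⬝ᵥ (evalMat S 0).mulVec w - c * ∑ i, w i ^ 2 := fun w => by
      rw [Matrix.sub_mulVec, dotProduct_sub, Matrix.smul_mulVec, Matrix.one_mulVec,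
        dotProduct_smul, smul_eq_mul]
      simp [dotProduct, sq]
    have hQ : Q.PosSemidef := by
      refine Matrix.PosSemidef.of_dotProduct_mulVec_nonneg ?_ fun w => ?_
      · refine (hS.posDef 0 hS.zero_mem).isHermitian.sub ?_
        rw [Matrix.IsHermitian, Matrix.conjTranspose_smul, Matrix.conjTranspose_one, star_trivial]
      · rw [star_trivial, hQw, sub_nonneg]
        exact h 0 (Set.mem_insert _ _) w
    have hsq : ∀ {f : (Fin d → ℝ) → (Fin n → ℝ)}, Continuous f →
        mean (fun x => f x ⬝ᵥ (evalMat S 0).mulVec (f x)) =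
          mean (fun x => f x ⬝ᵥ Q.mulVec (f x)) + c * ∑ i, mean fun x => f x i ^ 2 := by
      intro f hf
      have hfi : ∀ i, Continuous fun x => f x i ^ 2 := fun i => ((continuous_apply i).comp hf).pow 2
      rw [← mean_sum fun i _ => hfi i, ← mean_const_mul, ← mean_add
        (continuous_quadratic (B := fun _ => Q) (fun _ _ => continuous_const) hf)
        (continuous_const.fun_mul (continuous_finsetSum _ fun i _ => hfi i))]
      congr 1
      ext x
      rw [hQw]
      ring
    have h1 := mean_multiplier_quadratic_le hm (sqrtSymbol_mem_Icc hσ N) hQ hz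
    have h2 := mean_coercive_le hSU hTc fun x => h _ (Set.mem_insert_of_mem _ (hUK x))
    have h3 : energyForm (fun x => evalMat ((evalMat S 0).map MvPolynomial.C) (U x))
        (fun x => evalMat (S - (evalMat S 0).map MvPolynomial.C) (U x)) (sqrtSymbol σ N) z z =
        mean (fun x => z x ⬝ᵥ (evalMat S 0).mulVec (z x)) +
          (mean (fun x => T x ⬝ᵥ (evalMat S (U x)).mulVec (T x)) -
            mean fun x => T x ⬝ᵥ (evalMat S 0).mulVec (T x)) := by
      have hb : Continuous fun x => T x ⬝ᵥ (evalMat S 0).mulVec (T x) :=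
        continuous_quadratic (B := fun _ => evalMat S 0) (fun _ _ => continuous_const) hTc
      have hd : ∀ a b, Continuous fun x => (evalMat S (U x) - evalMat S 0) a b := fun a b =>
        (hSU a b).sub continuous_const
      simp only [energyForm, evalMat_sub, evalMat_map_C, Finset.sum_add_distrib]
      rw [sum_mean_eq_mean_quadratic (B := fun _ => evalMat S 0) (fun _ _ => continuous_const) hzc,
        sum_mean_eq_mean_quadratic (B := fun x => evalMat S (U x) - evalMat S 0) hd hTc,
        add_right_inj, eq_sub_iff_add_eq, ← mean_add (continuous_quadratic hd hTc) hb]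
      congr 1
      ext x
      rw [Matrix.sub_mulVec, dotProduct_sub, sub_add_cancel]
    rw [h3, hsq hzc, hsq hTc]
    linarith

theorem fullFilterOp_eq_schemeOp {σ : (Fin d → ℝ) → ℝ} (hσ : IsFilterProfile σ) {N : ℕ}
    (hN : 1 ≤ N) (A : Fin d → Matrix (Fin n) (Fin n) (MvPolynomial (Fin n) ℝ))
    {f : (Fin d → ℝ) → (Fin n → ℝ)} (hf : ContDiff ℝ 1 f) (hp : IsTorusPeriodic f) :
    fullFilterOp A σ N f = schemeOp 0 A σ N f := by
  have hm := isSymbol_filterSymbol hσ hN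
  have hcont : ∀ j b, Continuous (comp (fun x => (evalMat (A j) (f x)).mulVec
      (partialDeriv j f x)) b) := fun j b => by
    rw [entries_mulVec_eq]
    refine continuous_finsetSum _ fun c _ => Continuous.mul ?_ (isTorusFun_partialDeriv hf hp j c).continuous
    exact Complex.continuous_ofReal.comp ((continuous_evalMat_apply (A j) b c).comp hf.continuous)
  have htrig : ∀ j b, IsTrig N (comp (smoothFilter σ N fun x => (evalMat (A j) (f x)).mulVec
      (partialDeriv j f x)) b) := fun j b => isTrig_multiplier hm _ b
  have hrhs : ∀ b, comp (schemeOp 0 A σ N f) b = fun x => ∑ j, comp (smoothFilter σ N fun x =>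
      (evalMat (A j) (f x)).mulVec (partialDeriv j f x)) b x := fun b => by
    rw [schemeOp, comp_linOp]
    simp
  ext x b
  have h : comp (fullFilterOp A σ N f) b = comp (schemeOp 0 A σ N f) b := by
    rw [hrhs, fullFilterOp, smoothFilter_eq]
    refine (isTrig_multiplier hm _ b).ext_fc (IsTrig.sum fun j _ => htrig j b) fun k => ?_
    have h1 : comp (hypOp A f) b = fun x => ∑ j, comp (fun x => (evalMat (A j) (f x)).mulVec
        (partialDeriv j f x)) b x := by
      ext x; simp [comp, hypOp]
    rw [fc_multiplier hm, h1, fc_sum fun j _ => hcont j b,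
      fc_sum fun j _ => (htrig j b).continuous, Finset.mul_sum]
    exact Finset.sum_congr rfl fun j _ => by rw [smoothFilter_eq, fc_multiplier hm]
  exact Complex.ofReal_injective (congrFun h x)

theorem partialFilterOp_eq_schemeOp (σ : (Fin d → ℝ) → ℝ) (N : ℕ)
    (A : Fin d → Matrix (Fin n) (Fin n) (MvPolynomial (Fin n) ℝ)) (f : (Fin d → ℝ) → (Fin n → ℝ)) :
    partialFilterOp A σ N f = schemeOp (fun j => evalMat (A j) 0)
      (fun j => A j - (evalMat (A j) 0).map MvPolynomial.C) σ N f := by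
  simp only [schemeOp, evalMat_sub, evalMat_map_C]
  rfl

end

end FourierScheme

theorem proposition3p4 {d n : ℕ}
    (A : Fin d → Matrix (Fin n) (Fin n) (MvPolynomial (Fin n) ℝ))
    (S : Matrix (Fin n) (Fin n) (MvPolynomial (Fin n) ℝ)) (𝒰 : Set (Fin n → ℝ))
    (hS : FourierScheme.IsSymmetrizer A S 𝒰)
    (σ : (Fin d → ℝ) → ℝ) (hσ : FourierScheme.IsFilterProfile σ)
    (s : ℝ) (hs : (d : ℝ) / 2 + 1 < s) :
    FourierScheme.SpectrallyConverges A 𝒰 s (FourierScheme.fullFilterOp A σ) ∧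
    (FourierScheme.IsCompatible A S 𝒰 →
      FourierScheme.SpectrallyConverges A 𝒰 s (FourierScheme.partialFilterOp A σ)) :=
  ⟨(hS.isSplitting_full σ).spectrallyConverges hσ hs fun _ hN _ hf hp =>
      FourierScheme.fullFilterOp_eq_schemeOp hσ hN A hf hp,
    fun hAS => (hS.isSplitting_partial hσ hAS).spectrallyConverges hσ hs fun N _ f _ _ =>
      FourierScheme.partialFilterOp_eq_schemeOp σ N A f⟩
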